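/- A self-avoiding polygon is a cycle in the square lattice $\mathbb Z^2$, considered up to translation; its perimeter is its number of edges. For $m\ge 0$, an $m$-staircase polygon is a self-avoiding polygon whose perimeter exceeds the perimeter of its minimum bounding rectangle by exactly $2m$ and which passes through both the bottom-left and the top-right corner of that rectangle. Let $c_{w,h}$ be the number (which is finite) of 2-staircase polygons whose minimum bounding rectangle has width $w$ and height $h$, and let $S_2(x,y)=\sum_{w,h} c_{w,h}x^wy^h$. Let $\Delta=1-2x-2y-2xy+x^2+y^2$, and let $\sqrt\Delta$ be the formal power series in $\mathbb Q[[x,y]]$ with square $\Delta$ and constant term $1$; write $\Delta^{3/2}=(\sqrt\Delta)^3$. Then, in the field of fractions of $\mathbb Q[[x,y]]$, $$S_2(x,y)=\frac{A^{(s)}_2}{2x^4y^4(1-x)^3(1-y)^3(1-x-y)}-\frac{B^{(s)}_2}{2x^4y^4(1-x)(1-y)\Delta^{3/2}},$$ where $$A^{(s)}_2 = (1-x)^9 x^4 - 3 (1-x)^7 x^4 (3 - 6 x + x^2) y + (1-x)^5 x^2 (4 - 8 x + 33 x^2 - 109 x^3 + 112 x^4 - 47 x^5 + 3 x^6) y^2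 - (1-x)^3 x^2 (28 - 96 x + 169 x^2 - 321 x^3 + 471 x^4 - 395 x^5 + 184 x^6 - 39 x^7 + x^8) y^3 - (1-x) (-1 + 8 x - 105 x^2 + 436 x^3 - 890 x^4 + 1198 x^5 - 1292 x^6 + 1120 x^7 - 701 x^8 + 301 x^9 - 81 x^{10} + 9 x^{11}) y^4 + (-9 + 81 x - 394 x^2 + 1144 x^3 - 2088 x^4 + 2562 x^5 - 2238 x^6 + 1410 x^7 - 588 x^8 + 139 x^9 - 20 x^{10} + 2 x^{11} + x^{12}) y^5 + (36 - 318 x + 1087 x^2 - 2037 x^3 + 2490 x^4 - 2238 x^5 + 1530 x^6 - 738 x^7 + 192 x^8 - 6 x^9 - 3 x^{10} - x^{11}) y^6 + (-84 + 714 x - 2071 x^2 + 2940 x^3 - 2412 x^4 + 1410 x^5 - 738 x^6 + 312 x^7 - 70 x^8 + 6 x^9 - x^{10}) y^7 + (126 - 1008 x + 2621 x^2 - 3103 x^3 + 1821 x^4 - 588 x^5 + 192 x^6 - 70 x^7 + 6 x^8 + x^9) y^8 - (1-x)^3 (126 - 546 x + 167 x^2 + 18 x^3 + 9 x^4 + x^5)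 y^9 + (1-x)^3 (84 - 294 x + 35 x^2 + 6 x^3 + x^4) y^{10} + (1-x)^3 (-36 + 90 x + x^2 + x^3) y^{11} - (1-x)^3 (-9 + 12 x + x^2) y^{12} - (1-x)^3 y^{13}$$ and $$B^{(s)}_2 = (1-x)^9 x^4 - (1-x)^8 (9-x) x^4 y - (1-x)^5 x^2 (-4 + 8 x - 33 x^2 + 51 x^3 + 13 x^4 + 7 x^5) y^2 - (1-x)^3 x^2 (28 - 64 x + 97 x^2 - 147 x^3 + 10 x^4 - x^5 - 34 x^6 + x^7) y^3 + (1-x) (1 - 8 x + 105 x^2 - 268 x^3 + 326 x^4 - 338 x^5 + 194 x^6 - 55 x^7 + 55 x^8 - 49 x^9 + 5 x^{10}) y^4 + (-9 + 73 x - 336 x^2 + 658 x^3 - 664 x^4 + 478 x^5 - 232 x^6 + 35 x^7 + 35 x^8 - 16 x^9 + 10 x^{10}) y^5 + (36 - 260 x + 672 x^2 - 806 x^3 + 532 x^4 - 232 x^5 + 64 x^6 - 11 x^7 - 33 x^8 - 10 x^9) y^6 + (-84 + 532 x - 826 x^2 + 569 x^3 - 249 x^4 + 35 x^5 - 11 x^6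 + 48 x^7 + 4 x^8) y^7 + (126 - 686 x + 588 x^2 - 146 x^3 + 110 x^4 + 35 x^5 - 33 x^6 + 4 x^7) y^8 + 2 (1-x) (-63 + 224 x + 110 x^2 + 65 x^3 + 13 x^4 + 5 x^5) y^9 - 2 (1-x) (-42 + 112 x + 84 x^2 + 32 x^3 + 5 x^4) y^{10} + (1-x) (-36 + 64 x + 42 x^2 + 5 x^3) y^{11} + (1-x)^2 (9 + x) y^{12} - (1-x) y^{13}.$$ -/

import Mathlib

open MvPowerSeries

/-- The square lattice: two points of `ℤ × ℤ` are adjacent when they are at distance one. -/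
def squareLattice : SimpleGraph (ℤ × ℤ) where
  Adj p q := |p.1 - q.1| + |p.2 - q.2| = 1
  symm := ⟨fun p q h => by rwa [abs_sub_comm q.1, abs_sub_comm q.2]⟩
  loopless := ⟨fun p h => by simp at h⟩

/-- A self-avoiding polygon, given by its set of edges: the edge set of a cycle (a closed walk
without repeated edges or vertices) in the square lattice. The number of edges is the perimeter. -/
def IsPolygon (E : Finset (Sym2 (ℤ × ℤ))) : Prop :=
  ∃ (v : ℤ × ℤ) (p : squareLattice.Walk v v), p.IsCycle ∧ p.edges.toFinset = E

/-- The polygon with edge set `E` passes through the lattice point `v`. -/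
def PassesThrough (E : Finset (Sym2 (ℤ × ℤ))) (v : ℤ × ℤ) : Prop :=
  ∃ e ∈ E, v ∈ e

/-- The minimum bounding rectangle of `E` is `[0, w] × [0, h]`: every vertex lies in this
rectangle, and each of its four sides contains a vertex. -/
def HasBoundingRectangle (E : Finset (Sym2 (ℤ × ℤ))) (w h : ℕ) : Prop :=
  (∀ v, PassesThrough E v → 0 ≤ v.1 ∧ v.1 ≤ w ∧ 0 ≤ v.2 ∧ v.2 ≤ h) ∧
  (∃ v, PassesThrough E v ∧ v.1 = 0) ∧ (∃ v, PassesThrough E v ∧ v.1 = w) ∧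
  (∃ v, PassesThrough E v ∧ v.2 = 0) ∧ (∃ v, PassesThrough E v ∧ v.2 = h)

/-- An `m`-staircase polygon of width `w` and height `h`, translated so that the bottom-left
corner of its minimum bounding rectangle is the origin: a self-avoiding polygon whose perimeter
exceeds that of its minimum bounding rectangle by `2 * m` and which passes through the
bottom-left and the top-right corner of that rectangle. -/
def IsStaircasePolygon (m w h : ℕ) (E : Finset (Sym2 (ℤ × ℤ))) : Prop :=
  IsPolygon E ∧ HasBoundingRectangle E w h ∧ E.card = 2 * (w + h) + 2 * m ∧
  PassesThrough E (0, 0) ∧ PassesThrough E ((w : ℤ), (h : ℤ))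

/-- The generating function of `m`-staircase polygons up to translation: the variable `X 0`
counts the width and `X 1` the height of the minimum bounding rectangle. -/
noncomputable def staircaseGF (m : ℕ) : MvPowerSeries (Fin 2) ℚ :=
  fun n => (Set.ncard {E | IsStaircasePolygon m (n 0) (n 1) E} : ℚ)

/-- The discriminant `Δ = 1 - 2x - 2y - 2xy + x² + y²`. -/
def discr {R : Type*} [CommRing R] (x y : R) : R :=
  1 - 2 * x - 2 * y - 2 * x * y + x ^ 2 + y ^ 2

/-- The polynomial `A₂⁽ˢ⁾`. -/
def polyA {R : Type*} [CommRing R] (x y : R) : R :=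
  (1-x)^9 * x^4 - 3 * (1-x)^7 * x^4 * (3 - 6 * x + x^2) * y + (1-x)^5 * x^2 * (4 - 8 * x +
    33 * x^2 - 109 * x^3 + 112 * x^4 - 47 * x^5 + 3 * x^6) * y^2 - (1-x)^3 * x^2 * (28 - 96
    * x + 169 * x^2 - 321 * x^3 + 471 * x^4 - 395 * x^5 + 184 * x^6 - 39 * x^7 + x^8) * y^3
    - (1-x) * (-1 + 8 * x - 105 * x^2 + 436 * x^3 - 890 * x^4 + 1198 * x^5 - 1292 * x^6 +
    1120 * x^7 - 701 * x^8 + 301 * x^9 - 81 * x^10 + 9 * x^11) * y^4 + (-9 + 81 * x - 394 *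
    x^2 + 1144 * x^3 - 2088 * x^4 + 2562 * x^5 - 2238 * x^6 + 1410 * x^7 - 588 * x^8 + 139 *
    x^9 - 20 * x^10 + 2 * x^11 + x^12) * y^5 + (36 - 318 * x + 1087 * x^2 - 2037 * x^3 +
    2490 * x^4 - 2238 * x^5 + 1530 * x^6 - 738 * x^7 + 192 * x^8 - 6 * x^9 - 3 * x^10 -
    x^11) * y^6 + (-84 + 714 * x - 2071 * x^2 + 2940 * x^3 - 2412 * x^4 + 1410 * x^5 - 738 *
    x^6 + 312 * x^7 - 70 * x^8 + 6 * x^9 - x^10) * y^7 + (126 - 1008 * x + 2621 * x^2 - 3103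
    * x^3 + 1821 * x^4 - 588 * x^5 + 192 * x^6 - 70 * x^7 + 6 * x^8 + x^9) * y^8 - (1-x)^3 *
    (126 - 546 * x + 167 * x^2 + 18 * x^3 + 9 * x^4 + x^5) * y^9 + (1-x)^3 * (84 - 294 * x +
    35 * x^2 + 6 * x^3 + x^4) * y^10 + (1-x)^3 * (-36 + 90 * x + x^2 + x^3) * y^11 - (1-x)^3
    * (-9 + 12 * x + x^2) * y^12 - (1-x)^3 * y^13

/-- The polynomial `B₂⁽ˢ⁾`. -/
def polyB {R : Type*} [CommRing R] (x y : R) : R :=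
  (1-x)^9 * x^4 - (1-x)^8 * (9-x) * x^4 * y - (1-x)^5 * x^2 * (-4 + 8 * x - 33 * x^2 + 51 *
    x^3 + 13 * x^4 + 7 * x^5) * y^2 - (1-x)^3 * x^2 * (28 - 64 * x + 97 * x^2 - 147 * x^3 +
    10 * x^4 - x^5 - 34 * x^6 + x^7) * y^3 + (1-x) * (1 - 8 * x + 105 * x^2 - 268 * x^3 +
    326 * x^4 - 338 * x^5 + 194 * x^6 - 55 * x^7 + 55 * x^8 - 49 * x^9 + 5 * x^10) * y^4 +
    (-9 + 73 * x - 336 * x^2 + 658 * x^3 - 664 * x^4 + 478 * x^5 - 232 * x^6 + 35 * x^7 + 35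
    * x^8 - 16 * x^9 + 10 * x^10) * y^5 + (36 - 260 * x + 672 * x^2 - 806 * x^3 + 532 * x^4
    - 232 * x^5 + 64 * x^6 - 11 * x^7 - 33 * x^8 - 10 * x^9) * y^6 + (-84 + 532 * x - 826 *
    x^2 + 569 * x^3 - 249 * x^4 + 35 * x^5 - 11 * x^6 + 48 * x^7 + 4 * x^8) * y^7 + (126 -
    686 * x + 588 * x^2 - 146 * x^3 + 110 * x^4 + 35 * x^5 - 33 * x^6 + 4 * x^7) * y^8 + 2 *
    (1-x) * (-63 + 224 * x + 110 * x^2 + 65 * x^3 + 13 * x^4 + 5 * x^5) * y^9 - 2 * (1-x) *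
    (-42 + 112 * x + 84 * x^2 + 32 * x^3 + 5 * x^4) * y^10 + (1-x) * (-36 + 64 * x + 42 *
    x^2 + 5 * x^3) * y^11 + (1-x)^2 * (9 + x) * y^12 - (1-x) * y^13

/-! Cut a polygon at the two corners (0,0) and (w,h) of its rectangle. One path starts to the north,
the other to the east, and they meet only at the two corners. A perimeter of 2(w+h)+4 means that the
two paths together make exactly two backward steps, to the west or south (`length_eq`). These are
distributed as (2,0), (0,2) or (1,1), and reflection in the diagonal exchanges the first two cases.
So the polygons are counted by pairs of words of these types (`ncard_staircase`).

The pairs are counted by a transfer argument along the diagonals x+y = const. A path with at most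
two backward steps that never falls below its first diagonal splits uniquely into pieces of ten
kinds. Each piece climbs one diagonal, below which the path never returns (`Reg.exists_firstStep`,
`Macro.word_append_inj`). Removing one piece from each path leaves a pair of the same kind whose
starting points lie on the next diagonal at a new distance d. Disjointness and confinement to the
rectangle become local conditions: a lower bound for the new distance, the room left to the walls,
and the memory of one vertex left behind on the new diagonal (`Pair20.block`, `Pair11.block`). As
functions of d the generating functions therefore satisfy linear recursions with coefficients
independent of d up to exceptions at d = 1, forced by generating functions with fewer backward steps
(`F20_rec`, `F11_rec`).

For plain pairs the characteristic equation is t + x + y + xy/t = 1. Put x = p(1-q) and y = q(1-p);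
then its roots are pq and (1-p)(1-q), and the square root of Δ is 1-p-q (`exists_param`). Every
generating function at distance d is divisible by (xy)^d, because the starting points of the pair
are d apart in both coordinates. This smallness excludes the second root: a small solution of such a
recursion is determined by its value at d = 0 (`XYSmall.unique`), since feeding the recursion into
itself raises the order of vanishing without bound. It thus suffices to exhibit small solutions.
They are combinations of the d-th powers of pq, xy/(1-x), xy/(1-y) and xy, whose coefficients are
polynomials in d of degree at most two; the degree grows because the forcing terms resonate with the
homogeneous solutions. Resonance with pq divides by 1-p-q, which is how the powers of the square
root of Δ enter. The formulas are wrong for d ≤ 0, where the true sequences vanish, and collisions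
of close paths need extra care, so some formulas are corrected at d = 1 (`cand`).

The polygon starts at the walls, while the recursions close up most easily for paths far from them.
Differences between successive distances from a wall satisfy recursions of lower order, and the
values at the wall follow by telescoping (`Param.Us_zero_one`, `Param.Hs_zero_one`). The sum over
the three types is compared with A and B through an identity of polynomials in x+y and pq
(`polyA_sub_polyB`). -/

/-! ### Lattice paths as words: vertices, displacements, backward steps. -/

/-- The four unit steps of the square lattice. -/
inductive Dir | E | N | W | S
  deriving DecidableEq

/-- A word of unit steps. -/
abbrev Wd := List Dir

/-- The vertices of the path that starts at `(x, y)` and follows the steps of a word. -/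
def verts (x y : ℤ) : Wd → List (ℤ × ℤ)
  | [] => [(x, y)]
  | Dir.E :: u => (x, y) :: verts (x + 1) y u
  | Dir.N :: u => (x, y) :: verts x (y + 1) u
  | Dir.W :: u => (x, y) :: verts (x - 1) y u
  | Dir.S :: u => (x, y) :: verts x (y - 1) u

/-- Net horizontal displacement. -/
def dX : Wd → ℤ
  | [] => 0
  | Dir.E :: u => 1 + dX u
  | Dir.N :: u => dX u
  | Dir.W :: u => -1 + dX u
  | Dir.S :: u => dX u

/-- Net vertical displacement. -/
def dY : Wd → ℤ
  | [] => 0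
  | Dir.E :: u => dY u
  | Dir.N :: u => 1 + dY u
  | Dir.W :: u => dY u
  | Dir.S :: u => -1 + dY u

/-- The number of steps to the west or to the south. -/
def backs : Wd → ℕ
  | [] => 0
  | Dir.E :: u => backs u
  | Dir.N :: u => backs u
  | Dir.W :: u => backs u + 1
  | Dir.S :: u => backs u + 1

theorem start_mem_verts (x y : ℤ) (u : Wd) : (x, y) ∈ verts x y u := by
  rcases u with _ | ⟨_ | _ | _ | _, u⟩ <;> simp [verts]

theorem end_mem_verts (x y : ℤ) (u : Wd) : (x + dX u, y + dY u) ∈ verts x y u := by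
  induction u generalizing x y with
  | nil => simp [verts, dX, dY]
  | cons s u ih =>
    cases s
    · have := ih (x + 1) y; simp only [verts, dX, dY, List.mem_cons]; right
      rwa [← add_assoc]
    · have := ih x (y + 1); simp only [verts, dX, dY, List.mem_cons]; right
      rwa [← add_assoc]
    · have := ih (x - 1) y; simp only [verts, dX, dY, List.mem_cons]; right
      rwa [← add_assoc, ← sub_eq_add_neg]
    · have := ih x (y - 1); simp only [verts, dX, dY, List.mem_cons]; right
      rwa [← add_assoc, ← sub_eq_add_neg]

/-- Only backward steps lower the level x + y, and each lowers it by one. This is how the tail of a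
path is shown to stay above a diagonal without further case analysis. -/
theorem level_ge_sub_backs {x y : ℤ} {u : Wd} {v : ℤ × ℤ} (hv : v ∈ verts x y u) :
    x + y - backs u ≤ v.1 + v.2 := by
  induction u generalizing x y with
  | nil => simp [verts] at hv; simp [hv, backs]
  | cons s u ih =>
    cases s <;> simp only [verts, List.mem_cons, backs] at hv ⊢ <;> rcases hv with rfl | hv <;>
      first
        | (have := ih hv; push_cast; omega)
        | (push_cast; omega)

/-- A backward step adds one to the length and takes one from the sum of the displacements. Hence
the excess of the perimeter is twice the number of backward steps. -/
theorem length_eq (u : Wd) : (u.length : ℤ) = dX u + dY u + 2 * backs u := by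
  induction u with
  | nil => simp [dX, dY, backs]
  | cons s u ih => cases s <;> simp only [List.length_cons, dX, dY, backs] <;> push_cast <;>
    linarith

/-- A path without steps to the west or south only goes up and right. -/
theorem mem_verts_of_backs_eq_zero {x y : ℤ} {u : Wd} (h : backs u = 0) {v : ℤ × ℤ}
    (hv : v ∈ verts x y u) : x ≤ v.1 ∧ y ≤ v.2 := by
  induction u generalizing x y with
  | nil => simp [verts] at hv; simp [hv]
  | cons s u ih =>
    cases s <;> simp only [verts, List.mem_cons, backs, Nat.add_eq_zero_iff, one_ne_zero,
      and_false] at hv h <;> rcases hv with rfl | hv <;>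
      first
        | simp
        | (have := ih h hv; omega)

theorem mem_verts_le_of_backs_eq_zero {x y : ℤ} {u : Wd} (h : backs u = 0) {v : ℤ × ℤ}
    (hv : v ∈ verts x y u) : v.1 ≤ x + dX u ∧ v.2 ≤ y + dY u := by
  induction u generalizing x y with
  | nil => simp [verts] at hv; simp [hv, dX, dY]
  | cons s u ih =>
    have h0 := mem_verts_of_backs_eq_zero h (end_mem_verts x y (s :: u))
    cases s <;> simp only [verts, List.mem_cons, backs, Nat.add_eq_zero_iff, one_ne_zero,
      and_false] at hv h <;> rcases hv with rfl | hv <;>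
      first
        | (exact h0)
        | (have := ih h hv; simp only [dX, dY]; omega)

/-! ### Cutting a path into pieces that climb one diagonal. -/

/-- The elementary pieces into which a path with at most two steps to the west or south is cut;
each of them ends one level `x + y` above its start. -/
inductive Macro | e | n | ese | nwn | esese | nwnwn | eesse | nesse | enwwn | nnwwn
  deriving DecidableEq

namespace Macro

instance : Fintype Macro :=
  ⟨{e, n, ese, nwn, esese, nwnwn, eesse, nesse, enwwn, nnwwn}, fun m => by cases m <;> simp⟩

/-- The steps of a piece. -/
def word : Macro → Wd
  | e => [.E]
  | n => [.N]
  | ese => [.E, .S, .E]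
  | nwn => [.N, .W, .N]
  | esese => [.E, .S, .E, .S, .E]
  | nwnwn => [.N, .W, .N, .W, .N]
  | eesse => [.E, .E, .S, .S, .E]
  | nesse => [.N, .E, .S, .S, .E]
  | enwwn => [.E, .N, .W, .W, .N]
  | nnwwn => [.N, .N, .W, .W, .N]

/-- Net horizontal displacement of a piece. -/
def dx : Macro → ℤ
  | e => 1
  | n => 0
  | ese => 2
  | nwn => -1
  | esese => 3
  | nwnwn => -2
  | eesse => 3
  | nesse => 2
  | enwwn => -1
  | nnwwn => -2

/-- Number of steps of a piece to the west or south. -/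
def cost : Macro → ℕ
  | e => 0
  | n => 0
  | ese => 1
  | nwn => 1
  | _ => 2

end Macro

/-- A path from `(x, y)` with `r` steps to the west or south, without self-intersection, that does
not descend below its initial level and whose last step is to the east or north. -/
structure Reg (x y : ℤ) (r : ℕ) (u : Wd) : Prop where
  back : backs u = r
  lev : ∀ v ∈ verts x y u, x + y ≤ v.1 + v.2
  nodup : (verts x y u).Nodup
  lastW : u.getLast? ≠ some .W
  lastS : u.getLast? ≠ some .S

theorem level_ge_nil {x y a : ℤ} (h : a ≤ x + y) : ∀ v ∈ verts x y [], a ≤ v.1 + v.2 := by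
  simpa [verts] using h

theorem level_ge_E {x y a : ℤ} {u : Wd} (h : a ≤ x + y)
    (hu : ∀ v ∈ verts (x + 1) y u, a ≤ v.1 + v.2) : ∀ v ∈ verts x y (.E :: u), a ≤ v.1 + v.2 :=
  List.forall_mem_cons.2 ⟨h, hu⟩

theorem level_ge_N {x y a : ℤ} {u : Wd} (h : a ≤ x + y)
    (hu : ∀ v ∈ verts x (y + 1) u, a ≤ v.1 + v.2) : ∀ v ∈ verts x y (.N :: u), a ≤ v.1 + v.2 :=
  List.forall_mem_cons.2 ⟨h, hu⟩

theorem level_ge_W {x y a : ℤ} {u : Wd} (h : a ≤ x + y)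
    (hu : ∀ v ∈ verts (x - 1) y u, a ≤ v.1 + v.2) : ∀ v ∈ verts x y (.W :: u), a ≤ v.1 + v.2 :=
  List.forall_mem_cons.2 ⟨h, hu⟩

theorem level_ge_S {x y a : ℤ} {u : Wd} (h : a ≤ x + y)
    (hu : ∀ v ∈ verts x (y - 1) u, a ≤ v.1 + v.2) : ∀ v ∈ verts x y (.S :: u), a ≤ v.1 + v.2 :=
  List.forall_mem_cons.2 ⟨h, hu⟩

/-- The piece is the initial segment up to the last departure from the initial level. A finite
search finds it: once the path is higher than the next level by the number of backward steps left,
it cannot come back. Every other branch dies because a vertex is repeated, the path falls below its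
initial level, a third backward step occurs, or the last step is backward. -/
theorem Reg.exists_firstStep {x y : ℤ} {r : ℕ} {u : Wd} (h : Reg x y r u) (hr : r ≤ 2)
    (hu : u ≠ []) : ∃ (m : Macro) (u' : Wd), u = m.word ++ u' ∧
      ∀ v ∈ verts (x + m.dx) (y + 1 - m.dx) u', x + y + 1 ≤ v.1 + v.2 := by
  obtain ⟨hb, hl, hn, hW, hS⟩ := h
  rw [← hb] at hr
  clear hb
  -- This closes a branch as soon as the level exceeds the required one by the number of backward
  -- steps that remain.
  have aux : ∀ (X Y : ℤ) (u : Wd), x + y + 1 + backs u ≤ X + Y →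
      ∀ v ∈ verts X Y u, x + y + 1 ≤ v.1 + v.2 := fun X Y u h v hv => by
    have := level_ge_sub_backs hv; omega
  · rcases u with _ | ⟨_ | _ | _ | _, u⟩
    · exact absurd rfl hu
    · rcases u with _ | ⟨_ | _ | _ | _, u⟩
      · exact ⟨.e, _, rfl, level_ge_nil (by simp only [Macro.dx]; omega)⟩
      · rcases u with _ | ⟨_ | _ | _ | _, u⟩
        · exact ⟨.e, _, rfl, level_ge_E (by simp only [Macro.dx]; omega) (level_ge_nil
            (by simp only [Macro.dx]; omega))⟩
        · exact ⟨.e, _, rfl, level_ge_E (by simp only [Macro.dx]; omega) (level_ge_E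
            (by simp only [Macro.dx]; omega) (aux _ _ _
              (by simp only [backs] at hr ⊢; simp only [Macro.dx]; omega)))⟩
        · exact ⟨.e, _, rfl, level_ge_E (by simp only [Macro.dx]; omega) (level_ge_N
            (by simp only [Macro.dx]; omega) (aux _ _ _
              (by simp only [backs] at hr ⊢; simp only [Macro.dx]; omega)))⟩
        · exact absurd hn (by simp [verts, start_mem_verts])
        · rcases u with _ | ⟨_ | _ | _ | _, u⟩
          · exact absurd rfl hS
          · exact ⟨.e, _, rfl, level_ge_E (by simp only [Macro.dx]; omega) (level_ge_S
              (by simp only [Macro.dx]; omega) (level_ge_E (by simp only [Macro.dx]; omega)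
                (aux _ _ _ (by simp only [backs] at hr ⊢; simp only [Macro.dx]; omega))))⟩
          · exact absurd hn (by simp [verts, start_mem_verts])
          · rcases u with _ | ⟨_ | _ | _ | _, u⟩
            · exact absurd rfl hW
            · exact absurd hn (by simp [verts, start_mem_verts])
            · exact absurd hn (by simp [verts, start_mem_verts])
            · exact absurd hr (by simp only [backs]; omega)
            · exact absurd hr (by simp only [backs]; omega)
          · rcases u with _ | ⟨_ | _ | _ | _, u⟩
            · exact absurd rfl hS
            · exact ⟨.eesse, _, rfl, aux _ _ _
                (by simp only [backs] at hr ⊢; simp only [Macro.dx]; omega)⟩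
            · exact absurd hn (by simp [verts, start_mem_verts])
            · exact absurd hr (by simp only [backs]; omega)
            · exact absurd hr (by simp only [backs]; omega)
      · rcases u with _ | ⟨_ | _ | _ | _, u⟩
        · exact ⟨.e, _, rfl, level_ge_N (by simp only [Macro.dx]; omega) (level_ge_nil
            (by simp only [Macro.dx]; omega))⟩
        · exact ⟨.e, _, rfl, level_ge_N (by simp only [Macro.dx]; omega) (level_ge_E
            (by simp only [Macro.dx]; omega) (aux _ _ _
              (by simp only [backs] at hr ⊢; simp only [Macro.dx]; omega)))⟩
        · exact ⟨.e, _, rfl, level_ge_N (by simp only [Macro.dx]; omega) (level_ge_N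
            (by simp only [Macro.dx]; omega) (aux _ _ _
              (by simp only [backs] at hr ⊢; simp only [Macro.dx]; omega)))⟩
        · rcases u with _ | ⟨_ | _ | _ | _, u⟩
          · exact absurd rfl hW
          · exact absurd hn (by simp [verts, start_mem_verts])
          · exact ⟨.e, _, rfl, level_ge_N (by simp only [Macro.dx]; omega) (level_ge_W
              (by simp only [Macro.dx]; omega) (level_ge_N (by simp only [Macro.dx]; omega)
                (aux _ _ _ (by simp only [backs] at hr ⊢; simp only [Macro.dx]; omega))))⟩
          · rcases u with _ | ⟨_ | _ | _ | _, u⟩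
            · exact absurd rfl hW
            · exact absurd hn (by simp [verts, start_mem_verts])
            · exact ⟨.enwwn, _, rfl, aux _ _ _
                (by simp only [backs] at hr ⊢; simp only [Macro.dx]; omega)⟩
            · exact absurd hr (by simp only [backs]; omega)
            · exact absurd hr (by simp only [backs]; omega)
          · exact absurd hn (by simp [verts, start_mem_verts])
        · exact absurd hn (by simp [verts, start_mem_verts])
      · exact absurd hn (by simp [verts, start_mem_verts])
      · rcases u with _ | ⟨_ | _ | _ | _, u⟩
        · exact absurd rfl hS
        · rcases u with _ | ⟨_ | _ | _ | _, u⟩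
          · exact ⟨.ese, _, rfl, level_ge_nil (by simp only [Macro.dx]; omega)⟩
          · exact ⟨.ese, _, rfl, level_ge_E (by simp only [Macro.dx]; omega) (aux _ _ _
              (by simp only [backs] at hr ⊢; simp only [Macro.dx]; omega))⟩
          · exact ⟨.ese, _, rfl, level_ge_N (by simp only [Macro.dx]; omega) (aux _ _ _
              (by simp only [backs] at hr ⊢; simp only [Macro.dx]; omega))⟩
          · exact absurd hn (by simp [verts, start_mem_verts])
          · rcases u with _ | ⟨_ | _ | _ | _, u⟩
            · exact absurd rfl hS
            · exact ⟨.esese, _, rfl, aux _ _ _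
                (by simp only [backs] at hr ⊢; simp only [Macro.dx]; omega)⟩
            · exact absurd hn (by simp [verts, start_mem_verts])
            · exact absurd hr (by simp only [backs]; omega)
            · exact absurd hr (by simp only [backs]; omega)
        · exact absurd hn (by simp [verts, start_mem_verts])
        -- After a step to the east and one to the south the path is back on its initial level, so
        -- another backward step would leave the permitted region.
        · exact absurd (hl (x + 1 - 1, y - 1) (by simp [verts, start_mem_verts]))
            (by simp only; omega)
        · exact absurd (hl (x + 1, y - 1 - 1) (by simp [verts, start_mem_verts]))
            (by simp only; omega)
    · rcases u with _ | ⟨_ | _ | _ | _, u⟩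
      · exact ⟨.n, _, rfl, level_ge_nil (by simp only [Macro.dx]; omega)⟩
      · rcases u with _ | ⟨_ | _ | _ | _, u⟩
        · exact ⟨.n, _, rfl, level_ge_E (by simp only [Macro.dx]; omega) (level_ge_nil
            (by simp only [Macro.dx]; omega))⟩
        · exact ⟨.n, _, rfl, level_ge_E (by simp only [Macro.dx]; omega) (level_ge_E
            (by simp only [Macro.dx]; omega) (aux _ _ _
              (by simp only [backs] at hr ⊢; simp only [Macro.dx]; omega)))⟩
        · exact ⟨.n, _, rfl, level_ge_E (by simp only [Macro.dx]; omega) (level_ge_N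
            (by simp only [Macro.dx]; omega) (aux _ _ _
              (by simp only [backs] at hr ⊢; simp only [Macro.dx]; omega)))⟩
        · exact absurd hn (by simp [verts, start_mem_verts])
        · rcases u with _ | ⟨_ | _ | _ | _, u⟩
          · exact absurd rfl hS
          · exact ⟨.n, _, rfl, level_ge_E (by simp only [Macro.dx]; omega) (level_ge_S
              (by simp only [Macro.dx]; omega) (level_ge_E (by simp only [Macro.dx]; omega)
                (aux _ _ _ (by simp only [backs] at hr ⊢; simp only [Macro.dx]; omega))))⟩
          · exact absurd hn (by simp [verts, start_mem_verts])
          · exact absurd hn (by simp [verts, start_mem_verts])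
          · rcases u with _ | ⟨_ | _ | _ | _, u⟩
            · exact absurd rfl hS
            · exact ⟨.nesse, _, rfl, aux _ _ _
                (by simp only [backs] at hr ⊢; simp only [Macro.dx]; omega)⟩
            · exact absurd hn (by simp [verts, start_mem_verts])
            · exact absurd hr (by simp only [backs]; omega)
            · exact absurd hr (by simp only [backs]; omega)
      · rcases u with _ | ⟨_ | _ | _ | _, u⟩
        · exact ⟨.n, _, rfl, level_ge_N (by simp only [Macro.dx]; omega) (level_ge_nil
            (by simp only [Macro.dx]; omega))⟩
        · exact ⟨.n, _, rfl, level_ge_N (by simp only [Macro.dx]; omega) (level_ge_E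
            (by simp only [Macro.dx]; omega) (aux _ _ _
              (by simp only [backs] at hr ⊢; simp only [Macro.dx]; omega)))⟩
        · exact ⟨.n, _, rfl, level_ge_N (by simp only [Macro.dx]; omega) (level_ge_N
            (by simp only [Macro.dx]; omega) (aux _ _ _
              (by simp only [backs] at hr ⊢; simp only [Macro.dx]; omega)))⟩
        · rcases u with _ | ⟨_ | _ | _ | _, u⟩
          · exact absurd rfl hW
          · exact absurd hn (by simp [verts, start_mem_verts])
          · exact ⟨.n, _, rfl, level_ge_N (by simp only [Macro.dx]; omega) (level_ge_W
              (by simp only [Macro.dx]; omega) (level_ge_N (by simp only [Macro.dx]; omega)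
                (aux _ _ _ (by simp only [backs] at hr ⊢; simp only [Macro.dx]; omega))))⟩
          · rcases u with _ | ⟨_ | _ | _ | _, u⟩
            · exact absurd rfl hW
            · exact absurd hn (by simp [verts, start_mem_verts])
            · exact ⟨.nnwwn, _, rfl, aux _ _ _
                (by simp only [backs] at hr ⊢; simp only [Macro.dx]; omega)⟩
            · exact absurd hr (by simp only [backs]; omega)
            · exact absurd hr (by simp only [backs]; omega)
          · rcases u with _ | ⟨_ | _ | _ | _, u⟩
            · exact absurd rfl hS
            · exact absurd hn (by simp [verts, start_mem_verts])
            · exact absurd hn (by simp [verts, start_mem_verts])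
            · exact absurd hr (by simp only [backs]; omega)
            · exact absurd hr (by simp only [backs]; omega)
        · exact absurd hn (by simp [verts, start_mem_verts])
      · rcases u with _ | ⟨_ | _ | _ | _, u⟩
        · exact absurd rfl hW
        · exact absurd hn (by simp [verts, start_mem_verts])
        · rcases u with _ | ⟨_ | _ | _ | _, u⟩
          · exact ⟨.nwn, _, rfl, level_ge_nil (by simp only [Macro.dx]; omega)⟩
          · exact ⟨.nwn, _, rfl, level_ge_E (by simp only [Macro.dx]; omega) (aux _ _ _
              (by simp only [backs] at hr ⊢; simp only [Macro.dx]; omega))⟩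
          · exact ⟨.nwn, _, rfl, level_ge_N (by simp only [Macro.dx]; omega) (aux _ _ _
              (by simp only [backs] at hr ⊢; simp only [Macro.dx]; omega))⟩
          · rcases u with _ | ⟨_ | _ | _ | _, u⟩
            · exact absurd rfl hW
            · exact absurd hn (by simp [verts, start_mem_verts])
            · exact ⟨.nwnwn, _, rfl, aux _ _ _
                (by simp only [backs] at hr ⊢; simp only [Macro.dx]; omega)⟩
            · exact absurd hr (by simp only [backs]; omega)
            · exact absurd hr (by simp only [backs]; omega)
          · exact absurd hn (by simp [verts, start_mem_verts])
        · exact absurd (hl (x - 1 - 1, y + 1) (by simp [verts, start_mem_verts]))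
            (by simp only; omega)
        · exact absurd (hl (x - 1, y + 1 - 1) (by simp [verts, start_mem_verts]))
            (by simp only; omega)
      · exact absurd hn (by simp [verts, start_mem_verts])
    · exact absurd (hl (x - 1, y) (by simp [verts, start_mem_verts])) (by simp only; omega)
    · exact absurd (hl (x, y - 1) (by simp [verts, start_mem_verts])) (by simp only; omega)

/-- If one piece were a proper prefix of another, the remainder after the shorter one would still
have to dip to the initial level, against the condition on the remainder. So the cut is unique. -/
theorem Macro.word_append_inj {x y : ℤ} {m m' : Macro} {u u' : Wd}
    (h : m.word ++ u = m'.word ++ u')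
    (hu : ∀ v ∈ verts (x + m.dx) (y + 1 - m.dx) u, x + y + 1 ≤ v.1 + v.2)
    (hu' : ∀ v ∈ verts (x + m'.dx) (y + 1 - m'.dx) u', x + y + 1 ≤ v.1 + v.2) :
    m = m' ∧ u = u' := by
  cases m <;> cases m' <;> simp [Macro.word] at h <;> simp [h]
  -- The cases left are those in which one word is a proper prefix of the other; the dip contradicts
  -- one of the level conditions.
  all_goals
    subst h
    simp only [verts, Macro.dx, List.forall_mem_cons] at hu hu'
    omega

theorem mem_verts_eq_start {x y : ℤ} {u : Wd} (h : backs u = 0) {v : ℤ × ℤ}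
    (hv : v ∈ verts x y u) (hl : v.1 + v.2 ≤ x + y) : v = (x, y) := by
  have := mem_verts_of_backs_eq_zero h hv
  ext <;> simp only <;> omega

theorem dX_append (u v : Wd) : dX (u ++ v) = dX u + dX v := by
  induction u with
  | nil => simp [dX]
  | cons s u ih => cases s <;> simp [dX, ih, add_assoc]

theorem dY_append (u v : Wd) : dY (u ++ v) = dY u + dY v := by
  induction u with
  | nil => simp [dY]
  | cons s u ih => cases s <;> simp [dY, ih, add_assoc]

theorem backs_append (u v : Wd) : backs (u ++ v) = backs u + backs v := by
  induction u with
  | nil => simp [backs]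
  | cons s u ih => cases s <;> simp [backs, ih, add_assoc, add_comm]

namespace Macro

/-- The vertices of a piece, except for the last one. -/
def pre (x y : ℤ) : Macro → List (ℤ × ℤ)
  | e => [(x, y)]
  | n => [(x, y)]
  | ese => [(x, y), (x + 1, y), (x + 1, y - 1)]
  | nwn => [(x, y), (x, y + 1), (x - 1, y + 1)]
  | esese => [(x, y), (x + 1, y), (x + 1, y - 1), (x + 2, y - 1), (x + 2, y - 2)]
  | nwnwn => [(x, y), (x, y + 1), (x - 1, y + 1), (x - 1, y + 2), (x - 2, y + 2)]
  | eesse => [(x, y), (x + 1, y), (x + 2, y), (x + 2, y - 1), (x + 2, y - 2)]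
  | nesse => [(x, y), (x, y + 1), (x + 1, y + 1), (x + 1, y), (x + 1, y - 1)]
  | enwwn => [(x, y), (x + 1, y), (x + 1, y + 1), (x, y + 1), (x - 1, y + 1)]
  | nnwwn => [(x, y), (x, y + 1), (x, y + 2), (x - 1, y + 2), (x - 2, y + 2)]

theorem verts_word_append (m : Macro) (x y : ℤ) (u : Wd) :
    verts x y (m.word ++ u) = m.pre x y ++ verts (x + m.dx) (y + 1 - m.dx) u := by
  cases m <;> simp [word, verts, pre, dx, sub_eq_add_neg, add_assoc]

theorem dX_word (m : Macro) : dX m.word = m.dx := by cases m <;> rfl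

theorem dY_word (m : Macro) : dY m.word = 1 - m.dx := by cases m <;> rfl

theorem backs_word (m : Macro) : backs m.word = m.cost := by cases m <;> rfl

/-- The position of the vertex of a piece on its final level which another piece might meet. -/
def ob : Macro → ℤ
  | ese => -1
  | nwn => 1
  | _ => 0

/-- How far a piece reaches to the west of its start. -/
def need : Macro → ℤ
  | nwn => 1
  | enwwn => 1
  | nwnwn => 2
  | nnwwn => 2
  | _ => 0

/-- How far a piece reaches to the north of its end. -/
def top : Macro → ℤ
  | ese => 1
  | esese => 2
  | eesse => 2
  | nesse => 2
  | _ => 0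

/-- The minimal distance after a piece of the upper path. -/
def lo : Macro → ℤ
  | e => 0
  | n => 0
  | enwwn => 3
  | _ => 1

/-- Every piece ends with a forward step, so putting it in front neither creates nor removes a
forbidden last step. -/
theorem getLast?_word_append (m : Macro) (u : Wd) :
    (∀ s : Dir, s = .W ∨ s = .S → (m.word ++ u).getLast? ≠ some s) ↔
    (∀ s : Dir, s = .W ∨ s = .S → u.getLast? ≠ some s) := by
  rcases List.eq_nil_or_concat u with rfl | ⟨u, s, rfl⟩
  · cases m <;> simp [word]
  · rw [List.concat_eq_append, ← List.append_assoc]; simp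

end Macro

/-! ### Pairs whose backward steps all belong to the upper path. -/

/-- A step of a path without steps to the west or south. -/
def fwd (b : Bool) : Dir := if b then .E else .N

/-- Horizontal displacement of `fwd b`. -/
def fx (b : Bool) : ℤ := if b then 1 else 0

theorem verts_fwd_cons (b : Bool) (x y : ℤ) (u : Wd) :
    verts x y (fwd b :: u) = (x, y) :: verts (x + fx b) (y + 1 - fx b) u := by
  cases b <;> simp [fwd, fx, verts]

theorem dX_fwd_cons (b : Bool) (u : Wd) : dX (fwd b :: u) = fx b + dX u := by
  cases b <;> simp [fwd, fx, dX]

theorem dY_fwd_cons (b : Bool) (u : Wd) : dY (fwd b :: u) = 1 - fx b + dY u := by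
  cases b <;> simp [fwd, fx, dY]

theorem backs_fwd_cons (b : Bool) (u : Wd) : backs (fwd b :: u) = backs u := by
  cases b <;> simp [fwd, backs]

/-- Two paths from `(x, y)` and `(X, Y)` to `(w, h)` which only meet at the end. The upper one has
`r` steps to the west or south, does not leave the rectangle to the west or north, and avoids
`(x + o, y - o)` unless `o = 0`; the lower one has no step to the west or south. -/
structure Pair20 (r : ℕ) (o x y X Y w h : ℤ) (u l : Wd) : Prop where
  reg : Reg x y r u
  plain : backs l = 0
  ux : x + dX u = w
  uy : y + dY u = h
  lx : X + dX l = w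
  ly : Y + dY l = h
  disj : ∀ v ∈ verts x y u, v ∈ verts X Y l → v = (w, h)
  obst : o ≠ 0 → (x + o, y - o) ∉ verts x y u
  rect : ∀ v ∈ verts x y u, 0 ≤ v.1 ∧ v.2 ≤ h

/-- When a piece of the upper path may be placed next to a step of the lower path. -/
structure Guard20 (m : Macro) (b : Bool) (r : ℕ) (o x y X h : ℤ) : Prop where
  cost : m.cost ≤ r
  ob : o ≠ 0 → o + m.ob ≠ 0
  need : m.need ≤ x
  top : y + 1 - m.dx + m.top ≤ h
  lo : m.lo ≤ X + fx b - (x + m.dx)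

/-- The remainder stays on or above the final level of the piece, so it can only meet those vertices
of the piece that reach this level. With at most two backward steps in all, the single dangerous
vertex is the one recorded by `Macro.ob`. -/
theorem Reg.append_iff {m : Macro} {r : ℕ} {x y : ℤ} {u : Wd} (hr : r ≤ 2)
    (hlev : ∀ v ∈ verts (x + m.dx) (y + 1 - m.dx) u, x + y + 1 ≤ v.1 + v.2) :
    Reg x y r (m.word ++ u) ↔ m.cost ≤ r ∧ Reg (x + m.dx) (y + 1 - m.dx) (r - m.cost) u ∧
      (m.ob ≠ 0 → (x + m.dx + m.ob, y + 1 - m.dx - m.ob) ∉ verts (x + m.dx) (y + 1 - m.dx) u) := by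
  have hlast := m.getLast?_word_append u
  have hb : backs (m.word ++ u) = m.cost + backs u := by rw [backs_append, m.backs_word]
  constructor
  · rintro ⟨h1, h2, h3, h4, h5⟩
    rw [m.verts_word_append] at h2 h3
    have hlast' := hlast.1 (by rintro s (rfl | rfl) <;> assumption)
    rw [List.nodup_append] at h3
    refine ⟨by omega, ⟨by omega, fun v hv => by have := hlev v hv; omega, h3.2.1,
      hlast' _ (Or.inl rfl), hlast' _ (Or.inr rfl)⟩, fun hob hmem => ?_⟩
    refine h3.2.2 _ ?_ _ hmem rfl
    cases m <;> simp [Macro.ob, Macro.pre, Macro.dx] at hob ⊢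
    · right; left; constructor <;> ring
  · rintro ⟨h1, ⟨h2, h3, h4, h5, h6⟩, h7⟩
    have hlast' := hlast.2 (by rintro s (rfl | rfl) <;> assumption)
    -- A piece of cost two leaves a monotone remainder, which moves up and right away from all
    -- vertices of the piece. A cheaper piece has at most one vertex on its final level.
    have key : ∀ v ∈ m.pre x y, v ∉ verts (x + m.dx) (y + 1 - m.dx) u := by
      intro v hv hv'
      have hl := hlev v hv'
      obtain ⟨a, c⟩ := v
      by_cases hm : m.cost = 2
      · have hu : backs u = 0 := by omega
        have := mem_verts_of_backs_eq_zero hu hv'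
        cases m <;> simp [Macro.cost] at hm <;>
          simp only [Macro.pre, Macro.dx, List.mem_cons, Prod.mk.injEq, List.not_mem_nil,
            or_false] at hv this hl <;> omega
      · cases m <;> simp [Macro.cost] at hm <;>
          simp only [Macro.pre, List.mem_cons, Prod.mk.injEq, List.not_mem_nil,
            or_false] at hv hl
        · omega
        · omega
        · have e : a = x + 1 ∧ c = y := by omega
          refine h7 (by simp [Macro.ob]) ?_
          rw [e.1, e.2] at hv'
          convert hv' using 2 <;> simp [Macro.ob, Macro.dx] <;> ring
        · have e : a = x ∧ c = y + 1 := by omega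
          refine h7 (by simp [Macro.ob]) ?_
          rw [e.1, e.2] at hv'
          convert hv' using 2 <;> simp [Macro.ob, Macro.dx]
    refine ⟨by omega, ?_, ?_, hlast' _ (Or.inl rfl), hlast' _ (Or.inr rfl)⟩
    · rw [m.verts_word_append]
      intro v hv
      rcases List.mem_append.1 hv with hv | hv
      · obtain ⟨a, c⟩ := v
        cases m <;> simp only [Macro.pre, List.mem_cons, Prod.mk.injEq, List.not_mem_nil,
            or_false] at hv ⊢ <;> omega
      · have := hlev v hv; omega
    · rw [m.verts_word_append, List.nodup_append]
      refine ⟨?_, h4, fun v hv v' hv' e => key v hv (e ▸ hv')⟩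
      cases m <;> simp [Macro.pre] <;> omega

/-- The lower path starts to the east, so if it were too close at the end of the piece, it would
start or end its step at a vertex of the piece on one of the two diagonals. When the two new points
coincide, they are the common end, which the room required to the north excludes for the pieces with
positive `Macro.top`. For `enwwn` the vertex east of its start lies on the new diagonal two units
from its end, hence the bound three. -/
theorem Macro.lo_le {m : Macro} {x y X c h : ℤ} (hx : x < X) (hc : c = 0 ∨ c = 1)
    (h0 : ∀ a b, (a, b) ∈ m.pre x y → a + b = x + y → a ≠ X)
    (h1 : ∀ a b, (a, b) ∈ m.pre x y → a + b = x + y + 1 → a ≠ X + c)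
    (hPQ : x + m.dx = X + c → y + 1 - m.dx = h) (htop : y + 1 - m.dx + m.top ≤ h) :
    m.lo ≤ X + c - (x + m.dx) := by
  cases m
  case ese =>
    have h2 := h0 (x + 1) (y - 1) (by simp [Macro.pre]) (by ring)
    have h3 := h1 (x + 1) y (by simp [Macro.pre]) (by ring)
    simp only [Macro.lo, Macro.dx, Macro.top] at *; omega
  case esese =>
    have h2 := h0 (x + 1) (y - 1) (by simp [Macro.pre]) (by ring)
    have h3 := h1 (x + 1) y (by simp [Macro.pre]) (by ring)
    have h4 := h0 (x + 2) (y - 2) (by simp [Macro.pre]) (by ring)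
    have h5 := h1 (x + 2) (y - 1) (by simp [Macro.pre]) (by ring)
    simp only [Macro.lo, Macro.dx, Macro.top] at *; omega
  case eesse =>
    have h3 := h1 (x + 1) y (by simp [Macro.pre]) (by ring)
    have h4 := h0 (x + 2) (y - 2) (by simp [Macro.pre]) (by ring)
    have h5 := h1 (x + 2) (y - 1) (by simp [Macro.pre]) (by ring)
    simp only [Macro.lo, Macro.dx, Macro.top] at *; omega
  case nesse =>
    have h2 := h0 (x + 1) (y - 1) (by simp [Macro.pre]) (by ring)
    have h3 := h1 (x + 1) y (by simp [Macro.pre]) (by ring)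
    simp only [Macro.lo, Macro.dx, Macro.top] at *; omega
  case enwwn =>
    have h3 := h1 (x + 1) y (by simp [Macro.pre]) (by ring)
    simp only [Macro.lo, Macro.dx, Macro.top] at *; omega
  all_goals
    simp only [Macro.lo, Macro.dx] at *; omega

/-- This is the transfer step. Both remainders stay on or above the next diagonal, so all
interaction with the removed part happens between the two diagonals or at the remembered vertex; the
guard lists exactly these local conditions. -/
theorem Pair20.block {m : Macro} {b : Bool} {r : ℕ} {o x y X Y w h : ℤ} {u l : Wd} (hr : r ≤ 2)
    (ho : o = 0 ∨ (o = 1 ∨ o = -1) ∧ r ≤ 1) (hx : x < X) (hX : X + Y = x + y)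
    (hlev : ∀ v ∈ verts (x + m.dx) (y + 1 - m.dx) u, x + y + 1 ≤ v.1 + v.2) :
    Pair20 r o x y X Y w h (m.word ++ u) (fwd b :: l) ↔
    Guard20 m b r o x y X h ∧ Pair20 (r - m.cost) m.ob (x + m.dx) (y + 1 - m.dx) (X + fx b)
      (Y + 1 - fx b) w h u l := by
  have hT : (w, h) = (x + m.dx + dX u, y + 1 - m.dx + dY u) →
      (w, h) ∈ verts (x + m.dx) (y + 1 - m.dx) u := fun e => e ▸ end_mem_verts _ _ u
  have hP := start_mem_verts (x + m.dx) (y + 1 - m.dx) u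
  have hQ := start_mem_verts (X + fx b) (Y + 1 - fx b) l
  have hfx : fx b = 0 ∨ fx b = 1 := by cases b <;> simp [fx]
  constructor
  · rintro ⟨h1, h2, h3, h4, h5, h6, h7, h8, h9⟩
    have hnd := h1.nodup
    rw [Reg.append_iff hr hlev] at h1
    obtain ⟨hc, h1, hob⟩ := h1
    rw [dX_append, m.dX_word] at h3
    rw [dY_append, m.dY_word] at h4
    rw [dX_fwd_cons] at h5
    rw [dY_fwd_cons] at h6
    rw [backs_fwd_cons] at h2
    rw [m.verts_word_append] at h7 h8 h9 hnd
    rw [verts_fwd_cons] at h7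
    rw [List.nodup_append] at hnd
    replace hT := hT (by ext <;> simp only <;> omega)
    -- A meeting point would have to be the common end, but that end already occurs in the remainder
    -- of the upper path, which has no repeated vertex.
    have hpre : ∀ v ∈ m.pre x y, v ≠ (X, Y) ∧ v ≠ (X + fx b, Y + 1 - fx b) := by
      refine fun v hv => ⟨fun e => ?_, fun e => ?_⟩
      · have := h7 v (by simp [hv]) (by simp [e])
        exact hnd.2.2 v hv _ hT this
      · have := h7 v (by simp [hv]) (by simp [e, hQ])
        exact hnd.2.2 v hv _ hT this
    have hrect := h9 _ (List.mem_append_right _ hP)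
    have hPQ : x + m.dx = X + fx b → y + 1 - m.dx = h := fun e => by
      have := h7 (x + m.dx, y + 1 - m.dx) (by simp [hP])
        (List.mem_cons_of_mem _ (by convert hQ using 2; omega))
      simp at this; omega
    have hneed : ∀ v ∈ m.pre x y, 0 ≤ v.1 ∧ v.2 ≤ h := fun v hv => h9 v (by simp [hv])
    have hob' : o ≠ 0 → (x + o, y - o) ∉ m.pre x y := fun ho hm => h8 ho (by simp [hm])
    -- The highest point of a piece relative to its end is its start, its end or the vertex just
    -- north of its start.
    have htop : y + 1 - m.dx + m.top ≤ h := by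
      have h1 := hneed (x, y)
      have h2 := hneed (x, y + 1)
      cases m <;> simp only [Macro.pre, Macro.top, Macro.dx, List.mem_cons, true_or, or_true,
        forall_const] at h1 h2 hrect ⊢ <;> omega
    refine ⟨?_, ?_⟩
    · refine ⟨hc, ?_, ?_, htop, ?_⟩
      · rcases ho with rfl | ⟨rfl | rfl, hr1⟩ <;> cases m <;> simp [Macro.ob, Macro.pre] at hob' ⊢
        exact hob' rfl
      · cases m <;> simp [Macro.pre, Macro.need] at hneed ⊢ <;> omega
      · refine Macro.lo_le hx hfx (fun a c hv hac e => (hpre _ hv).1 ?_)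
          (fun a c hv hac e => (hpre _ hv).2 ?_) hPQ htop <;> ext <;> simp only <;> omega
    · exact ⟨h1, h2, by omega, by omega, by omega, by omega,
        fun v hv hv' => h7 v (List.mem_append_right _ hv) (List.mem_cons_of_mem _ hv'), hob,
        fun v hv => h9 v (List.mem_append_right _ hv)⟩
  · rintro ⟨⟨g1, g2, g3, g4, g5⟩, h1, h2, h3, h4, h5, h6, h7, h8, h9⟩
    have hrect := h9 _ hP
    have hPQ : x + m.dx = X + fx b → y + 1 - m.dx = h := fun e => by
      have := h7 (x + m.dx, y + 1 - m.dx) hP (by convert hQ using 2; omega)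
      simp at this; omega
    refine ⟨(Reg.append_iff hr hlev).2 ⟨g1, h1, h8⟩, by rwa [backs_fwd_cons],
      by rw [dX_append, m.dX_word]; omega, by rw [dY_append, m.dY_word]; omega,
      by rw [dX_fwd_cons]; omega, by rw [dY_fwd_cons]; omega, ?_, ?_, ?_⟩
    · rw [m.verts_word_append, verts_fwd_cons]
      intro v hv hv'
      rcases List.mem_append.1 hv with hv | hv <;> rcases List.mem_cons.1 hv' with hv' | hv'
      · exfalso
        subst hv'
        cases m <;> simp [Macro.pre, Macro.lo, Macro.dx, Macro.top] at hv g4 g5 hPQ <;> omega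
      · exfalso
        -- The remainder of the lower path is monotone, hence stays to the east of its first vertex,
        -- and the distance bound keeps that vertex away from the piece.
        have := mem_verts_of_backs_eq_zero h2 hv'
        obtain ⟨a, c⟩ := v
        cases m <;> simp [Macro.pre, Macro.lo, Macro.dx, Macro.top] at hv g4 g5 this hPQ <;> omega
      · have := hlev v hv
        subst hv'; simp only at this; omega
      · exact h7 v hv hv'
    · rw [m.verts_word_append]
      intro ho0 hv
      rcases List.mem_append.1 hv with hv | hv
      · rcases ho with rfl | ⟨rfl | rfl, hr1⟩ <;> cases m <;>
          simp [Macro.ob, Macro.pre, Macro.cost] at hv g2 ho0 g1 <;> omega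
      · have := hlev _ hv
        simp only at this; omega
    · rw [m.verts_word_append]
      intro v hv
      rcases List.mem_append.1 hv with hv | hv
      · obtain ⟨a, c⟩ := v
        cases m <;> simp [Macro.pre, Macro.need, Macro.top, Macro.dx] at hv g3 g4 hrect ⊢ <;> omega
      · exact h9 v hv

/-! ### Recursions for the number of pairs. -/

theorem ncard_eq_sum_of_cover {α β ι : Type*} [Fintype ι] {S : Set α} {T : ι → Set β}
    {f : ι → β → α} (hT : ∀ i, (T i).Finite) (hmaps : ∀ i, ∀ b ∈ T i, f i b ∈ S)
    (hcover : ∀ a ∈ S, ∃ i, ∃ b ∈ T i, f i b = a)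
    (hinj : ∀ i i' b b', b ∈ T i → b' ∈ T i' → f i b = f i' b' → i = i' ∧ b = b') :
    S.ncard = ∑ i, (T i).ncard := by
  have (i : ι) : Finite (T i) := hT i
  rw [← Nat.card_coe_set_eq]
  simp_rw [← Nat.card_coe_set_eq]
  rw [← Nat.card_sigma]
  symm
  refine Nat.card_congr (Equiv.ofBijective (fun p => ⟨f p.1 p.2, hmaps _ _ p.2.2⟩) ⟨?_, ?_⟩)
  · rintro ⟨i, b, hb⟩ ⟨i', b', hb'⟩ h
    obtain ⟨rfl, rfl⟩ := hinj i i' b b' hb hb' (congrArg Subtype.val h)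
    rfl
  · rintro ⟨a, ha⟩
    obtain ⟨i, b, hb, rfl⟩ := hcover a ha
    exact ⟨⟨i, b, hb⟩, rfl⟩

instance : Finite Dir :=
  Finite.of_injective (β := Fin 4) (fun s => match s with | .E => 0 | .N => 1 | .W => 2 | .S => 3)
    (by intro s t h; cases s <;> cases t <;> simp_all)

theorem finite_words_of_length (k : ℤ) : {u : Wd | (u.length : ℤ) = k}.Finite := by
  refine (List.finite_length_eq Dir k.toNat).subset fun u hu => ?_
  change (u.length : ℤ) = k at hu
  change u.length = k.toNat
  omega

theorem verts_shift (a c x y : ℤ) (u : Wd) :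
    verts (x + a) (y + c) u = (verts x y u).map fun v => (v.1 + a, v.2 + c) := by
  induction u generalizing x y with
  | nil => simp [verts]
  | cons s u ih =>
    cases s <;> simp only [verts, List.map_cons, ← ih, add_right_comm, sub_add_eq_add_sub]

theorem mem_verts_shift {a c x y : ℤ} {u : Wd} {v : ℤ × ℤ} :
    v ∈ verts (x + a) (y + c) u ↔ (v.1 - a, v.2 - c) ∈ verts x y u := by
  rw [verts_shift, List.mem_map]
  constructor
  · rintro ⟨v, hv, rfl⟩; simpa using hv
  · exact fun h => ⟨_, h, by simp⟩

theorem sub_backs_le_fst {x y : ℤ} {u : Wd} {v : ℤ × ℤ} (hv : v ∈ verts x y u) :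
    x - backs u ≤ v.1 := by
  induction u generalizing x y with
  | nil => simp [verts] at hv; simp [hv, backs]
  | cons s u ih =>
    cases s <;> simp only [verts, List.mem_cons, backs] at hv ⊢ <;> rcases hv with rfl | hv <;>
      first
        | (have := ih hv; push_cast; omega)
        | (push_cast; omega)

theorem Reg.shift {a c x y : ℤ} {r : ℕ} {u : Wd} (h : Reg x y r u) : Reg (x + a) (y + c) r u := by
  refine ⟨h.back, fun v hv => ?_, ?_, h.lastW, h.lastS⟩
  · have := h.lev _ (mem_verts_shift.1 hv)
    simp only at this; omega
  · rw [verts_shift]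
    refine h.nodup.map fun v w e => ?_
    simp only [Prod.mk.injEq, add_left_inj] at e
    exact Prod.ext e.1 e.2

/-- Only the western wall obstructs a horizontal translation, and it is out of reach when the new
starting abscissa is at least the number of backward steps. Vertical translations move the northern
wall along. -/
theorem Pair20.shift {a c : ℤ} {r : ℕ} {o x y X Y w h : ℤ} {u l : Wd}
    (H : Pair20 r o x y X Y w h u l) (ha : a = 0 ∨ r ≤ x + a) :
    Pair20 r o (x + a) (y + c) (X + a) (Y + c) (w + a) (h + c) u l := by
  obtain ⟨h1, h2, h3, h4, h5, h6, h7, h8, h9⟩ := H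
  refine ⟨h1.shift, h2, by omega, by omega, by omega, by omega, fun v hv hv' => ?_, fun ho hv => ?_,
    fun v hv => ?_⟩
  · have := h7 _ (mem_verts_shift.1 hv) (mem_verts_shift.1 hv')
    simp only [Prod.mk.injEq] at this
    ext <;> simp only <;> omega
  · rw [mem_verts_shift] at hv
    exact h8 ho (by convert hv using 2 <;> simp only <;> ring)
  · have h' := h9 _ (mem_verts_shift.1 hv)
    have := sub_backs_le_fst hv
    rw [h1.back] at this
    simp only at h'
    omega

/-- The pairs of paths described by `Pair20`. -/
def set20 (r : ℕ) (o x y X Y w h : ℤ) : Set (Wd × Wd) := {p | Pair20 r o x y X Y w h p.1 p.2}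

theorem set20_finite (r : ℕ) (o x y X Y w h : ℤ) : (set20 r o x y X Y w h).Finite := by
  refine ((finite_words_of_length (w - x + (h - y) + 2 * r)).prod
    (finite_words_of_length (w - X + (h - Y)))).subset ?_
  rintro ⟨u, l⟩ ⟨h1, h2, h3, h4, h5, h6, -, -, -⟩
  have hu := length_eq u
  have hl := length_eq l
  rw [h1.back] at hu
  rw [h2] at hl
  simp only at *
  exact ⟨by change (u.length : ℤ) = _; omega, by change (l.length : ℤ) = _; omega⟩

theorem exists_fwd_cons {l : Wd} (h : backs l = 0) (hl : l ≠ []) :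
    ∃ b l', l = fwd b :: l' ∧ backs l' = 0 := by
  rcases l with _ | ⟨_ | _ | _ | _, l⟩
  · exact absurd rfl hl
  · exact ⟨true, l, rfl, h⟩
  · exact ⟨false, l, rfl, h⟩
  · simp [backs] at h
  · simp [backs] at h

theorem dX_nonneg {l : Wd} (h : backs l = 0) : 0 ≤ dX l := by
  have := (mem_verts_of_backs_eq_zero h (end_mem_verts 0 0 l)).1; simpa using this

theorem fwd_injective {b b' : Bool} (h : fwd b = fwd b') : b = b' := by
  cases b <;> cases b' <;> simp_all [fwd]

-- Existence of a first piece makes the transfer step exhaustive, and uniqueness of the cut makes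
-- the union over pieces and steps disjoint.
open Classical in
theorem ncard_set20 {r : ℕ} {o x y X Y w h : ℤ} (hr : r ≤ 2)
    (ho : o = 0 ∨ (o = 1 ∨ o = -1) ∧ r ≤ 1) (hx : x < X) (hX : X + Y = x + y) :
    (set20 r o x y X Y w h).ncard = ∑ p : Macro × Bool, if Guard20 p.1 p.2 r o x y X h then
      (set20 (r - p.1.cost) p.1.ob (x + p.1.dx) (y + 1 - p.1.dx) (X + fx p.2)
        (Y + 1 - fx p.2) w h).ncard else 0 := by
  rw [ncard_eq_sum_of_cover (ι := Macro × Bool) (S := set20 r o x y X Y w h)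
    (T := fun p => if Guard20 p.1 p.2 r o x y X h then
      set20 (r - p.1.cost) p.1.ob (x + p.1.dx) (y + 1 - p.1.dx) (X + fx p.2)
        (Y + 1 - fx p.2) w h else ∅) (f := fun p q => (p.1.word ++ q.1, fwd p.2 :: q.2))]
  · refine Finset.sum_congr rfl fun p _ => ?_
    split_ifs <;> simp
  · intro p
    split_ifs
    · exact set20_finite ..
    · exact Set.finite_empty
  · rintro ⟨m, b⟩ ⟨u, l⟩ hq
    simp only at hq
    split_ifs at hq with hg
    · refine (Pair20.block hr ho hx hX fun v hv => ?_).2 ⟨hg, hq⟩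
      have := hq.reg.lev v hv
      omega
    · exact absurd hq (Set.notMem_empty _)
  · rintro ⟨u, l⟩ hq
    have hq' : Pair20 r o x y X Y w h u l := hq
    -- An empty upper path would make its start the common end, which lies to the west of the start
    -- of the lower path; the latter never goes west.
    have hu : u ≠ [] := by
      rintro rfl
      have h1 := dX_nonneg hq'.plain
      have h2 := hq'.ux
      have h3 := hq'.lx
      simp [dX] at h2; omega
    obtain ⟨m, u', rfl, hlev⟩ := hq'.reg.exists_firstStep hr hu
    -- An empty lower path would put the common end on the initial diagonal, below the remainder of
    -- the upper path.
    have hl : l ≠ [] := by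
      rintro rfl
      have h1 := hlev _ (end_mem_verts _ _ u')
      have h2 := hq'.ux
      have h3 := hq'.lx
      have h4 := hq'.uy
      have h5 := hq'.ly
      rw [dX_append, m.dX_word] at h2
      rw [dY_append, m.dY_word] at h4
      simp [dX, dY] at h1 h3 h5; omega
    obtain ⟨b, l', rfl, -⟩ := exists_fwd_cons hq'.plain hl
    obtain ⟨hg, hq'⟩ := (Pair20.block hr ho hx hX hlev).1 hq'
    exact ⟨(m, b), (u', l'), by simp only [if_pos hg]; exact hq', rfl⟩
  · rintro ⟨m, b⟩ ⟨m', b'⟩ ⟨u, l⟩ ⟨u', l'⟩ hq hq' he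
    simp only at hq hq'
    split_ifs at hq hq' with hg hg'
    · simp only [Prod.mk.injEq, List.cons.injEq] at he
      obtain ⟨h1, h2, h3⟩ := he
      obtain ⟨rfl, rfl⟩ := Macro.word_append_inj (x := x) (y := y) h1
        (fun v hv => by have := hq.reg.lev v hv; omega)
        (fun v hv => by have := hq'.reg.lev v hv; omega)
      exact ⟨by rw [fwd_injective h2], by rw [h3]⟩
    all_goals simp_all

/-- The number of pairs of paths `Pair20` for a given distance `d` of the starting points; `f` is the
abscissa of the upper one, `i` its width, and `j` is the height of the lower path. -/
noncomputable def cnt20 (r : ℕ) (o f d i j : ℤ) : ℕ := (set20 r o f d (f + d) 0 (f + i) j).ncard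

theorem ncard_set20_shift {r : ℕ} {o x y X Y w h : ℤ} (a c : ℤ) (ha : a = 0 ∨ r ≤ x ∧ r ≤ x + a) :
    (set20 r o (x + a) (y + c) (X + a) (Y + c) (w + a) (h + c)).ncard =
      (set20 r o x y X Y w h).ncard := by
  congr 1
  ext p
  refine ⟨fun hp => ?_, fun hp => Pair20.shift hp (by omega)⟩
  have := Pair20.shift (a := -a) (c := -c) hp (by omega)
  simpa [set20] using this

/-- With at most r steps to the west the wall is never reached from distance r, so only finitely
many values of f have to be distinguished. -/
theorem cnt20_stable {r : ℕ} {o f f' d i j : ℤ} (hf : r ≤ f) (hf' : r ≤ f') :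
    cnt20 r o f d i j = cnt20 r o f' d i j := by
  have := ncard_set20_shift (r := r) (o := o) (x := f) (y := d) (X := f + d) (Y := 0) (w := f + i)
    (h := j) (f' - f) 0 (by omega)
  unfold cnt20
  rw [← this]
  congr 2 <;> ring

-- After a step of the lower path to the north, a vertical translation returns its start to ordinate
-- zero. The count thus depends only on distances, and the recursion refers to the same family.
open Classical in
theorem cnt20_eq {r : ℕ} {o f d i j : ℤ} (hr : r ≤ 2) (ho : o = 0 ∨ (o = 1 ∨ o = -1) ∧ r ≤ 1)
    (hd : 0 < d) : cnt20 r o f d i j = ∑ p : Macro × Bool,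
      if p.1.cost ≤ r ∧ (o ≠ 0 → o + p.1.ob ≠ 0) ∧ p.1.need ≤ f ∧
        p.1.top ≤ (j - (1 - fx p.2)) - (d + fx p.2 - p.1.dx) ∧ p.1.lo ≤ d + fx p.2 - p.1.dx then
      cnt20 (r - p.1.cost) p.1.ob (f + p.1.dx) (d + fx p.2 - p.1.dx) (i - p.1.dx) (j - (1 - fx p.2))
      else 0 := by
  rw [cnt20, ncard_set20 hr ho (by omega) (by omega)]
  refine Finset.sum_congr rfl fun ⟨m, b⟩ _ => ?_
  congr 1
  · refine propext ⟨?_, ?_⟩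
    · rintro ⟨h1, h2, h3, h4, h5⟩
      exact ⟨h1, h2, h3, by simp only at *; omega, by simp only at *; omega⟩
    · rintro ⟨h1, h2, h3, h4, h5⟩
      exact ⟨h1, h2, h3, by simp only at *; omega, by simp only at *; omega⟩
  · refine Eq.trans ?_ (ncard_set20_shift 0 (1 - fx b) (Or.inl rfl))
    congr 2 <;> simp only <;> ring

/-- The end lies weakly east of the start of the lower path and weakly north of the start of the
upper path. Divisibility of the generating function by (xy)^d comes from here. -/
theorem le_of_cnt20_ne_zero {r : ℕ} {o f d i j : ℤ} (h : cnt20 r o f d i j ≠ 0) : d ≤ i ∧ d ≤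
    j := by
  obtain ⟨⟨u, l⟩, hq⟩ := Set.nonempty_of_ncard_ne_zero h
  obtain ⟨-, h2, h3, h4, h5, h6, -, -, h9⟩ := hq
  have := dX_nonneg h2
  have := h9 _ (start_mem_verts _ _ _)
  simp only at *
  omega

/-- The common start is a meeting point, hence the common end, and a path without repeated vertices
cannot return to its start. -/
theorem Pair20.eq_nil {r : ℕ} {o x y w h : ℤ} {u l : Wd} (H : Pair20 r o x y x y w h u l) :
    u = [] ∧ l = [] := by
  have h1 := H.disj _ (start_mem_verts x y u) (start_mem_verts x y l)
  obtain ⟨rfl, rfl⟩ := Prod.mk.inj h1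
  have h2 := H.ux
  have h3 := H.uy
  have h4 := H.lx
  have h5 := H.ly
  have hl := length_eq l
  rw [H.plain] at hl
  refine ⟨?_, by rw [← List.length_eq_zero_iff]; omega⟩
  have hn := H.reg.nodup
  rcases u with _ | ⟨s, u⟩
  · rfl
  · exfalso
    cases s <;> simp only [verts, List.nodup_cons, dX, dY] at hn h2 h3 <;> refine hn.1 ?_ <;>
      convert end_mem_verts _ _ u using 2 <;> omega

theorem cnt20_zero_left {r : ℕ} {o f i j : ℤ} (hr : r ≠ 0) : cnt20 r o f 0 i j = 0 := by
  rw [cnt20, add_zero]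
  refine (congrArg Set.ncard (Set.eq_empty_of_forall_notMem fun p hp => hr ?_)).trans
    (Set.ncard_empty _)
  rw [← hp.reg.back, (Pair20.eq_nil hp).1, backs]

theorem pair20_nil {x y : ℤ} (hx : 0 ≤ x) : Pair20 0 0 x y x y x y [] [] :=
  ⟨⟨rfl, by simp [verts], by simp [verts], by simp, by simp⟩, rfl, by simp [dX], by simp [dY],
    by simp [dX], by simp [dY], by simp [verts], by simp, by simp [verts, hx]⟩

theorem cnt20_zero_zero {f i j : ℤ} (hf : 0 ≤ f) :
    cnt20 0 0 f 0 i j = if i = 0 ∧ j = 0 then 1 else 0 := by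
  rw [cnt20, add_zero]
  split_ifs with h
  · rw [h.1, h.2, add_zero, Set.ncard_eq_one]
    refine ⟨([], []), Set.eq_singleton_iff_unique_mem.2 ⟨pair20_nil hf, fun p hp => ?_⟩⟩
    exact Prod.ext (Pair20.eq_nil hp).1 (Pair20.eq_nil hp).2
  · refine (congrArg Set.ncard (Set.eq_empty_of_forall_notMem fun p hp => h ?_)).trans
      (Set.ncard_empty _)
    have h1 := hp.ux
    have h2 := hp.uy
    rw [(Pair20.eq_nil hp).1] at h1 h2
    simp only [dX, dY] at h1 h2
    omega

/-- A monotone path meets its initial diagonal only at its start, so the remembered vertex is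
irrelevant once no backward step is left. -/
theorem cnt20_zero_ob {o f d i j : ℤ} : cnt20 0 o f d i j = cnt20 0 0 f d i j := by
  unfold cnt20
  congr 1
  ext p
  refine ⟨fun ⟨h1, h2, h3, h4, h5, h6, h7, h8, h9⟩ => ⟨h1, h2, h3, h4, h5, h6, h7, by simp, h9⟩,
    fun ⟨h1, h2, h3, h4, h5, h6, h7, h8, h9⟩ => ⟨h1, h2, h3, h4, h5, h6, h7, fun ho hv => ?_, h9⟩⟩
  have := mem_verts_eq_start h1.back hv (by simp only; omega)
  simp at this; omega

/-! ### Pairs with at most one backward step on each path. -/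

theorem sub_backs_le_snd {x y : ℤ} {u : Wd} {v : ℤ × ℤ} (hv : v ∈ verts x y u) :
    y - backs u ≤ v.2 := by
  induction u generalizing x y with
  | nil => simp [verts] at hv; simp [hv, backs]
  | cons s u ih =>
    cases s <;> simp only [verts, List.mem_cons, backs] at hv ⊢ <;> rcases hv with rfl | hv <;>
      first
        | (have := ih hv; push_cast; omega)
        | (push_cast; omega)

/-- Two paths from `(x, y)` and `(X, Y)` to `(w, h)` which only meet at the end, with `r` and `s`
steps to the west or south. The upper one does not leave the rectangle to the west or north, the
lower one does not leave it to the south or east. If `c` then the lower path avoids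
`(x + 1, y - 1)`, if `c'` then the upper path avoids `(X - 1, Y + 1)`. -/
structure Pair11 (r s : ℕ) (c c' : Prop) (x y X Y w h : ℤ) (u l : Wd) : Prop where
  regU : Reg x y r u
  regL : Reg X Y s l
  ux : x + dX u = w
  uy : y + dY u = h
  lx : X + dX l = w
  ly : Y + dY l = h
  disj : ∀ v ∈ verts x y u, v ∈ verts X Y l → v = (w, h)
  obL : c → (x + 1, y - 1) ∉ verts X Y l
  obU : c' → (X - 1, Y + 1) ∉ verts x y u
  rectU : ∀ v ∈ verts x y u, 0 ≤ v.1 ∧ v.2 ≤ h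
  rectL : ∀ v ∈ verts X Y l, 0 ≤ v.2 ∧ v.1 ≤ w

namespace Macro

/-- How far a piece with at most one step to the west or south reaches to the south of its start. -/
def need' : Macro → ℤ
  | ese => 1
  | _ => 0

/-- How far a piece with at most one step to the west or south reaches to the east of its end. -/
def top' : Macro → ℤ
  | nwn => 1
  | _ => 0

/-- The minimal distance after a pair of pieces. -/
def lo₂ : Macro → Macro → ℤ
  | ese, ese => 2
  | nwn, nwn => 2
  | ese, _ => 1
  | _, nwn => 1
  | _, _ => 0

theorem eq_of_cost_le_one {m : Macro} (h : m.cost ≤ 1) : m = e ∨ m = n ∨ m = ese ∨ m = nwn := by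
  cases m <;> simp [cost] at h ⊢

end Macro

/-- When two pieces of the upper and the lower path may be placed next to each other. -/
structure Guard11 (m m' : Macro) (r s : ℕ) (c c' : Prop) (x y X Y w h : ℤ) : Prop where
  cost : m.cost ≤ r
  cost' : m'.cost ≤ s
  need : m.need ≤ x
  need' : m'.need' ≤ Y
  top : y + 1 - m.dx + m.top ≤ h
  top' : X + m'.dx + m'.top' ≤ w
  lo : Macro.lo₂ m m' ≤ X + m'.dx - (x + m.dx)
  ob : c → m' = .nwn → X ≠ x + 2
  ob' : c' → m = .ese → X ≠ x + 2

/-- Two pieces of the same bent kind collide when they start at distance one; for the other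
combinations too small a final distance forces a common vertex or premature coincidence of the ends.
-/
theorem Macro.lo₂_le {m m' : Macro} {x y X Y : ℤ} (hm : m.cost ≤ 1) (hm' : m'.cost ≤ 1)
    (hx : x < X) (hX : X + Y = x + y) (d1 : ∀ v ∈ m.pre x y, v ∉ m'.pre X Y)
    (d2 : (X + m'.dx, Y + 1 - m'.dx) ∉ m.pre x y) (d3 : (x + m.dx, y + 1 - m.dx) ∉ m'.pre X Y)
    (d4 : x + m.dx = X + m'.dx → m.top = 0 ∧ m'.top' = 0) :
    lo₂ m m' ≤ X + m'.dx - (x + m.dx) := by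
  by_contra hlt
  -- A pair of pieces shortens the distance by at most three, so only three initial distances can
  -- violate the bound.
  have hX3 : (X = x + 1 ∧ y = Y + 1) ∨ (X = x + 2 ∧ y = Y + 2) ∨ (X = x + 3 ∧ y = Y + 3) := by
    clear d1 d2 d3 d4
    rcases eq_of_cost_le_one hm with rfl | rfl | rfl | rfl <;>
    rcases eq_of_cost_le_one hm' with rfl | rfl | rfl | rfl <;>
    simp only [lo₂, dx] at hlt <;> omega
  rcases hX3 with ⟨rfl, rfl⟩ | ⟨rfl, rfl⟩ | ⟨rfl, rfl⟩ <;>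
  rcases eq_of_cost_le_one hm with rfl | rfl | rfl | rfl <;>
  rcases eq_of_cost_le_one hm' with rfl | rfl | rfl | rfl <;>
  simp [pre, lo₂, dx, top, top'] at d1 d2 d3 d4 hlt <;> omega

/-- Here one path can leave behind a vertex on the next diagonal that the other, still having its
backward step, may run into. An upper `nwn` leaves it on the side of the lower path, and a lower
`ese` on the side of the upper path; the flags carry this memory for one level. Within one path no
memory is needed, since its only backward step has been spent. -/
theorem Pair11.block {m m' : Macro} {r s : ℕ} {c c' : Prop} {x y X Y w h : ℤ} {u l : Wd}
    (hr : r ≤ 1) (hs : s ≤ 1) (hc : c → x + 2 ≤ X) (hc' : c' → x + 2 ≤ X)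
    (hx : x < X) (hX : X + Y = x + y)
    (hlev : ∀ v ∈ verts (x + m.dx) (y + 1 - m.dx) u, x + y + 1 ≤ v.1 + v.2)
    (hlev' : ∀ v ∈ verts (X + m'.dx) (Y + 1 - m'.dx) l, X + Y + 1 ≤ v.1 + v.2) :
    Pair11 r s c c' x y X Y w h (m.word ++ u) (m'.word ++ l) ↔
    Guard11 m m' r s c c' x y X Y w h ∧
      Pair11 (r - m.cost) (s - m'.cost) (m = .nwn ∧ s - m'.cost ≠ 0) (m' = .ese ∧ r - m.cost ≠ 0)
        (x + m.dx) (y + 1 - m.dx) (X + m'.dx) (Y + 1 - m'.dx) w h u l := by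
  have hP := start_mem_verts (x + m.dx) (y + 1 - m.dx) u
  have hQ := start_mem_verts (X + m'.dx) (Y + 1 - m'.dx) l
  have hTU : (x + m.dx + dX u, y + 1 - m.dx + dY u) = (w, h) →
      (w, h) ∈ verts (x + m.dx) (y + 1 - m.dx) u := fun e => e ▸ end_mem_verts _ _ u
  have hTL : (X + m'.dx + dX l, Y + 1 - m'.dx + dY l) = (w, h) →
      (w, h) ∈ verts (X + m'.dx) (Y + 1 - m'.dx) l := fun e => e ▸ end_mem_verts _ _ l
  constructor
  · rintro ⟨h1, h2, h3, h4, h5, h6, h7, h8, h8', h9, h9'⟩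
    have hnd := h1.nodup
    have hnd' := h2.nodup
    obtain ⟨hcost, h1, -⟩ := (Reg.append_iff (by omega) hlev).1 h1
    obtain ⟨hcost', h2, -⟩ := (Reg.append_iff (by omega) hlev').1 h2
    rw [dX_append, Macro.dX_word] at h3 h5
    rw [dY_append, Macro.dY_word] at h4 h6
    rw [Macro.verts_word_append, List.nodup_append] at hnd hnd'
    rw [Macro.verts_word_append] at h7 h8 h8' h9 h9'
    rw [Macro.verts_word_append] at h7
    replace hTU := hTU (by ext <;> simp only <;> omega)
    replace hTL := hTL (by ext <;> simp only <;> omega)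
    have d1 : ∀ v ∈ m.pre x y, v ∉ m'.pre X Y := fun v hv hv' =>
      hnd.2.2 v hv _ hTU (h7 v (by simp [hv]) (by simp [hv']))
    have d2 : (X + m'.dx, Y + 1 - m'.dx) ∉ m.pre x y := fun hv =>
      hnd.2.2 _ hv _ hTU (h7 _ (by simp [hv]) (by simp [hQ]))
    have d3 : (x + m.dx, y + 1 - m.dx) ∉ m'.pre X Y := fun hv =>
      hnd'.2.2 _ hv _ hTL (h7 _ (by simp [hP]) (by simp [hv]))
    have r1 := h9 _ (List.mem_append_right _ hP)
    have r2 := h9' _ (List.mem_append_right _ hQ)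
    have r3 : ∀ v ∈ m.pre x y, 0 ≤ v.1 ∧ v.2 ≤ h := fun v hv => h9 v (by simp [hv])
    have r4 : ∀ v ∈ m'.pre X Y, 0 ≤ v.2 ∧ v.1 ≤ w := fun v hv => h9' v (by simp [hv])
    have d4 : x + m.dx = X + m'.dx → x + m.dx = w ∧ y + 1 - m.dx = h := fun e => by
      have := h7 (x + m.dx, y + 1 - m.dx) (by simp [hP])
        (by rw [e, show y + 1 - m.dx = Y + 1 - m'.dx by omega]; simp [hQ])
      simpa using this
    have o1 : c → (x + 1, y - 1) ∉ m'.pre X Y := fun hc hv => h8 hc (by simp [hv])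
    have o2 : c' → (X - 1, Y + 1) ∉ m.pre x y := fun hc hv => h8' hc (by simp [hv])
    have t1 : y + 1 - m.dx + m.top ≤ h := by
      have h1 := r3 (x, y)
      rcases Macro.eq_of_cost_le_one (hcost.trans hr) with rfl | rfl | rfl | rfl <;>
        simp only [Macro.pre, Macro.top, Macro.dx, List.mem_cons, true_or, forall_const]
          at h1 r1 ⊢ <;> omega
    have t2 : X + m'.dx + m'.top' ≤ w := by
      have h1 := r4 (X, Y)
      rcases Macro.eq_of_cost_le_one (hcost'.trans hs) with rfl | rfl | rfl | rfl <;>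
        simp only [Macro.pre, Macro.top', Macro.dx, List.mem_cons, true_or, forall_const]
          at h1 r2 ⊢ <;> omega
    have t3 : 0 ≤ m.top := by cases m <;> simp [Macro.top]
    have t4 : 0 ≤ m'.top' := by cases m' <;> simp [Macro.top']
    have g1 : m.need ≤ x := by
      rcases Macro.eq_of_cost_le_one (hcost.trans hr) with rfl | rfl | rfl | rfl <;>
        simp [Macro.pre, Macro.need] at r3 ⊢ <;> omega
    have g2 : m'.need' ≤ Y := by
      rcases Macro.eq_of_cost_le_one (hcost'.trans hs) with rfl | rfl | rfl | rfl <;>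
        simp [Macro.pre, Macro.need'] at r4 ⊢ <;> omega
    have g3 := Macro.lo₂_le (hcost.trans hr) (hcost'.trans hs) hx hX d1 d2 d3 fun e => by
      have := d4 e; omega
    have g4 : c → m' = .nwn → X ≠ x + 2 := by
      rintro h0 rfl rfl
      exact o1 h0 (by simp [Macro.pre]; omega)
    have g5 : c' → m = .ese → X ≠ x + 2 := by
      rintro h0 rfl rfl
      exact o2 h0 (by simp [Macro.pre]; omega)
    refine ⟨⟨hcost, hcost', g1, g2, t1, t2, g3, g4, g5⟩, h1, h2, by omega, by omega, by omega,
      by omega, fun v hv hv' =>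
      h7 v (by simp [hv]) (by simp [hv']), ?_, ?_, fun v hv => h9 v (by simp [hv]),
      fun v hv => h9' v (by simp [hv])⟩
    · rintro ⟨rfl, -⟩ hv
      refine hnd.2.2 (x, y + 1) (by simp [Macro.pre]) _ hTU
        (h7 _ (by simp [Macro.pre]) (List.mem_append_right _ ?_))
      convert hv using 2 <;> simp [Macro.dx]
    · rintro ⟨rfl, -⟩ hv
      refine hnd'.2.2 (X + 1, Y) (by simp [Macro.pre]) _ hTL
        (h7 _ (List.mem_append_right _ ?_) (by simp [Macro.pre]))
      convert hv using 2 <;> simp [Macro.dx] <;> ring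
  · rintro ⟨⟨g1, g1', g2, g2', g3, g3', g4, g5, g5'⟩, h1, h2, h3, h4, h5, h6, h7, h7', h8, h9, h9'⟩
    have hcr := g1.trans hr
    have hcs := g1'.trans hs
    have hPQ : x + m.dx = X + m'.dx → x + m.dx = w ∧ y + 1 - m.dx = h := fun e => by
      have := h7 (x + m.dx, y + 1 - m.dx) hP
        (by rw [e, show y + 1 - m.dx = Y + 1 - m'.dx by omega]; exact hQ)
      simpa using this
    have r1 := h9 _ hP
    have r2 := h9' _ hQ
    have e1 : ∀ v ∈ m.pre x y, v ∉ m'.pre X Y := by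
      rintro ⟨a, b⟩ hv hv'
      rcases Macro.eq_of_cost_le_one hcr with rfl | rfl | rfl | rfl <;>
      rcases Macro.eq_of_cost_le_one hcs with rfl | rfl | rfl | rfl <;>
      simp only [Macro.pre, Macro.lo₂, Macro.dx, List.mem_cons, Prod.mk.injEq, List.not_mem_nil,
        or_false] at hv hv' g4 <;> omega
    have e2 : ∀ v ∈ m.pre x y, v ∉ verts (X + m'.dx) (Y + 1 - m'.dx) l := by
      rintro ⟨a, b⟩ hv hv'
      have k1 := hlev' _ hv'
      have k2 := sub_backs_le_fst hv'
      rw [h2.back] at k2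
      rcases Macro.eq_of_cost_le_one hcr with rfl | rfl | rfl | rfl <;>
        simp only [Macro.pre, List.mem_cons, Prod.mk.injEq, List.not_mem_nil, or_false] at hv k1 k2
      · omega
      · omega
      · have : 1 ≤ X + m'.dx - (x + 2) := by
          cases m' <;> simp only [Macro.lo₂, Macro.dx] at g4 ⊢ <;> omega
        omega
      · have hab : a = x ∧ b = y + 1 := by omega
        -- A lower path without backward steps stays to the east of this vertex; otherwise the flag
        -- of the remainder forbids it.
        by_cases hs0 : s - m'.cost = 0
        · have : x + 1 ≤ X + m'.dx := by
            rcases Macro.eq_of_cost_le_one hcs with rfl | rfl | rfl | rfl <;>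
              simp only [Macro.lo₂, Macro.dx] at g4 ⊢ <;> omega
          omega
        · refine h7' ⟨rfl, hs0⟩ ?_
          rw [hab.1, hab.2] at hv'
          convert hv' using 2 <;> simp [Macro.dx]
    have e3 : ∀ v ∈ m'.pre X Y, v ∉ verts (x + m.dx) (y + 1 - m.dx) u := by
      rintro ⟨a, b⟩ hv' hv
      have k1 := hlev _ hv
      have k2 := sub_backs_le_snd hv
      rw [h1.back] at k2
      rcases Macro.eq_of_cost_le_one hcs with rfl | rfl | rfl | rfl <;>
        simp only [Macro.pre, List.mem_cons, Prod.mk.injEq, List.not_mem_nil, or_false] at hv' k1 k2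
      · omega
      · omega
      · obtain ⟨rfl, rfl⟩ : a = X + 1 ∧ b = Y := by omega
        by_cases hr0 : r - m.cost = 0
        · have : x + m.dx ≤ X := by
            rcases Macro.eq_of_cost_le_one hcr with rfl | rfl | rfl | rfl <;>
              simp only [Macro.lo₂, Macro.dx] at g4 ⊢ <;> omega
          omega
        · refine h8 ⟨rfl, hr0⟩ ?_
          convert hv using 2 <;> simp [Macro.dx] <;> ring
      · have : 1 ≤ X - 1 - (x + m.dx) := by
          rcases Macro.eq_of_cost_le_one hcr with rfl | rfl | rfl | rfl <;>
            simp only [Macro.lo₂, Macro.dx] at g4 ⊢ <;> omega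
        omega
    refine ⟨(Reg.append_iff (by omega) hlev).2 ⟨g1, h1, ?_⟩,
      (Reg.append_iff (by omega) hlev').2 ⟨g1', h2, ?_⟩,
      by rw [dX_append, m.dX_word]; omega, by rw [dY_append, m.dY_word]; omega,
      by rw [dX_append, m'.dX_word]; omega, by rw [dY_append, m'.dY_word]; omega, ?_, ?_, ?_, ?_,
        ?_⟩
    -- A piece that leaves such a vertex has used the only backward step, so the remainder is
    -- monotone and cannot get there.
    · intro hob hv
      have h0 : backs u = 0 := by
        rw [h1.back]
        rcases Macro.eq_of_cost_le_one hcr with rfl | rfl | rfl | rfl <;>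
          simp [Macro.ob, Macro.cost] at hob ⊢ <;> omega
      have := mem_verts_eq_start h0 hv (by simp only; omega)
      simp at this; omega
    · intro hob hv
      have h0 : backs l = 0 := by
        rw [h2.back]
        rcases Macro.eq_of_cost_le_one hcs with rfl | rfl | rfl | rfl <;>
          simp [Macro.ob, Macro.cost] at hob ⊢ <;> omega
      have := mem_verts_eq_start h0 hv (by simp only; omega)
      simp at this; omega
    · rw [Macro.verts_word_append, Macro.verts_word_append]
      intro v hv hv'
      rcases List.mem_append.1 hv with hv | hv <;> rcases List.mem_append.1 hv' with hv' | hv'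
      · exact absurd hv' (e1 v hv)
      · exact absurd hv' (e2 v hv)
      · exact absurd hv (e3 v hv')
      · exact h7 v hv hv'
    · rw [Macro.verts_word_append]
      intro hc0 hv
      rcases List.mem_append.1 hv with hv | hv
      · have := hc hc0
        rcases Macro.eq_of_cost_le_one hcs with rfl | rfl | rfl | rfl <;>
          simp [Macro.pre, hc0] at hv g5 <;> omega
      · have := hlev' _ hv
        simp only at this; omega
    · rw [Macro.verts_word_append]
      intro hc0 hv
      rcases List.mem_append.1 hv with hv | hv
      · have := hc' hc0
        rcases Macro.eq_of_cost_le_one hcr with rfl | rfl | rfl | rfl <;>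
          simp [Macro.pre, hc0] at hv g5' <;> omega
      · have := hlev _ hv
        simp only at this; omega
    · rw [Macro.verts_word_append]
      intro v hv
      rcases List.mem_append.1 hv with hv | hv
      · obtain ⟨a, b⟩ := v
        rcases Macro.eq_of_cost_le_one hcr with rfl | rfl | rfl | rfl <;>
          simp [Macro.pre, Macro.need, Macro.top, Macro.dx] at hv g2 g3 r1 ⊢ <;> omega
      · exact h9 v hv
    · rw [Macro.verts_word_append]
      intro v hv
      rcases List.mem_append.1 hv with hv | hv
      · obtain ⟨a, b⟩ := v
        rcases Macro.eq_of_cost_le_one hcs with rfl | rfl | rfl | rfl <;>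
          simp [Macro.pre, Macro.need', Macro.top', Macro.dx] at hv g2' g3' r2 ⊢ <;> omega
      · exact h9' v hv

/-- Reflection in the diagonal. -/
def Dir.swap : Dir → Dir
  | .E => .N
  | .N => .E
  | .W => .S
  | .S => .W

theorem Dir.swap_swap (s : Dir) : s.swap.swap = s := by cases s <;> rfl

theorem map_swap_swap (u : Wd) : (u.map Dir.swap).map Dir.swap = u := by
  simp [Dir.swap_swap, Function.comp_def]

theorem verts_swap (x y : ℤ) (u : Wd) :
    verts y x (u.map Dir.swap) = (verts x y u).map Prod.swap := by
  induction u generalizing x y with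
  | nil => simp [verts]
  | cons s u ih => cases s <;> simp [verts, Dir.swap, ih]

theorem mem_verts_swap {x y : ℤ} {u : Wd} {v : ℤ × ℤ} :
    v ∈ verts y x (u.map Dir.swap) ↔ v.swap ∈ verts x y u := by
  rw [verts_swap, List.mem_map]
  exact ⟨by rintro ⟨v, hv, rfl⟩; simpa using hv, fun h => ⟨_, h, by simp⟩⟩

theorem dX_swap (u : Wd) : dX (u.map Dir.swap) = dY u := by
  induction u with
  | nil => rfl
  | cons s u ih => cases s <;> simp [dX, dY, Dir.swap, ih]

theorem dY_swap (u : Wd) : dY (u.map Dir.swap) = dX u := by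
  induction u with
  | nil => rfl
  | cons s u ih => cases s <;> simp [dX, dY, Dir.swap, ih]

theorem backs_swap (u : Wd) : backs (u.map Dir.swap) = backs u := by
  induction u with
  | nil => rfl
  | cons s u ih => cases s <;> simp [backs, Dir.swap, ih]

theorem Reg.swap {x y : ℤ} {r : ℕ} {u : Wd} (h : Reg x y r u) : Reg y x r (u.map Dir.swap) := by
  refine ⟨by rw [backs_swap, h.back], fun v hv => ?_, ?_, ?_, ?_⟩
  · have := h.lev _ (mem_verts_swap.1 hv)
    simp only [Prod.fst_swap, Prod.snd_swap] at this; omega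
  · rw [verts_swap]; exact h.nodup.map Prod.swap_injective
  · rw [List.getLast?_map]
    intro e
    obtain ⟨s, hs, e⟩ := Option.map_eq_some_iff.1 e
    cases s <;> simp [Dir.swap] at e
    exact h.lastS hs
  · rw [List.getLast?_map]
    intro e
    obtain ⟨s, hs, e⟩ := Option.map_eq_some_iff.1 e
    cases s <;> simp [Dir.swap] at e
    exact h.lastW hs

theorem Pair11.swap {r s : ℕ} {c c' : Prop} {x y X Y w h : ℤ} {u l : Wd}
    (H : Pair11 r s c c' x y X Y w h u l) :
    Pair11 s r c' c Y X y x h w (l.map Dir.swap) (u.map Dir.swap) := by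
  obtain ⟨h1, h2, h3, h4, h5, h6, h7, h8, h8', h9, h9'⟩ := H
  refine ⟨h2.swap, h1.swap, by rwa [dX_swap], by rwa [dY_swap], by rwa [dX_swap], by rwa [dY_swap],
    fun v hv hv' => ?_, fun hc hv => h8' hc (mem_verts_swap.1 hv),
    fun hc hv => h8 hc (mem_verts_swap.1 hv), fun v hv => h9' _ (mem_verts_swap.1 hv),
    fun v hv => h9 _ (mem_verts_swap.1 hv)⟩
  rw [← Prod.swap_swap v, h7 _ (mem_verts_swap.1 hv') (mem_verts_swap.1 hv), Prod.swap_prod_mk]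

theorem Pair11.shift {a b : ℤ} {r s : ℕ} {c c' : Prop} {x y X Y w h : ℤ} {u l : Wd}
    (H : Pair11 r s c c' x y X Y w h u l) (ha : a = 0 ∨ r ≤ x + a) (hb : b = 0 ∨ s ≤ Y + b) :
    Pair11 r s c c' (x + a) (y + b) (X + a) (Y + b) (w + a) (h + b) u l := by
  obtain ⟨h1, h2, h3, h4, h5, h6, h7, h8, h8', h9, h9'⟩ := H
  refine ⟨h1.shift, h2.shift, by omega, by omega, by omega, by omega, fun v hv hv' => ?_,
    fun hc hv => ?_, fun hc hv => ?_, fun v hv => ?_, fun v hv => ?_⟩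
  · have := h7 _ (mem_verts_shift.1 hv) (mem_verts_shift.1 hv')
    simp only [Prod.mk.injEq] at this
    ext <;> simp only <;> omega
  · rw [mem_verts_shift] at hv
    exact h8 hc (by convert hv using 2 <;> simp only <;> ring)
  · rw [mem_verts_shift] at hv
    exact h8' hc (by convert hv using 2 <;> simp only <;> ring)
  · have h' := h9 _ (mem_verts_shift.1 hv)
    have := sub_backs_le_fst hv
    rw [h1.back] at this
    simp only at h'
    omega
  · have h' := h9' _ (mem_verts_shift.1 hv)
    have := sub_backs_le_snd hv
    rw [h2.back] at this
    simp only at h'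
    omega

/-- The pairs of paths described by `Pair11`. -/
def set11 (r s : ℕ) (c c' : Prop) (x y X Y w h : ℤ) : Set (Wd × Wd) :=
  {p | Pair11 r s c c' x y X Y w h p.1 p.2}

theorem set11_finite (r s : ℕ) (c c' : Prop) (x y X Y w h : ℤ) :
    (set11 r s c c' x y X Y w h).Finite := by
  refine ((finite_words_of_length (w - x + (h - y) + 2 * r)).prod
    (finite_words_of_length (w - X + (h - Y) + 2 * s))).subset ?_
  rintro ⟨u, l⟩ ⟨h1, h2, h3, h4, h5, h6, -, -, -, -, -⟩
  have hu := length_eq u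
  have hl := length_eq l
  rw [h1.back] at hu
  rw [h2.back] at hl
  simp only at *
  exact ⟨by change (u.length : ℤ) = _; omega, by change (l.length : ℤ) = _; omega⟩

-- The argument is that for one bent path, with the cut into pieces now applied to both paths.
open Classical in
theorem ncard_set11 {r s : ℕ} {c c' : Prop} {x y X Y w h : ℤ} (hr : r ≤ 1) (hs : s ≤ 1)
    (hc : c → x + 2 ≤ X) (hc' : c' → x + 2 ≤ X) (hx : x < X) (hX : X + Y = x + y) :
    (set11 r s c c' x y X Y w h).ncard = ∑ p : Macro × Macro,
      if Guard11 p.1 p.2 r s c c' x y X Y w h then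
      (set11 (r - p.1.cost) (s - p.2.cost) (p.1 = .nwn ∧ s - p.2.cost ≠ 0)
        (p.2 = .ese ∧ r - p.1.cost ≠ 0) (x + p.1.dx) (y + 1 - p.1.dx) (X + p.2.dx)
        (Y + 1 - p.2.dx) w h).ncard else 0 := by
  rw [ncard_eq_sum_of_cover (ι := Macro × Macro) (S := set11 r s c c' x y X Y w h)
    (T := fun p => if Guard11 p.1 p.2 r s c c' x y X Y w h then
      set11 (r - p.1.cost) (s - p.2.cost) (p.1 = .nwn ∧ s - p.2.cost ≠ 0)
        (p.2 = .ese ∧ r - p.1.cost ≠ 0) (x + p.1.dx) (y + 1 - p.1.dx) (X + p.2.dx)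
        (Y + 1 - p.2.dx) w h else ∅) (f := fun p q => (p.1.word ++ q.1, p.2.word ++ q.2))]
  · refine Finset.sum_congr rfl fun p _ => ?_
    split_ifs <;> simp
  · intro p
    split_ifs
    · exact set11_finite ..
    · exact Set.finite_empty
  · rintro ⟨m, m'⟩ ⟨u, l⟩ hq
    simp only at hq
    split_ifs at hq with hg
    · refine (Pair11.block hr hs hc hc' hx hX (fun v hv => ?_) fun v hv => ?_).2 ⟨hg, hq⟩
      · have := hq.regU.lev v hv
        omega
      · have := hq.regL.lev v hv
        omega
    · exact absurd hq (Set.notMem_empty _)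
  · rintro ⟨u, l⟩ hq
    have hq' : Pair11 r s c c' x y X Y w h u l := hq
    have hul : u ≠ [] ∧ l ≠ [] := by
      by_contra hcon
      have h1 := hq'.ux
      have h2 := hq'.uy
      have h3 := hq'.lx
      have h4 := hq'.ly
      by_cases hu : u = []
      · by_cases hl : l = []
        · subst hu hl; simp [dX] at h1 h3; omega
        · obtain ⟨m, l', rfl, hlev⟩ := hq'.regL.exists_firstStep (by omega) hl
          have h5 := hlev _ (end_mem_verts _ _ l')
          rw [dX_append, m.dX_word] at h3
          rw [dY_append, m.dY_word] at h4
          subst hu; simp [dX, dY] at h1 h2 h5; omega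
      · obtain rfl : l = [] := by by_contra hl; exact hcon ⟨hu, hl⟩
        obtain ⟨m, u', rfl, hlev⟩ := hq'.regU.exists_firstStep (by omega) hu
        have h5 := hlev _ (end_mem_verts _ _ u')
        rw [dX_append, m.dX_word] at h1
        rw [dY_append, m.dY_word] at h2
        simp [dX, dY] at h3 h4 h5; omega
    obtain ⟨m, u', rfl, hlev⟩ := hq'.regU.exists_firstStep (by omega) hul.1
    obtain ⟨m', l', rfl, hlev'⟩ := hq'.regL.exists_firstStep (by omega) hul.2
    obtain ⟨hg, hq'⟩ := (Pair11.block hr hs hc hc' hx hX hlev hlev').1 hq'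
    exact ⟨(m, m'), (u', l'), by simp only [if_pos hg]; exact hq', rfl⟩
  · rintro ⟨m, b⟩ ⟨m', b'⟩ ⟨u, l⟩ ⟨u', l'⟩ hq hq' he
    simp only at hq hq'
    split_ifs at hq hq' with hg hg'
    · simp only [Prod.mk.injEq] at he
      obtain ⟨h1, h2⟩ := he
      obtain ⟨rfl, rfl⟩ := Macro.word_append_inj (x := x) (y := y) h1
        (fun v hv => by have := hq.regU.lev v hv; omega)
        (fun v hv => by have := hq'.regU.lev v hv; omega)
      obtain ⟨rfl, rfl⟩ := Macro.word_append_inj (x := X) (y := Y) h2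
        (fun v hv => by have := hq.regL.lev v hv; omega)
        (fun v hv => by have := hq'.regL.lev v hv; omega)
      exact ⟨rfl, rfl⟩
    all_goals simp_all

/-- The number of pairs of paths `Pair11` for a given distance `d` of the starting points; `f` is the
abscissa of the upper one and `g` the ordinate of the lower one; `i` is the width of the upper path
and `j` the height of the lower path. -/
noncomputable def cnt11 (r s : ℕ) (c c' : Prop) (f g d i j : ℤ) : ℕ :=
  (set11 r s c c' f (g + d) (f + d) g (f + i) (g + j)).ncard

/-- Reflection in the diagonal exchanges the two paths and the two walls, so statements about the
upper path transfer to the lower one. -/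
theorem cnt11_swap {r s : ℕ} {c c' : Prop} {f g d i j : ℤ} :
    cnt11 r s c c' f g d i j = cnt11 s r c' c g f d j i := by
  unfold cnt11
  refine Set.ncard_congr (fun p _ => (p.2.map Dir.swap, p.1.map Dir.swap))
    (fun p hp => Pair11.swap hp) ?_ ?_
  · rintro ⟨u, l⟩ ⟨u', l'⟩ - - h
    simp only [Prod.mk.injEq] at h
    rw [← map_swap_swap u, h.2, ← map_swap_swap l, h.1, map_swap_swap, map_swap_swap]
  · rintro ⟨u, l⟩ hp
    exact ⟨(l.map Dir.swap, u.map Dir.swap), Pair11.swap hp, by simp only [map_swap_swap]⟩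

theorem ncard_set11_shift {r s : ℕ} {c c' : Prop} {x y X Y w h : ℤ} (a b : ℤ)
    (ha : a = 0 ∨ r ≤ x ∧ r ≤ x + a) (hb : b = 0 ∨ s ≤ Y ∧ s ≤ Y + b) :
    (set11 r s c c' (x + a) (y + b) (X + a) (Y + b) (w + a) (h + b)).ncard =
      (set11 r s c c' x y X Y w h).ncard := by
  congr 1
  ext p
  refine ⟨fun hp => ?_, fun hp => Pair11.shift hp (by omega) (by omega)⟩
  have := Pair11.shift (a := -a) (b := -b) hp (by omega) (by omega)
  simpa [set11] using this

theorem cnt11_stable {r s : ℕ} {c c' : Prop} {f f' g g' d i j : ℤ}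
    (hf : f = f' ∨ r ≤ f ∧ r ≤ f') (hg : g = g' ∨ s ≤ g ∧ s ≤ g') :
    cnt11 r s c c' f g d i j = cnt11 r s c c' f' g' d i j := by
  have := ncard_set11_shift (r := r) (s := s) (c := c) (c' := c') (x := f) (y := g + d)
    (X := f + d) (Y := g) (w := f + i) (h := g + j) (f' - f) (g' - g) (by omega) (by omega)
  unfold cnt11
  rw [← this]
  congr 2 <;> ring

open Classical in
theorem cnt11_eq {r s : ℕ} {c c' : Prop} {f g d i j : ℤ} (hr : r ≤ 1) (hs : s ≤ 1)
    (hc : c → 2 ≤ d) (hc' : c' → 2 ≤ d) (hd : 0 < d) :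
    cnt11 r s c c' f g d i j = ∑ p : Macro × Macro,
      if p.1.cost ≤ r ∧ p.2.cost ≤ s ∧ p.1.need ≤ f ∧ p.2.need' ≤ g ∧
        p.1.top ≤ (j - (1 - p.2.dx)) - (d + p.2.dx - p.1.dx) ∧
        p.2.top' ≤ (i - p.1.dx) - (d + p.2.dx - p.1.dx) ∧
        p.1.lo₂ p.2 ≤ d + p.2.dx - p.1.dx ∧ (c → p.2 = .nwn → d ≠ 2) ∧
        (c' → p.1 = .ese → d ≠ 2) then
      cnt11 (r - p.1.cost) (s - p.2.cost) (p.1 = .nwn ∧ s - p.2.cost ≠ 0)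
        (p.2 = .ese ∧ r - p.1.cost ≠ 0) (f + p.1.dx) (g + (1 - p.2.dx)) (d + p.2.dx - p.1.dx)
        (i - p.1.dx) (j - (1 - p.2.dx))
      else 0 := by
  rw [cnt11, ncard_set11 hr hs (fun h => by have := hc h; omega) (fun h => by have := hc' h; omega)
    (by omega) (by omega)]
  refine Finset.sum_congr rfl fun ⟨m, m'⟩ _ => ?_
  congr 1
  · refine propext ⟨?_, ?_⟩
    · rintro ⟨h1, h2, h3, h4, h5, h6, h7, h8, h9⟩
      exact ⟨h1, h2, h3, h4, by simp only at *; omega, by simp only at *; omega,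
        by simp only at *; omega, fun a b => by have := h8 a b; omega,
        fun a b => by have := h9 a b; omega⟩
    · rintro ⟨h1, h2, h3, h4, h5, h6, h7, h8, h9⟩
      exact ⟨h1, h2, h3, h4, by simp only at *; omega, by simp only at *; omega,
        by simp only at *; omega, fun a b => by have := h8 a b; omega,
        fun a b => by have := h9 a b; omega⟩
  · rw [cnt11]
    congr 2 <;> simp only <;> ring

theorem le_of_cnt11_ne_zero {r s : ℕ} {c c' : Prop} {f g d i j : ℤ}
    (h : cnt11 r s c c' f g d i j ≠ 0) : d ≤ i ∧ d ≤ j := by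
  obtain ⟨⟨u, l⟩, hq⟩ := Set.nonempty_of_ncard_ne_zero h
  obtain ⟨h1, h2, h3, h4, h5, h6, -, -, -, h9, h9'⟩ := hq
  have := h9 _ (start_mem_verts _ _ _)
  have := h9' _ (start_mem_verts _ _ _)
  simp only at *
  omega

theorem Reg.eq_nil {x y : ℤ} {r : ℕ} {u : Wd} (h : Reg x y r u) (hx : dX u = 0) (hy : dY u = 0) :
    u = [] := by
  have hn := h.nodup
  rcases u with _ | ⟨s, u⟩
  · rfl
  · exfalso
    cases s <;> simp only [verts, List.nodup_cons, dX, dY] at hn hx hy <;> refine hn.1 ?_ <;>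
      convert end_mem_verts _ _ u using 2 <;> omega

theorem cnt11_zero_left {r s : ℕ} {c c' : Prop} {f g i j : ℤ} (hr : r ≠ 0 ∨ s ≠ 0) :
    cnt11 r s c c' f g 0 i j = 0 := by
  rw [cnt11, add_zero, add_zero]
  refine (congrArg Set.ncard (Set.eq_empty_of_forall_notMem fun p hp => ?_)).trans
    (Set.ncard_empty _)
  have h1 := Prod.mk.inj (hp.disj _ (start_mem_verts f g p.1) (start_mem_verts f g p.2))
  have h2 := hp.ux
  have h3 := hp.uy
  have h4 := hp.lx
  have h5 := hp.ly
  have h6 := hp.regU.back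
  have h7 := hp.regL.back
  rw [hp.regU.eq_nil (by omega) (by omega)] at h6
  rw [hp.regL.eq_nil (by omega) (by omega)] at h7
  simp only [backs] at h6 h7
  omega

theorem nodup_verts_of_backs_eq_zero {x y : ℤ} {u : Wd} (h : backs u = 0) :
    (verts x y u).Nodup := by
  induction u generalizing x y with
  | nil => simp [verts]
  | cons s u ih =>
    cases s <;> simp only [verts, backs, List.nodup_cons, Nat.add_eq_zero_iff, one_ne_zero,
      and_false] at h ⊢ <;> refine ⟨fun hv => ?_, ih h⟩ <;>
      have := mem_verts_of_backs_eq_zero h hv <;> simp only at this <;> omega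

theorem reg_of_backs_eq_zero {x y : ℤ} {u : Wd} (h : backs u = 0) : Reg x y 0 u := by
  have key (s : Dir) (hs : s = .W ∨ s = .S) : u.getLast? ≠ some s := by
    intro e
    rcases List.eq_nil_or_concat u with rfl | ⟨u, t, rfl⟩
    · simp at e
    · rw [List.concat_eq_append, List.getLast?_concat, Option.some_inj] at e
      rw [List.concat_eq_append, backs_append] at h
      rcases hs with rfl | rfl <;> subst e <;> simp [backs] at h
  exact ⟨h, fun v hv => by have := mem_verts_of_backs_eq_zero h hv; omega,
    nodup_verts_of_backs_eq_zero h, key _ (Or.inl rfl), key _ (Or.inr rfl)⟩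

/-- A monotone lower path stays between its ends in both coordinates, so its wall conditions hold
automatically. -/
theorem cnt11_zero_zero {f g d i j : ℤ} (hg : 0 ≤ g) :
    cnt11 0 0 False False f g d i j = cnt20 0 0 f d i j := by
  rw [cnt11_stable (f' := f) (g' := 0) (Or.inl rfl) (Or.inr ⟨by simpa using hg, by simp⟩), cnt11,
    cnt20, zero_add, zero_add]
  congr 1
  ext p
  constructor
  · rintro ⟨h1, h2, h3, h4, h5, h6, h7, -, -, h9, h9'⟩
    exact ⟨h1, h2.back, h3, h4, h5, by omega, h7, by simp, h9⟩
  · rintro ⟨h1, h2, h3, h4, h5, h6, h7, -, h9⟩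
    refine ⟨h1, reg_of_backs_eq_zero h2, h3, h4, h5, by omega, h7, by simp, by simp, h9,
      fun v hv => ?_⟩
    have k1 := mem_verts_of_backs_eq_zero h2 hv
    have k2 := mem_verts_le_of_backs_eq_zero h2 hv
    omega

/-! ### Generating functions of arrays in the field of fractions. -/

/-- The field of fractions of the power series ring in two variables. -/
abbrev FPS := FractionRing (MvPowerSeries (Fin 2) ℚ)

/-- The embedding of the power series ring into its field of fractions. -/
noncomputable abbrev toFPS : MvPowerSeries (Fin 2) ℚ →+* FPS := algebraMap _ _

theorem toFPS_injective : Function.Injective toFPS := IsFractionRing.injective _ _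

/-- The generating function of an array; the index `i` is counted by the variable `a`, the index
`j` by the variable `b`. -/
noncomputable def gf (a b : Fin 2) (c : ℤ → ℤ → ℕ) : MvPowerSeries (Fin 2) ℚ :=
  fun n => (c (n a) (n b) : ℚ)

theorem coeff_gf {a b : Fin 2} {c : ℤ → ℤ → ℕ} (n : Fin 2 →₀ ℕ) :
    coeff n (gf a b c) = c (n a) (n b) := rfl

theorem gf_sum {ι : Type*} (s : Finset ι) {a b : Fin 2} (c : ι → ℤ → ℤ → ℕ) :
    gf a b (fun i j => ∑ p ∈ s, c p i j) = ∑ p ∈ s, gf a b (c p) := by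
  ext n
  simp [coeff_gf]

theorem gf_zero {a b : Fin 2} : gf a b (fun _ _ => 0) = 0 := by
  ext n
  simp [coeff_gf]

theorem coeff_X_pow_mul_X_pow_mul {a b : Fin 2} (hab : a ≠ b) (k l : ℕ)
    (f : MvPowerSeries (Fin 2) ℚ) (n : Fin 2 →₀ ℕ) :
    coeff n (X a ^ k * X b ^ l * f) = if k ≤ n a ∧ l ≤ n b then
      coeff (n - (Finsupp.single a k + Finsupp.single b l)) f else 0 := by
  rw [X_pow_eq, X_pow_eq, monomial_mul_monomial, coeff_monomial_mul, mul_one, one_mul]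
  congr 1
  refine propext ⟨fun h => ?_, fun h i => ?_⟩
  · have h1 := h a
    have h2 := h b
    simp [hab, hab.symm] at h1 h2
    exact ⟨h1, h2⟩
  · obtain rfl | rfl : i = a ∨ i = b := by omega
    · simpa [hab] using h.1
    · simpa [hab.symm] using h.2

/-- The array vanishes at negative indices. -/
def Good (c : ℤ → ℤ → ℕ) : Prop := ∀ i j, c i j ≠ 0 → 0 ≤ i ∧ 0 ≤ j

theorem X_pow_mul_gf {a b : Fin 2} (hab : a ≠ b) {c c' : ℤ → ℤ → ℕ} (hc : Good c) {k l : ℕ}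
    (h : ∀ i j, 0 ≤ i → 0 ≤ j → c' i j = c (i - k) (j - l)) :
    gf a b c' = X a ^ k * X b ^ l * gf a b c := by
  ext n
  rw [coeff_X_pow_mul_X_pow_mul hab, coeff_gf, coeff_gf, h _ _ (by simp) (by simp)]
  split_ifs with hn
  · congr 2 <;> simp [hab, hab.symm, hn]
  · rw [Nat.cast_eq_zero]
    by_contra h0
    have := hc _ _ h0
    omega

theorem toFPS_X_ne_zero (a : Fin 2) : toFPS (X a) ≠ 0 := by
  rw [Ne, map_eq_zero_iff _ toFPS_injective]
  intro h
  have := congrArg (coeff (Finsupp.single a 1)) h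
  simp at this

/-- The generating function in the field of fractions. -/
noncomputable def gK (a b : Fin 2) (c : ℤ → ℤ → ℕ) : FPS := toFPS (gf a b c)

/-- Pieces with net displacement to the west shift an index the wrong way for power series; over the
field of fractions this is a negative power of the variable. Vanishing at negative indices ensures
that no coefficient is lost. -/
theorem gK_shift {a b : Fin 2} (hab : a ≠ b) {c c' : ℤ → ℤ → ℕ} (hc : Good c) (hc' : Good c')
    (k l : ℤ) (h : ∀ i j, c' i j = c (i - k) (j - l)) :
    gK a b c' = toFPS (X a) ^ k * toFPS (X b) ^ l * gK a b c := by
  -- Writing the shifts as differences of natural numbers clears the negative powers, and the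
  -- identity can be compared among power series.
  obtain ⟨k₁, k₂, rfl⟩ : ∃ k₁ k₂ : ℕ, k = k₁ - k₂ := ⟨k.toNat, (-k).toNat, by omega⟩
  obtain ⟨l₁, l₂, rfl⟩ : ∃ l₁ l₂ : ℕ, l = l₁ - l₂ := ⟨l.toNat, (-l).toNat, by omega⟩
  have key : X a ^ k₂ * X b ^ l₂ * gf a b c' = X a ^ k₁ * X b ^ l₁ * gf a b c := by
    rw [← X_pow_mul_gf hab hc (c' := fun i j => c (i - k₁) (j - l₁)) (fun _ _ _ _ => rfl),
      ← X_pow_mul_gf hab hc' fun i j _ _ => ?_]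
    rw [h]
    congr 1 <;> ring
  have key' := congrArg toFPS key
  simp only [map_mul, map_pow] at key'
  have h1 := toFPS_X_ne_zero a
  have h2 := toFPS_X_ne_zero b
  rw [zpow_sub₀ h1, zpow_sub₀ h2, zpow_natCast, zpow_natCast, zpow_natCast, zpow_natCast, gK, gK]
  field_simp
  linear_combination key'

theorem gK_sum {ι : Type*} (s : Finset ι) {a b : Fin 2} (c : ι → ℤ → ℤ → ℕ) :
    gK a b (fun i j => ∑ p ∈ s, c p i j) = ∑ p ∈ s, gK a b (c p) := by
  simp only [gK, gf_sum, map_sum]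

theorem gK_zero {a b : Fin 2} : gK a b (fun _ _ => 0) = 0 := by rw [gK, gf_zero, map_zero]

/-! ### Small sequences and uniqueness of small solutions. -/

/-- Sequences whose term of index `d` is divisible by `(xy) ^ d`, up to a common denominator. -/
def XYSmall (Z : ℤ → FPS) : Prop := ∃ D : MvPowerSeries (Fin 2) ℚ, D ≠ 0 ∧
  ∀ d : ℕ, ∃ r, toFPS D * Z d = toFPS ((X 0 * X 1) ^ d * r)

theorem XYSmall.add {Z W : ℤ → FPS} (hZ : XYSmall Z) (hW : XYSmall W) : XYSmall
    (fun d => Z d + W d) := by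
  obtain ⟨D, hD, h⟩ := hZ
  obtain ⟨D', hD', h'⟩ := hW
  refine ⟨D * D', mul_ne_zero hD hD', fun d => ?_⟩
  obtain ⟨r, hr⟩ := h d
  obtain ⟨r', hr'⟩ := h' d
  refine ⟨D' * r + D * r', ?_⟩
  simp only [map_mul, map_add] at *
  linear_combination toFPS D' * hr + toFPS D * hr'

theorem XYSmall.const_mul {Z : ℤ → FPS} (a : FPS) (hZ : XYSmall Z) : XYSmall
    (fun d => a * Z d) := by
  obtain ⟨D, hD, h⟩ := hZ
  obtain ⟨n, m, hm, rfl⟩ := IsFractionRing.div_surjective (A := MvPowerSeries (Fin 2) ℚ) a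
  have hm' := nonZeroDivisors.ne_zero hm
  refine ⟨D * m, mul_ne_zero hD hm', fun d => ?_⟩
  obtain ⟨r, hr⟩ := h d
  refine ⟨n * r, ?_⟩
  have : toFPS m ≠ 0 := by rwa [Ne, map_eq_zero_iff _ toFPS_injective]
  simp only [map_mul] at *
  field_simp
  linear_combination toFPS n * hr

theorem XYSmall.neg {Z : ℤ → FPS} (hZ : XYSmall Z) : XYSmall (fun d => -Z d) := by
  simpa using hZ.const_mul (-1)

theorem XYSmall.sub {Z W : ℤ → FPS} (hZ : XYSmall Z) (hW : XYSmall W) : XYSmall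
    (fun d => Z d - W d) := by
  simpa [sub_eq_add_neg] using hZ.add hW.neg

/-- Two sequences that agree from `N` on are both small or not. -/
theorem XYSmall.congr {Z W : ℤ → FPS} (hZ : XYSmall Z) (N : ℕ) (h : ∀ d : ℤ, N ≤ d → W d = Z d) :
    XYSmall W := by
  -- Finitely many terms have a common denominator, and multiplying it by a power of xy makes them
  -- as divisible as required.
  have key (N : ℕ) : ∃ D : MvPowerSeries (Fin 2) ℚ, D ≠ 0 ∧
      ∀ d : ℕ, d < N → ∃ r, toFPS D * W d = toFPS ((X 0 * X 1) ^ d * r) := by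
    induction N with
    | zero => exact ⟨1, one_ne_zero, by simp⟩
    | succ N ih =>
      obtain ⟨D, hD, ih⟩ := ih
      obtain ⟨n, m, hm, hnm⟩ := IsFractionRing.div_surjective (A := MvPowerSeries (Fin 2) ℚ) (W N)
      have hm' := nonZeroDivisors.ne_zero hm
      have hX (a : Fin 2) : (X a : MvPowerSeries (Fin 2) ℚ) ≠ 0 := fun h => by
        simpa [h] using toFPS_X_ne_zero a
      refine ⟨D * (m * (X 0 * X 1) ^ N), mul_ne_zero hD (mul_ne_zero hm'
        (pow_ne_zero _ (mul_ne_zero (hX 0) (hX 1)))), fun d hd => ?_⟩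
      obtain hd | rfl := Nat.lt_succ_iff_lt_or_eq.1 hd
      · obtain ⟨r, hr⟩ := ih d hd
        refine ⟨r * (m * (X 0 * X 1) ^ N), ?_⟩
        simp only [map_mul, map_pow] at *
        linear_combination (toFPS m * (toFPS (X 0) * toFPS (X 1)) ^ N) * hr
      · have : toFPS m ≠ 0 := by rwa [Ne, map_eq_zero_iff _ toFPS_injective]
        refine ⟨D * n, ?_⟩
        rw [← hnm]
        simp only [map_mul, map_pow]
        field_simp
  obtain ⟨D, hD, h1⟩ := hZ
  obtain ⟨D', hD', h2⟩ := key N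
  refine ⟨D * D', mul_ne_zero hD hD', fun d => ?_⟩
  by_cases hd : d < N
  · obtain ⟨r, hr⟩ := h2 d hd
    refine ⟨D * r, ?_⟩
    simp only [map_mul] at *
    linear_combination toFPS D * hr
  · obtain ⟨r, hr⟩ := h1 d
    refine ⟨D' * r, ?_⟩
    rw [h d (by omega)]
    simp only [map_mul] at *
    linear_combination toFPS D' * hr

/-- A base `b` that is a multiple of `xy` gives the small sequence of its powers. -/
theorem XYSmall.zpow {b : MvPowerSeries (Fin 2) ℚ} (hb : X 0 * X 1 ∣ b) (k : ℕ) :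
    XYSmall (fun d => (d : FPS) ^ k * toFPS b ^ d) := by
  obtain ⟨t, rfl⟩ := hb
  refine ⟨1, one_ne_zero, fun d => ⟨(d : MvPowerSeries (Fin 2) ℚ) ^ k * t ^ d, ?_⟩⟩
  simp only [map_one, map_mul, map_pow, map_natCast, zpow_natCast, Int.cast_natCast]
  ring

theorem le_order_pow_mul (d : ℕ) (r : MvPowerSeries (Fin 2) ℚ) :
    (d : ℕ∞) ≤ ((X 0 * X 1) ^ d * r).order := by
  have hX (a : Fin 2) : (1 : ℕ∞) ≤ (X a : MvPowerSeries (Fin 2) ℚ).order := by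
    rw [one_le_order_iff_constCoeff_eq_zero]; simp
  refine le_trans ?_ le_order_mul
  refine le_add_right (le_trans ?_ (le_order_pow d))
  rw [nsmul_eq_mul]
  calc (d : ℕ∞) = d * 1 := by simp
    _ ≤ d * (X 0 * X 1 : MvPowerSeries (Fin 2) ℚ).order := by
      gcongr
      exact le_trans (le_add_right (hX 0)) le_order_mul

/-- A small sequence that starts with zero and satisfies a linear recursion
`Z d = a Z d + b Z (d + 1) + c Z (d - 1)` vanishes. -/
theorem XYSmall.eq_zero {Z : ℤ → FPS} (hZ : XYSmall Z) (h0 : Z 0 = 0)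
    {a b c : MvPowerSeries (Fin 2) ℚ} (ha : constantCoeff a = 0) (hc : 2 ≤ c.order)
    (h : ∀ d : ℤ, 1 ≤ d → Z d = toFPS a * Z d + toFPS b * Z (d + 1) + toFPS c * Z (d - 1)) (d : ℤ)
    (hd : 0 ≤ d) : Z d = 0 := by
  obtain ⟨D, hD, hs⟩ := hZ
  choose r hr using hs
  set z : ℕ → MvPowerSeries (Fin 2) ℚ := fun d => (X 0 * X 1) ^ d * r d with hz
  have hz0 : z 0 = 0 := by
    apply toFPS_injective
    rw [hz, ← hr 0]
    simp [h0]
  -- Solving for the middle term is possible within power series because the constant coefficient of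
  -- a vanishes.
  have hrec (d : ℕ) : z (d + 1) = (1 - a)⁻¹ * (b * z (d + 2) + c * z d) := by
    have h1 := h (d + 1) (by omega)
    have h2 : (1 - a) * z (d + 1) = b * z (d + 2) + c * z d := by
      apply toFPS_injective
      simp only [map_mul, map_sub, map_one, map_add]
      simp only [hz, ← hr]
      push_cast
      have e : (d : ℤ) + 1 + 1 = d + 2 := by ring
      have e' : (d : ℤ) + 1 - 1 = d := by ring
      rw [e, e'] at h1
      linear_combination toFPS D * h1
    rw [← h2, ← mul_assoc, MvPowerSeries.inv_mul_cancel _ (by simp [ha]), one_mul]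
  -- Each application of the recursion gains one order: the later term starts one order higher, and
  -- the earlier one is multiplied by something of order two. No condition on b is needed.
  have key (N : ℕ) : ∀ d : ℕ, ((d + N : ℕ) : ℕ∞) ≤ (z d).order := by
    induction N with
    | zero => exact fun d => le_order_pow_mul d _
    | succ N ih =>
      rintro (_ | d)
      · simp [hz0]
      · rw [hrec]
        refine le_trans (le_add_left (le_trans (le_min ?_ ?_) min_order_le_add)) le_order_mul
        · exact le_trans (le_trans (by norm_cast; omega) (le_add_left (ih (d + 2)))) le_order_mul
        · refine le_trans (le_trans ?_ (add_le_add hc (ih d))) le_order_mul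
          norm_cast
          omega
  have hz (d : ℕ) : z d = 0 := by
    rw [← order_eq_top_iff, ENat.eq_top_iff_forall_ge]
    exact fun N => le_trans (by norm_cast; omega) (key N d)
  lift d to ℕ using hd
  have h1 := hr d
  rw [show (X 0 * X 1) ^ d * r d = 0 from hz d, map_zero] at h1
  exact (mul_eq_zero.1 h1).resolve_left fun h => hD ((map_eq_zero_iff _ toFPS_injective).1 h)

/-- A small sequence is determined by its initial term and a linear recursion. -/
theorem XYSmall.unique {Φ Ψ : ℤ → FPS} (hΦ : XYSmall Φ) (hΨ : XYSmall Ψ) (h0 : Φ 0 = Ψ 0)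
    (a b c : MvPowerSeries (Fin 2) ℚ) (ha : constantCoeff a = 0) (hc : 2 ≤ c.order)
    (h : ∀ d : ℤ, 1 ≤ d → Ψ d - toFPS a * Ψ d - toFPS b * Ψ (d + 1) - toFPS c * Ψ (d - 1) =
      Φ d - toFPS a * Φ d - toFPS b * Φ (d + 1) - toFPS c * Φ (d - 1)) (d : ℤ) (hd : 0 ≤ d) :
    Φ d = Ψ d :=
  sub_eq_zero.1 ((hΦ.sub hΨ).eq_zero (sub_eq_zero.2 h0) (b := b) ha hc
    (fun d hd => by linear_combination -h d hd) d hd)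

/-! ### Generating functions of pairs and their general recursions. -/

/-- The generating function of the pairs of paths counted by `cnt20` for which the height of the
lower path exceeds `d` by at least `e`. It is zero for negative `d`. -/
noncomputable def F20 (a b : Fin 2) (r : ℕ) (o f e d : ℤ) : FPS :=
  if 0 ≤ d then gK a b fun i j => if e ≤ j - d then cnt20 r o f d i j else 0 else 0

/-- The generating function of the pairs of paths counted by `cnt11` for which the height of the
lower path exceeds `d` by at least `e`, and the width of the upper path by at least `e'`. It is
zero for negative `d`. -/
noncomputable def F11 (a b : Fin 2) (r s : ℕ) (c c' : Prop) (f g e e' d : ℤ) : FPS :=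
  if 0 ≤ d then gK a b fun i j => if e ≤ j - d ∧ e' ≤ i - d then cnt11 r s c c' f g d i j else 0
  else 0

section

variable {a b : Fin 2} {r s : ℕ} {o f g e e' d : ℤ} {c c' : Prop}

theorem F20_of_neg (hd : d < 0) : F20 a b r o f e d = 0 := by rw [F20, if_neg (by omega)]

theorem F11_of_neg (hd : d < 0) : F11 a b r s c c' f g e e' d = 0 := by
  rw [F11, if_neg (by omega)]

theorem F20_stable {f' : ℤ} (hf : r ≤ f) (hf' : r ≤ f') : F20 a b r o f e d = F20 a b r o f' e
    d := by
  simp only [F20, cnt20_stable hf hf']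

theorem F11_stable {f' g' : ℤ} (hf : f = f' ∨ r ≤ f ∧ r ≤ f') (hg : g = g' ∨ s ≤ g ∧ s ≤ g') :
    F11 a b r s c c' f g e e' d = F11 a b r s c c' f' g' e e' d := by
  simp only [F11, cnt11_stable hf hg]

theorem F20_zero_ob : F20 a b 0 o f e d = F20 a b 0 0 f e d := by simp only [F20, cnt20_zero_ob]

/-- The width of the upper path is at least d whenever there is a pair at all, so a condition
without positive excess is empty. -/
theorem F11_of_nonpos_right (he : e' ≤ 0) :
    F11 a b r s c c' f g e e' d = F11 a b r s c c' f g e 0 d := by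
  unfold F11
  congr 2
  ext i j
  by_cases h : cnt11 r s c c' f g d i j = 0
  · simp [h]
  · have := le_of_cnt11_ne_zero h
    congr 1
    exact propext ⟨fun h => ⟨h.1, by omega⟩, fun h => ⟨h.1, by omega⟩⟩

theorem gK_swap {c : ℤ → ℤ → ℕ} : gK a b c = gK b a fun i j => c j i := rfl

theorem F11_swap : F11 a b r s c c' f g e e' d = F11 b a s r c' c g f e' e d := by
  unfold F11
  rw [gK_swap]
  simp only [cnt11_swap (r := r), and_comm (a := e ≤ _)]

theorem F11_zero_zero (hg : 0 ≤ g) (he' : e' ≤ 0) :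
    F11 a b 0 0 False False f g e e' d = F20 a b 0 0 f e d := by
  rw [F11_of_nonpos_right he']
  simp only [F11, F20, cnt11_zero_zero hg]
  congr 2
  ext i j
  by_cases h : cnt20 0 0 f d i j = 0
  · simp [h]
  · have := le_of_cnt20_ne_zero h
    congr 1
    exact propext ⟨fun h => h.1, fun h => ⟨h, by omega⟩⟩

theorem gf_single (a b : Fin 2) (hab : a ≠ b) :
    gK a b (fun i j => if i = 0 ∧ j = 0 then 1 else 0) = 1 := by
  rw [gK, show gf a b _ = 1 from ?_, map_one]
  ext n
  rw [coeff_gf, coeff_one]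
  have : n = 0 ↔ ((n a : ℤ) = 0 ∧ (n b : ℤ) = 0) := by
    constructor
    · rintro rfl; simp
    · rintro ⟨h1, h2⟩
      ext i
      obtain rfl | rfl : i = a ∨ i = b := by omega
      · exact_mod_cast h1
      · exact_mod_cast h2
  simp only [this, Nat.cast_ite, Nat.cast_one, Nat.cast_zero]

theorem F20_zero_zero (hab : a ≠ b) (hf : 0 ≤ f) : F20 a b 0 o f 0 0 = 1 := by
  rw [F20_zero_ob, F20, if_pos le_rfl, ← gf_single a b hab]
  congr 1
  ext i j
  rw [cnt20_zero_zero hf]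
  split_ifs <;> first | rfl | omega

/-- At distance zero the only plain pair consists of empty paths, whose height has no excess. -/
theorem F20_zero_pos (hf : 0 ≤ f) (he : 0 < e) : F20 a b 0 o f e 0 = 0 := by
  rw [F20_zero_ob, F20, if_pos le_rfl, ← gK_zero]
  congr 1
  ext i j
  rw [cnt20_zero_zero hf]
  split_ifs <;> first | rfl | omega

theorem F20_zero_left (hr : r ≠ 0) : F20 a b r o f e 0 = 0 := by
  simp [F20, cnt20_zero_left hr, gK_zero]

theorem F11_zero_left (hr : r ≠ 0 ∨ s ≠ 0) : F11 a b r s c c' f g e e' 0 = 0 := by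
  simp [F11, cnt11_zero_left hr, gK_zero]

theorem F11_zero_pos (hf : 0 ≤ f) (hg : 0 ≤ g) (he : 0 < e ∨ 0 < e') :
    F11 a b r s False False f g e e' 0 = 0 := by
  by_cases hr : r ≠ 0 ∨ s ≠ 0
  · exact F11_zero_left hr
  · obtain ⟨rfl, rfl⟩ : r = 0 ∧ s = 0 := by omega
    rw [F11, if_pos le_rfl, ← gK_zero]
    congr 1
    ext i j
    rw [cnt11_zero_zero hg, cnt20_zero_zero hf]
    split_ifs <;> first | rfl | omega

/-- Shifting both indices by d takes out the factor (xy)^d, with common denominator one. -/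
theorem gK_small {a b : Fin 2} (hab : a ≠ b) {c : ℤ → ℤ → ℤ → ℕ}
    (h : ∀ d i j, c d i j ≠ 0 → d ≤ i ∧ d ≤ j) : XYSmall fun d => gK a b (c d) := by
  refine ⟨1, one_ne_zero, fun d => ⟨gf a b fun i j => c d (i + d) (j + d), ?_⟩⟩
  rw [map_one, one_mul]
  beta_reduce
  rw [gK, X_pow_mul_gf (c := fun i j => c d (i + d) (j + d)) hab ?_
    (k := d) (l := d)]
  · have : (X a * X b : MvPowerSeries (Fin 2) ℚ) = X 0 * X 1 := by
      obtain ⟨rfl, rfl⟩ | ⟨rfl, rfl⟩ : (a = 0 ∧ b = 1) ∨ (a = 1 ∧ b = 0) := by omega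
      · rfl
      · exact mul_comm _ _
    rw [← mul_pow, this]
  · intro i j _ _
    simp
  · intro i j hij
    have := h _ _ _ hij
    omega

theorem F20_small (hab : a ≠ b) : XYSmall (F20 a b r o f e) := by
  refine (gK_small hab (c := fun d i j => if e ≤ j - d then cnt20 r o f d i j else 0)
    fun d i j h => ?_).congr 0 fun d hd => by rw [F20, if_pos (by simpa using hd)]
  split_ifs at h
  · exact le_of_cnt20_ne_zero h
  · exact absurd rfl h

theorem F11_small (hab : a ≠ b) : XYSmall (F11 a b r s c c' f g e e') := by
  refine (gK_small hab (c := fun d i j => if e ≤ j - d ∧ e' ≤ i - d then cnt11 r s c c' f g d i j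
    else 0) fun d i j h => ?_).congr 0 fun d hd => by rw [F11, if_pos (by simpa using hd)]
  split_ifs at h
  · exact le_of_cnt11_ne_zero h
  · exact absurd rfl h

theorem fx_nonneg (t : Bool) : 0 ≤ fx t ∧ fx t ≤ 1 := by cases t <;> simp [fx]

theorem F20_eq (hab : a ≠ b) (hr : r ≤ 2) (ho : o = 0 ∨ (o = 1 ∨ o = -1) ∧ r ≤ 1) (hd : 0 < d) :
    F20 a b r o f e d = ∑ m : Macro, ∑ t : Bool,
      if m.cost ≤ r ∧ (o ≠ 0 → o + m.ob ≠ 0) ∧ m.need ≤ f ∧ m.lo ≤ d + fx t - m.dx then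
        toFPS (X a) ^ m.dx * toFPS (X b) ^ (1 - fx t) * F20 a b (r - m.cost) m.ob (f + m.dx)
          (max m.top (e - (1 - m.dx))) (d + fx t - m.dx) else 0 := by
  rw [F20, if_pos hd.le, ← Fintype.sum_prod_type']
  -- The excess of height over distance is the room between the upper path and the northern wall. A
  -- piece uses up its vertical displacement and asks for room of its own, so the two requirements
  -- combine to a maximum.
  have key : (fun i j => if e ≤ j - d then cnt20 r o f d i j else 0) = fun i j =>
      ∑ p : Macro × Bool, if p.1.cost ≤ r ∧ (o ≠ 0 → o + p.1.ob ≠ 0) ∧ p.1.need ≤ f ∧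
        p.1.lo ≤ d + fx p.2 - p.1.dx then
      (if max p.1.top (e - (1 - p.1.dx)) ≤ (j - (1 - fx p.2)) - (d + fx p.2 - p.1.dx) then
        cnt20 (r - p.1.cost) p.1.ob (f + p.1.dx) (d + fx p.2 - p.1.dx) (i - p.1.dx)
          (j - (1 - fx p.2)) else 0) else 0 := by
    ext i j
    split_ifs with hej
    · rw [cnt20_eq hr ho hd]
      refine Finset.sum_congr rfl fun p _ => ?_
      rw [← ite_and]
      congr 1
      refine propext ⟨?_, ?_⟩
      · rintro ⟨h1, h2, h3, h4, h5⟩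
        exact ⟨⟨h1, h2, h3, h5⟩, max_le h4 (by omega)⟩
      · rintro ⟨⟨h1, h2, h3, h5⟩, h4⟩
        exact ⟨h1, h2, h3, le_trans (le_max_left _ _) h4, h5⟩
    · symm
      refine Finset.sum_eq_zero fun p _ => ?_
      split_ifs with h1 h2
      · have := le_trans (le_max_right _ _) h2
        omega
      · rfl
      · rfl
  rw [key, gK_sum]
  refine Finset.sum_congr rfl fun p _ => ?_
  split_ifs with h
  · have hlo : 0 ≤ p.1.lo := by cases p.1 <;> simp [Macro.lo]
    have := fx_nonneg p.2
    rw [F20, if_pos (by omega)]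
    refine gK_shift hab (fun i j hij => ?_) (fun i j hij => ?_) _ _ fun i j => rfl
    · split_ifs at hij
      · have := le_of_cnt20_ne_zero hij
        omega
      · exact absurd rfl hij
    · split_ifs at hij
      · have := le_of_cnt20_ne_zero hij
        omega
      · exact absurd rfl hij
  · exact gK_zero

open Classical in
theorem F11_eq (hab : a ≠ b) (hr : r ≤ 1) (hs : s ≤ 1) (hc : c → 2 ≤ d) (hc' : c' → 2 ≤ d)
    (hd : 0 < d) :
    F11 a b r s c c' f g e e' d = ∑ m : Macro, ∑ m' : Macro,
      if m.cost ≤ r ∧ m'.cost ≤ s ∧ m.need ≤ f ∧ m'.need' ≤ g ∧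
        m.lo₂ m' ≤ d + m'.dx - m.dx ∧ (c → m' = .nwn → d ≠ 2) ∧ (c' → m = .ese → d ≠ 2) then
        toFPS (X a) ^ m.dx * toFPS (X b) ^ (1 - m'.dx) *
        F11 a b (r - m.cost) (s - m'.cost) (m = .nwn ∧ s - m'.cost ≠ 0)
          (m' = .ese ∧ r - m.cost ≠ 0) (f + m.dx) (g + (1 - m'.dx)) (max m.top (e - (1 - m.dx)))
          (max m'.top' (e' - m'.dx)) (d + m'.dx - m.dx) else 0 := by
  rw [F11, if_pos hd.le, ← Fintype.sum_prod_type']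
  have key : (fun i j => if e ≤ j - d ∧ e' ≤ i - d then cnt11 r s c c' f g d i j else 0) =
      fun i j => ∑ p : Macro × Macro, if p.1.cost ≤ r ∧ p.2.cost ≤ s ∧ p.1.need ≤ f ∧
        p.2.need' ≤ g ∧ p.1.lo₂ p.2 ≤ d + p.2.dx - p.1.dx ∧ (c → p.2 = .nwn → d ≠ 2) ∧
        (c' → p.1 = .ese → d ≠ 2) then
      (if max p.1.top (e - (1 - p.1.dx)) ≤ (j - (1 - p.2.dx)) - (d + p.2.dx - p.1.dx) ∧
          max p.2.top' (e' - p.2.dx) ≤ (i - p.1.dx) - (d + p.2.dx - p.1.dx) then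
        cnt11 (r - p.1.cost) (s - p.2.cost) (p.1 = .nwn ∧ s - p.2.cost ≠ 0)
        (p.2 = .ese ∧ r - p.1.cost ≠ 0) (f + p.1.dx) (g + (1 - p.2.dx)) (d + p.2.dx - p.1.dx)
        (i - p.1.dx) (j - (1 - p.2.dx)) else 0) else 0 := by
    ext i j
    split_ifs with hej
    · rw [cnt11_eq hr hs hc hc' hd]
      refine Finset.sum_congr rfl fun p _ => ?_
      rw [← ite_and]
      congr 1
      refine propext ⟨?_, ?_⟩
      · rintro ⟨h1, h2, h3, h4, h5, h6, h7, h8, h9⟩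
        exact ⟨⟨h1, h2, h3, h4, h7, h8, h9⟩, max_le h5 (by omega), max_le h6 (by omega)⟩
      · rintro ⟨⟨h1, h2, h3, h4, h7, h8, h9⟩, h5, h6⟩
        exact ⟨h1, h2, h3, h4, le_trans (le_max_left _ _) h5, le_trans (le_max_left _ _) h6, h7,
          h8, h9⟩
    · symm
      refine Finset.sum_eq_zero fun p _ => ?_
      split_ifs with h1 h2
      · have := le_trans (le_max_right _ _) h2.1
        have := le_trans (le_max_right _ _) h2.2
        omega
      · rfl
      · rfl
  rw [key, gK_sum]
  refine Finset.sum_congr rfl fun p _ => ?_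
  split_ifs with h
  · obtain ⟨m, m'⟩ := p
    simp only at h ⊢
    have hlo : 0 ≤ d + m'.dx - m.dx ∧ 0 ≤ d + m'.dx ∧ 0 ≤ d + m'.dx - m.dx + 1 - m'.dx := by
      have h1 := h.1.trans hr
      have h2 := h.2.1.trans hs
      have h3 := h.2.2.2.2.1
      cases m <;> simp [Macro.cost] at h1 <;> cases m' <;> simp [Macro.cost] at h2 <;>
        simp [Macro.lo₂, Macro.dx] at h3 ⊢ <;> omega
    rw [F11, if_pos hlo.1]
    refine gK_shift hab (fun i j hij => ?_) (fun i j hij => ?_) _ _ fun i j => rfl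
    · split_ifs at hij
      · have := le_of_cnt11_ne_zero hij
        omega
      · exact absurd rfl hij
    · split_ifs at hij
      · have := le_of_cnt11_ne_zero hij
        omega
      · exact absurd rfl hij
  · exact gK_zero

end

theorem sum_macro (φ : Macro → FPS) : ∑ m, φ m = φ .e + φ .n + φ .ese + φ .nwn + φ .esese +
    φ .nwnwn + φ .eesse + φ .nesse + φ .enwwn + φ .nnwwn := by
  have : (Finset.univ : Finset Macro) =
    {.e, .n, .ese, .nwn, .esese, .nwnwn, .eesse, .nesse, .enwwn, .nnwwn} := rfl
  rw [this]
  repeat rw [Finset.sum_insert (by decide)]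
  rw [Finset.sum_singleton]
  ring

section

variable {a b : Fin 2} {r s : ℕ} {o f g e e' d : ℤ} {c c' : Prop}

/-- The bound on the new distance can be dropped: where it fails, the generating function on the
right is zero anyway, either because the distance is not positive or because the room required to
the north is missing. The one exception is `enwwn` at distance one next to a step north, where
distance two is forbidden but not vanishing, and is subtracted. -/
theorem F20_rec (hab : a ≠ b) (hr : r ≤ 2) (ho : o = 0 ∨ (o = 1 ∨ o = -1) ∧ r ≤ 1) (hf : 0 ≤ f)
    (hd : 0 < d) :
    F20 a b r o f e d = ∑ m : Macro,
      if m.cost ≤ r ∧ (o ≠ 0 → o + m.ob ≠ 0) ∧ m.need ≤ f then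
        toFPS (X a) ^ m.dx * (toFPS (X b) * F20 a b (r - m.cost) m.ob (f + m.dx)
          (max m.top (e - (1 - m.dx))) (d - m.dx) + F20 a b (r - m.cost) m.ob (f + m.dx)
          (max m.top (e - (1 - m.dx))) (d + 1 - m.dx) - if m = .enwwn ∧ d = 1 then
          toFPS (X b) * F20 a b (r - 2) 0 (f - 1) (max 0 (e - 2)) 2 else 0) else 0 := by
  rw [F20_eq hab hr ho hd]
  refine Finset.sum_congr rfl fun m _ => ?_
  by_cases hg : m.cost ≤ r ∧ (o ≠ 0 → o + m.ob ≠ 0) ∧ m.need ≤ f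
  swap
  · rw [if_neg hg, Finset.sum_eq_zero]
    exact fun t _ => if_neg fun h => hg ⟨h.1, h.2.1, h.2.2.1⟩
  rw [if_pos hg]
  by_cases hm : m = .enwwn ∧ d = 1
  · rw [if_pos hm]
    obtain ⟨rfl, rfl⟩ := hm
    simp [fx, Macro.dx, Macro.lo, Macro.ob, Macro.top, Macro.need, Macro.cost] at hg ⊢
    simp [hg, sub_eq_add_neg]
  · rw [if_neg hm, sub_zero, mul_add, Fintype.sum_bool, add_comm]
    have key (t : Bool) : (if m.cost ≤ r ∧ (o ≠ 0 → o + m.ob ≠ 0) ∧ m.need ≤ f ∧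
        m.lo ≤ d + fx t - m.dx then
        toFPS (X a) ^ m.dx * toFPS (X b) ^ (1 - fx t) * F20 a b (r - m.cost) m.ob (f + m.dx)
          (max m.top (e - (1 - m.dx))) (d + fx t - m.dx) else 0) =
        toFPS (X a) ^ m.dx * toFPS (X b) ^ (1 - fx t) * F20 a b (r - m.cost) m.ob (f + m.dx)
          (max m.top (e - (1 - m.dx))) (d + fx t - m.dx) := by
      split_ifs with h
      · rfl
      · symm
        refine mul_eq_zero_of_right _ ?_
        have h0 := fx_nonneg t
        have hlo : ¬ m.lo ≤ d + fx t - m.dx := fun h' => h ⟨hg.1, hg.2.1, hg.2.2, h'⟩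
        obtain hneg | hz : d + fx t - m.dx < 0 ∨ d + fx t - m.dx = 0 := by
          cases m <;> simp [Macro.lo, Macro.dx] at hlo hm ⊢ <;> omega
        · exact F20_of_neg hneg
        · rw [hz]
          -- At distance zero, a path with backward steps left has no continuation; if none are
          -- left, the piece asks for positive room, which the empty pair lacks.
          by_cases hr0 : r - m.cost = 0
          · rw [hr0]
            cases m <;> simp only [Macro.lo, Macro.dx] at hlo hz <;> try omega
            all_goals
              exact F20_zero_pos (by simp only [Macro.dx]; omega) (by simp [Macro.top])
          · exact F20_zero_left hr0
    rw [key, key]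
    simp [fx, mul_assoc]

/-! ### The recursions with up to two backward steps on the upper path. -/

/-- The plain pairs of paths. -/
noncomputable def Zs (a b : Fin 2) (e d : ℤ) : FPS := F20 a b 0 0 0 e d

/-- The pairs of paths whose upper path has one step to the west or south. -/
noncomputable def Ws (a b : Fin 2) (o f e d : ℤ) : FPS := F20 a b 1 o f e d

/-- The pairs of paths whose upper path has two steps to the west or south. -/
noncomputable def Us (a b : Fin 2) (f d : ℤ) : FPS := F20 a b 2 0 f 0 d

theorem F20_eq_Zs (hf : 0 ≤ f) : F20 a b 0 o f e d = Zs a b e d := by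
  rw [F20_zero_ob, F20_stable (f' := 0) (by simpa using hf) (by simp), Zs]

theorem F20_eq_Ws (hf : 1 ≤ f) : F20 a b 1 o f e d = Ws a b o 1 e d := by
  rw [F20_stable (f' := 1) (by simpa using hf) (by simp), Ws]

theorem F20_eq_Ws_zero : F20 a b 1 o 0 e d = Ws a b o 0 e d := rfl

theorem F20_eq_Us (hf : 2 ≤ f) : F20 a b 2 0 f 0 d = Us a b 2 d := by
  rw [F20_stable (f' := 2) (by simpa using hf) (by simp), Us]

theorem F20_eq_Us_zero : F20 a b 2 0 0 0 d = Us a b 0 d := rfl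

theorem F20_eq_Us_one : F20 a b 2 0 1 0 d = Us a b 1 d := rfl

end

section

variable {a b : Fin 2} {d : ℤ}

theorem Zs_rec (hab : a ≠ b) (hd : 0 < d) {e : ℤ} (he : 0 ≤ e) : Zs a b e d =
    toFPS (X a) * (toFPS (X b) * Zs a b e (d - 1) + Zs a b e d) +
    (toFPS (X b) * Zs a b (max 0 (e - 1)) d + Zs a b (max 0 (e - 1)) (d + 1)) := by
  refine (F20_rec hab (by norm_num) (by norm_num) (by norm_num) hd).trans ?_
  rw [sum_macro]
  simp [-mul_eq_mul_left_iff, -add_left_inj, -add_right_inj, Macro.cost, Macro.ob, Macro.need,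
    Macro.dx, Macro.top, F20_eq_Zs, he]

/-- The four lines belong to `e`, `n`, `ese` and `nwn`; in each, the two terms are a step of the
lower path to the north and to the east. After `ese` the upper path still has to climb back, whence
the index 1 of the plain pairs. -/
theorem Ws_rec (hab : a ≠ b) (hd : 0 < d) : Ws a b 0 1 0 d =
    toFPS (X a) * (toFPS (X b) * Ws a b 0 1 0 (d - 1) + Ws a b 0 1 0 d) +
    (toFPS (X b) * Ws a b 0 1 0 d + Ws a b 0 1 0 (d + 1)) +
    toFPS (X a) ^ 2 * (toFPS (X b) * Zs a b 1 (d - 2) + Zs a b 1 (d - 1)) +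
    (toFPS (X a))⁻¹ * (toFPS (X b) * Zs a b 0 (d + 1) + Zs a b 0 (d + 2)) := by
  refine (F20_rec hab (by norm_num) (by norm_num) (by norm_num) hd).trans ?_
  rw [sum_macro]
  simp [-mul_eq_mul_left_iff, -add_left_inj, -add_right_inj, Macro.cost, Macro.ob, Macro.need,
    Macro.dx, Macro.top]
  norm_num [F20_eq_Zs, F20_eq_Ws, F20_eq_Ws_zero, F20_eq_Us, F20_eq_Us_zero, F20_eq_Us_one,
    -mul_eq_mul_left_iff, -add_left_inj, -add_right_inj, -mul_eq_mul_right_iff]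
  ring_nf

theorem Ws_rec_one (hab : a ≠ b) (hd : 0 < d) : Ws a b 0 1 1 d =
    toFPS (X a) * (toFPS (X b) * Ws a b 0 1 1 (d - 1) + Ws a b 0 1 1 d) +
    (toFPS (X b) * Ws a b 0 1 0 d + Ws a b 0 1 0 (d + 1)) +
    toFPS (X a) ^ 2 * (toFPS (X b) * Zs a b 2 (d - 2) + Zs a b 2 (d - 1)) +
    (toFPS (X a))⁻¹ * (toFPS (X b) * Zs a b 0 (d + 1) + Zs a b 0 (d + 2)) := by
  refine (F20_rec hab (by norm_num) (by norm_num) (by norm_num) hd).trans ?_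
  rw [sum_macro]
  simp [-mul_eq_mul_left_iff, -add_left_inj, -add_right_inj, Macro.cost, Macro.ob, Macro.need,
    Macro.dx, Macro.top]
  norm_num [F20_eq_Zs, F20_eq_Ws, F20_eq_Ws_zero, F20_eq_Us, F20_eq_Us_zero, F20_eq_Us_one,
    -mul_eq_mul_left_iff, -add_left_inj, -add_right_inj, -mul_eq_mul_right_iff]
  ring_nf

/-- The vertex left behind by a preceding `ese` rules out `nwn`. -/
theorem Ws_rec_neg (hab : a ≠ b) (hd : 0 < d) : Ws a b (-1) 1 1 d =
    toFPS (X a) * (toFPS (X b) * Ws a b 0 1 1 (d - 1) + Ws a b 0 1 1 d) +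
    (toFPS (X b) * Ws a b 0 1 0 d + Ws a b 0 1 0 (d + 1)) +
    toFPS (X a) ^ 2 * (toFPS (X b) * Zs a b 2 (d - 2) + Zs a b 2 (d - 1)) := by
  refine (F20_rec hab (by norm_num) (by norm_num) (by norm_num) hd).trans ?_
  rw [sum_macro]
  simp [-mul_eq_mul_left_iff, -add_left_inj, -add_right_inj, Macro.cost, Macro.ob, Macro.need,
    Macro.dx, Macro.top]
  norm_num [F20_eq_Zs, F20_eq_Ws, F20_eq_Ws_zero, F20_eq_Us, F20_eq_Us_zero, F20_eq_Us_one,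
    -mul_eq_mul_left_iff, -add_left_inj, -add_right_inj, -mul_eq_mul_right_iff]
  ring_nf

/-- The vertex left behind by a preceding `nwn` rules out `ese`. -/
theorem Ws_rec_pos (hab : a ≠ b) (hd : 0 < d) : Ws a b 1 1 0 d =
    toFPS (X a) * (toFPS (X b) * Ws a b 0 1 0 (d - 1) + Ws a b 0 1 0 d) +
    (toFPS (X b) * Ws a b 0 1 0 d + Ws a b 0 1 0 (d + 1)) +
    (toFPS (X a))⁻¹ * (toFPS (X b) * Zs a b 0 (d + 1) + Zs a b 0 (d + 2)) := by
  refine (F20_rec hab (by norm_num) (by norm_num) (by norm_num) hd).trans ?_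
  rw [sum_macro]
  simp [-mul_eq_mul_left_iff, -add_left_inj, -add_right_inj, Macro.cost, Macro.ob, Macro.need,
    Macro.dx, Macro.top]
  norm_num [F20_eq_Zs, F20_eq_Ws, F20_eq_Ws_zero, F20_eq_Us, F20_eq_Us_zero, F20_eq_Us_one,
    -mul_eq_mul_left_iff, -add_left_inj, -add_right_inj, -mul_eq_mul_right_iff]
  ring_nf

/-- At the western wall `nwn` is impossible; one step to the east makes the wall harmless. -/
theorem Ws_rec_zero (hab : a ≠ b) (hd : 0 < d) : Ws a b 0 0 0 d =
    toFPS (X a) * (toFPS (X b) * Ws a b 0 1 0 (d - 1) + Ws a b 0 1 0 d) +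
    (toFPS (X b) * Ws a b 0 0 0 d + Ws a b 0 0 0 (d + 1)) +
    toFPS (X a) ^ 2 * (toFPS (X b) * Zs a b 1 (d - 2) + Zs a b 1 (d - 1)) := by
  refine (F20_rec hab (by norm_num) (by norm_num) (by norm_num) hd).trans ?_
  rw [sum_macro]
  simp [-mul_eq_mul_left_iff, -add_left_inj, -add_right_inj, Macro.cost, Macro.ob, Macro.need,
    Macro.dx, Macro.top]
  norm_num [F20_eq_Zs, F20_eq_Ws, F20_eq_Ws_zero, F20_eq_Us, F20_eq_Us_zero, F20_eq_Us_one,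
    -mul_eq_mul_left_iff, -add_left_inj, -add_right_inj, -mul_eq_mul_right_iff]
  ring_nf

theorem Ws_rec_pos_zero (hab : a ≠ b) (hd : 0 < d) : Ws a b 1 0 0 d =
    toFPS (X a) * (toFPS (X b) * Ws a b 0 1 0 (d - 1) + Ws a b 0 1 0 d) +
    (toFPS (X b) * Ws a b 0 0 0 d + Ws a b 0 0 0 (d + 1)) := by
  refine (F20_rec hab (by norm_num) (by norm_num) (by norm_num) hd).trans ?_
  rw [sum_macro]
  simp [-mul_eq_mul_left_iff, -add_left_inj, -add_right_inj, Macro.cost, Macro.ob, Macro.need,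
    Macro.dx, Macro.top]
  norm_num [F20_eq_Zs, F20_eq_Ws, F20_eq_Ws_zero, F20_eq_Us, F20_eq_Us_zero, F20_eq_Us_one,
    -mul_eq_mul_left_iff, -add_left_inj, -add_right_inj, -mul_eq_mul_right_iff]

/-- The factors two come from `esese` and `eesse`, and from `nwnwn` and `nnwwn`, which have equal
displacements and equal demands of room. The exception at d = 1 belongs to `enwwn`. -/
theorem Us_rec (hab : a ≠ b) (hd : 0 < d) : Us a b 2 d =
    toFPS (X a) * (toFPS (X b) * Us a b 2 (d - 1) + Us a b 2 d) +
    (toFPS (X b) * Us a b 2 d + Us a b 2 (d + 1)) +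
    toFPS (X a) ^ 2 * (toFPS (X b) * Ws a b (-1) 1 1 (d - 2) + Ws a b (-1) 1 1 (d - 1)) +
    (toFPS (X a))⁻¹ * (toFPS (X b) * Ws a b 1 1 0 (d + 1) + Ws a b 1 1 0 (d + 2)) +
    2 * toFPS (X a) ^ 3 * (toFPS (X b) * Zs a b 2 (d - 3) + Zs a b 2 (d - 2)) +
    2 * ((toFPS (X a)) ^ 2)⁻¹ * (toFPS (X b) * Zs a b 0 (d + 2) + Zs a b 0 (d + 3)) +
    toFPS (X a) ^ 2 * (toFPS (X b) * Zs a b 2 (d - 2) + Zs a b 2 (d - 1)) +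
    (toFPS (X a))⁻¹ * (toFPS (X b) * Zs a b 0 (d + 1) + Zs a b 0 (d + 2) -
      if d = 1 then toFPS (X b) * Zs a b 0 2 else 0) := by
  refine (F20_rec hab (by norm_num) (by norm_num) (by norm_num) hd).trans ?_
  rw [sum_macro]
  simp [-mul_eq_mul_left_iff, -add_left_inj, -add_right_inj, Macro.cost, Macro.ob, Macro.need,
    Macro.dx, Macro.top]
  norm_num [F20_eq_Zs, F20_eq_Ws, F20_eq_Ws_zero, F20_eq_Us, F20_eq_Us_zero, F20_eq_Us_one,
    -mul_eq_mul_left_iff, -add_left_inj, -add_right_inj, -mul_eq_mul_right_iff]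
  ring_nf

theorem Us_rec_one (hab : a ≠ b) (hd : 0 < d) : Us a b 1 d =
    toFPS (X a) * (toFPS (X b) * Us a b 2 (d - 1) + Us a b 2 d) +
    (toFPS (X b) * Us a b 1 d + Us a b 1 (d + 1)) +
    toFPS (X a) ^ 2 * (toFPS (X b) * Ws a b (-1) 1 1 (d - 2) + Ws a b (-1) 1 1 (d - 1)) +
    (toFPS (X a))⁻¹ * (toFPS (X b) * Ws a b 1 0 0 (d + 1) + Ws a b 1 0 0 (d + 2)) +
    2 * toFPS (X a) ^ 3 * (toFPS (X b) * Zs a b 2 (d - 3) + Zs a b 2 (d - 2)) +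
    toFPS (X a) ^ 2 * (toFPS (X b) * Zs a b 2 (d - 2) + Zs a b 2 (d - 1)) +
    (toFPS (X a))⁻¹ * (toFPS (X b) * Zs a b 0 (d + 1) + Zs a b 0 (d + 2) -
      if d = 1 then toFPS (X b) * Zs a b 0 2 else 0) := by
  refine (F20_rec hab (by norm_num) (by norm_num) (by norm_num) hd).trans ?_
  rw [sum_macro]
  simp [-mul_eq_mul_left_iff, -add_left_inj, -add_right_inj, Macro.cost, Macro.ob, Macro.need,
    Macro.dx, Macro.top]
  norm_num [F20_eq_Zs, F20_eq_Ws, F20_eq_Ws_zero, F20_eq_Us, F20_eq_Us_zero, F20_eq_Us_one,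
    -mul_eq_mul_left_iff, -add_left_inj, -add_right_inj, -mul_eq_mul_right_iff]
  ring_nf

theorem Us_rec_zero (hab : a ≠ b) (hd : 0 < d) : Us a b 0 d =
    toFPS (X a) * (toFPS (X b) * Us a b 1 (d - 1) + Us a b 1 d) +
    (toFPS (X b) * Us a b 0 d + Us a b 0 (d + 1)) +
    toFPS (X a) ^ 2 * (toFPS (X b) * Ws a b (-1) 1 1 (d - 2) + Ws a b (-1) 1 1 (d - 1)) +
    2 * toFPS (X a) ^ 3 * (toFPS (X b) * Zs a b 2 (d - 3) + Zs a b 2 (d - 2)) +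
    toFPS (X a) ^ 2 * (toFPS (X b) * Zs a b 2 (d - 2) + Zs a b 2 (d - 1)) := by
  refine (F20_rec hab (by norm_num) (by norm_num) (by norm_num) hd).trans ?_
  rw [sum_macro]
  simp [-mul_eq_mul_left_iff, -add_left_inj, -add_right_inj, Macro.cost, Macro.ob, Macro.need,
    Macro.dx, Macro.top]
  norm_num [F20_eq_Zs, F20_eq_Ws, F20_eq_Ws_zero, F20_eq_Us, F20_eq_Us_zero, F20_eq_Us_one,
    -mul_eq_mul_left_iff, -add_left_inj, -add_right_inj, -mul_eq_mul_right_iff]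
  ring_nf

end

/-! ### The recursions with backward steps on both paths. -/

theorem cnt11_zero_right {r : ℕ} {f g d i j : ℤ} (hg : 0 ≤ g) :
    cnt11 r 0 False False f g d i j = cnt20 r 0 f d i j := by
  rw [cnt11_stable (f' := f) (g' := 0) (Or.inl rfl) (Or.inr ⟨by simpa using hg, by simp⟩), cnt11,
    cnt20, zero_add, zero_add]
  congr 1
  ext p
  constructor
  · rintro ⟨h1, h2, h3, h4, h5, h6, h7, -, -, h9, h9'⟩
    exact ⟨h1, h2.back, h3, h4, h5, by omega, h7, by simp, h9⟩
  · rintro ⟨h1, h2, h3, h4, h5, h6, h7, -, h9⟩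
    refine ⟨h1, reg_of_backs_eq_zero h2, h3, h4, h5, by omega, h7, by simp, by simp, h9,
      fun v hv => ?_⟩
    have k1 := mem_verts_of_backs_eq_zero h2 hv
    have k2 := mem_verts_le_of_backs_eq_zero h2 hv
    omega

section

variable {a b : Fin 2} {r s : ℕ} {f g e e' d : ℤ}

theorem F11_zero_right (hg : 0 ≤ g) (he' : e' ≤ 0) :
    F11 a b r 0 False False f g e e' d = F20 a b r 0 f e d := by
  rw [F11_of_nonpos_right he']
  simp only [F11, F20, cnt11_zero_right hg]
  congr 2
  ext i j
  by_cases h : cnt20 r 0 f d i j = 0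
  · simp [h]
  · have := le_of_cnt20_ne_zero h
    congr 1
    exact propext ⟨fun h => h.1, fun h => ⟨h, by omega⟩⟩

theorem sum_macro_of_cost {k : ℕ} (hk : k ≤ 1) (φ : Macro → FPS) (h : ∀ m, ¬ m.cost ≤ k → φ m = 0) :
    ∑ m, φ m = φ .e + φ .n + φ .ese + φ .nwn := by
  rw [sum_macro, h .esese, h .nwnwn, h .eesse, h .nesse, h .enwwn, h .nnwwn]
  · ring
  all_goals simp only [Macro.cost]; omega

-- As before, a violated distance bound usually meets a vanishing generating function. The
-- exceptions are two pieces `ese` or two pieces `nwn` at distance one: they collide although the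
-- new distance is again one, so their contribution is subtracted.
open Classical in
theorem F11_rec (hab : a ≠ b) (hr : r ≤ 1) (hs : s ≤ 1) (hf : 0 ≤ f) (hg : 0 ≤ g) (hd : 0 < d) :
    F11 a b r s False False f g e e' d = ∑ m : Macro, ∑ m' : Macro,
      if m.cost ≤ r ∧ m'.cost ≤ s ∧ m.need ≤ f ∧ m'.need' ≤ g then
        toFPS (X a) ^ m.dx * toFPS (X b) ^ (1 - m'.dx) *
        (F11 a b (r - m.cost) (s - m'.cost) (m = .nwn ∧ s - m'.cost ≠ 0)
          (m' = .ese ∧ r - m.cost ≠ 0) (f + m.dx) (g + (1 - m'.dx)) (max m.top (e - (1 - m.dx)))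
          (max m'.top' (e' - m'.dx)) (d + m'.dx - m.dx) -
        if d = 1 ∧ (m = .ese ∧ m' = .ese ∨ m = .nwn ∧ m' = .nwn) then
        F11 a b (r - m.cost) (s - m'.cost) False False (f + m.dx) (g + (1 - m'.dx))
          (max m.top (e - (1 - m.dx))) (max m'.top' (e' - m'.dx)) 1 else 0) else 0 := by
  rw [F11_eq hab hr hs (by simp) (by simp) hd]
  refine Finset.sum_congr rfl fun m _ => Finset.sum_congr rfl fun m' _ => ?_
  simp only [false_implies, and_true]
  by_cases hg : m.cost ≤ r ∧ m'.cost ≤ s ∧ m.need ≤ f ∧ m'.need' ≤ g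
  swap
  · rw [if_neg hg, if_neg fun h => hg ⟨h.1, h.2.1, h.2.2.1, h.2.2.2.1⟩]
  rw [if_pos hg]
  by_cases hlo : m.lo₂ m' ≤ d + m'.dx - m.dx
  · rw [if_pos ⟨hg.1, hg.2.1, hg.2.2.1, hg.2.2.2, hlo⟩, if_neg, sub_zero]
    rintro ⟨rfl, ⟨rfl, rfl⟩ | ⟨rfl, rfl⟩⟩ <;> simp [Macro.lo₂, Macro.dx] at hlo
  · rw [if_neg fun h => hlo h.2.2.2.2]
    symm
    refine mul_eq_zero_of_right _ ?_
    rcases lt_trichotomy (d + m'.dx - m.dx) 0 with hneg | hz | hpos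
    · rw [F11_of_neg hneg, if_neg, sub_zero]
      rintro ⟨rfl, ⟨rfl, rfl⟩ | ⟨rfl, rfl⟩⟩ <;> simp [Macro.dx] at hneg
    · rw [hz, if_neg, sub_zero]
      · obtain rfl | rfl | rfl | rfl := m.eq_of_cost_le_one (hg.1.trans hr) <;>
        obtain rfl | rfl | rfl | rfl := m'.eq_of_cost_le_one (hg.2.1.trans hs) <;>
        simp only [Macro.lo₂, Macro.dx, Macro.need, Macro.need', Macro.cost] at hlo hg hz <;>
        first
        | omega
        | (simp only [reduceCtorEq, false_and]
           refine F11_zero_pos ?_ ?_ ?_ <;> simp [Macro.dx, Macro.top, Macro.top'] <;> omega)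
      · rintro ⟨rfl, ⟨rfl, rfl⟩ | ⟨rfl, rfl⟩⟩ <;> simp [Macro.dx] at hz
    · obtain rfl | rfl | rfl | rfl := m.eq_of_cost_le_one (hg.1.trans hr) <;>
      obtain rfl | rfl | rfl | rfl := m'.eq_of_cost_le_one (hg.2.1.trans hs) <;>
      simp only [Macro.lo₂, Macro.dx, Macro.need, Macro.need', Macro.cost] at hlo hg hpos <;>
      first
      | omega
      | (obtain rfl : d = 1 := by omega
         obtain rfl : r = 1 := by omega
         obtain rfl : s = 1 := by omega
         simp [Macro.dx, Macro.cost])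

/-- The forbidden vertex can only be reached by an `ese` of the upper path from distance two. The
lower path must then step east, since after a step north the paths would meet too early; so one term
is removed. -/
theorem F11_flag (hab : a ≠ b) (hf : 0 ≤ f) (hg : 0 ≤ g) (hd : 2 ≤ d) :
    F11 a b 1 0 False True f g 0 0 d = F11 a b 1 0 False False f g 0 0 d -
      if d = 2 then toFPS (X a) ^ 2 * F11 a b 0 0 False False (f + 2) g 1 0 1 else 0 := by
  rw [F11_eq hab (by norm_num) (by norm_num) (by simp) (fun _ => hd) (by omega),
    F11_eq hab (by norm_num) (by norm_num) (by simp) (by simp) (by omega)]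
  simp only [sum_macro]
  by_cases h2 : d = 2
  · subst h2
    simp [Macro.cost, Macro.need, Macro.need', Macro.lo₂, Macro.dx, Macro.top, Macro.top', hf, hg]
    ring
  · simp [h2]

/-- The plain pairs of paths. -/
noncomputable def Ys (a b : Fin 2) (e e' d : ℤ) : FPS := F11 a b 0 0 False False 0 0 e e' d

/-- The pairs of paths whose upper path has one step to the west or south. -/
noncomputable def Rs (a b : Fin 2) (f e' d : ℤ) : FPS := F11 a b 1 0 False False f 0 0 e' d

/-- The pairs of paths each of which has one step to the west or south. -/
noncomputable def Hs (a b : Fin 2) (f g d : ℤ) : FPS := F11 a b 1 1 False False f g 0 0 d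

theorem F11_eq_Ys (hf : 0 ≤ f) (hg : 0 ≤ g) : F11 a b 0 0 False False f g e e' d = Ys a b e e' d :=
  F11_stable (Or.inr (by simpa using hf)) (Or.inr (by simpa using hg))

theorem F11_eq_Rs (hf : 1 ≤ f) (hg : 0 ≤ g) :
    F11 a b 1 0 False False f g 0 e' d = Rs a b 1 e' d :=
  F11_stable (Or.inr (by simpa using hf)) (Or.inr (by simpa using hg))

theorem F11_eq_Rs_zero (hg : 0 ≤ g) : F11 a b 1 0 False False 0 g 0 e' d = Rs a b 0 e' d :=
  F11_stable (Or.inl rfl) (Or.inr (by simpa using hg))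

theorem F11_eq_Rs' (hf : 0 ≤ f) (hg : 1 ≤ g) :
    F11 a b 0 1 False False f g e 0 d = Rs b a 1 e d := by
  rw [F11_swap, F11_eq_Rs hg hf]

theorem F11_eq_Rs_zero' (hf : 0 ≤ f) : F11 a b 0 1 False False f 0 e 0 d = Rs b a 0 e d := by
  rw [F11_swap, F11_eq_Rs_zero hf]

theorem F11_eq_Hs (hf : 1 ≤ f) (hg : 1 ≤ g) :
    F11 a b 1 1 False False f g 0 0 d = Hs a b 1 1 d :=
  F11_stable (Or.inr (by simpa using hf)) (Or.inr (by simpa using hg))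

theorem F11_eq_Hs_left (hf : 1 ≤ f) : F11 a b 1 1 False False f 0 0 0 d = Hs a b 1 0 d :=
  F11_stable (Or.inr (by simpa using hf)) (Or.inl rfl)

theorem F11_eq_Hs_right (hg : 1 ≤ g) : F11 a b 1 1 False False 0 g 0 0 d = Hs a b 0 1 d :=
  F11_stable (Or.inl rfl) (Or.inr (by simpa using hg))

theorem F11_eq_Hs_zero : F11 a b 1 1 False False 0 0 0 0 d = Hs a b 0 0 d := rfl

theorem Hs_swap : Hs a b f g d = Hs b a g f d := F11_swap

theorem Ys_swap : Ys a b e e' d = Ys b a e' e d := F11_swap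

theorem Ys_eq_Zs (he' : e' ≤ 0) : Ys a b e e' d = Zs a b e d := F11_zero_zero le_rfl he'

theorem Ys_eq_Zs' (he : e ≤ 0) : Ys a b e e' d = Zs b a e' d := by rw [Ys_swap, Ys_eq_Zs he]

theorem Rs_eq_Ws (he' : e' ≤ 0) : Rs a b f e' d = Ws a b 0 f 0 d := F11_zero_right le_rfl he'

theorem F11_eq_flag (hab : a ≠ b) (hf : 1 ≤ f) (hg : 0 ≤ g) (hd : 2 ≤ d) :
    F11 a b 1 0 False True f g 0 0 d = Ws a b 0 1 0 d -
      if d = 2 then toFPS (X a) ^ 2 * Zs a b 1 1 else 0 := by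
  rw [F11_flag hab (by omega) hg hd, F11_eq_Rs hf hg, F11_eq_Ys (by omega) hg, Rs_eq_Ws le_rfl,
    Ys_eq_Zs le_rfl]

theorem F11_eq_flag_zero (hab : a ≠ b) (hg : 0 ≤ g) (hd : 2 ≤ d) :
    F11 a b 1 0 False True 0 g 0 0 d = Ws a b 0 0 0 d -
      if d = 2 then toFPS (X a) ^ 2 * Zs a b 1 1 else 0 := by
  rw [F11_flag hab (by omega) hg hd, F11_eq_Rs_zero hg, F11_eq_Ys (by omega) hg, Rs_eq_Ws le_rfl,
    Ys_eq_Zs le_rfl]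

theorem F11_eq_flag' (hab : a ≠ b) (hf : 0 ≤ f) (hg : 1 ≤ g) (hd : 2 ≤ d) :
    F11 a b 0 1 True False f g 0 0 d = Ws b a 0 1 0 d -
      if d = 2 then toFPS (X b) ^ 2 * Zs b a 1 1 else 0 := by
  rw [F11_swap, F11_eq_flag hab.symm hg hf hd]

theorem F11_eq_flag_zero' (hab : a ≠ b) (hf : 0 ≤ f) (hd : 2 ≤ d) :
    F11 a b 0 1 True False f 0 0 0 d = Ws b a 0 0 0 d -
      if d = 2 then toFPS (X b) ^ 2 * Zs b a 1 1 else 0 := by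
  rw [F11_swap, F11_eq_flag_zero hab.symm hf hd]

theorem Ys_rec (hab : a ≠ b) (hd : 0 < d) : Ys a b 1 1 d =
    toFPS (X a) * Zs a b 1 d +
    toFPS (X a) * toFPS (X b) * Ys a b 1 1 (d - 1) +
    Zs a b 0 (d + 1) +
    toFPS (X b) * Zs b a 1 d := by
  refine (F11_rec hab (by norm_num) (by norm_num) (by norm_num) (by norm_num) hd).trans ?_
  rw [sum_macro_of_cost zero_le_one _ fun m hm => Finset.sum_eq_zero fun m' _ => if_neg fun h => hm
    h.1]
  repeat rw [sum_macro_of_cost zero_le_one _ fun m hm => if_neg fun h => hm h.2.1]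
  simp [-mul_eq_mul_left_iff, -add_left_inj, -add_right_inj, Macro.cost, Macro.need,
    Macro.need', Macro.dx, Macro.top, Macro.top']
  norm_num [F11_eq_Ys, F11_eq_Rs, F11_eq_Rs', F11_eq_Rs_zero, F11_eq_Rs_zero', F11_eq_Hs,
    F11_eq_Hs_left, F11_eq_Hs_right, F11_eq_Hs_zero, Ys_eq_Zs, Ys_eq_Zs', Rs_eq_Ws,
    -mul_eq_mul_left_iff, -add_left_inj, -add_right_inj, -mul_eq_mul_right_iff]
  ring_nf

theorem Rs_rec (hab : a ≠ b) (hd : 0 < d) : Rs a b 1 1 d =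
    toFPS (X a) * (Ws a b 0 1 0 d + toFPS (X b) * Rs a b 1 1 (d - 1)) +
    (Ws a b 0 1 0 (d + 1) + toFPS (X b) * Rs a b 1 1 d) +
    toFPS (X a) ^ 2 * (Zs a b 1 (d - 1) + toFPS (X b) * Ys a b 1 1 (d - 2)) +
    (toFPS (X a))⁻¹ * (Zs a b 0 (d + 2) + toFPS (X b) * Zs b a 1 (d + 1)) := by
  refine (F11_rec hab (by norm_num) (by norm_num) (by norm_num) (by norm_num) hd).trans ?_
  rw [sum_macro_of_cost le_rfl _ fun m hm => Finset.sum_eq_zero fun m' _ => if_neg fun h => hm h.1]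
  repeat rw [sum_macro_of_cost zero_le_one _ fun m hm => if_neg fun h => hm h.2.1]
  simp [-mul_eq_mul_left_iff, -add_left_inj, -add_right_inj, Macro.cost, Macro.need,
    Macro.need', Macro.dx, Macro.top, Macro.top']
  norm_num [F11_eq_Ys, F11_eq_Rs, F11_eq_Rs', F11_eq_Rs_zero, F11_eq_Rs_zero', F11_eq_Hs,
    F11_eq_Hs_left, F11_eq_Hs_right, F11_eq_Hs_zero, Ys_eq_Zs, Ys_eq_Zs', Rs_eq_Ws,
    -mul_eq_mul_left_iff, -add_left_inj, -add_right_inj, -mul_eq_mul_right_iff]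
  ring_nf

theorem Rs_rec_zero (hab : a ≠ b) (hd : 0 < d) : Rs a b 0 1 d =
    toFPS (X a) * (Ws a b 0 1 0 d + toFPS (X b) * Rs a b 1 1 (d - 1)) +
    (Ws a b 0 0 0 (d + 1) + toFPS (X b) * Rs a b 0 1 d) +
    toFPS (X a) ^ 2 * (Zs a b 1 (d - 1) + toFPS (X b) * Ys a b 1 1 (d - 2)) := by
  refine (F11_rec hab (by norm_num) (by norm_num) (by norm_num) (by norm_num) hd).trans ?_
  rw [sum_macro_of_cost le_rfl _ fun m hm => Finset.sum_eq_zero fun m' _ => if_neg fun h => hm h.1]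
  repeat rw [sum_macro_of_cost zero_le_one _ fun m hm => if_neg fun h => hm h.2.1]
  simp [-mul_eq_mul_left_iff, -add_left_inj, -add_right_inj, Macro.cost, Macro.need,
    Macro.need', Macro.dx, Macro.top, Macro.top']
  norm_num [F11_eq_Ys, F11_eq_Rs, F11_eq_Rs', F11_eq_Rs_zero, F11_eq_Rs_zero', F11_eq_Hs,
    F11_eq_Hs_left, F11_eq_Hs_right, F11_eq_Hs_zero, Ys_eq_Zs, Ys_eq_Zs', Rs_eq_Ws,
    -mul_eq_mul_left_iff, -add_left_inj, -add_right_inj, -mul_eq_mul_right_iff]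
  ring_nf

/-- The terms are the sixteen pairs of pieces of cost at most one. The corrections at d = 1 have two
origins: the colliding pairs of equal bent pieces, and the vertex that a bent piece leaves at
distance two from the other path. -/
theorem Hs_rec_1_1 (hab : a ≠ b) (hd : 0 < d) : Hs a b 1 1 d =
    toFPS (X a) * (Hs a b 1 1 d + toFPS (X b) * Hs a b 1 1 (d - 1)) +
    (Hs a b 1 1 (d + 1) + toFPS (X b) * Hs a b 1 1 d) +
    toFPS (X a) ^ 2 * (Rs b a 1 1 (d - 1) + toFPS (X b) * Rs b a 1 1 (d - 2)) +
    toFPS (X b) ^ 2 * (Rs a b 1 1 (d - 1) + toFPS (X a) * Rs a b 1 1 (d - 2)) +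
    (toFPS (X a))⁻¹ * (Ws b a 0 1 0 (d + 2) + toFPS (X b) * (Ws b a 0 1 0 (d + 1) -
      if d = 1 then toFPS (X b) ^ 2 * Zs b a 1 1 else 0)) +
    (toFPS (X b))⁻¹ * (Ws a b 0 1 0 (d + 2) + toFPS (X a) * (Ws a b 0 1 0 (d + 1) -
      if d = 1 then toFPS (X a) ^ 2 * Zs a b 1 1 else 0)) +
    toFPS (X a) ^ 2 * (toFPS (X b))⁻¹ * (Zs a b 1 d - if d = 1 then Zs a b 1 1 else 0) +
    (toFPS (X a))⁻¹ * toFPS (X b) ^ 2 * (Zs b a 1 d - if d = 1 then Zs b a 1 1 else 0) +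
    toFPS (X a) ^ 2 * toFPS (X b) ^ 2 * Ys a b 1 1 (d - 3) +
    (toFPS (X a))⁻¹ * (toFPS (X b))⁻¹ * Zs a b 0 (d + 3) := by
  refine (F11_rec hab (by norm_num) (by norm_num) (by norm_num) (by norm_num) hd).trans ?_
  rw [sum_macro_of_cost le_rfl _ fun m hm => Finset.sum_eq_zero fun m' _ => if_neg fun h => hm h.1]
  repeat rw [sum_macro_of_cost le_rfl _ fun m hm => if_neg fun h => hm h.2.1]
  simp [-mul_eq_mul_left_iff, -add_left_inj, -add_right_inj, Macro.cost, Macro.need,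
    Macro.need', Macro.dx, Macro.top, Macro.top']
  norm_num [add_assoc, add_sub_assoc, show (2 : ℤ) ≤ d + 1 by omega, show (2 : ℤ) ≤ d + 2 by omega,
    show d + 2 ≠ 2 by omega, show d + 1 = 2 ↔ d = 1 by omega, F11_eq_flag hab, F11_eq_flag' hab,
    F11_eq_flag_zero hab, F11_eq_flag_zero' hab, -mul_eq_mul_left_iff, -add_left_inj,
    -add_right_inj, -mul_eq_mul_right_iff]
  norm_num [F11_eq_Ys, F11_eq_Rs, F11_eq_Rs', F11_eq_Rs_zero, F11_eq_Rs_zero', F11_eq_Hs,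
    F11_eq_Hs_left, F11_eq_Hs_right, F11_eq_Hs_zero, Ys_eq_Zs, Ys_eq_Zs', Rs_eq_Ws,
    -mul_eq_mul_left_iff, -add_left_inj, -add_right_inj, -mul_eq_mul_right_iff]
  ring_nf

theorem Hs_rec_1_0 (hab : a ≠ b) (hd : 0 < d) : Hs a b 1 0 d =
    toFPS (X a) * (Hs a b 1 0 d + toFPS (X b) * Hs a b 1 1 (d - 1)) +
    (Hs a b 1 0 (d + 1) + toFPS (X b) * Hs a b 1 1 d) +
    toFPS (X a) ^ 2 * (Rs b a 0 1 (d - 1) + toFPS (X b) * Rs b a 1 1 (d - 2)) +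
    toFPS (X b) ^ 2 * (Rs a b 1 1 (d - 1) + toFPS (X a) * Rs a b 1 1 (d - 2)) +
    (toFPS (X a))⁻¹ * (Ws b a 0 0 0 (d + 2) + toFPS (X b) * (Ws b a 0 1 0 (d + 1) -
      if d = 1 then toFPS (X b) ^ 2 * Zs b a 1 1 else 0)) +
    (toFPS (X a))⁻¹ * toFPS (X b) ^ 2 * (Zs b a 1 d - if d = 1 then Zs b a 1 1 else 0) +
    toFPS (X a) ^ 2 * toFPS (X b) ^ 2 * Ys a b 1 1 (d - 3) := by
  refine (F11_rec hab (by norm_num) (by norm_num) (by norm_num) (by norm_num) hd).trans ?_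
  rw [sum_macro_of_cost le_rfl _ fun m hm => Finset.sum_eq_zero fun m' _ => if_neg fun h => hm h.1]
  repeat rw [sum_macro_of_cost le_rfl _ fun m hm => if_neg fun h => hm h.2.1]
  simp [-mul_eq_mul_left_iff, -add_left_inj, -add_right_inj, Macro.cost, Macro.need,
    Macro.need', Macro.dx, Macro.top, Macro.top']
  norm_num [add_assoc, add_sub_assoc, show (2 : ℤ) ≤ d + 1 by omega, show (2 : ℤ) ≤ d + 2 by omega,
    show d + 2 ≠ 2 by omega, show d + 1 = 2 ↔ d = 1 by omega, F11_eq_flag hab, F11_eq_flag' hab,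
    F11_eq_flag_zero hab, F11_eq_flag_zero' hab, -mul_eq_mul_left_iff, -add_left_inj,
    -add_right_inj, -mul_eq_mul_right_iff]
  norm_num [F11_eq_Ys, F11_eq_Rs, F11_eq_Rs', F11_eq_Rs_zero, F11_eq_Rs_zero', F11_eq_Hs,
    F11_eq_Hs_left, F11_eq_Hs_right, F11_eq_Hs_zero, Ys_eq_Zs, Ys_eq_Zs', Rs_eq_Ws,
    -mul_eq_mul_left_iff, -add_left_inj, -add_right_inj, -mul_eq_mul_right_iff]
  ring_nf

theorem Hs_rec_0_0 (hab : a ≠ b) (hd : 0 < d) : Hs a b 0 0 d =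
    toFPS (X a) * (Hs a b 1 0 d + toFPS (X b) * Hs a b 1 1 (d - 1)) +
    (Hs a b 0 0 (d + 1) + toFPS (X b) * Hs a b 0 1 d) +
    toFPS (X a) ^ 2 * (Rs b a 0 1 (d - 1) + toFPS (X b) * Rs b a 1 1 (d - 2)) +
    toFPS (X b) ^ 2 * (Rs a b 0 1 (d - 1) + toFPS (X a) * Rs a b 1 1 (d - 2)) +
    toFPS (X a) ^ 2 * toFPS (X b) ^ 2 * Ys a b 1 1 (d - 3) := by
  refine (F11_rec hab (by norm_num) (by norm_num) (by norm_num) (by norm_num) hd).trans ?_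
  rw [sum_macro_of_cost le_rfl _ fun m hm => Finset.sum_eq_zero fun m' _ => if_neg fun h => hm h.1]
  repeat rw [sum_macro_of_cost le_rfl _ fun m hm => if_neg fun h => hm h.2.1]
  simp [-mul_eq_mul_left_iff, -add_left_inj, -add_right_inj, Macro.cost, Macro.need,
    Macro.need', Macro.dx, Macro.top, Macro.top']
  norm_num [add_assoc, add_sub_assoc, show (2 : ℤ) ≤ d + 1 by omega, show (2 : ℤ) ≤ d + 2 by omega,
    show d + 2 ≠ 2 by omega, show d + 1 = 2 ↔ d = 1 by omega, F11_eq_flag hab, F11_eq_flag' hab,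
    F11_eq_flag_zero hab, F11_eq_flag_zero' hab, -mul_eq_mul_left_iff, -add_left_inj,
    -add_right_inj, -mul_eq_mul_right_iff]
  norm_num [F11_eq_Ys, F11_eq_Rs, F11_eq_Rs', F11_eq_Rs_zero, F11_eq_Rs_zero', F11_eq_Hs,
    F11_eq_Hs_left, F11_eq_Hs_right, F11_eq_Hs_zero, Ys_eq_Zs, Ys_eq_Zs', Rs_eq_Ws,
    -mul_eq_mul_left_iff, -add_left_inj, -add_right_inj, -mul_eq_mul_right_iff]
  ring_nf

end

/-! ### Explicit solutions of the recursions over a field. -/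

section

variable {F : Type*} [Field F] {p q : F}

/-- None of the polynomials that occur in denominators vanishes. -/
structure Generic (p q : F) : Prop where
  hp : p ≠ 0
  hq : q ≠ 0
  hp' : 1 - p ≠ 0
  hq' : 1 - q ≠ 0
  hs : 1 - p - q ≠ 0
  hx' : 1 - p * (1 - q) ≠ 0
  hy' : 1 - q * (1 - p) ≠ 0
  ht : 1 - p - q + 2 * p * q ≠ 0

theorem Generic.symm (h : Generic p q) : Generic q p :=
  ⟨h.hq, h.hp, h.hq', h.hp', fun e => h.hs (by linear_combination e), h.hy', h.hx',
    fun e => h.ht (by linear_combination e)⟩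

/-- With x = p(1-q) and y = q(1-p), this is the root of t + x + y + xy/t = 1 that is divisible by
xy. -/
noncomputable def baseG (p q : F) : F := p * q

/-- This is xy/(1-x), the root for recursions in which only the terms with x and xy/t involve the
unknown; exchanging p and q gives xy/(1-y). -/
noncomputable def baseP (p q : F) : F := p * (1 - q) * (q * (1 - p)) / (1 - p * (1 - q))

noncomputable def baseR (p q : F) : F := p * (1 - q) * (q * (1 - p))

theorem baseG_comm (p q : F) : baseG p q = baseG q p := mul_comm _ _

theorem baseR_comm (p q : F) : baseR p q = baseR q p := mul_comm _ _

theorem Generic.baseG_ne (h : Generic p q) : baseG p q ≠ 0 := mul_ne_zero h.hp h.hq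

theorem Generic.baseR_ne (h : Generic p q) : baseR p q ≠ 0 :=
  mul_ne_zero (mul_ne_zero h.hp h.hq') (mul_ne_zero h.hq h.hp')

theorem Generic.baseP_ne (h : Generic p q) : baseP p q ≠ 0 := div_ne_zero h.baseR_ne h.hx'

variable [CharZero F]

/-- Coefficients of the powers of each base are written uniformly as quadratic polynomials in the
index, zeros included, so that smallness of every solution follows from `Param.small_quad`. The
final letters G, P, Q, R refer to the bases pq, xy/(1-x), xy/(1-y) and xy. -/
noncomputable def plainSeqG (_p _q n : F) : F := 1 + 0 * n + 0 * n ^ 2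

noncomputable def plainSeq (p q : F) (d : ℤ) : F := plainSeqG p q d * baseG p q ^ d

noncomputable def plainSeqOneG (_p _q n : F) : F := 1 + 0 * n + 0 * n ^ 2

noncomputable def plainSeqOneP (_p _q n : F) : F := -1 + 0 * n + 0 * n ^ 2

noncomputable def plainSeqOne (p q : F) (d : ℤ) : F := plainSeqOneG p q d * baseG p q ^ d +
    plainSeqOneP p q d * baseP p q ^ d

noncomputable def plainSeqTwoG (_p _q n : F) : F := 1 + 0 * n + 0 * n ^ 2

noncomputable def plainSeqTwoP (p q n : F) : F := -1 + -1 * q * (1 - p) / (1 - p * (1 - q)) ^ 2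
    * n + 0 * n ^ 2

noncomputable def plainSeqTwo (p q : F) (d : ℤ) : F := plainSeqTwoG p q d * baseG p q ^ d +
    plainSeqTwoP p q d * baseP p q ^ d

noncomputable def westSeqG (p q n : F) : F := (-1 + 2 * p + q ^ 2 - 2 * p * q - p ^ 2 - p * q ^
    2 + 2 * p ^ 2 * q - p ^ 2 * q ^ 2) / (q ^ 2 * (1 - p) ^ 2) + (1 - 3 * q + 3 * q ^ 2) / (q *
    (1 - q) * (1 - p - q)) * n + 0 * n ^ 2

noncomputable def westSeqP (p q n : F) : F := (1 - p * (1 - q)) ^ 2 / (q ^ 2 * (1 - p) ^ 2) + 0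
    * n + 0 * n ^ 2

noncomputable def westSeq (p q : F) (d : ℤ) : F := westSeqG p q d * baseG p q ^ d + westSeqP p q
    d * baseP p q ^ d

noncomputable def westSeqOneG (p q n : F) : F := (-1 + 2 * p + q ^ 2 - 2 * p * q - p ^ 2 - p * q
    ^ 2 + 2 * p ^ 2 * q - p ^ 2 * q ^ 2) / (q ^ 2 * (1 - p) ^ 2) + (1 - 3 * q + 3 * q ^ 2) / (q
    * (1 - q) * (1 - p - q)) * n + 0 * n ^ 2

noncomputable def westSeqOneP (p q n : F) : F := (1 - 3 * p - q ^ 2 + 3 * p * q + 3 * p ^ 2 + 2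
    * p * q ^ 2 - 6 * p ^ 2 * q - p ^ 3 + 2 * p ^ 2 * q ^ 2 + 3 * p ^ 3 * q - 3 * p ^ 3 * q ^ 2
    + p ^ 3 * q ^ 3) / (q ^ 2 * (1 - p) ^ 2 * (1 - p * (1 - q))) + (3/2 - p + p * q) / (1 - p *
    (1 - q)) ^ 2 * n + -1/2 / (1 - p * (1 - q)) ^ 2 * n ^ 2

noncomputable def westSeqOne (p q : F) (d : ℤ) : F := westSeqOneG p q d * baseG p q ^ d +
    westSeqOneP p q d * baseP p q ^ d

noncomputable def westSeqNegG (p q n : F) : F := (-1 + q + 2 * p + q ^ 2 - 4 * p * q - p ^ 2 - q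
    ^ 3 + p * q ^ 2 + 3 * p ^ 2 * q - q ^ 4 + p * q ^ 3 - 3 * p ^ 2 * q ^ 2 + 2 * p * q ^ 4 + p
    ^ 2 * q ^ 3 - p ^ 2 * q ^ 4) / (q ^ 2 * (1 - p) ^ 2 * (1 - q)) + (1 - 3 * q + 3 * q ^ 2) /
    (q * (1 - q) * (1 - p - q)) * n + 0 * n ^ 2

noncomputable def westSeqNegP (p q n : F) : F := (1 - 3 * p - q ^ 2 + 3 * p * q + 3 * p ^ 2 + 2
    * p * q ^ 2 - 6 * p ^ 2 * q - p ^ 3 + 2 * p ^ 2 * q ^ 2 + 3 * p ^ 3 * q - 3 * p ^ 3 * q ^ 2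
    + p ^ 3 * q ^ 3) / (q ^ 2 * (1 - p) ^ 2 * (1 - p * (1 - q))) + (3/2 - p + p * q) / (1 - p *
    (1 - q)) ^ 2 * n + -1/2 / (1 - p * (1 - q)) ^ 2 * n ^ 2

noncomputable def westSeqNeg (p q : F) (d : ℤ) : F := westSeqNegG p q d * baseG p q ^ d +
    westSeqNegP p q d * baseP p q ^ d

noncomputable def westSeqZeroG (p q n : F) : F := (-1 + 2 * q + 2 * p - 6 * p * q - p ^ 2 - 2 *
    q ^ 3 + 5 * p * q ^ 2 + 4 * p ^ 2 * q - 6 * p ^ 2 * q ^ 2 + p * q ^ 4 + 4 * p ^ 2 * q ^ 3 -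
    2 * p ^ 2 * q ^ 4) / (q ^ 2 * (1 - p) ^ 2 * (1 - q) ^ 2) + (1 - 3 * q + 3 * q ^ 2) / (q * (1
    - q) * (1 - p - q)) * n + 0 * n ^ 2

noncomputable def westSeqZeroP (p q n : F) : F := (1 - p * (1 - q)) ^ 2 / (q ^ 2 * (1 - p) ^ 2)
    + 0 * n + 0 * n ^ 2

noncomputable def westSeqZero (p q : F) (d : ℤ) : F := westSeqZeroG p q d * baseG p q ^ d +
    westSeqZeroP p q d * baseP p q ^ d

noncomputable def westSeqPosG (p q n : F) : F := (-1 - q + 2 * p + 3 * q ^ 2 - p ^ 2 - q ^ 3 - 5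
    * p * q ^ 2 + p ^ 2 * q + 2 * p * q ^ 3 + p ^ 2 * q ^ 2 - p ^ 2 * q ^ 3) / (q ^ 2 * (1 - p)
    ^ 2) + (1 - 3 * q + 3 * q ^ 2) / (q * (1 - q) * (1 - p - q)) * n + 0 * n ^ 2

noncomputable def westSeqPosP (p q n : F) : F := (1 + q - p) * (1 - p * (1 - q)) / (q ^ 2 * (1 -
    p) ^ 2) + 0 * n + 0 * n ^ 2

noncomputable def westSeqPos (p q : F) (d : ℤ) : F := westSeqPosG p q d * baseG p q ^ d +
    westSeqPosP p q d * baseP p q ^ d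

noncomputable def westSeqPosZeroG (p q n : F) : F := (-1 + q + 2 * p + 4 * q ^ 2 - 4 * p * q - p
    ^ 2 - 8 * q ^ 3 - 3 * p * q ^ 2 + 3 * p ^ 2 * q + 4 * q ^ 4 + 12 * p * q ^ 3 - 2 * p ^ 2 * q
    ^ 2 - q ^ 5 - 7 * p * q ^ 4 - 2 * p ^ 2 * q ^ 3 + 2 * p * q ^ 5 + 2 * p ^ 2 * q ^ 4 - p ^ 2
    * q ^ 5) / (q ^ 2 * (1 - p) ^ 2 * (1 - q) ^ 2) + (1 - 3 * q + 3 * q ^ 2) / (q * (1 - q) * (1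
    - p - q)) * n + 0 * n ^ 2

noncomputable def westSeqPosZeroP (p q n : F) : F := (1 + q - p) * (1 - p * (1 - q)) / (q ^ 2 *
    (1 - p) ^ 2) + 0 * n + 0 * n ^ 2

noncomputable def westSeqPosZero (p q : F) (d : ℤ) : F := westSeqPosZeroG p q d * baseG p q ^ d
    + westSeqPosZeroP p q d * baseP p q ^ d

/-- The constant term solves the homogeneous recursion and hence drops out of its verification; it
is fixed only by the conditions near d = 0. It is kept apart so that it need not be expanded there.
-/
noncomputable def twoSeqG0 (p q : F) : F := (-2 * q + 4 * p + 9 * q ^ 2 - 11 * p * q - 12 * p ^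
    2 - 14 * q ^ 3 + 46 * p ^ 2 * q + 12 * p ^ 3 + 11 * q ^ 4 + 23 * p * q ^ 3 - 59 * p ^ 2 * q
    ^ 2 - 51 * p ^ 3 * q - 4 * p ^ 4 - 9 * q ^ 5 - 31 * p * q ^ 4 + 25 * p ^ 2 * q ^ 3 + 81 * p
    ^ 3 * q ^ 2 + 18 * p ^ 4 * q + 7 * q ^ 6 + 34 * p * q ^ 5 + 17 * p ^ 2 * q ^ 4 - 64 * p ^ 3
    * q ^ 3 - 31 * p ^ 4 * q ^ 2 - 2 * q ^ 7 - 24 * p * q ^ 6 - 44 * p ^ 2 * q ^ 5 + 26 * p ^ 3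
    * q ^ 4 + 26 * p ^ 4 * q ^ 3 + 6 * p * q ^ 7 + 30 * p ^ 2 * q ^ 6 + 7 * p ^ 3 * q ^ 5 - 10 *
    p ^ 4 * q ^ 4 - 6 * p ^ 2 * q ^ 7 - 10 * p ^ 3 * q ^ 6 - 2 * p ^ 4 * q ^ 5 + 2 * p ^ 3 * q ^
    7 + 2 * p ^ 4 * q ^ 6) / (q ^ 3 * (1 - p) ^ 3 * (1 - q) ^ 2 * (1 - p - q))

noncomputable def twoSeqG1 (p q : F) : F := (-1 + 13/2 * q + 4 * p - 33/2 * q ^ 2 - 53/2 * p * q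
    - 6 * p ^ 2 + 35/2 * q ^ 3 + 71 * p * q ^ 2 + 81/2 * p ^ 2 * q + 4 * p ^ 3 - 3/2 * q ^ 4 -
    183/2 * p * q ^ 3 - 221/2 * p ^ 2 * q ^ 2 - 55/2 * p ^ 3 * q - p ^ 4 - 15/2 * q ^ 5 + 58 * p
    * q ^ 4 + 301/2 * p ^ 2 * q ^ 3 + 74 * p ^ 3 * q ^ 2 + 7 * p ^ 4 * q - 9/2 * q ^ 6 - 73/2 *
    p * q ^ 5 - 243/2 * p ^ 2 * q ^ 4 - 193/2 * p ^ 3 * q ^ 3 - 18 * p ^ 4 * q ^ 2 + 15 * q ^ 7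
    + 50 * p * q ^ 6 + 205/2 * p ^ 2 * q ^ 5 + 74 * p ^ 3 * q ^ 4 + 20 * p ^ 4 * q ^ 3 - 10 * q
    ^ 8 - 49 * p * q ^ 7 - 185/2 * p ^ 2 * q ^ 6 - 123/2 * p ^ 3 * q ^ 5 - 10 * p ^ 4 * q ^ 4 +
    2 * q ^ 9 + 24 * p * q ^ 8 + 55 * p ^ 2 * q ^ 7 + 47 * p ^ 3 * q ^ 6 + 7 * p ^ 4 * q ^ 5 - 4
    * p * q ^ 9 - 18 * p ^ 2 * q ^ 8 - 20 * p ^ 3 * q ^ 7 - 6 * p ^ 4 * q ^ 6 + 2 * p ^ 2 * q ^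
    9 + 4 * p ^ 3 * q ^ 8 + 2 * p ^ 4 * q ^ 7) / (q ^ 3 * (1 - p) ^ 2 * (1 - q) ^ 2 * (1 - p -
    q) ^ 3)

noncomputable def twoSeqG2 (p q : F) : F := (1/2 - 3 * q + 15/2 * q ^ 2 - 9 * q ^ 3 + 9/2 * q ^
    4) / (q ^ 2 * (1 - q) ^ 2 * (1 - p - q) ^ 2)

noncomputable def twoSeqG (p q n : F) : F := twoSeqG0 p q + twoSeqG1 p q * n + twoSeqG2 p q * n
    ^ 2

noncomputable def twoSeqP (p q n : F) : F := (2 * q - 4 * p - 3 * q ^ 2 + p * q + 8 * p ^ 2 - q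
    ^ 3 + 8 * p * q ^ 2 - 13 * p ^ 2 * q - 4 * p ^ 3 + 2 * p * q ^ 3 - 2 * p ^ 2 * q ^ 2 + 10 *
    p ^ 3 * q + p ^ 2 * q ^ 3 - 7 * p ^ 3 * q ^ 2 + 2 * p ^ 3 * q ^ 3) / (q ^ 3 * (1 - p) ^ 3) +
    (1 - 3/2 * q - 2 * p + q ^ 2 + 5/2 * p * q + p ^ 2 - p * q ^ 2 - p ^ 2 * q + p ^ 2 * q ^ 2)
    / (q ^ 3 * (1 - p) ^ 3) * n + 1/2 / (q ^ 2 * (1 - p) ^ 2) * n ^ 2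

noncomputable def twoSeq (p q : F) (d : ℤ) : F := twoSeqG p q d * baseG p q ^ d + twoSeqP p q d
    * baseP p q ^ d

/-- The recursion for this difference has the single homogeneous root 1-y, which is not small. Only
the forced part in powers of pq remains, because the forcing in powers of xy/(1-x) cancels. -/
noncomputable def twoDiffG (_p q n : F) : F := (2 - q) * q ^ 3 / (1 - q) ^ 4 + 0 * n + 0 * n ^ 2

noncomputable def twoDiff (p q : F) (d : ℤ) : F := twoDiffG p q d * baseG p q ^ d

noncomputable def twoDiffZeroG (p q n : F) : F := (-1 + 3 * q + 3 * p - 8 * p * q - 3 * p ^ 2 -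
    7 * q ^ 3 - p * q ^ 2 + 7 * p ^ 2 * q + p ^ 3 + 9 * q ^ 4 + 16 * p * q ^ 3 + 3 * p ^ 2 * q ^
    2 - 2 * p ^ 3 * q - 5 * q ^ 5 - 17 * p * q ^ 4 - 13 * p ^ 2 * q ^ 3 - 2 * p ^ 3 * q ^ 2 + q
    ^ 6 + 10 * p * q ^ 5 + 8 * p ^ 2 * q ^ 4 + 5 * p ^ 3 * q ^ 3 - 2 * p * q ^ 6 - 5 * p ^ 2 * q
    ^ 5 - 2 * p ^ 3 * q ^ 4 + p ^ 2 * q ^ 6 + p ^ 3 * q ^ 5) / ((1 - p) ^ 2 * (1 - q) ^ 4 * (1 -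
    p - q)) + (1 - 3 * q + 3 * q ^ 2) * q / ((1 - q) ^ 3 * (1 - p - q)) * n + 0 * n ^ 2

/-- A forcing by powers of xy/(1-x) is divided by 1-y-xy/(1-x) = (1-x-y)/(1-x). This brings in the
denominator 1-x-y = 1-p-q+2pq of the final formula. -/
noncomputable def twoDiffZeroP (p q n : F) : F := (1 + q - p) / (1 - p - q + 2 * p * q) + 0 * n
    + 0 * n ^ 2

noncomputable def twoDiffZero (p q : F) (d : ℤ) : F := twoDiffZeroG p q d * baseG p q ^ d +
    twoDiffZeroP p q d * baseP p q ^ d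

/-- The signs are those of inclusion and exclusion: from all plain pairs remove those without excess
height and those without excess width, and add back those with neither. -/
noncomputable def plainSeqBothG (_p _q n : F) : F := 1 + 0 * n + 0 * n ^ 2

noncomputable def plainSeqBothP (_p _q n : F) : F := -1 + 0 * n + 0 * n ^ 2

noncomputable def plainSeqBothQ (_p _q n : F) : F := -1 + 0 * n + 0 * n ^ 2

noncomputable def plainSeqBothR (_p _q n : F) : F := 1 + 0 * n + 0 * n ^ 2

noncomputable def plainSeqBoth (p q : F) (d : ℤ) : F := plainSeqBothG p q d * baseG p q ^ d +
    plainSeqBothP p q d * baseP p q ^ d + plainSeqBothQ p q d * baseP q p ^ d + plainSeqBothR p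
    q d * baseR p q ^ d

noncomputable def eastSeqG (p q n : F) : F := (-1 + 2 * p + q ^ 2 - 2 * p * q - p ^ 2 - p * q ^
    2 + 2 * p ^ 2 * q - p ^ 2 * q ^ 2) / (q ^ 2 * (1 - p) ^ 2) + (1 - 3 * q + 3 * q ^ 2) / (q *
    (1 - q) * (1 - p - q)) * n + 0 * n ^ 2

noncomputable def eastSeqP (p q n : F) : F := (1 - p * (1 - q)) ^ 2 / (q ^ 2 * (1 - p) ^ 2) + 0
    * n + 0 * n ^ 2

noncomputable def eastSeqQ (p q n : F) : F := (1 + q - p * q) * (1 - q * (1 - p)) / (q ^ 2 * (1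
    - p) ^ 2) + (-1 + 3 * q - 3 * q ^ 2 - 3 * p * q + 6 * p * q ^ 2 - 3 * p ^ 2 * q ^ 2) / (q *
    (1 - p) * (1 - q * (1 - p)) ^ 2) * n + 0 * n ^ 2

noncomputable def eastSeqR (p q n : F) : F := -1 / (q ^ 2 * (1 - p) ^ 2) + 0 * n + 0 * n ^ 2

noncomputable def eastSeq (p q : F) (d : ℤ) : F := eastSeqG p q d * baseG p q ^ d + eastSeqP p q
    d * baseP p q ^ d + eastSeqQ p q d * baseP q p ^ d + eastSeqR p q d * baseR p q ^ d

noncomputable def eastSeqZeroG (p q n : F) : F := (-1 + 2 * q + 2 * p - 6 * p * q - p ^ 2 - 2 *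
    q ^ 3 + 5 * p * q ^ 2 + 4 * p ^ 2 * q - 6 * p ^ 2 * q ^ 2 + p * q ^ 4 + 4 * p ^ 2 * q ^ 3 -
    2 * p ^ 2 * q ^ 4) / (q ^ 2 * (1 - p) ^ 2 * (1 - q) ^ 2) + (1 - 3 * q + 3 * q ^ 2) / (q * (1
    - q) * (1 - p - q)) * n + 0 * n ^ 2

noncomputable def eastSeqZeroP (p q n : F) : F := (1 - p * (1 - q)) ^ 2 / (q ^ 2 * (1 - p) ^ 2)
    + 0 * n + 0 * n ^ 2

noncomputable def eastSeqZeroQ (p q n : F) : F := (1 - 2 * q + 2 * p * q + 2 * q ^ 3 - 6 * p * q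
    ^ 3 + 6 * p ^ 2 * q ^ 3 - 2 * p ^ 3 * q ^ 3) / (q ^ 2 * (1 - p) ^ 2 * (1 - q * (1 - p)) ^ 2)
    + (-1 + 3 * q - 3 * q ^ 2 - 3 * p * q + 6 * p * q ^ 2 - 3 * p ^ 2 * q ^ 2) / (q * (1 - p) *
    (1 - q * (1 - p)) ^ 2) * n + 0 * n ^ 2

noncomputable def eastSeqZeroR (p q n : F) : F := -1 / (q ^ 2 * (1 - p) ^ 2) + 0 * n + 0 * n ^ 2

noncomputable def eastSeqZero (p q : F) (d : ℤ) : F := eastSeqZeroG p q d * baseG p q ^ d +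
    eastSeqZeroP p q d * baseP p q ^ d + eastSeqZeroQ p q d * baseP q p ^ d + eastSeqZeroR p q d
    * baseR p q ^ d

set_option maxHeartbeats 2000000 in
noncomputable def bothSeqG0 (p q : F) : F := (1 - 2 * q - 2 * p - 5 * q ^ 2 + 5 * p * q - 5 * p
    ^ 2 + 20 * q ^ 3 + 20 * p * q ^ 2 + 20 * p ^ 2 * q + 20 * p ^ 3 - 23 * q ^ 4 - 93 * p * q ^
    3 - 72 * p ^ 2 * q ^ 2 - 93 * p ^ 3 * q - 23 * p ^ 4 + 10 * q ^ 5 + 130 * p * q ^ 4 + 209 *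
    p ^ 2 * q ^ 3 + 209 * p ^ 3 * q ^ 2 + 130 * p ^ 4 * q + 10 * p ^ 5 - q ^ 6 - 75 * p * q ^ 5
    - 304 * p ^ 2 * q ^ 4 - 367 * p ^ 3 * q ^ 3 - 304 * p ^ 4 * q ^ 2 - 75 * p ^ 5 * q - p ^ 6 +
    16 * p * q ^ 6 + 202 * p ^ 2 * q ^ 5 + 456 * p ^ 3 * q ^ 4 + 456 * p ^ 4 * q ^ 3 + 202 * p ^
    5 * q ^ 2 + 16 * p ^ 6 * q - p * q ^ 7 - 57 * p ^ 2 * q ^ 6 - 299 * p ^ 3 * q ^ 5 - 498 * p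
    ^ 4 * q ^ 4 - 299 * p ^ 5 * q ^ 3 - 57 * p ^ 6 * q ^ 2 - p ^ 7 * q + 5 * p ^ 2 * q ^ 7 + 94
    * p ^ 3 * q ^ 6 + 302 * p ^ 4 * q ^ 5 + 302 * p ^ 5 * q ^ 4 + 94 * p ^ 6 * q ^ 3 + 5 * p ^ 7
    * q ^ 2 - 10 * p ^ 3 * q ^ 7 - 93 * p ^ 4 * q ^ 6 - 157 * p ^ 5 * q ^ 5 - 93 * p ^ 6 * q ^ 4
    - 10 * p ^ 7 * q ^ 3 + 11 * p ^ 4 * q ^ 7 + 31 * p ^ 5 * q ^ 6 + 31 * p ^ 6 * q ^ 5 + 11 * p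
    ^ 7 * q ^ 4 + p ^ 5 * q ^ 7 + 11 * p ^ 6 * q ^ 6 + p ^ 7 * q ^ 5 - p ^ 5 * q ^ 8 - 7 * p ^ 6
    * q ^ 7 - 7 * p ^ 7 * q ^ 6 - p ^ 8 * q ^ 5 + p ^ 6 * q ^ 8 + 2 * p ^ 7 * q ^ 7 + p ^ 8 * q
    ^ 6) / (p ^ 2 * q ^ 2 * (1 - p) ^ 2 * (1 - q) ^ 2 * (1 - p - q) * (1 - p * (1 - q)) * (1 - q
    * (1 - p)))

noncomputable def bothSeqG1 (p q : F) : F := (-q - p + 7 * q ^ 2 + 8 * p * q + 7 * p ^ 2 - 21 *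
    q ^ 3 - 32 * p * q ^ 2 - 32 * p ^ 2 * q - 21 * p ^ 3 + 34 * q ^ 4 + 80 * p * q ^ 3 + 64 * p
    ^ 2 * q ^ 2 + 80 * p ^ 3 * q + 34 * p ^ 4 - 31 * q ^ 5 - 124 * p * q ^ 4 - 95 * p ^ 2 * q ^
    3 - 95 * p ^ 3 * q ^ 2 - 124 * p ^ 4 * q - 31 * p ^ 5 + 15 * q ^ 6 + 113 * p * q ^ 5 + 130 *
    p ^ 2 * q ^ 4 + 20 * p ^ 3 * q ^ 3 + 130 * p ^ 4 * q ^ 2 + 113 * p ^ 5 * q + 15 * p ^ 6 - 3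
    * q ^ 7 - 55 * p * q ^ 6 - 124 * p ^ 2 * q ^ 5 + 15 * p ^ 3 * q ^ 4 + 15 * p ^ 4 * q ^ 3 -
    124 * p ^ 5 * q ^ 2 - 55 * p ^ 6 * q - 3 * p ^ 7 + 11 * p * q ^ 7 + 61 * p ^ 2 * q ^ 6 + 11
    * p ^ 3 * q ^ 5 - 78 * p ^ 4 * q ^ 4 + 11 * p ^ 5 * q ^ 3 + 61 * p ^ 6 * q ^ 2 + 11 * p ^ 7
    * q - 11 * p ^ 2 * q ^ 7 - 5 * p ^ 3 * q ^ 6 + 20 * p ^ 4 * q ^ 5 + 20 * p ^ 5 * q ^ 4 - 5 *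
    p ^ 6 * q ^ 3 - 11 * p ^ 7 * q ^ 2 - 5 * p ^ 3 * q ^ 7 - 10 * p ^ 4 * q ^ 6 + 38 * p ^ 5 * q
    ^ 5 - 10 * p ^ 6 * q ^ 4 - 5 * p ^ 7 * q ^ 3 + 12 * p ^ 4 * q ^ 7 - 21 * p ^ 5 * q ^ 6 - 21
    * p ^ 6 * q ^ 5 + 12 * p ^ 7 * q ^ 4 - 3 * p ^ 5 * q ^ 7 + 12 * p ^ 6 * q ^ 6 - 3 * p ^ 7 *
    q ^ 5) / (p ^ 2 * q ^ 2 * (1 - p) ^ 3 * (1 - q) ^ 3 * (1 - p - q) ^ 3)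

noncomputable def bothSeqG2 (p q : F) : F := (1 - 3 * q - 3 * p + 3 * q ^ 2 + 9 * p * q + 3 * p
    ^ 2 - 9 * p * q ^ 2 - 9 * p ^ 2 * q + 9 * p ^ 2 * q ^ 2) / (p * q * (1 - p) * (1 - q) * (1 -
    p - q) ^ 2)

noncomputable def bothSeqG (p q n : F) : F := bothSeqG0 p q + bothSeqG1 p q * n + bothSeqG2 p q
    * n ^ 2

noncomputable def bothSeqQ (p q n : F) : F := (-1 + 6 * q ^ 2 - 8 * q ^ 3 - 12 * p * q ^ 2 + q ^
    4 + 24 * p * q ^ 3 + 6 * p ^ 2 * q ^ 2 - 4 * p * q ^ 4 - 24 * p ^ 2 * q ^ 3 + 6 * p ^ 2 * q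
    ^ 4 + 8 * p ^ 3 * q ^ 3 - 4 * p ^ 3 * q ^ 4 + p ^ 4 * q ^ 4) / (p ^ 2 * q ^ 2 * (1 - p) ^ 2
    * (1 - q) ^ 2) + (1 - 3 * q + 3 * q ^ 2 + 3 * p * q - 6 * p * q ^ 2 + 3 * p ^ 2 * q ^ 2) /
    (p ^ 2 * q * (1 - p) * (1 - q) ^ 2) * n + 0 * n ^ 2

noncomputable def bothSeqP (p q n : F) : F := (-1 + 6 * p ^ 2 - 12 * p ^ 2 * q - 8 * p ^ 3 + 6 *
    p ^ 2 * q ^ 2 + 24 * p ^ 3 * q + p ^ 4 - 24 * p ^ 3 * q ^ 2 - 4 * p ^ 4 * q + 8 * p ^ 3 * q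
    ^ 3 + 6 * p ^ 4 * q ^ 2 - 4 * p ^ 4 * q ^ 3 + p ^ 4 * q ^ 4) / (p ^ 2 * q ^ 2 * (1 - p) ^ 2
    * (1 - q) ^ 2) + (1 - 3 * p + 3 * p * q + 3 * p ^ 2 - 6 * p ^ 2 * q + 3 * p ^ 2 * q ^ 2) /
    (p * q ^ 2 * (1 - p) ^ 2 * (1 - q)) * n + 0 * n ^ 2

noncomputable def bothSeqR (p q n : F) : F := 1 / (p ^ 2 * q ^ 2 * (1 - p) ^ 2 * (1 - q) ^ 2) +
    0 * n + 0 * n ^ 2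

noncomputable def bothSeq (p q : F) (d : ℤ) : F := bothSeqG p q d * baseG p q ^ d + bothSeqQ p q
    d * baseP q p ^ d + bothSeqP p q d * baseP p q ^ d + bothSeqR p q d * baseR p q ^ d

noncomputable def bothDiffG (p q n : F) : F := (-1 + 4 * q + 3 * p - 6 * q ^ 2 - 11 * p * q - 3
    * p ^ 2 + 4 * q ^ 3 + 16 * p * q ^ 2 + 10 * p ^ 2 * q + p ^ 3 + q ^ 4 - 11 * p * q ^ 3 - 13
    * p ^ 2 * q ^ 2 - 3 * p ^ 3 * q - p * q ^ 4 + 9 * p ^ 2 * q ^ 3 + 3 * p ^ 3 * q ^ 2 - p ^ 2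
    * q ^ 4 - p ^ 3 * q ^ 3) * p ^ 2 / (q ^ 2 * (1 - p) ^ 4 * (1 - q) * (1 - p - q)) + (1 - 3 *
    q + 3 * q ^ 2) * p ^ 2 / (q * (1 - p) ^ 2 * (1 - q) * (1 - p - q)) * n + 0 * n ^ 2

noncomputable def bothDiffP (p q n : F) : F := p ^ 2 * (1 - q) ^ 2 / (q ^ 2 * (1 - p) ^ 2) + 0 *
    n + 0 * n ^ 2

noncomputable def bothDiff (p q : F) (d : ℤ) : F := bothDiffG p q d * baseG p q ^ d + bothDiffP
    p q d * baseP p q ^ d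

noncomputable def bothDiffDiffG (p q n : F) : F := p ^ 2 * q ^ 2 / ((1 - p) ^ 2 * (1 - q) ^ 2) +
    0 * n + 0 * n ^ 2

noncomputable def bothDiffDiff (p q : F) (d : ℤ) : F := bothDiffDiffG p q d * baseG p q ^ d

/-- Since pq is a characteristic root, the constant coefficient leaves no defect, and the others
leave one with leading factor 1-p-q, the derivative of the characteristic polynomial up to
normalisation. Solving a resonant forcing therefore divides by the square root of Δ. -/
theorem quad_baseG (h : Generic p q) (c₀ c₁ c₂ n : F) : c₀ + c₁ * n + c₂ * n ^ 2 =
    p * (1 - q) * (q * (1 - p)) * ((c₀ + c₁ * (n - 1) + c₂ * (n - 1) ^ 2) / baseG p q) +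
    p * (1 - q) * (c₀ + c₁ * n + c₂ * n ^ 2) + q * (1 - p) * (c₀ + c₁ * n + c₂ * n ^ 2) +
    (c₀ + c₁ * (n + 1) + c₂ * (n + 1) ^ 2) * baseG p q +
    ((1 - p - q) * c₁ - (1 - p * (1 - q) - q * (1 - p)) * c₂ + 2 * (1 - p - q) * c₂ * n) := by
  obtain ⟨h₁, h₂, h₃, h₄, h₅, h₆, h₇, h₈⟩ := id h
  simp only [baseG]
  field_simp
  ring

/-- The recursion is checked separately for the coefficient of each base, as an identity of rational
functions with the index as a free variable; the results are then combined with the powers as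
weights. All the following verifications have this form. -/
theorem plainSeq_eq (h : Generic p q) (d : ℤ) : plainSeq p q d = (p * (1 - q)) * (q * (1 - p)) *
    plainSeq p q (d - 1) + (p * (1 - q)) * plainSeq p q d + (q * (1 - p)) * plainSeq p q d +
    plainSeq p q (d + 1) := by
  obtain ⟨h₁, h₂, h₃, h₄, h₅, h₆, h₇, h₈⟩ := id h
  have hG (n : F) : plainSeqG p q n = (p * (1 - q)) * (q * (1 - p)) * (plainSeqG p q (n - 1) /
      baseG p q) + (p * (1 - q)) * (plainSeqG p q n) + (q * (1 - p)) * (plainSeqG p q n) +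
      (plainSeqG p q (n + 1) * baseG p q) := by
    simp only [plainSeqG, baseG]
    field_simp
    ring
  simp only [plainSeq, Int.cast_add, Int.cast_sub, Int.cast_one, zpow_add₀ h.baseG_ne, zpow_sub₀
    h.baseG_ne, zpow_ofNat]
  linear_combination baseG p q ^ d * hG d

theorem plainSeqOne_eq (h : Generic p q) (d : ℤ) : plainSeqOne p q d = (p * (1 - q)) * (q * (1 -
    p)) * plainSeqOne p q (d - 1) + (p * (1 - q)) * plainSeqOne p q d + (q * (1 - p)) * plainSeq
    p q d + plainSeq p q (d + 1) := by
  obtain ⟨h₁, h₂, h₃, h₄, h₅, h₆, h₇, h₈⟩ := id h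
  have hG (n : F) : plainSeqOneG p q n = (p * (1 - q)) * (q * (1 - p)) * (plainSeqOneG p q (n -
      1) / baseG p q) + (p * (1 - q)) * (plainSeqOneG p q n) + (q * (1 - p)) * (plainSeqG p q n)
      + (plainSeqG p q (n + 1) * baseG p q) := by
    simp only [plainSeqOneG, plainSeqG, baseG]
    field_simp
    ring
  have hP (n : F) : plainSeqOneP p q n = (p * (1 - q)) * (q * (1 - p)) * (plainSeqOneP p q (n -
      1) / baseP p q) + (p * (1 - q)) * (plainSeqOneP p q n) := by
    simp only [plainSeqOneP, baseP]
    field_simp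
    ring
  simp only [plainSeqOne, plainSeq, Int.cast_add, Int.cast_sub, Int.cast_one, zpow_add₀ h.baseG_ne,
    zpow_sub₀ h.baseG_ne, zpow_sub₀ h.baseP_ne, zpow_ofNat]
  linear_combination baseG p q ^ d * hG d + baseP p q ^ d * hP d

theorem plainSeqTwo_eq (h : Generic p q) (d : ℤ) : plainSeqTwo p q d = (p * (1 - q)) * (q * (1 -
    p)) * plainSeqTwo p q (d - 1) + (p * (1 - q)) * plainSeqTwo p q d + (q * (1 - p)) *
    plainSeqOne p q d + plainSeqOne p q (d + 1) := by
  obtain ⟨h₁, h₂, h₃, h₄, h₅, h₆, h₇, h₈⟩ := id h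
  have hG (n : F) : plainSeqTwoG p q n = (p * (1 - q)) * (q * (1 - p)) * (plainSeqTwoG p q (n -
      1) / baseG p q) + (p * (1 - q)) * (plainSeqTwoG p q n) + (q * (1 - p)) * (plainSeqOneG p q
      n) + (plainSeqOneG p q (n + 1) * baseG p q) := by
    simp only [plainSeqTwoG, plainSeqOneG, baseG]
    field_simp
    ring
  have hP (n : F) : plainSeqTwoP p q n = (p * (1 - q)) * (q * (1 - p)) * (plainSeqTwoP p q (n -
      1) / baseP p q) + (p * (1 - q)) * (plainSeqTwoP p q n) + (q * (1 - p)) * (plainSeqOneP p q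
      n) + (plainSeqOneP p q (n + 1) * baseP p q) := by
    simp only [plainSeqTwoP, plainSeqOneP, baseP]
    field_simp
    ring
  simp only [plainSeqTwo, plainSeqOne, Int.cast_add, Int.cast_sub, Int.cast_one, zpow_add₀
    h.baseG_ne, zpow_sub₀ h.baseG_ne, zpow_add₀ h.baseP_ne, zpow_sub₀ h.baseP_ne, zpow_ofNat]
  linear_combination baseG p q ^ d * hG d + baseP p q ^ d * hP d

theorem westSeq_eq (h : Generic p q) (d : ℤ) : westSeq p q d = (p * (1 - q)) * (q * (1 - p)) *
    westSeq p q (d - 1) + (p * (1 - q)) * westSeq p q d + (q * (1 - p)) * westSeq p q d +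
    westSeq p q (d + 1) + (p * (1 - q)) ^ 2 * (q * (1 - p)) * plainSeqOne p q (d - 2) + (p * (1
    - q)) ^ 2 * plainSeqOne p q (d - 1) + 1 / (p * (1 - q)) * (q * (1 - p)) * plainSeq p q (d +
    1) + 1 / (p * (1 - q)) * plainSeq p q (d + 2) := by
  obtain ⟨h₁, h₂, h₃, h₄, h₅, h₆, h₇, h₈⟩ := id h
  have hG (n : F) : westSeqG p q n = (p * (1 - q)) * (q * (1 - p)) * (westSeqG p q (n - 1) /
      baseG p q) + (p * (1 - q)) * (westSeqG p q n) + (q * (1 - p)) * (westSeqG p q n) +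
      (westSeqG p q (n + 1) * baseG p q) + (p * (1 - q)) ^ 2 * (q * (1 - p)) * (plainSeqOneG p q
      (n - 2) / baseG p q ^ 2) + (p * (1 - q)) ^ 2 * (plainSeqOneG p q (n - 1) / baseG p q) + 1
      / (p * (1 - q)) * (q * (1 - p)) * (plainSeqG p q (n + 1) * baseG p q) + 1 / (p * (1 - q))
      * (plainSeqG p q (n + 2) * baseG p q ^ 2) := by
    simp only [westSeqG, plainSeqOneG, plainSeqG, baseG]
    field_simp
    ring
  have hP (n : F) : westSeqP p q n = (p * (1 - q)) * (q * (1 - p)) * (westSeqP p q (n - 1) /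
      baseP p q) + (p * (1 - q)) * (westSeqP p q n) + (q * (1 - p)) * (westSeqP p q n) +
      (westSeqP p q (n + 1) * baseP p q) + (p * (1 - q)) ^ 2 * (q * (1 - p)) * (plainSeqOneP p q
      (n - 2) / baseP p q ^ 2) + (p * (1 - q)) ^ 2 * (plainSeqOneP p q (n - 1) / baseP p q) :=
      by
    simp only [westSeqP, plainSeqOneP, baseP]
    field_simp
    ring
  simp only [westSeq, plainSeqOne, plainSeq, Int.cast_add, Int.cast_sub, Int.cast_ofNat,
    Int.cast_one, zpow_add₀ h.baseG_ne, zpow_sub₀ h.baseG_ne, zpow_add₀ h.baseP_ne, zpow_sub₀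
    h.baseP_ne, zpow_ofNat]
  linear_combination baseG p q ^ d * hG d + baseP p q ^ d * hP d

theorem westSeqOne_eq (h : Generic p q) (d : ℤ) : westSeqOne p q d = (p * (1 - q)) * (q * (1 -
    p)) * westSeqOne p q (d - 1) + (p * (1 - q)) * westSeqOne p q d + (q * (1 - p)) * westSeq p
    q d + westSeq p q (d + 1) + (p * (1 - q)) ^ 2 * (q * (1 - p)) * plainSeqTwo p q (d - 2) + (p
    * (1 - q)) ^ 2 * plainSeqTwo p q (d - 1) + 1 / (p * (1 - q)) * (q * (1 - p)) * plainSeq p q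
    (d + 1) + 1 / (p * (1 - q)) * plainSeq p q (d + 2) := by
  obtain ⟨h₁, h₂, h₃, h₄, h₅, h₆, h₇, h₈⟩ := id h
  have hG (n : F) : westSeqOneG p q n = (p * (1 - q)) * (q * (1 - p)) * (westSeqOneG p q (n - 1)
      / baseG p q) + (p * (1 - q)) * (westSeqOneG p q n) + (q * (1 - p)) * (westSeqG p q n) +
      (westSeqG p q (n + 1) * baseG p q) + (p * (1 - q)) ^ 2 * (q * (1 - p)) * (plainSeqTwoG p q
      (n - 2) / baseG p q ^ 2) + (p * (1 - q)) ^ 2 * (plainSeqTwoG p q (n - 1) / baseG p q) + 1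
      / (p * (1 - q)) * (q * (1 - p)) * (plainSeqG p q (n + 1) * baseG p q) + 1 / (p * (1 - q))
      * (plainSeqG p q (n + 2) * baseG p q ^ 2) := by
    simp only [westSeqOneG, westSeqG, plainSeqTwoG, plainSeqG, baseG]
    field_simp
    ring
  have hP (n : F) : westSeqOneP p q n = (p * (1 - q)) * (q * (1 - p)) * (westSeqOneP p q (n - 1)
      / baseP p q) + (p * (1 - q)) * (westSeqOneP p q n) + (q * (1 - p)) * (westSeqP p q n) +
      (westSeqP p q (n + 1) * baseP p q) + (p * (1 - q)) ^ 2 * (q * (1 - p)) * (plainSeqTwoP p q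
      (n - 2) / baseP p q ^ 2) + (p * (1 - q)) ^ 2 * (plainSeqTwoP p q (n - 1) / baseP p q) :=
      by
    simp only [westSeqOneP, westSeqP, plainSeqTwoP, baseP]
    field_simp
    ring
  simp only [westSeqOne, westSeq, plainSeqTwo, plainSeq, Int.cast_add, Int.cast_sub, Int.cast_ofNat,
    Int.cast_one, zpow_add₀ h.baseG_ne, zpow_sub₀ h.baseG_ne, zpow_add₀ h.baseP_ne, zpow_sub₀
    h.baseP_ne, zpow_ofNat]
  linear_combination baseG p q ^ d * hG d + baseP p q ^ d * hP d

theorem westSeqNeg_eq (h : Generic p q) (d : ℤ) : westSeqNeg p q d = (p * (1 - q)) * (q * (1 -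
    p)) * westSeqOne p q (d - 1) + (p * (1 - q)) * westSeqOne p q d + (q * (1 - p)) * westSeq p
    q d + westSeq p q (d + 1) + (p * (1 - q)) ^ 2 * (q * (1 - p)) * plainSeqTwo p q (d - 2) + (p
    * (1 - q)) ^ 2 * plainSeqTwo p q (d - 1) := by
  obtain ⟨h₁, h₂, h₃, h₄, h₅, h₆, h₇, h₈⟩ := id h
  have hG (n : F) : westSeqNegG p q n = (p * (1 - q)) * (q * (1 - p)) * (westSeqOneG p q (n - 1)
      / baseG p q) + (p * (1 - q)) * (westSeqOneG p q n) + (q * (1 - p)) * (westSeqG p q n) +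
      (westSeqG p q (n + 1) * baseG p q) + (p * (1 - q)) ^ 2 * (q * (1 - p)) * (plainSeqTwoG p q
      (n - 2) / baseG p q ^ 2) + (p * (1 - q)) ^ 2 * (plainSeqTwoG p q (n - 1) / baseG p q) :=
      by
    simp only [westSeqNegG, westSeqOneG, westSeqG, plainSeqTwoG, baseG]
    field_simp
    ring
  have hP (n : F) : westSeqNegP p q n = (p * (1 - q)) * (q * (1 - p)) * (westSeqOneP p q (n - 1)
      / baseP p q) + (p * (1 - q)) * (westSeqOneP p q n) + (q * (1 - p)) * (westSeqP p q n) +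
      (westSeqP p q (n + 1) * baseP p q) + (p * (1 - q)) ^ 2 * (q * (1 - p)) * (plainSeqTwoP p q
      (n - 2) / baseP p q ^ 2) + (p * (1 - q)) ^ 2 * (plainSeqTwoP p q (n - 1) / baseP p q) :=
      by
    simp only [westSeqNegP, westSeqOneP, westSeqP, plainSeqTwoP, baseP]
    field_simp
    ring
  simp only [westSeqNeg, westSeqOne, westSeq, plainSeqTwo, Int.cast_add, Int.cast_sub,
    Int.cast_ofNat, Int.cast_one, zpow_add₀ h.baseG_ne, zpow_sub₀ h.baseG_ne, zpow_add₀ h.baseP_ne,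
    zpow_sub₀ h.baseP_ne, zpow_ofNat]
  linear_combination baseG p q ^ d * hG d + baseP p q ^ d * hP d

theorem westSeqZero_eq (h : Generic p q) (d : ℤ) : westSeqZero p q d = (p * (1 - q)) * (q * (1 -
    p)) * westSeq p q (d - 1) + (p * (1 - q)) * westSeq p q d + (q * (1 - p)) * westSeqZero p q
    d + westSeqZero p q (d + 1) + (p * (1 - q)) ^ 2 * (q * (1 - p)) * plainSeqOne p q (d - 2) +
    (p * (1 - q)) ^ 2 * plainSeqOne p q (d - 1) := by
  obtain ⟨h₁, h₂, h₃, h₄, h₅, h₆, h₇, h₈⟩ := id h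
  have hG (n : F) : westSeqZeroG p q n = (p * (1 - q)) * (q * (1 - p)) * (westSeqG p q (n - 1) /
      baseG p q) + (p * (1 - q)) * (westSeqG p q n) + (q * (1 - p)) * (westSeqZeroG p q n) +
      (westSeqZeroG p q (n + 1) * baseG p q) + (p * (1 - q)) ^ 2 * (q * (1 - p)) * (plainSeqOneG
      p q (n - 2) / baseG p q ^ 2) + (p * (1 - q)) ^ 2 * (plainSeqOneG p q (n - 1) / baseG p q)
      := by
    simp only [westSeqZeroG, westSeqG, plainSeqOneG, baseG]
    field_simp
    ring
  have hP (n : F) : westSeqZeroP p q n = (p * (1 - q)) * (q * (1 - p)) * (westSeqP p q (n - 1) /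
      baseP p q) + (p * (1 - q)) * (westSeqP p q n) + (q * (1 - p)) * (westSeqZeroP p q n) +
      (westSeqZeroP p q (n + 1) * baseP p q) + (p * (1 - q)) ^ 2 * (q * (1 - p)) * (plainSeqOneP
      p q (n - 2) / baseP p q ^ 2) + (p * (1 - q)) ^ 2 * (plainSeqOneP p q (n - 1) / baseP p q)
      := by
    simp only [westSeqZeroP, westSeqP, plainSeqOneP, baseP]
    field_simp
    ring
  simp only [westSeqZero, westSeq, plainSeqOne, Int.cast_add, Int.cast_sub, Int.cast_ofNat,
    Int.cast_one, zpow_add₀ h.baseG_ne, zpow_sub₀ h.baseG_ne, zpow_add₀ h.baseP_ne, zpow_sub₀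
    h.baseP_ne, zpow_ofNat]
  linear_combination baseG p q ^ d * hG d + baseP p q ^ d * hP d

theorem westSeqPos_eq (h : Generic p q) (d : ℤ) : westSeqPos p q d = (p * (1 - q)) * (q * (1 -
    p)) * westSeq p q (d - 1) + (p * (1 - q)) * westSeq p q d + (q * (1 - p)) * westSeq p q d +
    westSeq p q (d + 1) + 1 / (p * (1 - q)) * (q * (1 - p)) * plainSeq p q (d + 1) + 1 / (p * (1
    - q)) * plainSeq p q (d + 2) := by
  obtain ⟨h₁, h₂, h₃, h₄, h₅, h₆, h₇, h₈⟩ := id h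
  have hG (n : F) : westSeqPosG p q n = (p * (1 - q)) * (q * (1 - p)) * (westSeqG p q (n - 1) /
      baseG p q) + (p * (1 - q)) * (westSeqG p q n) + (q * (1 - p)) * (westSeqG p q n) +
      (westSeqG p q (n + 1) * baseG p q) + 1 / (p * (1 - q)) * (q * (1 - p)) * (plainSeqG p q (n
      + 1) * baseG p q) + 1 / (p * (1 - q)) * (plainSeqG p q (n + 2) * baseG p q ^ 2) := by
    simp only [westSeqPosG, westSeqG, plainSeqG, baseG]
    field_simp
    ring
  have hP (n : F) : westSeqPosP p q n = (p * (1 - q)) * (q * (1 - p)) * (westSeqP p q (n - 1) /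
      baseP p q) + (p * (1 - q)) * (westSeqP p q n) + (q * (1 - p)) * (westSeqP p q n) +
      (westSeqP p q (n + 1) * baseP p q) := by
    simp only [westSeqPosP, westSeqP, baseP]
    field_simp
    ring
  simp only [westSeqPos, westSeq, plainSeq, Int.cast_add, Int.cast_sub, Int.cast_ofNat,
    Int.cast_one, zpow_add₀ h.baseG_ne, zpow_sub₀ h.baseG_ne, zpow_add₀ h.baseP_ne, zpow_sub₀
    h.baseP_ne, zpow_ofNat]
  linear_combination baseG p q ^ d * hG d + baseP p q ^ d * hP d

theorem westSeqPosZero_eq (h : Generic p q) (d : ℤ) : westSeqPosZero p q d = (p * (1 - q)) * (q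
    * (1 - p)) * westSeq p q (d - 1) + (p * (1 - q)) * westSeq p q d + (q * (1 - p)) *
    westSeqZero p q d + westSeqZero p q (d + 1) := by
  obtain ⟨h₁, h₂, h₃, h₄, h₅, h₆, h₇, h₈⟩ := id h
  have hG (n : F) : westSeqPosZeroG p q n = (p * (1 - q)) * (q * (1 - p)) * (westSeqG p q (n -
      1) / baseG p q) + (p * (1 - q)) * (westSeqG p q n) + (q * (1 - p)) * (westSeqZeroG p q n)
      + (westSeqZeroG p q (n + 1) * baseG p q) := by
    simp only [westSeqPosZeroG, westSeqG, westSeqZeroG, baseG]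
    field_simp
    ring
  have hP (n : F) : westSeqPosZeroP p q n = (p * (1 - q)) * (q * (1 - p)) * (westSeqP p q (n -
      1) / baseP p q) + (p * (1 - q)) * (westSeqP p q n) + (q * (1 - p)) * (westSeqZeroP p q n)
      + (westSeqZeroP p q (n + 1) * baseP p q) := by
    simp only [westSeqPosZeroP, westSeqP, westSeqZeroP, baseP]
    field_simp
    ring
  simp only [westSeqPosZero, westSeq, westSeqZero, Int.cast_add, Int.cast_sub, Int.cast_one,
    zpow_add₀ h.baseG_ne, zpow_sub₀ h.baseG_ne, zpow_add₀ h.baseP_ne, zpow_sub₀ h.baseP_ne,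
    zpow_ofNat]
  linear_combination baseG p q ^ d * hG d + baseP p q ^ d * hP d

theorem twoSeq_eq (h : Generic p q) (d : ℤ) : twoSeq p q d = (p * (1 - q)) * (q * (1 - p)) *
    twoSeq p q (d - 1) + (p * (1 - q)) * twoSeq p q d + (q * (1 - p)) * twoSeq p q d + twoSeq p
    q (d + 1) + (p * (1 - q)) ^ 2 * (q * (1 - p)) * westSeqNeg p q (d - 2) + (p * (1 - q)) ^ 2 *
    westSeqNeg p q (d - 1) + 1 / (p * (1 - q)) * (q * (1 - p)) * westSeqPos p q (d + 1) + 1 / (p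
    * (1 - q)) * westSeqPos p q (d + 2) + 2 * (p * (1 - q)) ^ 3 * (q * (1 - p)) * plainSeqTwo p
    q (d - 3) + 2 * (p * (1 - q)) ^ 3 * plainSeqTwo p q (d - 2) + 2 / (p * (1 - q)) ^ 2 * (q *
    (1 - p)) * plainSeq p q (d + 2) + 2 / (p * (1 - q)) ^ 2 * plainSeq p q (d + 3) + (p * (1 -
    q)) ^ 2 * (q * (1 - p)) * plainSeqTwo p q (d - 2) + (p * (1 - q)) ^ 2 * plainSeqTwo p q (d -
    1) + 1 / (p * (1 - q)) * (q * (1 - p)) * plainSeq p q (d + 1) + 1 / (p * (1 - q)) * plainSeq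
    p q (d + 2) := by
  obtain ⟨h₁, h₂, h₃, h₄, h₅, h₆, h₇, h₈⟩ := id h
  -- The forcing in powers of pq has to match the defect of the quadratic coefficient; the large
  -- constant term does not enter.
  have e (n : F) : (1 - p - q) * twoSeqG1 p q - (1 - p * (1 - q) - q * (1 - p)) * twoSeqG2 p q +
      2 * (1 - p - q) * twoSeqG2 p q * n = (p * (1 - q)) ^ 2 * (q * (1 - p)) * (westSeqNegG p q
      (n - 2) / baseG p q ^ 2) + (p * (1 - q)) ^ 2 * (westSeqNegG p q (n - 1) / baseG p q) + 1 /
      (p * (1 - q)) * (q * (1 - p)) * (westSeqPosG p q (n + 1) * baseG p q) + 1 / (p * (1 - q))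
      * (westSeqPosG p q (n + 2) * baseG p q ^ 2) + 2 * (p * (1 - q)) ^ 3 * (q * (1 - p)) *
      (plainSeqTwoG p q (n - 3) / baseG p q ^ 3) + 2 * (p * (1 - q)) ^ 3 * (plainSeqTwoG p q (n
      - 2) / baseG p q ^ 2) + 2 / (p * (1 - q)) ^ 2 * (q * (1 - p)) * (plainSeqG p q (n + 2) *
      baseG p q ^ 2) + 2 / (p * (1 - q)) ^ 2 * (plainSeqG p q (n + 3) * baseG p q ^ 3) + (p * (1
      - q)) ^ 2 * (q * (1 - p)) * (plainSeqTwoG p q (n - 2) / baseG p q ^ 2) + (p * (1 - q)) ^ 2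
      * (plainSeqTwoG p q (n - 1) / baseG p q) + 1 / (p * (1 - q)) * (q * (1 - p)) * (plainSeqG
      p q (n + 1) * baseG p q) + 1 / (p * (1 - q)) * (plainSeqG p q (n + 2) * baseG p q ^ 2) :=
      by
    simp only [twoSeqG1, twoSeqG2, westSeqNegG, westSeqPosG, plainSeqTwoG, plainSeqG, baseG]
    field_simp
    ring
  have hG (n : F) : twoSeqG p q n = (p * (1 - q)) * (q * (1 - p)) * (twoSeqG p q (n - 1) / baseG
      p q) + (p * (1 - q)) * (twoSeqG p q n) + (q * (1 - p)) * (twoSeqG p q n) + (twoSeqG p q (n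
      + 1) * baseG p q) + (p * (1 - q)) ^ 2 * (q * (1 - p)) * (westSeqNegG p q (n - 2) / baseG p
      q ^ 2) + (p * (1 - q)) ^ 2 * (westSeqNegG p q (n - 1) / baseG p q) + 1 / (p * (1 - q)) *
      (q * (1 - p)) * (westSeqPosG p q (n + 1) * baseG p q) + 1 / (p * (1 - q)) * (westSeqPosG p
      q (n + 2) * baseG p q ^ 2) + 2 * (p * (1 - q)) ^ 3 * (q * (1 - p)) * (plainSeqTwoG p q (n
      - 3) / baseG p q ^ 3) + 2 * (p * (1 - q)) ^ 3 * (plainSeqTwoG p q (n - 2) / baseG p q ^ 2)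
      + 2 / (p * (1 - q)) ^ 2 * (q * (1 - p)) * (plainSeqG p q (n + 2) * baseG p q ^ 2) + 2 / (p
      * (1 - q)) ^ 2 * (plainSeqG p q (n + 3) * baseG p q ^ 3) + (p * (1 - q)) ^ 2 * (q * (1 -
      p)) * (plainSeqTwoG p q (n - 2) / baseG p q ^ 2) + (p * (1 - q)) ^ 2 * (plainSeqTwoG p q
      (n - 1) / baseG p q) + 1 / (p * (1 - q)) * (q * (1 - p)) * (plainSeqG p q (n + 1) * baseG
      p q) + 1 / (p * (1 - q)) * (plainSeqG p q (n + 2) * baseG p q ^ 2) := by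
    simp only [twoSeqG]
    linear_combination quad_baseG h (twoSeqG0 p q) (twoSeqG1 p q) (twoSeqG2 p q) n +
      e n
  have hP (n : F) : twoSeqP p q n = (p * (1 - q)) * (q * (1 - p)) * (twoSeqP p q (n - 1) / baseP
      p q) + (p * (1 - q)) * (twoSeqP p q n) + (q * (1 - p)) * (twoSeqP p q n) + (twoSeqP p q (n
      + 1) * baseP p q) + (p * (1 - q)) ^ 2 * (q * (1 - p)) * (westSeqNegP p q (n - 2) / baseP p
      q ^ 2) + (p * (1 - q)) ^ 2 * (westSeqNegP p q (n - 1) / baseP p q) + 1 / (p * (1 - q)) *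
      (q * (1 - p)) * (westSeqPosP p q (n + 1) * baseP p q) + 1 / (p * (1 - q)) * (westSeqPosP p
      q (n + 2) * baseP p q ^ 2) + 2 * (p * (1 - q)) ^ 3 * (q * (1 - p)) * (plainSeqTwoP p q (n
      - 3) / baseP p q ^ 3) + 2 * (p * (1 - q)) ^ 3 * (plainSeqTwoP p q (n - 2) / baseP p q ^ 2)
      + (p * (1 - q)) ^ 2 * (q * (1 - p)) * (plainSeqTwoP p q (n - 2) / baseP p q ^ 2) + (p * (1
      - q)) ^ 2 * (plainSeqTwoP p q (n - 1) / baseP p q) := by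
    simp only [twoSeqP, westSeqNegP, westSeqPosP, plainSeqTwoP, baseP]
    field_simp
    ring
  simp only [twoSeq, westSeqNeg, westSeqPos, plainSeqTwo, plainSeq, Int.cast_add, Int.cast_sub,
    Int.cast_ofNat, Int.cast_one, zpow_add₀ h.baseG_ne, zpow_sub₀ h.baseG_ne, zpow_add₀ h.baseP_ne,
    zpow_sub₀ h.baseP_ne, zpow_ofNat]
  linear_combination baseG p q ^ d * hG d + baseP p q ^ d * hP d

theorem twoDiff_eq (h : Generic p q) (d : ℤ) : twoDiff p q d = (q * (1 - p)) * twoDiff p q d +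
    twoDiff p q (d + 1) + 1 / (p * (1 - q)) * (q * (1 - p)) * westSeqPos p q (d + 1) + 1 / (p *
    (1 - q)) * westSeqPos p q (d + 2) + -1 / (p * (1 - q)) * (q * (1 - p)) * westSeqPosZero p q
    (d + 1) + -1 / (p * (1 - q)) * westSeqPosZero p q (d + 2) + 2 / (p * (1 - q)) ^ 2 * (q * (1
    - p)) * plainSeq p q (d + 2) + 2 / (p * (1 - q)) ^ 2 * plainSeq p q (d + 3) := by
  obtain ⟨h₁, h₂, h₃, h₄, h₅, h₆, h₇, h₈⟩ := id h
  have hG (n : F) : twoDiffG p q n = (q * (1 - p)) * (twoDiffG p q n) + (twoDiffG p q (n + 1) *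
      baseG p q) + 1 / (p * (1 - q)) * (q * (1 - p)) * (westSeqPosG p q (n + 1) * baseG p q) + 1
      / (p * (1 - q)) * (westSeqPosG p q (n + 2) * baseG p q ^ 2) + -1 / (p * (1 - q)) * (q * (1
      - p)) * (westSeqPosZeroG p q (n + 1) * baseG p q) + -1 / (p * (1 - q)) * (westSeqPosZeroG
      p q (n + 2) * baseG p q ^ 2) + 2 / (p * (1 - q)) ^ 2 * (q * (1 - p)) * (plainSeqG p q (n +
      2) * baseG p q ^ 2) + 2 / (p * (1 - q)) ^ 2 * (plainSeqG p q (n + 3) * baseG p q ^ 3) :=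
      by
    simp only [twoDiffG, westSeqPosG, westSeqPosZeroG, plainSeqG, baseG]
    field_simp
    ring
  have hP (n : F) : 0 = 1 / (p * (1 - q)) * (q * (1 - p)) * (westSeqPosP p q (n + 1) * baseP p
      q) + 1 / (p * (1 - q)) * (westSeqPosP p q (n + 2) * baseP p q ^ 2) + -1 / (p * (1 - q)) *
      (q * (1 - p)) * (westSeqPosZeroP p q (n + 1) * baseP p q) + -1 / (p * (1 - q)) *
      (westSeqPosZeroP p q (n + 2) * baseP p q ^ 2) := by
    simp only [westSeqPosP, westSeqPosZeroP, baseP]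
    field_simp
    ring
  simp only [twoDiff, westSeqPos, westSeqPosZero, plainSeq, Int.cast_add, Int.cast_ofNat,
    Int.cast_one, zpow_add₀ h.baseG_ne, zpow_add₀ h.baseP_ne, zpow_ofNat]
  linear_combination baseG p q ^ d * hG d + baseP p q ^ d * hP d

theorem twoDiffZero_eq (h : Generic p q) (d : ℤ) : twoDiffZero p q d = (p * (1 - q)) * (q * (1 -
    p)) * twoDiff p q (d - 1) + (p * (1 - q)) * twoDiff p q d + (q * (1 - p)) * twoDiffZero p q
    d + twoDiffZero p q (d + 1) + 1 / (p * (1 - q)) * (q * (1 - p)) * westSeqPosZero p q (d + 1)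
    + 1 / (p * (1 - q)) * westSeqPosZero p q (d + 2) + 1 / (p * (1 - q)) * (q * (1 - p)) *
    plainSeq p q (d + 1) + 1 / (p * (1 - q)) * plainSeq p q (d + 2) := by
  obtain ⟨h₁, h₂, h₃, h₄, h₅, h₆, h₇, h₈⟩ := id h
  have hG (n : F) : twoDiffZeroG p q n = (p * (1 - q)) * (q * (1 - p)) * (twoDiffG p q (n - 1) /
      baseG p q) + (p * (1 - q)) * (twoDiffG p q n) + (q * (1 - p)) * (twoDiffZeroG p q n) +
      (twoDiffZeroG p q (n + 1) * baseG p q) + 1 / (p * (1 - q)) * (q * (1 - p)) *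
      (westSeqPosZeroG p q (n + 1) * baseG p q) + 1 / (p * (1 - q)) * (westSeqPosZeroG p q (n +
      2) * baseG p q ^ 2) + 1 / (p * (1 - q)) * (q * (1 - p)) * (plainSeqG p q (n + 1) * baseG p
      q) + 1 / (p * (1 - q)) * (plainSeqG p q (n + 2) * baseG p q ^ 2) := by
    simp only [twoDiffZeroG, twoDiffG, westSeqPosZeroG, plainSeqG, baseG]
    field_simp
    ring
  have hP (n : F) : twoDiffZeroP p q n = (q * (1 - p)) * (twoDiffZeroP p q n) + (twoDiffZeroP p
      q (n + 1) * baseP p q) + 1 / (p * (1 - q)) * (q * (1 - p)) * (westSeqPosZeroP p q (n + 1)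
      * baseP p q) + 1 / (p * (1 - q)) * (westSeqPosZeroP p q (n + 2) * baseP p q ^ 2) := by
    simp only [twoDiffZeroP, westSeqPosZeroP, baseP]
    -- The denominator is made opaque while fractions are cleared, and restored for the final
    -- expansion.
    obtain ⟨t, ht⟩ : ∃ t, t = 1 - p - q + 2 * p * q := ⟨_, rfl⟩
    rw [← ht] at h₈ ⊢
    field_simp
    rw [ht]
    ring
  simp only [twoDiffZero, twoDiff, westSeqPosZero, plainSeq, Int.cast_add, Int.cast_sub,
    Int.cast_ofNat, Int.cast_one, zpow_add₀ h.baseG_ne, zpow_sub₀ h.baseG_ne, zpow_add₀ h.baseP_ne,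
    zpow_ofNat]
  linear_combination baseG p q ^ d * hG d + baseP p q ^ d * hP d

theorem plainSeqBoth_eq (h : Generic p q) (d : ℤ) : plainSeqBoth p q d = (p * (1 - q)) *
    plainSeqOne p q d + (p * (1 - q)) * (q * (1 - p)) * plainSeqBoth p q (d - 1) + plainSeq p q
    (d + 1) + (q * (1 - p)) * plainSeqOne q p d := by
  obtain ⟨h₁, h₂, h₃, h₄, h₅, h₆, h₇, h₈⟩ := id h
  have hG (n : F) : plainSeqBothG p q n = (p * (1 - q)) * (plainSeqOneG p q n) + (p * (1 - q)) *
      (q * (1 - p)) * (plainSeqBothG p q (n - 1) / baseG p q) + (plainSeqG p q (n + 1) * baseG p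
      q) + (q * (1 - p)) * (plainSeqOneG q p n) := by
    simp only [plainSeqBothG, plainSeqOneG, plainSeqG, baseG]
    field_simp
    ring
  have hP (n : F) : plainSeqBothP p q n = (p * (1 - q)) * (plainSeqOneP p q n) + (p * (1 - q)) *
      (q * (1 - p)) * (plainSeqBothP p q (n - 1) / baseP p q) := by
    simp only [plainSeqBothP, plainSeqOneP, baseP]
    field_simp
    ring
  have hQ (n : F) : plainSeqBothQ p q n = (p * (1 - q)) * (q * (1 - p)) * (plainSeqBothQ p q (n
      - 1) / baseP q p) + (q * (1 - p)) * (plainSeqOneP q p n) := by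
    simp only [plainSeqBothQ, plainSeqOneP, baseP]
    field_simp
    ring
  have hR (n : F) : plainSeqBothR p q n = (p * (1 - q)) * (q * (1 - p)) * (plainSeqBothR p q (n
      - 1) / baseR p q) := by
    simp only [plainSeqBothR, baseR]
    field_simp
    ring
  simp only [plainSeqBoth, plainSeqOne, plainSeq, Int.cast_add, Int.cast_sub, Int.cast_one,
    baseG_comm q p, zpow_add₀ h.baseG_ne, zpow_sub₀ h.baseG_ne, zpow_sub₀ h.baseP_ne, zpow_sub₀
    h.symm.baseP_ne, zpow_sub₀ h.baseR_ne, zpow_ofNat]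
  linear_combination baseG p q ^ d * hG d + baseP p q ^ d * hP d + baseP q p ^ d * hQ d + baseR
    p q ^ d * hR d

theorem eastSeq_eq (h : Generic p q) (d : ℤ) : eastSeq p q d = (p * (1 - q)) * westSeq p q d +
    (p * (1 - q)) * (q * (1 - p)) * eastSeq p q (d - 1) + westSeq p q (d + 1) + (q * (1 - p)) *
    eastSeq p q d + (p * (1 - q)) ^ 2 * plainSeqOne p q (d - 1) + (p * (1 - q)) ^ 2 * (q * (1 -
    p)) * plainSeqBoth p q (d - 2) + 1 / (p * (1 - q)) * plainSeq p q (d + 2) + 1 / (p * (1 -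
    q)) * (q * (1 - p)) * plainSeqOne q p (d + 1) := by
  obtain ⟨h₁, h₂, h₃, h₄, h₅, h₆, h₇, h₈⟩ := id h
  have hG (n : F) : eastSeqG p q n = (p * (1 - q)) * (westSeqG p q n) + (p * (1 - q)) * (q * (1
      - p)) * (eastSeqG p q (n - 1) / baseG p q) + (westSeqG p q (n + 1) * baseG p q) + (q * (1
      - p)) * (eastSeqG p q n) + (p * (1 - q)) ^ 2 * (plainSeqOneG p q (n - 1) / baseG p q) + (p
      * (1 - q)) ^ 2 * (q * (1 - p)) * (plainSeqBothG p q (n - 2) / baseG p q ^ 2) + 1 / (p * (1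
      - q)) * (plainSeqG p q (n + 2) * baseG p q ^ 2) + 1 / (p * (1 - q)) * (q * (1 - p)) *
      (plainSeqOneG q p (n + 1) * baseG p q) := by
    simp only [eastSeqG, westSeqG, plainSeqOneG, plainSeqBothG, plainSeqG, baseG]
    field_simp
    ring
  have hP (n : F) : eastSeqP p q n = (p * (1 - q)) * (westSeqP p q n) + (p * (1 - q)) * (q * (1
      - p)) * (eastSeqP p q (n - 1) / baseP p q) + (westSeqP p q (n + 1) * baseP p q) + (q * (1
      - p)) * (eastSeqP p q n) + (p * (1 - q)) ^ 2 * (plainSeqOneP p q (n - 1) / baseP p q) + (p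
      * (1 - q)) ^ 2 * (q * (1 - p)) * (plainSeqBothP p q (n - 2) / baseP p q ^ 2) := by
    simp only [eastSeqP, westSeqP, plainSeqOneP, plainSeqBothP, baseP]
    field_simp
    ring
  have hQ (n : F) : eastSeqQ p q n = (p * (1 - q)) * (q * (1 - p)) * (eastSeqQ p q (n - 1) /
      baseP q p) + (q * (1 - p)) * (eastSeqQ p q n) + (p * (1 - q)) ^ 2 * (q * (1 - p)) *
      (plainSeqBothQ p q (n - 2) / baseP q p ^ 2) + 1 / (p * (1 - q)) * (q * (1 - p)) *
      (plainSeqOneP q p (n + 1) * baseP q p) := by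
    simp only [eastSeqQ, plainSeqBothQ, plainSeqOneP, baseP]
    field_simp
    ring
  have hR (n : F) : eastSeqR p q n = (p * (1 - q)) * (q * (1 - p)) * (eastSeqR p q (n - 1) /
      baseR p q) + (q * (1 - p)) * (eastSeqR p q n) + (p * (1 - q)) ^ 2 * (q * (1 - p)) *
      (plainSeqBothR p q (n - 2) / baseR p q ^ 2) := by
    simp only [eastSeqR, plainSeqBothR, baseR]
    field_simp
    ring
  simp only [eastSeq, westSeq, plainSeqOne, plainSeqBoth, plainSeq, Int.cast_add, Int.cast_sub,
    Int.cast_ofNat, Int.cast_one, baseG_comm q p, zpow_add₀ h.baseG_ne, zpow_sub₀ h.baseG_ne,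
    zpow_add₀ h.baseP_ne, zpow_sub₀ h.baseP_ne, zpow_add₀ h.symm.baseP_ne, zpow_sub₀
    h.symm.baseP_ne, zpow_sub₀ h.baseR_ne, zpow_ofNat]
  linear_combination baseG p q ^ d * hG d + baseP p q ^ d * hP d + baseP q p ^ d * hQ d + baseR
    p q ^ d * hR d

theorem eastSeqZero_eq (h : Generic p q) (d : ℤ) : eastSeqZero p q d = (p * (1 - q)) * westSeq p
    q d + (p * (1 - q)) * (q * (1 - p)) * eastSeq p q (d - 1) + westSeqZero p q (d + 1) + (q *
    (1 - p)) * eastSeqZero p q d + (p * (1 - q)) ^ 2 * plainSeqOne p q (d - 1) + (p * (1 - q)) ^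
    2 * (q * (1 - p)) * plainSeqBoth p q (d - 2) := by
  obtain ⟨h₁, h₂, h₃, h₄, h₅, h₆, h₇, h₈⟩ := id h
  have hG (n : F) : eastSeqZeroG p q n = (p * (1 - q)) * (westSeqG p q n) + (p * (1 - q)) * (q *
      (1 - p)) * (eastSeqG p q (n - 1) / baseG p q) + (westSeqZeroG p q (n + 1) * baseG p q) +
      (q * (1 - p)) * (eastSeqZeroG p q n) + (p * (1 - q)) ^ 2 * (plainSeqOneG p q (n - 1) /
      baseG p q) + (p * (1 - q)) ^ 2 * (q * (1 - p)) * (plainSeqBothG p q (n - 2) / baseG p q ^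
      2) := by
    simp only [eastSeqZeroG, westSeqG, eastSeqG, westSeqZeroG, plainSeqOneG, plainSeqBothG, baseG]
    field_simp
    ring
  have hP (n : F) : eastSeqZeroP p q n = (p * (1 - q)) * (westSeqP p q n) + (p * (1 - q)) * (q *
      (1 - p)) * (eastSeqP p q (n - 1) / baseP p q) + (westSeqZeroP p q (n + 1) * baseP p q) +
      (q * (1 - p)) * (eastSeqZeroP p q n) + (p * (1 - q)) ^ 2 * (plainSeqOneP p q (n - 1) /
      baseP p q) + (p * (1 - q)) ^ 2 * (q * (1 - p)) * (plainSeqBothP p q (n - 2) / baseP p q ^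
      2) := by
    simp only [eastSeqZeroP, westSeqP, eastSeqP, westSeqZeroP, plainSeqOneP, plainSeqBothP, baseP]
    field_simp
    ring
  have hQ (n : F) : eastSeqZeroQ p q n = (p * (1 - q)) * (q * (1 - p)) * (eastSeqQ p q (n - 1) /
      baseP q p) + (q * (1 - p)) * (eastSeqZeroQ p q n) + (p * (1 - q)) ^ 2 * (q * (1 - p)) *
      (plainSeqBothQ p q (n - 2) / baseP q p ^ 2) := by
    simp only [eastSeqZeroQ, eastSeqQ, plainSeqBothQ, baseP]
    field_simp
    ring
  have hR (n : F) : eastSeqZeroR p q n = (p * (1 - q)) * (q * (1 - p)) * (eastSeqR p q (n - 1) /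
      baseR p q) + (q * (1 - p)) * (eastSeqZeroR p q n) + (p * (1 - q)) ^ 2 * (q * (1 - p)) *
      (plainSeqBothR p q (n - 2) / baseR p q ^ 2) := by
    simp only [eastSeqZeroR, eastSeqR, plainSeqBothR, baseR]
    field_simp
    ring
  simp only [eastSeqZero, westSeq, eastSeq, westSeqZero, plainSeqOne, plainSeqBoth, Int.cast_add,
    Int.cast_sub, Int.cast_ofNat, Int.cast_one, zpow_add₀ h.baseG_ne, zpow_sub₀ h.baseG_ne,
    zpow_add₀ h.baseP_ne, zpow_sub₀ h.baseP_ne, zpow_sub₀ h.symm.baseP_ne, zpow_sub₀ h.baseR_ne,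
    zpow_ofNat]
  linear_combination baseG p q ^ d * hG d + baseP p q ^ d * hP d + baseP q p ^ d * hQ d + baseR
    p q ^ d * hR d

end

section

variable {F : Type*} [Field F] [CharZero F] {p q : F}

set_option maxRecDepth 8000 in
set_option maxHeartbeats 2000000 in
theorem bothSeq_eq (h : Generic p q) (d : ℤ) : bothSeq p q d = (p * (1 - q)) * (q * (1 - p)) *
    bothSeq p q (d - 1) + (p * (1 - q)) * bothSeq p q d + (q * (1 - p)) * bothSeq p q d +
    bothSeq p q (d + 1) + (p * (1 - q)) ^ 2 * eastSeq q p (d - 1) + (p * (1 - q)) ^ 2 * (q * (1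
    - p)) * eastSeq q p (d - 2) + (q * (1 - p)) ^ 2 * eastSeq p q (d - 1) + (q * (1 - p)) ^ 2 *
    (p * (1 - q)) * eastSeq p q (d - 2) + 1 / (p * (1 - q)) * westSeq q p (d + 2) + 1 / (p * (1
    - q)) * (q * (1 - p)) * westSeq q p (d + 1) + 1 / (q * (1 - p)) * westSeq p q (d + 2) + 1 /
    (q * (1 - p)) * (p * (1 - q)) * westSeq p q (d + 1) + (p * (1 - q)) ^ 2 / (q * (1 - p)) *
    plainSeqOne p q d + (q * (1 - p)) ^ 2 / (p * (1 - q)) * plainSeqOne q p d + (p * (1 - q)) ^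
    2 * (q * (1 - p)) ^ 2 * plainSeqBoth p q (d - 3) + 1 / (p * (1 - q)) / (q * (1 - p)) *
    plainSeq p q (d + 3) := by
  obtain ⟨h₁, h₂, h₃, h₄, h₅, h₆, h₇, h₈⟩ := id h
  have e (n : F) : (1 - p - q) * bothSeqG1 p q - (1 - p * (1 - q) - q * (1 - p)) * bothSeqG2 p q
      + 2 * (1 - p - q) * bothSeqG2 p q * n = (p * (1 - q)) ^ 2 * (eastSeqG q p (n - 1) / baseG
      p q) + (p * (1 - q)) ^ 2 * (q * (1 - p)) * (eastSeqG q p (n - 2) / baseG p q ^ 2) + (q *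
      (1 - p)) ^ 2 * (eastSeqG p q (n - 1) / baseG p q) + (q * (1 - p)) ^ 2 * (p * (1 - q)) *
      (eastSeqG p q (n - 2) / baseG p q ^ 2) + 1 / (p * (1 - q)) * (westSeqG q p (n + 2) * baseG
      p q ^ 2) + 1 / (p * (1 - q)) * (q * (1 - p)) * (westSeqG q p (n + 1) * baseG p q) + 1 / (q
      * (1 - p)) * (westSeqG p q (n + 2) * baseG p q ^ 2) + 1 / (q * (1 - p)) * (p * (1 - q)) *
      (westSeqG p q (n + 1) * baseG p q) + (p * (1 - q)) ^ 2 / (q * (1 - p)) * (plainSeqOneG p q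
      n) + (q * (1 - p)) ^ 2 / (p * (1 - q)) * (plainSeqOneG q p n) + (p * (1 - q)) ^ 2 * (q *
      (1 - p)) ^ 2 * (plainSeqBothG p q (n - 3) / baseG p q ^ 3) + 1 / (p * (1 - q)) / (q * (1 -
      p)) * (plainSeqG p q (n + 3) * baseG p q ^ 3) := by
    simp only [bothSeqG1, bothSeqG2, eastSeqG, westSeqG, plainSeqOneG, plainSeqBothG, plainSeqG,
      baseG]
    -- Exchanging p and q produces the same denominator in another form; one normal form makes the
    -- denominators recognisable as equal.
    simp only [sub_right_comm 1 q p]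
    field_simp
    ring
  have hG (n : F) : bothSeqG p q n = (p * (1 - q)) * (q * (1 - p)) * (bothSeqG p q (n - 1) /
      baseG p q) + (p * (1 - q)) * (bothSeqG p q n) + (q * (1 - p)) * (bothSeqG p q n) +
      (bothSeqG p q (n + 1) * baseG p q) + (p * (1 - q)) ^ 2 * (eastSeqG q p (n - 1) / baseG p
      q) + (p * (1 - q)) ^ 2 * (q * (1 - p)) * (eastSeqG q p (n - 2) / baseG p q ^ 2) + (q * (1
      - p)) ^ 2 * (eastSeqG p q (n - 1) / baseG p q) + (q * (1 - p)) ^ 2 * (p * (1 - q)) *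
      (eastSeqG p q (n - 2) / baseG p q ^ 2) + 1 / (p * (1 - q)) * (westSeqG q p (n + 2) * baseG
      p q ^ 2) + 1 / (p * (1 - q)) * (q * (1 - p)) * (westSeqG q p (n + 1) * baseG p q) + 1 / (q
      * (1 - p)) * (westSeqG p q (n + 2) * baseG p q ^ 2) + 1 / (q * (1 - p)) * (p * (1 - q)) *
      (westSeqG p q (n + 1) * baseG p q) + (p * (1 - q)) ^ 2 / (q * (1 - p)) * (plainSeqOneG p q
      n) + (q * (1 - p)) ^ 2 / (p * (1 - q)) * (plainSeqOneG q p n) + (p * (1 - q)) ^ 2 * (q *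
      (1 - p)) ^ 2 * (plainSeqBothG p q (n - 3) / baseG p q ^ 3) + 1 / (p * (1 - q)) / (q * (1 -
      p)) * (plainSeqG p q (n + 3) * baseG p q ^ 3) := by
    simp only [bothSeqG]
    linear_combination quad_baseG h (bothSeqG0 p q) (bothSeqG1 p q) (bothSeqG2 p q) n +
      e n
  have hQ (n : F) : bothSeqQ p q n = (p * (1 - q)) * (q * (1 - p)) * (bothSeqQ p q (n - 1) /
      baseP q p) + (p * (1 - q)) * (bothSeqQ p q n) + (q * (1 - p)) * (bothSeqQ p q n) +
      (bothSeqQ p q (n + 1) * baseP q p) + (p * (1 - q)) ^ 2 * (eastSeqP q p (n - 1) / baseP q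
      p) + (p * (1 - q)) ^ 2 * (q * (1 - p)) * (eastSeqP q p (n - 2) / baseP q p ^ 2) + (q * (1
      - p)) ^ 2 * (eastSeqQ p q (n - 1) / baseP q p) + (q * (1 - p)) ^ 2 * (p * (1 - q)) *
      (eastSeqQ p q (n - 2) / baseP q p ^ 2) + 1 / (p * (1 - q)) * (westSeqP q p (n + 2) * baseP
      q p ^ 2) + 1 / (p * (1 - q)) * (q * (1 - p)) * (westSeqP q p (n + 1) * baseP q p) + (q *
      (1 - p)) ^ 2 / (p * (1 - q)) * (plainSeqOneP q p n) + (p * (1 - q)) ^ 2 * (q * (1 - p)) ^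
      2 * (plainSeqBothQ p q (n - 3) / baseP q p ^ 3) := by
    simp only [bothSeqQ, eastSeqP, eastSeqQ, westSeqP, plainSeqOneP, plainSeqBothQ, baseP]
    field_simp
    ring
  have hP (n : F) : bothSeqP p q n = (p * (1 - q)) * (q * (1 - p)) * (bothSeqP p q (n - 1) /
      baseP p q) + (p * (1 - q)) * (bothSeqP p q n) + (q * (1 - p)) * (bothSeqP p q n) +
      (bothSeqP p q (n + 1) * baseP p q) + (p * (1 - q)) ^ 2 * (eastSeqQ q p (n - 1) / baseP p
      q) + (p * (1 - q)) ^ 2 * (q * (1 - p)) * (eastSeqQ q p (n - 2) / baseP p q ^ 2) + (q * (1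
      - p)) ^ 2 * (eastSeqP p q (n - 1) / baseP p q) + (q * (1 - p)) ^ 2 * (p * (1 - q)) *
      (eastSeqP p q (n - 2) / baseP p q ^ 2) + 1 / (q * (1 - p)) * (westSeqP p q (n + 2) * baseP
      p q ^ 2) + 1 / (q * (1 - p)) * (p * (1 - q)) * (westSeqP p q (n + 1) * baseP p q) + (p *
      (1 - q)) ^ 2 / (q * (1 - p)) * (plainSeqOneP p q n) + (p * (1 - q)) ^ 2 * (q * (1 - p)) ^
      2 * (plainSeqBothP p q (n - 3) / baseP p q ^ 3) := by
    simp only [bothSeqP, eastSeqQ, eastSeqP, westSeqP, plainSeqOneP, plainSeqBothP, baseP]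
    field_simp
    ring
  have hR (n : F) : bothSeqR p q n = (p * (1 - q)) * (q * (1 - p)) * (bothSeqR p q (n - 1) /
      baseR p q) + (p * (1 - q)) * (bothSeqR p q n) + (q * (1 - p)) * (bothSeqR p q n) +
      (bothSeqR p q (n + 1) * baseR p q) + (p * (1 - q)) ^ 2 * (eastSeqR q p (n - 1) / baseR p
      q) + (p * (1 - q)) ^ 2 * (q * (1 - p)) * (eastSeqR q p (n - 2) / baseR p q ^ 2) + (q * (1
      - p)) ^ 2 * (eastSeqR p q (n - 1) / baseR p q) + (q * (1 - p)) ^ 2 * (p * (1 - q)) *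
      (eastSeqR p q (n - 2) / baseR p q ^ 2) + (p * (1 - q)) ^ 2 * (q * (1 - p)) ^ 2 *
      (plainSeqBothR p q (n - 3) / baseR p q ^ 3) := by
    simp only [bothSeqR, eastSeqR, plainSeqBothR, baseR]
    field_simp
    ring
  simp only [bothSeq, eastSeq, westSeq, plainSeqOne, plainSeqBoth, plainSeq, Int.cast_add,
    Int.cast_sub, Int.cast_ofNat, Int.cast_one, baseG_comm q p, baseR_comm q p, zpow_add₀
    h.baseG_ne, zpow_sub₀ h.baseG_ne, zpow_add₀ h.baseP_ne, zpow_sub₀ h.baseP_ne, zpow_add₀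
    h.symm.baseP_ne, zpow_sub₀ h.symm.baseP_ne, zpow_add₀ h.baseR_ne, zpow_sub₀ h.baseR_ne,
    zpow_ofNat]
  linear_combination baseG p q ^ d * hG d + baseP q p ^ d * hQ d + baseP p q ^ d * hP d + baseR
    p q ^ d * hR d

theorem bothDiff_eq (h : Generic p q) (d : ℤ) : bothDiff p q d = (p * (1 - q)) * bothDiff p q d
    + bothDiff p q (d + 1) + (p * (1 - q)) ^ 2 * eastSeq q p (d - 1) + -(p * (1 - q)) ^ 2 *
    eastSeqZero q p (d - 1) + 1 / (p * (1 - q)) * westSeq q p (d + 2) + -1 / (p * (1 - q)) *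
    westSeqZero q p (d + 2) + 1 / (q * (1 - p)) * westSeq p q (d + 2) + 1 / (q * (1 - p)) * (p *
    (1 - q)) * westSeq p q (d + 1) + (p * (1 - q)) ^ 2 / (q * (1 - p)) * plainSeqOne p q d + 1 /
    (p * (1 - q)) / (q * (1 - p)) * plainSeq p q (d + 3) := by
  obtain ⟨h₁, h₂, h₃, h₄, h₅, h₆, h₇, h₈⟩ := id h
  have hG (n : F) : bothDiffG p q n = (p * (1 - q)) * (bothDiffG p q n) + (bothDiffG p q (n + 1)
      * baseG p q) + (p * (1 - q)) ^ 2 * (eastSeqG q p (n - 1) / baseG p q) + -(p * (1 - q)) ^ 2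
      * (eastSeqZeroG q p (n - 1) / baseG p q) + 1 / (p * (1 - q)) * (westSeqG q p (n + 2) *
      baseG p q ^ 2) + -1 / (p * (1 - q)) * (westSeqZeroG q p (n + 2) * baseG p q ^ 2) + 1 / (q
      * (1 - p)) * (westSeqG p q (n + 2) * baseG p q ^ 2) + 1 / (q * (1 - p)) * (p * (1 - q)) *
      (westSeqG p q (n + 1) * baseG p q) + (p * (1 - q)) ^ 2 / (q * (1 - p)) * (plainSeqOneG p q
      n) + 1 / (p * (1 - q)) / (q * (1 - p)) * (plainSeqG p q (n + 3) * baseG p q ^ 3) := by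
    simp only [bothDiffG, eastSeqG, eastSeqZeroG, westSeqG, westSeqZeroG, plainSeqOneG, plainSeqG,
      baseG]
    field_simp
    ring
  have hP (n : F) : bothDiffP p q n = (p * (1 - q)) * (bothDiffP p q n) + (bothDiffP p q (n + 1)
      * baseP p q) + (p * (1 - q)) ^ 2 * (eastSeqQ q p (n - 1) / baseP p q) + -(p * (1 - q)) ^ 2
      * (eastSeqZeroQ q p (n - 1) / baseP p q) + 1 / (q * (1 - p)) * (westSeqP p q (n + 2) *
      baseP p q ^ 2) + 1 / (q * (1 - p)) * (p * (1 - q)) * (westSeqP p q (n + 1) * baseP p q) +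
      (p * (1 - q)) ^ 2 / (q * (1 - p)) * (plainSeqOneP p q n) := by
    simp only [bothDiffP, eastSeqQ, eastSeqZeroQ, westSeqP, plainSeqOneP, baseP]
    field_simp
    ring
  have hQ (n : F) : 0 = (p * (1 - q)) ^ 2 * (eastSeqP q p (n - 1) / baseP q p) + -(p * (1 - q))
      ^ 2 * (eastSeqZeroP q p (n - 1) / baseP q p) + 1 / (p * (1 - q)) * (westSeqP q p (n + 2) *
      baseP q p ^ 2) + -1 / (p * (1 - q)) * (westSeqZeroP q p (n + 2) * baseP q p ^ 2) := by
    simp only [eastSeqP, eastSeqZeroP, westSeqP, westSeqZeroP, baseP]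
    field_simp
    ring
  have hR (n : F) : 0 = (p * (1 - q)) ^ 2 * (eastSeqR q p (n - 1) / baseR p q) + -(p * (1 - q))
      ^ 2 * (eastSeqZeroR q p (n - 1) / baseR p q) := by
    simp only [eastSeqR, eastSeqZeroR, baseR]
    field_simp
    ring
  simp only [bothDiff, eastSeq, eastSeqZero, westSeq, westSeqZero, plainSeqOne, plainSeq,
    Int.cast_add, Int.cast_sub, Int.cast_ofNat, Int.cast_one, baseG_comm q p, baseR_comm q p,
    zpow_add₀ h.baseG_ne, zpow_sub₀ h.baseG_ne, zpow_add₀ h.baseP_ne, zpow_sub₀ h.baseP_ne,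
    zpow_add₀ h.symm.baseP_ne, zpow_sub₀ h.symm.baseP_ne, zpow_sub₀ h.baseR_ne, zpow_ofNat]
  linear_combination baseG p q ^ d * hG d + baseP p q ^ d * hP d + baseP q p ^ d * hQ d + baseR
    p q ^ d * hR d

theorem bothDiffDiff_eq (h : Generic p q) (d : ℤ) : bothDiffDiff p q d = bothDiffDiff p q (d +
    1) + 1 / (p * (1 - q)) * westSeq q p (d + 2) + -1 / (p * (1 - q)) * westSeqZero q p (d + 2)
    + 1 / (q * (1 - p)) * westSeq p q (d + 2) + -1 / (q * (1 - p)) * westSeqZero p q (d + 2) + 1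
    / (p * (1 - q)) / (q * (1 - p)) * plainSeq p q (d + 3) := by
  obtain ⟨h₁, h₂, h₃, h₄, h₅, h₆, h₇, h₈⟩ := id h
  have hG (n : F) : bothDiffDiffG p q n = (bothDiffDiffG p q (n + 1) * baseG p q) + 1 / (p * (1
      - q)) * (westSeqG q p (n + 2) * baseG p q ^ 2) + -1 / (p * (1 - q)) * (westSeqZeroG q p (n
      + 2) * baseG p q ^ 2) + 1 / (q * (1 - p)) * (westSeqG p q (n + 2) * baseG p q ^ 2) + -1 /
      (q * (1 - p)) * (westSeqZeroG p q (n + 2) * baseG p q ^ 2) + 1 / (p * (1 - q)) / (q * (1 -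
      p)) * (plainSeqG p q (n + 3) * baseG p q ^ 3) := by
    simp only [bothDiffDiffG, westSeqG, westSeqZeroG, plainSeqG, baseG]
    field_simp
    ring
  have hQ (n : F) : 0 = 1 / (p * (1 - q)) * (westSeqP q p (n + 2) * baseP q p ^ 2) + -1 / (p *
      (1 - q)) * (westSeqZeroP q p (n + 2) * baseP q p ^ 2) := by
    simp only [westSeqP, westSeqZeroP, baseP]
    field_simp
    ring
  have hP (n : F) : 0 = 1 / (q * (1 - p)) * (westSeqP p q (n + 2) * baseP p q ^ 2) + -1 / (q *
      (1 - p)) * (westSeqZeroP p q (n + 2) * baseP p q ^ 2) := by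
    simp only [westSeqP, westSeqZeroP, baseP]
    field_simp
    ring
  simp only [bothDiffDiff, westSeq, westSeqZero, plainSeq, Int.cast_add, Int.cast_ofNat,
    Int.cast_one, baseG_comm q p, zpow_add₀ h.baseG_ne, zpow_add₀ h.baseP_ne, zpow_add₀
    h.symm.baseP_ne, zpow_ofNat]
  linear_combination baseG p q ^ d * hG d + baseP q p ^ d * hQ d + baseP p q ^ d * hP d

end

/-! ### Behaviour near distance zero. -/

/-- The sequence that vanishes for `d ≤ 0` and is otherwise given by `f`, up to an additional
constant at `d = 1`. -/
def cand {F : Type*} [Field F] (ε : F) (f : ℤ → F) (d : ℤ) : F :=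
  if d ≤ 0 then 0 else if d = 1 then f 1 + ε else f d

section

variable {F : Type*} [Field F] {ε : F} {f : ℤ → F} {d : ℤ}

theorem cand_of_nonpos (hd : d ≤ 0) : cand ε f d = 0 := if_pos hd

theorem cand_one : cand ε f 1 = f 1 + ε := by simp [cand]

theorem cand_of_two_le (hd : 2 ≤ d) : cand ε f d = f d := by
  rw [cand, if_neg (by omega), if_neg (by omega)]

theorem cand_of_one_le (hd : 1 ≤ d) : cand 0 f d = f d := by
  rw [cand, if_neg (by omega), add_zero]
  split_ifs with h
  · rw [h]
  · rfl

end

theorem XYSmall.cand {f : ℤ → FPS} (hf : XYSmall f) (ε : FPS) : XYSmall (cand ε f) :=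
  hf.congr 2 fun _ hd => cand_of_two_le (by simpa using hd)

instance : CharZero (MvPowerSeries (Fin 2) ℚ) := algebraRat.charZero _

instance : CharZero FPS := charZero_of_injective_ringHom toFPS_injective

theorem Zs_small {a b : Fin 2} (hab : a ≠ b) (e : ℤ) : XYSmall (Zs a b e) := F20_small hab

theorem Ws_small {a b : Fin 2} (hab : a ≠ b) (o f e : ℤ) : XYSmall (Ws a b o f e) := F20_small hab

theorem Us_small {a b : Fin 2} (hab : a ≠ b) (f : ℤ) : XYSmall (Us a b f) := F20_small hab

theorem Ys_small {a b : Fin 2} (hab : a ≠ b) (e e' : ℤ) : XYSmall (Ys a b e e') := F11_small hab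

theorem Rs_small {a b : Fin 2} (hab : a ≠ b) (f e' : ℤ) : XYSmall (Rs a b f e') := F11_small hab

theorem Hs_small {a b : Fin 2} (hab : a ≠ b) (f g : ℤ) : XYSmall (Hs a b f g) := F11_small hab

section

variable {a b : Fin 2} {d : ℤ}

theorem Zs_of_neg {e : ℤ} (hd : d < 0) : Zs a b e d = 0 := F20_of_neg hd

theorem Ys_of_neg {e e' : ℤ} (hd : d < 0) : Ys a b e e' d = 0 := F11_of_neg hd

theorem Ws_of_nonpos_right {o f e : ℤ} (hd : d ≤ 0) : Ws a b o f e d = 0 := by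
  obtain hd | rfl := hd.lt_or_eq
  · exact F20_of_neg hd
  · exact F20_zero_left one_ne_zero

theorem Us_of_nonpos {f : ℤ} (hd : d ≤ 0) : Us a b f d = 0 := by
  obtain hd | rfl := hd.lt_or_eq
  · exact F20_of_neg hd
  · exact F20_zero_left two_ne_zero

theorem Rs_of_nonpos {f e' : ℤ} (hd : d ≤ 0) : Rs a b f e' d = 0 := by
  obtain hd | rfl := hd.lt_or_eq
  · exact F11_of_neg hd
  · exact F11_zero_left (Or.inl one_ne_zero)

theorem Hs_of_nonpos {f g : ℤ} (hd : d ≤ 0) : Hs a b f g d = 0 := by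
  obtain hd | rfl := hd.lt_or_eq
  · exact F11_of_neg hd
  · exact F11_zero_left (Or.inl one_ne_zero)

end

/-- A rational parametrisation of the variables. -/
structure Param (a b : Fin 2) (p q : FPS) : Prop where
  hab : a ≠ b
  hx : toFPS (X a) = p * (1 - q)
  hy : toFPS (X b) = q * (1 - p)
  gen : Generic p q
  dvd : ∃ g, X 0 * X 1 ∣ g ∧ toFPS g = p * q

section

variable {F : Type*} [Field F] [CharZero F] {p q : F}

/-- At d = 1 the recursion reaches back to indices where the true sequences are zero and the
formulas are not. The spurious contributions must cancel, and here they do so without a correction.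
-/
theorem westSeq_boundary (h : Generic p q) : (p * (1 - q)) * (q * (1 - p)) * westSeq p q 0 + (p
    * (1 - q)) ^ 2 * (q * (1 - p)) * plainSeqOne p q (-1) = 0 := by
  obtain ⟨h₁, h₂, h₃, h₄, h₅, h₆, h₇, h₈⟩ := id h
  simp only [westSeq, westSeqG, westSeqP, plainSeqOne, plainSeqOneG, plainSeqOneP, Int.cast_zero,
    Int.cast_neg, Int.cast_one, zpow_neg, zpow_ofNat, baseG, baseP]
  field_simp
  ring

theorem westSeqOne_boundary (h : Generic p q) : (p * (1 - q)) * (q * (1 - p)) * westSeqOne p q 0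
    + (p * (1 - q)) ^ 2 * (q * (1 - p)) * plainSeqTwo p q (-1) = 0 := by
  obtain ⟨h₁, h₂, h₃, h₄, h₅, h₆, h₇, h₈⟩ := id h
  simp only [westSeqOne, westSeqOneG, westSeqOneP, plainSeqTwo, plainSeqTwoG, plainSeqTwoP,
    Int.cast_zero, Int.cast_neg, Int.cast_one, zpow_neg, zpow_ofNat, baseG, baseP]
  field_simp
  ring

/-- The deviation of the true value at d = 1 from the formula. It is governed by the recursions at d
= 1 and d = 2, the latter because of the term with index d - 1; both conditions are checked below.
-/
noncomputable def twoEps (p q : F) : F := (-q - p + 3 * p * q - p * q ^ 2 - p ^ 2 * q + p ^ 2 *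
    q ^ 2) * p * q / ((1 - p) * (1 - p * (1 - q)))

noncomputable def twoDiffZeroEps (p q : F) : F := -1 * p * q ^ 3 * (1 - p) / ((1 - q) ^ 3 * (1 -
    q * (1 - p)))

noncomputable def bothDiffEps (p q : F) : F := (-1 - p + p * q + 3 * p ^ 2 - 4 * p ^ 2 * q - p ^
    3 + p ^ 2 * q ^ 2 + 2 * p ^ 3 * q - p ^ 3 * q ^ 2) * p ^ 3 * q * (1 - q) ^ 2 / ((1 - p) ^ 2
    * (1 - p * (1 - q)) ^ 3)

set_option maxRecDepth 8000 in
set_option maxHeartbeats 2000000 in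
theorem twoSeq_boundary_one (h : Generic p q) : (1 - (p * (1 - q)) - (q * (1 - p))) * twoEps p q
    + (p * (1 - q)) * (q * (1 - p)) * twoSeq p q 0 + (p * (1 - q)) ^ 2 * ((q * (1 - p)) *
    westSeqNeg p q (-1) + westSeqNeg p q 0) + 2 * (p * (1 - q)) ^ 3 * ((q * (1 - p)) *
    plainSeqTwo p q (-2) + plainSeqTwo p q (-1)) + (p * (1 - q)) ^ 2 * (q * (1 - p)) *
    plainSeqTwo p q (-1) + 1 / (p * (1 - q)) * (q * (1 - p)) * plainSeq p q 2 = 0 := by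
  obtain ⟨h₁, h₂, h₃, h₄, h₅, h₆, h₇, h₈⟩ := id h
  simp only [twoEps, twoSeq, twoSeqG, twoSeqG0, twoSeqG1, twoSeqG2, twoSeqP, westSeqNeg,
    westSeqNegG, westSeqNegP, plainSeqTwo, plainSeqTwoG, plainSeqTwoP, plainSeq, plainSeqG,
    Int.cast_zero, Int.cast_neg, Int.cast_one, Int.cast_ofNat, zpow_neg, zpow_ofNat, baseG, baseP]
  field_simp
  ring

theorem twoSeq_boundary_two (h : Generic p q) : -((p * (1 - q)) * (q * (1 - p)) * twoEps p q) +
    (p * (1 - q)) ^ 2 * (q * (1 - p)) * westSeqNeg p q 0 + 2 * (p * (1 - q)) ^ 3 * (q * (1 - p))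
    * plainSeqTwo p q (-1) = 0 := by
  obtain ⟨h₁, h₂, h₃, h₄, h₅, h₆, h₇, h₈⟩ := id h
  simp only [twoEps, westSeqNeg, westSeqNegG, westSeqNegP, plainSeqTwo, plainSeqTwoG, plainSeqTwoP,
    Int.cast_zero, Int.cast_neg, Int.cast_one, zpow_neg, zpow_ofNat, baseG, baseP]
  field_simp
  ring

theorem twoDiffZero_boundary (h : Generic p q) : (1 - (q * (1 - p))) * twoDiffZeroEps p q + (p *
    (1 - q)) * (q * (1 - p)) * twoDiff p q 0 + 1 / (p * (1 - q)) * (q * (1 - p)) * plainSeq p q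
    2 = 0 := by
  obtain ⟨h₁, h₂, h₃, h₄, h₅, h₆, h₇, h₈⟩ := id h
  simp only [twoDiffZeroEps, twoDiff, twoDiffG, plainSeq, plainSeqG, Int.cast_zero, Int.cast_ofNat,
    zpow_ofNat, baseG]
  field_simp
  ring

theorem eastSeq_boundary (h : Generic p q) : (p * (1 - q)) * (q * (1 - p)) * eastSeq p q 0 + (p
    * (1 - q)) ^ 2 * (q * (1 - p)) * plainSeqBoth p q (-1) = 0 := by
  obtain ⟨h₁, h₂, h₃, h₄, h₅, h₆, h₇, h₈⟩ := id h
  simp only [eastSeq, eastSeqG, eastSeqP, eastSeqQ, eastSeqR, plainSeqBoth, plainSeqBothG,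
    plainSeqBothP, plainSeqBothQ, plainSeqBothR, Int.cast_zero, Int.cast_neg, Int.cast_one,
    zpow_neg, zpow_ofNat, baseG, baseP, baseR]
  field_simp
  ring

set_option maxRecDepth 8000 in
set_option maxHeartbeats 2000000 in
theorem bothSeq_boundary_one (h : Generic p q) : (1 - (p * (1 - q)) - (q * (1 - p))) * (p * q) +
    (p * (1 - q)) * (q * (1 - p)) * bothSeq p q 0 + (p * (1 - q)) ^ 2 * ((q * (1 - p)) * eastSeq
    q p (-1) + eastSeq q p 0) + (q * (1 - p)) ^ 2 * ((p * (1 - q)) * eastSeq p q (-1) + eastSeq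
    p q 0) + 1 / (p * (1 - q)) * (q * (1 - p)) * (q * (1 - p)) ^ 2 * plainSeqOne q p 1 + 1 / (q
    * (1 - p)) * (p * (1 - q)) * (p * (1 - q)) ^ 2 * plainSeqOne p q 1 + (p * (1 - q)) ^ 2 / (q
    * (1 - p)) * plainSeqOne p q 1 + (q * (1 - p)) ^ 2 / (p * (1 - q)) * plainSeqOne q p 1 + (p
    * (1 - q)) ^ 2 * (q * (1 - p)) ^ 2 * plainSeqBoth p q (-2) = 0 := by
  obtain ⟨h₁, h₂, h₃, h₄, h₅, h₆, h₇, h₈⟩ := id h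
  simp only [bothSeq, bothSeqG, bothSeqG0, bothSeqG1, bothSeqG2, bothSeqQ, bothSeqP, bothSeqR,
    eastSeq, eastSeqG, eastSeqP, eastSeqQ, eastSeqR, plainSeqOne, plainSeqOneG, plainSeqOneP,
    plainSeqBoth, plainSeqBothG, plainSeqBothP, plainSeqBothQ, plainSeqBothR, Int.cast_zero,
    Int.cast_neg, Int.cast_one, Int.cast_ofNat, zpow_neg, zpow_ofNat, baseG, baseP, baseR]
  simp only [sub_right_comm 1 q p]
  field_simp
  ring

theorem bothSeq_boundary_two (h : Generic p q) : -((p * (1 - q)) * (q * (1 - p)) * (p * q)) + (p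
    * (1 - q)) ^ 2 * (q * (1 - p)) * eastSeq q p 0 + (q * (1 - p)) ^ 2 * (p * (1 - q)) * eastSeq
    p q 0 + (p * (1 - q)) ^ 2 * (q * (1 - p)) ^ 2 * plainSeqBoth p q (-1) = 0 := by
  obtain ⟨h₁, h₂, h₃, h₄, h₅, h₆, h₇, h₈⟩ := id h
  simp only [eastSeq, eastSeqG, eastSeqP, eastSeqQ, eastSeqR, plainSeqBoth, plainSeqBothG,
    plainSeqBothP, plainSeqBothQ, plainSeqBothR, Int.cast_zero, Int.cast_neg, Int.cast_one,
    zpow_neg, zpow_ofNat, baseG, baseP, baseR]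
  field_simp
  ring

theorem bothDiff_boundary (h : Generic p q) : (1 - (p * (1 - q))) * bothDiffEps p q + (p * (1 -
    q)) ^ 2 * (eastSeq q p 0 - eastSeqZero q p 0) + 1 / (q * (1 - p)) * (p * (1 - q)) * (p * (1
    - q)) ^ 2 * plainSeqOne p q 1 + (p * (1 - q)) ^ 2 / (q * (1 - p)) * plainSeqOne p q 1 = 0 :=
    by
  obtain ⟨h₁, h₂, h₃, h₄, h₅, h₆, h₇, h₈⟩ := id h
  simp only [bothDiffEps, eastSeq, eastSeqG, eastSeqP, eastSeqQ, eastSeqR, eastSeqZero,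
    eastSeqZeroG, eastSeqZeroP, eastSeqZeroQ, eastSeqZeroR, plainSeqOne, plainSeqOneG, plainSeqOneP,
    Int.cast_zero, Int.cast_one, zpow_ofNat, baseG, baseP, baseR]
  field_simp
  ring

end

/-! ### Identification of the generating functions with the explicit solutions. -/

namespace Param

variable {a b : Fin 2} {p q : FPS} {d : ℤ}

theorem symm (h : Param a b p q) : Param b a q p :=
  ⟨h.hab.symm, h.hy, h.hx, h.gen.symm, by rw [mul_comm q]; exact h.dvd⟩

theorem X_mul_X {a b : Fin 2} (hab : a ≠ b) : (X a * X b : MvPowerSeries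
    (Fin 2) ℚ) = X 0 * X 1 := by
  obtain ⟨rfl, rfl⟩ | ⟨rfl, rfl⟩ : (a = 0 ∧ b = 1) ∨ (a = 1 ∧ b = 0) := by omega
  · rfl
  · exact mul_comm _ _

theorem small_quad {B : FPS} (hB : ∃ g, X 0 * X 1 ∣ g ∧ toFPS g = B) (c₀ c₁ c₂ : FPS) :
    XYSmall fun d => (c₀ + c₁ * d + c₂ * d ^ 2) * B ^ d := by
  obtain ⟨g, hg, rfl⟩ := hB
  convert (((XYSmall.zpow hg 0).const_mul c₀).add ((XYSmall.zpow hg 1).const_mul c₁)).add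
    ((XYSmall.zpow hg 2).const_mul c₂) using 2
  ring

theorem dvdG (h : Param a b p q) : ∃ g, X 0 * X 1 ∣ g ∧ toFPS g = baseG p q := h.dvd

theorem dvdR (h : Param a b p q) : ∃ g, X 0 * X 1 ∣ g ∧ toFPS g = baseR p q :=
  ⟨X a * X b, by rw [X_mul_X h.hab], by rw [map_mul, h.hx, h.hy, baseR]⟩

theorem dvdP (h : Param a b p q) : ∃ g, X 0 * X 1 ∣ g ∧ toFPS g = baseP p q := by
  -- Since 1-x is a unit, this base is a power series multiple of xy.
  refine ⟨X a * X b * (1 - X a)⁻¹, by rw [X_mul_X h.hab]; exact Dvd.intro _ rfl, ?_⟩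
  rw [baseP, eq_div_iff h.gen.hx', ← h.hx, ← h.hy, ← map_one toFPS, ← map_sub, ← map_mul, ← map_mul,
    mul_assoc, MvPowerSeries.inv_mul_cancel _ (by simp), mul_one]

theorem two_le_order (_h : Param a b p q) : 2 ≤ (X a * X b : MvPowerSeries (Fin 2) ℚ).order := by
  have hX (a : Fin 2) : (1 : ℕ∞) ≤ (X a : MvPowerSeries (Fin 2) ℚ).order := by
    rw [one_le_order_iff_constCoeff_eq_zero]; simp
  exact le_trans (by norm_num) (le_trans (add_le_add (hX a) (hX b)) le_order_mul)

theorem plainSeq_small (h : Param a b p q) : XYSmall (plainSeq p q) := small_quad h.dvdG _ _ _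

theorem plainSeqOne_small (h : Param a b p q) : XYSmall (plainSeqOne p q) := (small_quad h.dvdG
    _ _ _).add (small_quad h.dvdP _ _ _)

theorem plainSeqTwo_small (h : Param a b p q) : XYSmall (plainSeqTwo p q) := (small_quad h.dvdG
    _ _ _).add (small_quad h.dvdP _ _ _)

theorem westSeq_small (h : Param a b p q) : XYSmall (westSeq p q) := (small_quad h.dvdG _ _
    _).add (small_quad h.dvdP _ _ _)

theorem westSeqOne_small (h : Param a b p q) : XYSmall (westSeqOne p q) := (small_quad h.dvdG _
    _ _).add (small_quad h.dvdP _ _ _)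

theorem westSeqZero_small (h : Param a b p q) : XYSmall (westSeqZero p q) := (small_quad h.dvdG
    _ _ _).add (small_quad h.dvdP _ _ _)

theorem twoSeq_small (h : Param a b p q) : XYSmall (twoSeq p q) := (small_quad h.dvdG _ _ _).add
    (small_quad h.dvdP _ _ _)

theorem twoDiff_small (h : Param a b p q) : XYSmall (twoDiff p q) := small_quad h.dvdG _ _ _

theorem twoDiffZero_small (h : Param a b p q) : XYSmall (twoDiffZero p q) := (small_quad h.dvdG
    _ _ _).add (small_quad h.dvdP _ _ _)

theorem plainSeqBoth_small (h : Param a b p q) : XYSmall (plainSeqBoth p q) := (((small_quad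
    h.dvdG _ _ _).add (small_quad h.dvdP _ _ _)).add (small_quad h.symm.dvdP _ _ _)).add
    (small_quad h.dvdR _ _ _)

theorem eastSeq_small (h : Param a b p q) : XYSmall (eastSeq p q) := (((small_quad h.dvdG _ _
    _).add (small_quad h.dvdP _ _ _)).add (small_quad h.symm.dvdP _ _ _)).add (small_quad h.dvdR
    _ _ _)

theorem eastSeqZero_small (h : Param a b p q) : XYSmall (eastSeqZero p q) := (((small_quad
    h.dvdG _ _ _).add (small_quad h.dvdP _ _ _)).add (small_quad h.symm.dvdP _ _ _)).add
    (small_quad h.dvdR _ _ _)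

theorem bothSeq_small (h : Param a b p q) : XYSmall (bothSeq p q) := (((small_quad h.dvdG _ _
    _).add (small_quad h.symm.dvdP _ _ _)).add (small_quad h.dvdP _ _ _)).add (small_quad h.dvdR
    _ _ _)

theorem bothDiff_small (h : Param a b p q) : XYSmall (bothDiff p q) := (small_quad h.dvdG _ _
    _).add (small_quad h.dvdP _ _ _)

theorem bothDiffDiff_small (h : Param a b p q) : XYSmall (bothDiffDiff p q) := small_quad h.dvdG
    _ _ _

/-- Both sides are small, agree at d = 0 and satisfy the same recursion. The identifications below
that are obtained by uniqueness use this scheme, with those already obtained as forcing terms. -/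
theorem Zs_eq (h : Param a b p q) (hd : 0 ≤ d) : Zs a b 0 d = plainSeq p q d := by
  refine XYSmall.unique (Zs_small h.hab 0) h.plainSeq_small ?_ (X a + X b) (1) (X a * X b)
    (by simp) h.two_le_order
    (fun d hd => ?_) d hd
  · rw [Zs, F20_zero_zero h.hab le_rfl]; simp [plainSeq, plainSeqG]
  · have r := Zs_rec h.hab (show 0 < d by omega) (e := 0) le_rfl
    have e := plainSeq_eq h.gen d
    simp only [map_add, map_mul, map_one, h.hx, h.hy] at r ⊢
    rw [max_eq_left (by norm_num)] at r
    linear_combination e - r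

theorem Zs_one_eq (h : Param a b p q) (hd : 0 ≤ d) : Zs a b 1 d = plainSeqOne p q d := by
  refine XYSmall.unique (Zs_small h.hab 1) h.plainSeqOne_small ?_ (X a) (0) (X a * X b)
    (by simp) h.two_le_order
    (fun d hd => ?_) d hd
  · rw [Zs, F20_zero_pos le_rfl one_pos]; simp [plainSeqOne, plainSeqOneG, plainSeqOneP]
  · have r := Zs_rec h.hab (show 0 < d by omega) (e := 1) zero_le_one
    have e := plainSeqOne_eq h.gen d
    simp only [map_mul, map_zero, h.hx, h.hy] at r ⊢
    rw [sub_self, max_self, h.Zs_eq (by omega), h.Zs_eq (by omega)] at r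
    linear_combination e - r

theorem Zs_two_eq (h : Param a b p q) (hd : 0 ≤ d) : Zs a b 2 d = plainSeqTwo p q d := by
  refine XYSmall.unique (Zs_small h.hab 2) h.plainSeqTwo_small ?_ (X a) (0) (X a * X b)
    (by simp) h.two_le_order
    (fun d hd => ?_) d hd
  · rw [Zs, F20_zero_pos le_rfl two_pos]; simp [plainSeqTwo, plainSeqTwoG, plainSeqTwoP]
  · have r := Zs_rec h.hab (show 0 < d by omega) (e := 2) zero_le_two
    have e := plainSeqTwo_eq h.gen d
    simp only [map_mul, map_zero, h.hx, h.hy] at r ⊢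
    rw [show max 0 ((2 : ℤ) - 1) = 1 by norm_num, h.Zs_one_eq (by omega),
      h.Zs_one_eq (by omega)] at r
    linear_combination e - r

theorem Ys_eq (h : Param a b p q) (hd : 0 ≤ d) : Ys a b 1 1 d = plainSeqBoth p q d := by
  refine XYSmall.unique (Ys_small h.hab 1 1) h.plainSeqBoth_small ?_ (0) (0) (X a * X b)
    (by simp) h.two_le_order
    (fun d hd => ?_) d hd
  · rw [Ys, F11_zero_pos le_rfl le_rfl (Or.inl one_pos)]; simp [plainSeqBoth, plainSeqBothG,
      plainSeqBothP, plainSeqBothQ, plainSeqBothR]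
  · have r := Ys_rec h.hab (show 0 < d by omega)
    have e := plainSeqBoth_eq h.gen d
    simp only [map_mul, map_zero, h.hx, h.hy] at r ⊢
    rw [h.Zs_eq (by omega), h.Zs_one_eq (by omega), h.symm.Zs_one_eq (by omega)] at r
    linear_combination e - r

theorem Ws_cand (h : Param a b p q) (hd : 0 ≤ d) : Ws a b 0 1 0 d = cand (0) (westSeq p q) d :=
    by
  refine XYSmall.unique (Φ := fun d => Ws a b 0 1 0 d) (Ws_small h.hab 0 1 0)
    (h.westSeq_small.cand _) ?_
    (X a + X b) (1) (X a * X b) (by simp) h.two_le_order (fun d hd => ?_) d hd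
  · simp (disch := norm_num) only [cand_of_nonpos, Ws_of_nonpos_right]
  · have r0 := Ws_rec h.hab (show 0 < d by omega)
    have e := westSeq_eq h.gen d
    simp only [map_add, map_mul, map_one, h.hx, h.hy] at r0 ⊢
    obtain rfl | rfl | hd : d = 1 ∨ d = 2 ∨ 3 ≤ d := by omega
    · simp (disch := norm_num) only [Int.reduceAdd, Int.reduceSub, Int.reduceNeg, Zs_of_neg,
        Ws_of_nonpos_right, cand_of_nonpos, cand_one, cand_of_two_le, h.Zs_eq, h.Zs_one_eq]
        at r0 e ⊢
      linear_combination e - r0 + westSeq_boundary h.gen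
    · simp (disch := norm_num) only [Int.reduceAdd, Int.reduceSub, cand_one, cand_of_two_le,
        h.Zs_eq, h.Zs_one_eq] at r0 e ⊢
      linear_combination e - r0
    · simp (disch := omega) only [cand_of_two_le, h.Zs_eq, h.Zs_one_eq] at r0 e ⊢
      linear_combination e - r0

theorem Ws_eq (h : Param a b p q) (hd : 1 ≤ d) : Ws a b 0 1 0 d = westSeq p q d := by
  rw [h.Ws_cand (by omega), cand_of_one_le hd]

theorem Ws_zero_cand (h : Param a b p q) (hd : 0 ≤ d) : Ws a b 0 0 0 d = cand (0) (westSeqZero p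
    q) d := by
  refine XYSmall.unique (Φ := fun d => Ws a b 0 0 0 d) (Ws_small h.hab 0 0 0)
    (h.westSeqZero_small.cand _) ?_
    (X b) (1) (0) (by simp) (by simp) (fun d hd => ?_) d hd
  · simp (disch := norm_num) only [cand_of_nonpos, Ws_of_nonpos_right]
  · have r0 := Ws_rec_zero h.hab (show 0 < d by omega)
    have e := westSeqZero_eq h.gen d
    simp only [map_one, map_zero, h.hx, h.hy] at r0 ⊢
    obtain rfl | rfl | hd : d = 1 ∨ d = 2 ∨ 3 ≤ d := by omega
    · simp (disch := norm_num) only [Int.reduceAdd, Int.reduceSub, Int.reduceNeg, Zs_of_neg,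
        Ws_of_nonpos_right, cand_of_nonpos, cand_one, cand_of_two_le, h.Zs_one_eq, h.Ws_eq]
        at r0 e ⊢
      linear_combination e - r0 + westSeq_boundary h.gen
    · simp (disch := norm_num) only [Int.reduceAdd, Int.reduceSub, cand_one, cand_of_two_le,
        h.Zs_one_eq, h.Ws_eq] at r0 e ⊢
      linear_combination e - r0
    · simp (disch := omega) only [cand_of_two_le, h.Zs_one_eq, h.Ws_eq]
        at r0 e ⊢
      linear_combination e - r0

theorem Ws_zero_eq (h : Param a b p q) (hd : 1 ≤ d) : Ws a b 0 0 0 d = westSeqZero p q d := by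
  rw [h.Ws_zero_cand (by omega), cand_of_one_le hd]

theorem Ws_one_cand (h : Param a b p q) (hd : 0 ≤ d) : Ws a b 0 1 1 d = cand (0) (westSeqOne p
    q) d := by
  refine XYSmall.unique (Φ := fun d => Ws a b 0 1 1 d) (Ws_small h.hab 0 1 1)
    (h.westSeqOne_small.cand _) ?_
    (X a) (0) (X a * X b) (by simp) h.two_le_order (fun d hd => ?_) d hd
  · simp (disch := norm_num) only [cand_of_nonpos, Ws_of_nonpos_right]
  · have r0 := Ws_rec_one h.hab (show 0 < d by omega)
    have e := westSeqOne_eq h.gen d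
    simp only [map_mul, map_zero, h.hx, h.hy] at r0 ⊢
    obtain rfl | rfl | hd : d = 1 ∨ d = 2 ∨ 3 ≤ d := by omega
    · simp (disch := norm_num) only [Int.reduceAdd, Int.reduceSub, Int.reduceNeg, Zs_of_neg,
        Ws_of_nonpos_right, cand_of_nonpos, cand_one, cand_of_two_le, h.Zs_eq, h.Zs_two_eq, h.Ws_eq]
        at r0 e ⊢
      linear_combination e - r0 + westSeqOne_boundary h.gen
    · simp (disch := norm_num) only [Int.reduceAdd, Int.reduceSub, cand_one, cand_of_two_le,
        h.Zs_eq, h.Zs_two_eq, h.Ws_eq] at r0 e ⊢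
      linear_combination e - r0
    · simp (disch := omega) only [cand_of_two_le, h.Zs_eq, h.Zs_two_eq, h.Ws_eq] at r0 e ⊢
      linear_combination e - r0

theorem Ws_one_eq (h : Param a b p q) (hd : 1 ≤ d) : Ws a b 0 1 1 d = westSeqOne p q d := by
  rw [h.Ws_one_cand (by omega), cand_of_one_le hd]

theorem Ws_neg_eq (h : Param a b p q) (hd : 1 ≤ d) : Ws a b (-1) 1 1 d = westSeqNeg p q d := by
  have r := Ws_rec_neg h.hab (show 0 < d by omega)
  have e := westSeqNeg_eq h.gen d
  simp only [h.hx, h.hy] at r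
  obtain rfl | hd := hd.eq_or_lt
  · simp (disch := norm_num) only [Int.reduceAdd, Int.reduceSub, Int.reduceNeg, Zs_of_neg,
      Ws_of_nonpos_right, h.Zs_two_eq, h.Ws_eq, h.Ws_one_eq] at r e
    linear_combination r - e - westSeqOne_boundary h.gen
  · simp (disch := omega) only [h.Zs_two_eq, h.Ws_eq, h.Ws_one_eq]
      at r e
    linear_combination r - e

/-- No uniqueness is needed, because the right side of the recursion contains only known sequences.
From d = 2 on their indices are positive; smaller d never follow an `nwn`. -/
theorem Ws_pos_eq (h : Param a b p q) (hd : 2 ≤ d) : Ws a b 1 1 0 d = westSeqPos p q d := by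
  have r := Ws_rec_pos h.hab (show 0 < d by omega)
  have e := westSeqPos_eq h.gen d
  simp only [h.hx, h.hy] at r
  simp (disch := omega) only [h.Zs_eq, h.Ws_eq] at r e
  linear_combination r - e

theorem Ws_pos_zero_eq (h : Param a b p q) (hd : 2 ≤ d) : Ws a b 1 0 0 d = westSeqPosZero p q
    d := by
  have r := Ws_rec_pos_zero h.hab (show 0 < d by omega)
  have e := westSeqPosZero_eq h.gen d
  simp only [h.hx, h.hy] at r
  simp (disch := omega) only [h.Ws_eq, h.Ws_zero_eq] at r e
  linear_combination r - e

theorem Us_cand (h : Param a b p q) (hd : 0 ≤ d) : Us a b 2 d = cand (twoEps p q) (twoSeq p q) d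
    := by
  refine XYSmall.unique (Φ := fun d => Us a b 2 d) (Us_small h.hab 2) (h.twoSeq_small.cand _) ?_
    (X a + X b) (1) (X a * X b) (by simp) h.two_le_order (fun d hd => ?_) d hd
  · simp (disch := norm_num) only [cand_of_nonpos, Us_of_nonpos]
  · have r0 := Us_rec h.hab (show 0 < d by omega)
    have e := twoSeq_eq h.gen d
    simp only [map_add, map_mul, map_one, h.hx, h.hy] at r0 ⊢
    obtain rfl | rfl | hd : d = 1 ∨ d = 2 ∨ 3 ≤ d := by omega
    · simp (disch := norm_num) only [Int.reduceAdd, Int.reduceSub, Int.reduceNeg, if_true,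
        Zs_of_neg, Ws_of_nonpos_right, Us_of_nonpos, cand_of_nonpos, cand_one, cand_of_two_le,
        h.Zs_eq, h.Zs_two_eq, h.Ws_pos_eq] at r0 e ⊢
      linear_combination e - r0 + twoSeq_boundary_one h.gen
    · simp (disch := norm_num) only [Int.reduceAdd, Int.reduceSub, Int.reduceNeg,
        OfNat.ofNat_ne_one, if_false, Zs_of_neg, Ws_of_nonpos_right, cand_one, cand_of_two_le,
        h.Zs_eq, h.Zs_two_eq, h.Ws_neg_eq, h.Ws_pos_eq] at r0 e ⊢
      linear_combination e - r0 + twoSeq_boundary_two h.gen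
    · simp (disch := omega) only [if_neg (show d ≠ 1 by omega), Zs_of_neg, cand_of_two_le,
        h.Zs_eq, h.Zs_two_eq, h.Ws_neg_eq, h.Ws_pos_eq] at r0 e ⊢
      linear_combination e - r0

/-- Pieces that do not feel the wall cancel in the difference, and after `e` both distances from the
wall count as two. What remains of the homogeneous part comes from `n` alone. -/
theorem Us_diff_cand (h : Param a b p q) (hd : 0 ≤ d) : (Us a b 2 d - Us a b 1 d) = cand (0)
    (twoDiff p q) d := by
  refine XYSmall.unique (Φ := fun d => (Us a b 2 d - Us a b 1 d)) ((Us_small h.hab 2).sub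
    (Us_small h.hab 1)) (h.twoDiff_small.cand _) ?_
    (X b) (1) (0) (by simp) (by simp) (fun d hd => ?_) d hd
  · simp (disch := norm_num) only [cand_of_nonpos, Us_of_nonpos, sub_self]
  · have r0 := Us_rec h.hab (show 0 < d by omega)
    have r1 := Us_rec_one h.hab (show 0 < d by omega)
    have e := twoDiff_eq h.gen d
    simp only [map_one, map_zero, h.hx, h.hy] at r0 r1 ⊢
    obtain rfl | rfl | hd : d = 1 ∨ d = 2 ∨ 3 ≤ d := by omega
    · simp (disch := norm_num) only [Int.reduceAdd, Int.reduceSub, Int.reduceNeg, if_true,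
        Zs_of_neg, Ws_of_nonpos_right, Us_of_nonpos, cand_of_nonpos, cand_one, cand_of_two_le,
        h.Zs_eq, h.Zs_two_eq, h.Ws_pos_eq, h.Ws_pos_zero_eq] at r0 r1 e ⊢
      linear_combination e - r0 + r1
    · simp (disch := norm_num) only [Int.reduceAdd, Int.reduceSub, Int.reduceNeg,
        OfNat.ofNat_ne_one, if_false, Zs_of_neg, Ws_of_nonpos_right, cand_one, cand_of_two_le,
        h.Zs_eq, h.Zs_two_eq, h.Ws_neg_eq, h.Ws_pos_eq, h.Ws_pos_zero_eq] at r0 r1 e ⊢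
      linear_combination e - r0 + r1
    · simp (disch := omega) only [if_neg (show d ≠ 1 by omega), Zs_of_neg, cand_of_two_le,
        h.Zs_eq, h.Zs_two_eq, h.Ws_neg_eq, h.Ws_pos_eq, h.Ws_pos_zero_eq] at r0 r1 e ⊢
      linear_combination e - r0 + r1

theorem Us_diff_eq (h : Param a b p q) (hd : 1 ≤ d) : Us a b 2 d - Us a b 1 d = twoDiff p q d := by
  rw [h.Us_diff_cand (by omega), cand_of_one_le hd]

theorem Us_diff_zero_cand (h : Param a b p q) (hd : 0 ≤ d) : (Us a b 1 d - Us a b 0 d) = cand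
    (twoDiffZeroEps p q) (twoDiffZero p q) d := by
  refine XYSmall.unique (Φ := fun d => (Us a b 1 d - Us a b 0 d)) ((Us_small h.hab 1).sub
    (Us_small h.hab 0)) (h.twoDiffZero_small.cand _) ?_
    (X b) (1) (0) (by simp) (by simp) (fun d hd => ?_) d hd
  · simp (disch := norm_num) only [cand_of_nonpos, Us_of_nonpos, sub_self]
  · have r0 := Us_rec_one h.hab (show 0 < d by omega)
    have r1 := Us_rec_zero h.hab (show 0 < d by omega)
    have e := twoDiffZero_eq h.gen d
    simp only [map_one, map_zero, h.hx, h.hy] at r0 r1 ⊢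
    obtain rfl | rfl | hd : d = 1 ∨ d = 2 ∨ 3 ≤ d := by omega
    · simp (disch := norm_num) only [Int.reduceAdd, Int.reduceSub, Int.reduceNeg, if_true,
        Zs_of_neg, Ws_of_nonpos_right, Us_of_nonpos, cand_of_nonpos, cand_one, cand_of_two_le,
        h.Zs_eq, h.Zs_two_eq, h.Ws_pos_zero_eq] at r0 r1 e ⊢
      -- After the piece `e` the distances one and zero from the wall become two and one, so the
      -- previous difference enters as a forcing term.
      linear_combination e - r0 + r1 + twoDiffZero_boundary h.gen -
        p * (1 - q) * h.Us_diff_eq (d := 1) (by norm_num)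
    · simp (disch := norm_num) only [Int.reduceAdd, Int.reduceSub, Int.reduceNeg,
        OfNat.ofNat_ne_one, if_false, Zs_of_neg, Ws_of_nonpos_right, cand_one, cand_of_two_le,
        h.Zs_eq, h.Zs_two_eq, h.Ws_neg_eq, h.Ws_pos_zero_eq] at r0 r1 e ⊢
      linear_combination e - r0 + r1 -
        p * (1 - q) * h.Us_diff_eq (d := 2) (by norm_num) -
        p * (1 - q) * (q * (1 - p)) * h.Us_diff_eq (d := 1) (by norm_num)
    · simp (disch := omega) only [if_neg (show d ≠ 1 by omega), Zs_of_neg, cand_of_two_le,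
        h.Zs_eq, h.Zs_two_eq, h.Ws_neg_eq, h.Ws_pos_zero_eq] at r0 r1 e ⊢
      linear_combination e - r0 + r1 -
        p * (1 - q) * h.Us_diff_eq (d := d) (by omega) -
        p * (1 - q) * (q * (1 - p)) * h.Us_diff_eq (d := d - 1) (by omega)

theorem Rs_cand (h : Param a b p q) (hd : 0 ≤ d) : Rs a b 1 1 d = cand (0) (eastSeq p q) d := by
  refine XYSmall.unique (Φ := fun d => Rs a b 1 1 d) (Rs_small h.hab 1 1)
    (h.eastSeq_small.cand _) ?_
    (X b) (0) (X a * X b) (by simp) h.two_le_order (fun d hd => ?_) d hd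
  · simp (disch := norm_num) only [cand_of_nonpos, Rs_of_nonpos]
  · have r0 := Rs_rec h.hab (show 0 < d by omega)
    have e := eastSeq_eq h.gen d
    simp only [map_mul, map_zero, h.hx, h.hy] at r0 ⊢
    obtain rfl | rfl | hd : d = 1 ∨ d = 2 ∨ 3 ≤ d := by omega
    · simp (disch := norm_num) only [Int.reduceAdd, Int.reduceSub, Int.reduceNeg, Ys_of_neg,
        Rs_of_nonpos, cand_of_nonpos, cand_one, cand_of_two_le, h.Zs_eq, h.Zs_one_eq,
        h.symm.Zs_one_eq, h.Ws_eq] at r0 e ⊢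
      linear_combination e - r0 + eastSeq_boundary h.gen
    · simp (disch := norm_num) only [Int.reduceAdd, Int.reduceSub, cand_one, cand_of_two_le,
        h.Zs_eq, h.Zs_one_eq, h.symm.Zs_one_eq, h.Ys_eq, h.Ws_eq] at r0 e ⊢
      linear_combination e - r0
    · simp (disch := omega) only [cand_of_two_le, h.Zs_eq, h.Zs_one_eq, h.symm.Zs_one_eq, h.Ys_eq,
        h.Ws_eq] at r0 e ⊢
      linear_combination e - r0

theorem Rs_eq (h : Param a b p q) (hd : 1 ≤ d) : Rs a b 1 1 d = eastSeq p q d := by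
  rw [h.Rs_cand (by omega), cand_of_one_le hd]

theorem Rs_zero_cand (h : Param a b p q) (hd : 0 ≤ d) : Rs a b 0 1 d = cand (0) (eastSeqZero p
    q) d := by
  refine XYSmall.unique (Φ := fun d => Rs a b 0 1 d) (Rs_small h.hab 0 1)
    (h.eastSeqZero_small.cand _) ?_
    (X b) (0) (0) (by simp) (by simp) (fun d hd => ?_) d hd
  · simp (disch := norm_num) only [cand_of_nonpos, Rs_of_nonpos]
  · have r0 := Rs_rec_zero h.hab (show 0 < d by omega)
    have e := eastSeqZero_eq h.gen d
    simp only [map_zero, h.hx, h.hy] at r0 ⊢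
    obtain rfl | rfl | hd : d = 1 ∨ d = 2 ∨ 3 ≤ d := by omega
    · simp (disch := norm_num) only [Int.reduceAdd, Int.reduceSub, Int.reduceNeg, Ys_of_neg,
        Rs_of_nonpos, cand_of_nonpos, cand_one, cand_of_two_le, h.Zs_one_eq, h.Ws_eq, h.Ws_zero_eq]
        at r0 e ⊢
      linear_combination e - r0 + eastSeq_boundary h.gen
    · simp (disch := norm_num) only [Int.reduceAdd, Int.reduceSub, cand_one, cand_of_two_le,
        h.Zs_one_eq, h.Ys_eq, h.Ws_eq, h.Ws_zero_eq, h.Rs_eq] at r0 e ⊢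
      linear_combination e - r0
    · simp (disch := omega) only [cand_of_two_le, h.Zs_one_eq, h.Ys_eq, h.Ws_eq, h.Ws_zero_eq,
        h.Rs_eq]
        at r0 e ⊢
      linear_combination e - r0

theorem Rs_zero_eq (h : Param a b p q) (hd : 1 ≤ d) : Rs a b 0 1 d = eastSeqZero p q d := by
  rw [h.Rs_zero_cand (by omega), cand_of_one_le hd]

theorem Hs_cand (h : Param a b p q) (hd : 0 ≤ d) : Hs a b 1 1 d = cand (p * q) (bothSeq p q) d
    := by
  refine XYSmall.unique (Φ := fun d => Hs a b 1 1 d) (Hs_small h.hab 1 1)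
    (h.bothSeq_small.cand _) ?_
    (X a + X b) (1) (X a * X b) (by simp) h.two_le_order (fun d hd => ?_) d hd
  · simp (disch := norm_num) only [cand_of_nonpos, Hs_of_nonpos]
  · have r0 := Hs_rec_1_1 h.hab (show 0 < d by omega)
    have e := bothSeq_eq h.gen d
    simp only [map_add, map_mul, map_one, h.hx, h.hy] at r0 ⊢
    obtain rfl | rfl | hd : d = 1 ∨ d = 2 ∨ 3 ≤ d := by omega
    · simp (disch := norm_num) only [Int.reduceAdd, Int.reduceSub, Int.reduceNeg, if_true,
        Ys_of_neg, Rs_of_nonpos, Hs_of_nonpos, cand_of_nonpos, cand_one, cand_of_two_le, h.Zs_eq,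
        h.Zs_one_eq, h.symm.Zs_one_eq, h.Ws_eq, h.symm.Ws_eq] at r0 e ⊢
      linear_combination e - r0 + bothSeq_boundary_one h.gen
    · simp (disch := norm_num) only [Int.reduceAdd, Int.reduceSub, Int.reduceNeg,
        OfNat.ofNat_ne_one, if_false, Ys_of_neg, Rs_of_nonpos, cand_one, cand_of_two_le, h.Zs_eq,
        h.Zs_one_eq, h.symm.Zs_one_eq, h.Ws_eq, h.Rs_eq, h.symm.Ws_eq, h.symm.Rs_eq] at r0 e ⊢
      linear_combination e - r0 + bothSeq_boundary_two h.gen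
    · simp (disch := omega) only [if_neg (show d ≠ 1 by omega), Zs_of_neg, cand_of_two_le,
        h.Zs_eq, h.Zs_one_eq, h.symm.Zs_one_eq, h.Ys_eq, h.Ws_eq, h.Rs_eq, h.symm.Ws_eq,
        h.symm.Rs_eq]
        at r0 e ⊢
      linear_combination e - r0

theorem Hs_diff_cand (h : Param a b p q) (hd : 0 ≤ d) : (Hs a b 1 1 d - Hs a b 1 0 d) = cand
    (bothDiffEps p q) (bothDiff p q) d := by
  refine XYSmall.unique (Φ := fun d => (Hs a b 1 1 d - Hs a b 1 0 d)) ((Hs_small h.hab 1 1).sub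
    (Hs_small h.hab 1 0)) (h.bothDiff_small.cand _) ?_
    (X a) (1) (0) (by simp) (by simp) (fun d hd => ?_) d hd
  · simp (disch := norm_num) only [cand_of_nonpos, Hs_of_nonpos, sub_self]
  · have r0 := Hs_rec_1_1 h.hab (show 0 < d by omega)
    have r1 := Hs_rec_1_0 h.hab (show 0 < d by omega)
    have e := bothDiff_eq h.gen d
    simp only [map_one, map_zero, h.hx, h.hy] at r0 r1 ⊢
    obtain rfl | rfl | hd : d = 1 ∨ d = 2 ∨ 3 ≤ d := by omega
    · simp (disch := norm_num) only [Int.reduceAdd, Int.reduceSub, if_true, Ys_of_neg, Rs_of_nonpos,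
        Hs_of_nonpos, cand_of_nonpos, cand_one, cand_of_two_le, h.Zs_eq, h.Zs_one_eq,
        h.symm.Zs_one_eq, h.Ws_eq, h.symm.Ws_eq, h.symm.Ws_zero_eq] at r0 r1 e ⊢
      linear_combination e - r0 + r1 + bothDiff_boundary h.gen
    · simp (disch := norm_num) only [Int.reduceAdd, Int.reduceSub, OfNat.ofNat_ne_one, if_false,
        Ys_of_neg, Rs_of_nonpos, cand_one, cand_of_two_le, h.Zs_eq, h.Zs_one_eq, h.symm.Zs_one_eq,
        h.Ws_eq, h.Rs_eq, h.symm.Ws_eq, h.symm.Ws_zero_eq, h.symm.Rs_eq, h.symm.Rs_zero_eq]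
        at r0 r1 e ⊢
      linear_combination e - r0 + r1
    · simp (disch := omega) only [if_neg (show d ≠ 1 by omega), Zs_of_neg, cand_of_two_le,
        h.Zs_eq, h.Zs_one_eq, h.symm.Zs_one_eq, h.Ys_eq, h.Ws_eq, h.Rs_eq, h.symm.Ws_eq,
        h.symm.Ws_zero_eq, h.symm.Rs_eq, h.symm.Rs_zero_eq]
        at r0 r1 e ⊢
      linear_combination e - r0 + r1

/-- In the mixed second difference over the western and the southern wall, only the pair of pieces
`n`, `e`, which moves away from neither wall, survives in the homogeneous part. -/
theorem Hs_diff_diff_cand (h : Param a b p q) (hd : 0 ≤ d) : (Hs a b 1 1 d - Hs a b 1 0 d - Hs a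
    b 0 1 d + Hs a b 0 0 d) = cand (0) (bothDiffDiff p q) d := by
  refine XYSmall.unique (Φ := fun d => (Hs a b 1 1 d - Hs a b 1 0 d - Hs a b 0 1 d + Hs a b 0 0 d))
    ((((Hs_small h.hab 1 1).sub (Hs_small h.hab 1 0)).sub (Hs_small h.hab 0 1)).add
      (Hs_small h.hab 0 0)) (h.bothDiffDiff_small.cand _) ?_
    (0) (1) (0) (by simp) (by simp) (fun d hd => ?_) d hd
  · simp (disch := norm_num) only [cand_of_nonpos, Hs_of_nonpos, sub_self, add_zero]
  · have r0 := Hs_rec_1_1 h.hab (show 0 < d by omega)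
    have r1 := Hs_rec_1_0 h.hab (show 0 < d by omega)
    -- The recursion for the remaining pair of wall distances is the reflected one.
    have r2 := Hs_rec_1_0 h.hab.symm (show 0 < d by omega)
    simp only [Hs_swap (a := b) (b := a), Ys_swap (a := b) (b := a)] at r2
    have r3 := Hs_rec_0_0 h.hab (show 0 < d by omega)
    have e := bothDiffDiff_eq h.gen d
    simp only [map_one, map_zero, h.hx, h.hy] at r0 r1 r2 r3 ⊢
    obtain rfl | rfl | hd : d = 1 ∨ d = 2 ∨ 3 ≤ d := by omega
    · simp (disch := norm_num) only [Int.reduceAdd, Int.reduceSub, if_true, Ys_of_neg, Rs_of_nonpos,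
        Hs_of_nonpos, cand_of_nonpos, cand_one, cand_of_two_le, h.Zs_eq, h.Zs_one_eq,
        h.symm.Zs_one_eq, h.Ws_eq, h.Ws_zero_eq, h.symm.Ws_eq, h.symm.Ws_zero_eq] at r0 r1 r2 r3 e ⊢
      linear_combination e - r0 + r1 + r2 - r3
    · simp (disch := norm_num) only [Int.reduceAdd, Int.reduceSub, OfNat.ofNat_ne_one, if_false,
        Ys_of_neg, Rs_of_nonpos, cand_one, cand_of_two_le, h.Zs_eq, h.Zs_one_eq, h.symm.Zs_one_eq,
        h.Ws_eq, h.Ws_zero_eq, h.Rs_eq, h.Rs_zero_eq, h.symm.Ws_eq, h.symm.Ws_zero_eq, h.symm.Rs_eq,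
        h.symm.Rs_zero_eq] at r0 r1 r2 r3 e ⊢
      linear_combination e - r0 + r1 + r2 - r3
    · simp (disch := omega) only [if_neg (show d ≠ 1 by omega), Zs_of_neg, cand_of_two_le,
        h.Zs_eq, h.Zs_one_eq, h.symm.Zs_one_eq, h.Ys_eq, h.Ws_eq, h.Ws_zero_eq, h.Rs_eq,
        h.Rs_zero_eq, h.symm.Ws_eq, h.symm.Ws_zero_eq, h.symm.Rs_eq, h.symm.Rs_zero_eq]
        at r0 r1 r2 r3 e ⊢
      linear_combination e - r0 + r1 + r2 - r3

end Param

/-! ### The square root of the discriminant and the parametrisation. -/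

/-- A power series with constant coefficient `1` has a square root with constant
coefficient `1`. -/
theorem exists_sq_eq {σ : Type*} (f : MvPowerSeries σ ℚ) (hf : constantCoeff f = 1) :
    ∃ s : MvPowerSeries σ ℚ, s ^ 2 = f ∧ constantCoeff s = 1 := by
  have ha : PowerSeries.HasSubst (f - 1) :=
    PowerSeries.HasSubst.of_constantCoeff_zero (by simp [hf])
  have h : ∃ s : MvPowerSeries σ ℚ, s ^ 2 = f := by
    -- The binomial series with exponent 1/2 squares to 1 + T; substituting T = f - 1 gives a root
    -- of f.
    refine ⟨(PowerSeries.binomialSeries ℚ (1 / 2 : ℚ)).subst (f - 1), ?_⟩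
    rw [sq, ← PowerSeries.subst_mul ha, ← PowerSeries.binomialSeries_add,
      show (1 / 2 + 1 / 2 : ℚ) = (1 : ℕ) by norm_num, PowerSeries.binomialSeries_nat, pow_one,
      PowerSeries.subst_add ha, PowerSeries.subst_X ha, ← PowerSeries.coe_substAlgHom ha, map_one]
    ring
  obtain ⟨s, hs⟩ := h
  have h1 : constantCoeff s ^ 2 = 1 := by rw [← map_pow, hs, hf]
  obtain h1 | h1 := eq_or_eq_neg_of_sq_eq_sq _ _ (h1.trans (one_pow 2).symm)
  · exact ⟨s, hs, h1⟩
  · exact ⟨-s, by rw [neg_sq, hs], by rw [map_neg, h1, neg_neg]⟩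

theorem toFPS_ne_zero_of_constantCoeff {f : MvPowerSeries (Fin 2) ℚ} (hf : constantCoeff f ≠ 0) :
    toFPS f ≠ 0 := by
  refine (map_ne_zero_iff toFPS toFPS_injective).mpr fun h => hf ?_
  rw [h, map_zero]

/-- The rational parametrisation attached to the square root of the discriminant. -/
theorem exists_param {s : MvPowerSeries (Fin 2) ℚ} (hs : s ^ 2 = discr (X 0) (X 1))
    (h1 : constantCoeff s = 1) : ∃ p q, Param 0 1 p q ∧ toFPS s = 1 - p - q := by
  -- G will be pq, the small root of the kernel, and then p = x + G and q = y + G are forced by x =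
  -- p(1-q) and y = q(1-p).
  obtain ⟨G, hG⟩ : ∃ G, 2 * G = 1 - X 0 - X 1 - s := ⟨C (1 / 2) * (1 - X 0 - X 1 - s), by
    rw [← mul_assoc, show (2 : MvPowerSeries (Fin 2) ℚ) = C 2 from rfl, ← map_mul]
    norm_num⟩
  have hcG : constantCoeff G = 0 := by
    have := congrArg constantCoeff hG
    rw [map_mul, map_ofNat] at this
    simpa [h1] using this
  have hGG : G * (1 - X 0 - X 1 - G) = X 0 * X 1 := by
    have h4 : (4 : MvPowerSeries (Fin 2) ℚ) ≠ 0 := by norm_num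
    refine mul_left_cancel₀ h4 ?_
    rw [discr] at hs
    linear_combination (2 * (1 - X 0 - X 1) - 2 * G - (1 - X 0 - X 1 - s)) * hG - hs
  have hpq : (X 0 + G) * (X 1 + G) = G := by linear_combination -hGG
  have hX : (X 0 + G) * (1 - (X 1 + G)) = X 0 := by linear_combination hGG
  have hY : (X 1 + G) * (1 - (X 0 + G)) = X 1 := by linear_combination hGG
  have hu : constantCoeff (1 - X 0 - X 1 - G : MvPowerSeries (Fin 2) ℚ) ≠ 0 := by simp [hcG]
  -- The complementary root is a unit, so the product equation of the two roots shows divisibility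
  -- by xy.
  have hd : X 0 * X 1 ∣ G := ⟨(1 - X 0 - X 1 - G)⁻¹, by
    rw [← hGG, mul_assoc, MvPowerSeries.mul_inv_cancel _ hu, mul_one]⟩
  have hX' := congrArg toFPS hX
  have hY' := congrArg toFPS hY
  simp only [map_mul, map_sub, map_one] at hX' hY'
  have hXne : toFPS (X 0 + G) * (1 - toFPS (X 1 + G)) ≠ 0 := hX' ▸ toFPS_X_ne_zero 0
  have hYne : toFPS (X 1 + G) * (1 - toFPS (X 0 + G)) ≠ 0 := hY' ▸ toFPS_X_ne_zero 1
  have hs' : toFPS s = 1 - toFPS (X 0 + G) - toFPS (X 1 + G) := by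
    rw [← map_one toFPS, ← map_sub, ← map_sub]
    congr 1
    linear_combination hG
  refine ⟨toFPS (X 0 + G), toFPS (X 1 + G), ⟨by decide, hX'.symm, hY'.symm,
    ⟨left_ne_zero_of_mul hXne, left_ne_zero_of_mul hYne, right_ne_zero_of_mul hYne,
      right_ne_zero_of_mul hXne, ?_, ?_, ?_, ?_⟩, G, hd, by rw [← map_mul, hpq]⟩, hs'⟩
  · rw [← hs']
    exact toFPS_ne_zero_of_constantCoeff (by simp [h1])
  · rw [hX', ← map_one toFPS, ← map_sub]
    exact toFPS_ne_zero_of_constantCoeff (by simp)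
  · rw [hY', ← map_one toFPS, ← map_sub]
    exact toFPS_ne_zero_of_constantCoeff (by simp)
  · rw [mul_assoc, ← map_mul, hpq, ← hs', show (2 : FPS) = toFPS 2 from (map_ofNat _ _).symm,
      ← map_mul, ← map_add]
    exact toFPS_ne_zero_of_constantCoeff (by simp [h1, hcG])

/-! ### Comparison with the polynomials A and B. -/

section

variable {R : Type*} [CommRing R]

/-- The numerator of the generating function of the pairs of words of types `2` and `0`, in
terms of `s = 1 - p - q` and `m = p q`. -/
def startTwoNum (s m : R) : R := (s ^ 3 - 3 * s ^
    4 + 3 * s ^ 5 - s ^ 6) + (9 * s ^ 2 - 25 * s ^ 3 + 23 * s ^ 4 - s ^ 5 - 5 * s ^ 6 + s ^ 7) *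
    m + (16 * s - 82 * s ^ 2 + 63 * s ^ 3 + 18 * s ^ 4 - 29 * s ^ 5 - 3 * s ^ 6) * m ^ 2 + (4 -
    99 * s + 112 * s ^ 2 + 101 * s ^ 3 - 38 * s ^ 4 - 18 * s ^ 5) * m ^ 3 + (-22 + 120 * s + 183
    * s ^ 2 + 9 * s ^ 3 - 22 * s ^ 4) * m ^ 4 + (24 + 99 * s + 18 * s ^ 2 - 12 * s ^ 3) * m ^ 5
    + (18 - 4 * s ^ 2) * m ^ 6

/-- The numerator of the generating function of the pairs of words of types `1` and `1`, in
terms of `s = 1 - p - q` and `m = p q`. -/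
def startBothNum (s m : R) : R := (2 * s ^ 5 - 6
    * s ^ 6 + 6 * s ^ 7 - 2 * s ^ 8) + (30 * s ^ 4 - 71 * s ^ 5 + 52 * s ^ 6 - 10 * s ^ 8 + s ^
    10) * m + (105 * s ^ 3 - 329 * s ^ 4 + 129 * s ^ 5 + 101 * s ^ 6 - 77 * s ^ 7 - 33 * s ^ 8 -
    s ^ 9 - s ^ 10) * m ^ 2 + (148 * s ^ 2 - 738 * s ^ 3 + 114 * s ^ 4 + 659 * s ^ 5 - 63 * s ^
    6 - 168 * s ^ 7 - 40 * s ^ 8 - 11 * s ^ 9 - s ^ 10) * m ^ 3 + (88 * s - 830 * s ^ 2 + 53 * s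
    ^ 3 + 1976 * s ^ 4 + 724 * s ^ 5 - 200 * s ^ 6 - 118 * s ^ 7 - 36 * s ^ 8 - 5 * s ^ 9) * m ^
    4 + (16 - 432 * s + 82 * s ^ 2 + 3097 * s ^ 3 + 2378 * s ^ 4 + 298 * s ^ 5 - 107 * s ^ 6 -
    52 * s ^ 7 - 10 * s ^ 8) * m ^ 5 + (-72 + 78 * s + 2561 * s ^ 2 + 3194 * s ^ 3 + 1006 * s ^
    4 + 47 * s ^ 5 - 32 * s ^ 6 - 10 * s ^ 7) * m ^ 6 + (12 + 1022 * s + 2159 * s ^ 2 + 1065 * s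
    ^ 3 + 151 * s ^ 4 - 5 * s ^ 6) * m ^ 7 + (146 + 720 * s + 548 * s ^ 2 + 98 * s ^ 3 + 9 * s ^
    4 - s ^ 5) * m ^ 8 + (96 + 144 * s + 21 * s ^ 2 + 3 * s ^ 3) * m ^ 9 + (18) * m ^ 10

/-- The polynomial `polyA x y` in terms of `u = x + y` and `v = x y`. -/
def symmPolyA (u v : R) : R :=
  (u ^ 4 - 9 * u ^ 5 + 36 * u ^ 6 - 84 * u ^ 7 + 126 * u ^ 8 - 126 * u ^ 9 + 84 * u ^ 10 - 36 *
    u ^ 11 + 9 * u ^ 12 - u ^ 13) + (-4 * u ^ 2 + 36 * u ^ 3 - 135 * u ^ 4 + 270 * u ^ 5 - 294 *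
    u ^ 6 + 126 * u ^ 7 + 84 * u ^ 8 - 150 * u ^ 9 + 90 * u ^ 10 - 26 * u ^ 11 + 3 * u ^ 12) * v
    + (6 - 46 * u + 113 * u ^ 2 + 20 * u ^ 3 - 677 * u ^ 4 + 1583 * u ^ 5 - 1831 * u ^ 6 + 1147
    * u ^ 7 - 325 * u ^ 8 - 13 * u ^ 9 + 26 * u ^ 10 - 3 * u ^ 11) * v ^ 2 + (44 - 361 * u +
    1206 * u ^ 2 - 2014 * u ^ 3 + 1494 * u ^ 4 + 208 * u ^ 5 - 1183 * u ^ 6 + 768 * u ^ 7 - 154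
    * u ^ 8 - 9 * u ^ 9 + u ^ 10) * v ^ 3 + (36 - 410 * u + 1635 * u ^ 2 - 3059 * u ^ 3 + 2764 *
    u ^ 4 - 905 * u ^ 5 - 216 * u ^ 6 + 156 * u ^ 7 - u ^ 8) * v ^ 4 + (-100 + 246 * u + 271 * u
    ^ 2 - 1232 * u ^ 3 + 1142 * u ^ 4 - 293 * u ^ 5 - 35 * u ^ 6 + u ^ 7) * v ^ 5 + (-182 + 494
    * u - 348 * u ^ 2 - 71 * u ^ 3 + 115 * u ^ 4 - 8 * u ^ 5) * v ^ 6 + (-68 + 133 * u - 83 * u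
    ^ 2 + 18 * u ^ 3) * v ^ 7 + (-8 * u) * v ^ 8

/-- The polynomial `polyB x y` in terms of `u = x + y` and `v = x y`. -/
def symmPolyB (u v : R) : R :=
  (u ^ 4 - 9 * u ^ 5 + 36 * u ^ 6 - 84 * u ^ 7 + 126 * u ^ 8 - 126 * u ^ 9 + 84 * u ^ 10 - 36 *
    u ^ 11 + 9 * u ^ 12 - u ^ 13) + (-4 * u ^ 2 + 36 * u ^ 3 - 143 * u ^ 4 + 328 * u ^ 5 - 476 *
    u ^ 6 + 448 * u ^ 7 - 266 * u ^ 8 + 88 * u ^ 9 - 8 * u ^ 10 - 4 * u ^ 11 + u ^ 12) * v + (6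
    - 46 * u + 145 * u ^ 2 - 212 * u ^ 3 + 574 * u ^ 5 - 1064 * u ^ 6 + 960 * u ^ 7 - 458 * u ^
    8 + 100 * u ^ 9 - 5 * u ^ 10) * v ^ 2 + (-4 - 77 * u + 742 * u ^ 2 - 2500 * u ^ 3 + 4321 * u
    ^ 4 - 4094 * u ^ 5 + 1954 * u ^ 6 - 290 * u ^ 7 - 53 * u ^ 8 + u ^ 9) * v ^ 3 + (-190 + 1292
    * u - 3536 * u ^ 2 + 4549 * u ^ 3 - 2285 * u ^ 4 - 299 * u ^ 5 + 483 * u ^ 6 - 14 * u ^ 7) *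
    v ^ 4 + (356 - 995 * u + 65 * u ^ 2 + 1827 * u ^ 3 - 1325 * u ^ 4 + 72 * u ^ 5) * v ^ 5 +
    (324 - 1388 * u + 1248 * u ^ 2 - 160 * u ^ 3) * v ^ 6 + (-112 + 128 * u) * v ^ 7

/-- A is symmetric in x and y although it is not written so; elementary symmetric functions keep the
later expansions small. -/
theorem polyA_eq (x y : R) : polyA x y = symmPolyA (x + y) (x * y) := by
  simp only [polyA, symmPolyA]
  ring

theorem polyB_eq (x y : R) : polyB x y = symmPolyB (x + y) (x * y) := by
  simp only [polyB, symmPolyB]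
  ring

-- Here u = x+y and m = pq, so that xy = m(1-u-m), the square root of Δ is 1-u-2m, and (1-x)(1-y) =
-- 1-u+xy. The whole comparison becomes an identity of polynomials in these two variables.
set_option maxRecDepth 20000 in
set_option maxHeartbeats 2000000 in
theorem symmPolyA_sub_symmPolyB (u m : R) :
    symmPolyA u (m * (1 - u - m)) * (1 - u - 2 * m) ^ 3 - symmPolyB u (m * (1 - u - m)) *
      ((1 - u + m * (1 - u - m)) ^ 2 * (1 - u)) =
    2 * m ^ 6 * (2 * (startTwoNum (1 - u - 2 * m) m *
      ((1 - u - m) * (1 - u + m * (1 - u - m)) ^ 2)) + startBothNum (1 - u - 2 * m) m * (1 - u)) := by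
  simp only [symmPolyA, symmPolyB, startTwoNum, startBothNum]
  ring

theorem polyA_sub_polyB (p q : R) :
    polyA (p * (1 - q)) (q * (1 - p)) * (1 - p - q) ^ 3 -
      polyB (p * (1 - q)) (q * (1 - p)) * ((1 - p * (1 - q)) ^ 2 * (1 - q * (1 - p)) ^ 2 *
        (1 - p - q + 2 * p * q)) =
    2 * p ^ 6 * q ^ 6 * (2 * (startTwoNum (1 - p - q) (p * q) * ((1 - p) * (1 - q) *
      (1 - p * (1 - q)) ^ 2 * (1 - q * (1 - p)) ^ 2)) +
      startBothNum (1 - p - q) (p * q) * (1 - p - q + 2 * p * q)) := by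
  have key := symmPolyA_sub_symmPolyB (p * (1 - q) + q * (1 - p)) (p * q)
  rw [show 1 - (p * (1 - q) + q * (1 - p)) - 2 * (p * q) = 1 - p - q by ring,
    show p * q * (1 - (p * (1 - q) + q * (1 - p)) - p * q) = p * (1 - q) * (q * (1 - p)) by ring,
    ← polyA_eq, ← polyB_eq] at key
  generalize polyA (_ : R) _ = A at *
  generalize polyB (_ : R) _ = B at *
  generalize startTwoNum (_ : R) _ = U at *
  generalize startBothNum (_ : R) _ = H at *
  linear_combination key

end

section

variable {F : Type*} [Field F] [CharZero F] {p q : F}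

-- This evaluates the telescoping from wall distance two down to zero at d = 1, including the
-- corrections there. The result is symmetric in p and q, so both orders of the two paths contribute
-- the same series.
set_option maxRecDepth 8000 in
set_option maxHeartbeats 4000000 in
theorem startTwo (h : Generic p q) : twoSeq p q 1 + twoEps p q - twoDiff p q 1 - (twoDiffZero p
    q 1 + twoDiffZeroEps p q) = startTwoNum (1 - p - q) (p * q) * p ^ 2 * q ^ 2 / ((1 - p) ^ 3 *
    (1 - q) ^ 3 * (1 - p - q) ^ 3 * (1 - p * (1 - q)) * (1 - q * (1 - p)) * (1 - p - q + 2 * p *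
    q)) := by
  obtain ⟨h₁, h₂, h₃, h₄, h₅, h₆, h₇, h₈⟩ := id h
  simp only [twoSeq, twoSeqG, twoSeqG0, twoSeqG1, twoSeqG2, twoSeqP, twoDiff, twoDiffG, twoDiffZero,
    twoDiffZeroG, twoDiffZeroP, twoEps, twoDiffZeroEps, startTwoNum, Int.cast_one, zpow_one, baseG,
    baseP]
  obtain ⟨t, ht⟩ : ∃ t, t = 1 - p - q + 2 * p * q := ⟨_, rfl⟩
  rw [← ht] at h₈ ⊢
  field_simp
  rw [ht]
  ring

-- The corresponding evaluation for one backward step on each path: the value at the corner of the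
-- two walls is recovered from first and mixed second differences.
set_option maxRecDepth 8000 in
set_option maxHeartbeats 4000000 in
theorem startBoth (h : Generic p q) : bothSeq p q 1 + p * q - (bothDiff p q 1 + bothDiffEps p q)
    - (bothDiff q p 1 + bothDiffEps q p) + bothDiffDiff p q 1 = startBothNum (1 - p - q) (p * q)
    * p ^ 2 * q ^ 2 / ((1 - p) ^ 4 * (1 - q) ^ 4 * (1 - p - q) ^ 3 * (1 - p * (1 - q)) ^ 3 * (1
    - q * (1 - p)) ^ 3) := by
  obtain ⟨h₁, h₂, h₃, h₄, h₅, h₆, h₇, h₈⟩ := id h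
  simp only [bothSeq, bothSeqG, bothSeqG0, bothSeqG1, bothSeqG2, bothSeqQ, bothSeqP, bothSeqR,
    bothDiff, bothDiffG, bothDiffP, bothDiffDiff, bothDiffDiffG, bothDiffEps, startBothNum,
    Int.cast_one, zpow_one, baseG, baseP, baseR]
  simp only [sub_right_comm 1 q p]
  field_simp
  ring

theorem polyA_div_sub_polyB_div (h : Generic p q) {x y s : F} (hx : x = p * (1 - q))
    (hy : y = q * (1 - p)) (hs : s = 1 - p - q) :
    polyA x y / (2 * x ^ 4 * y ^ 4 * (1 - x) ^ 3 * (1 - y) ^ 3 * (1 - x - y)) -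
      polyB x y / (2 * x ^ 4 * y ^ 4 * (1 - x) * (1 - y) * s ^ 3) =
    2 * (startTwoNum s (p * q) * p ^ 2 * q ^ 2 / ((1 - p) ^ 3 * (1 - q) ^ 3 * (1 - p - q) ^ 3 *
      (1 - p * (1 - q)) * (1 - q * (1 - p)) * (1 - p - q + 2 * p * q))) +
      startBothNum s (p * q) * p ^ 2 * q ^ 2 / ((1 - p) ^ 4 * (1 - q) ^ 4 * (1 - p - q) ^ 3 *
        (1 - p * (1 - q)) ^ 3 * (1 - q * (1 - p)) ^ 3) := by
  have key := polyA_sub_polyB p q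
  obtain ⟨h₁, h₂, h₃, h₄, h₅, h₆, h₇, h₈⟩ := h
  have ht : 1 - p - q + 2 * p * q = 1 - x - y := by rw [hx, hy]; ring
  rw [ht, ← hx, ← hy, ← hs] at key
  rw [← hs] at h₅
  rw [← hx] at h₆
  rw [← hy] at h₇
  have h₉ := h₈
  rw [ht] at h₉
  -- Only these powers need p and q explicitly; everything else can be made opaque, so that clearing
  -- fractions leaves exactly the polynomial identity.
  have hp : p ^ 4 * (1 - q) ^ 4 = x ^ 4 := by rw [hx]; ring
  have hq : q ^ 4 * (1 - p) ^ 4 = y ^ 4 := by rw [hy]; ring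
  rw [ht, ← hs, ← hx, ← hy, mul_assoc 2 (x ^ 4), ← hp, ← hq]
  generalize polyA x y = A at *
  generalize polyB x y = B at *
  generalize startTwoNum s (p * q) = U at *
  generalize startBothNum s (p * q) = H at *
  generalize 1 - x - y = t at *
  generalize 1 - x = x' at *
  generalize 1 - y = y' at *
  generalize 1 - p = p' at *
  generalize 1 - q = q' at *
  field_simp
  linear_combination key

end

/-! ### Confinement to the whole rectangle. -/

/-- The lower path lies below the upper one: the upper path of a pair does not leave the rectangle
to the south or east. -/
theorem Pair20.rect' {r : ℕ} {o x y X Y w h : ℤ} {u l : Wd} (hr : r ≤ 2)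
    (ho : o = 0 ∨ (o = 1 ∨ o = -1) ∧ r ≤ 1) (hx : x ≤ X) (hX : X + Y = x + y)
    (H : Pair20 r o x y X Y w h u l) : ∀ v ∈ verts x y u, v.1 ≤ w ∧ Y ≤ v.2 := by
  obtain ⟨n, hn⟩ : ∃ n, l.length = n := ⟨_, rfl⟩
  induction n generalizing r o x y X Y u l with
  | zero =>
    obtain rfl := List.length_eq_zero_iff.1 hn
    have h1 := H.lx
    have h2 := H.ly
    have h3 := H.ux
    have h4 := H.uy
    have hu : u = [] := by
      by_contra hu
      obtain ⟨m, u', rfl, hlev⟩ := H.reg.exists_firstStep hr hu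
      have h1 := hlev _ (end_mem_verts _ _ u')
      rw [dX_append, m.dX_word] at h3
      rw [dY_append, m.dY_word] at h4
      simp [dX, dY] at *; omega
    subst hu
    simp [verts, dX, dY] at *; omega
  | succ n ih =>
    obtain ⟨b, l', rfl, -⟩ := exists_fwd_cons H.plain (by rintro rfl; simp at hn)
    have hu : u ≠ [] := by
      rintro rfl
      have h1 := length_eq (fwd b :: l')
      have h2 := H.ux
      have h3 := H.lx
      have h4 := H.uy
      have h5 := H.ly
      rw [H.plain] at h1
      simp [dX, dY] at h1 h2 h4; omega
    have hxX : x < X := by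
      refine hx.lt_of_ne ?_
      rintro rfl
      obtain rfl : Y = y := by omega
      exact hu (Pair20.eq_nil H).1
    obtain ⟨m, u', rfl, hlev⟩ := H.reg.exists_firstStep hr hu
    obtain ⟨hg, H'⟩ := (Pair20.block hr ho hxX hX hlev).1 H
    obtain ⟨g1, g2, g3, g4, g5⟩ := hg
    have hfx : fx b = 0 ∨ fx b = 1 := by cases b <;> simp [fx]
    have hlo : 0 ≤ m.lo := by cases m <;> simp [Macro.lo]
    -- The distance bound of the transfer step keeps the remainders in the right order, so the
    -- induction applies to them; the piece itself is handled by its list of vertices.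
    have key := ih (by omega) (by cases m <;> simp [Macro.ob, Macro.cost] at g1 ⊢ <;> omega)
      (by omega) (by omega) H' (by simpa using hn)
    have hw : X + fx b ≤ w := by
      have h1 := dX_nonneg H'.plain
      have h2 := H'.lx
      omega
    rw [m.verts_word_append]
    intro v hv
    rcases List.mem_append.1 hv with hv | hv
    · obtain ⟨a, c⟩ := v
      cases m <;> simp [Macro.pre, Macro.lo, Macro.dx] at hv g5 ⊢ <;> omega
    · have := key v hv
      omega

/-- The paths of a pair do not leave the rectangle. -/
theorem Pair11.rect' {r s : ℕ} {c c' : Prop} {x y X Y w h : ℤ} {u l : Wd} (hr : r ≤ 1) (hs : s ≤ 1)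
    (hc : c → x + 2 ≤ X) (hc' : c' → x + 2 ≤ X) (hx : x ≤ X) (hX : X + Y = x + y)
    (H : Pair11 r s c c' x y X Y w h u l) :
    (∀ v ∈ verts x y u, v.1 ≤ w ∧ 0 ≤ v.2) ∧ ∀ v ∈ verts X Y l, 0 ≤ v.1 ∧ v.2 ≤ h := by
  obtain ⟨n, hn⟩ : ∃ n, u.length = n := ⟨_, rfl⟩
  induction n using Nat.strong_induction_on generalizing r s c c' x y X Y u l with
  | _ n ih =>
  have hU := H.rectU
  have hL := H.rectL
  obtain hxX | rfl := hx.lt_or_eq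
  · have hul : u ≠ [] ∧ l ≠ [] := by
      by_contra hcon
      have h1 := H.ux
      have h2 := H.uy
      have h3 := H.lx
      have h4 := H.ly
      by_cases hu : u = []
      · by_cases hl : l = []
        · subst hu hl; simp [dX] at h1 h3; omega
        · obtain ⟨m, l', rfl, hlev⟩ := H.regL.exists_firstStep (by omega) hl
          have h5 := hlev _ (end_mem_verts _ _ l')
          rw [dX_append, m.dX_word] at h3
          rw [dY_append, m.dY_word] at h4
          subst hu; simp [dX, dY] at h1 h2 h5; omega
      · obtain rfl : l = [] := by by_contra hl; exact hcon ⟨hu, hl⟩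
        obtain ⟨m, u', rfl, hlev⟩ := H.regU.exists_firstStep (by omega) hu
        have h5 := hlev _ (end_mem_verts _ _ u')
        rw [dX_append, m.dX_word] at h1
        rw [dY_append, m.dY_word] at h2
        simp [dX, dY] at h3 h4 h5; omega
    obtain ⟨m, u', rfl, hlev⟩ := H.regU.exists_firstStep (by omega) hul.1
    obtain ⟨m', l', rfl, hlev'⟩ := H.regL.exists_firstStep (by omega) hul.2
    obtain ⟨⟨g1, g1', g2, g2', g3, g3', g4, g5, g5'⟩, H'⟩ :=
      (Pair11.block hr hs hc hc' hxX hX hlev hlev').1 H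
    have hm := Macro.eq_of_cost_le_one (g1.trans hr)
    have hm' := Macro.eq_of_cost_le_one (g1'.trans hs)
    have hlo : 0 ≤ Macro.lo₂ m m' := by
      rcases hm with rfl | rfl | rfl | rfl <;> rcases hm' with rfl | rfl | rfl | rfl <;>
        simp [Macro.lo₂]
    have hlen : 0 < m.word.length := by cases m <;> simp [Macro.word]
    obtain ⟨k1, k2⟩ := ih u'.length (by rw [← hn, List.length_append]; omega)
      (by omega) (by omega)
      (by rcases hm with rfl | rfl | rfl | rfl <;> rcases hm' with rfl | rfl | rfl | rfl <;>
            simp [Macro.lo₂, Macro.dx] at g4 ⊢ <;> omega)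
      (by rcases hm with rfl | rfl | rfl | rfl <;> rcases hm' with rfl | rfl | rfl | rfl <;>
            simp [Macro.lo₂, Macro.dx] at g4 ⊢ <;> omega) (by omega) (by omega) H' rfl
    have hP := hU (x + m.dx, y + 1 - m.dx) (by
      rw [m.verts_word_append]; exact List.mem_append_right _ (start_mem_verts _ _ _))
    have hQ := hL (X + m'.dx, Y + 1 - m'.dx) (by
      rw [m'.verts_word_append]; exact List.mem_append_right _ (start_mem_verts _ _ _))
    have hP' := hU _ (start_mem_verts _ _ _)
    have hQ' := hL _ (start_mem_verts _ _ _)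
    simp only at hP hQ hP' hQ'
    rw [m.verts_word_append, m'.verts_word_append]
    refine ⟨fun v hv => ?_, fun v hv => ?_⟩
    · rcases List.mem_append.1 hv with hv | hv
      · obtain ⟨a, c⟩ := v
        clear k1 k2 hU hL hlev hlev' ih
        rcases hm with rfl | rfl | rfl | rfl <;>
          simp [Macro.pre, Macro.dx] at hv hP hlo g4 ⊢ <;> omega
      · exact k1 v hv
    · rcases List.mem_append.1 hv with hv | hv
      · obtain ⟨a, c⟩ := v
        clear k1 k2 hU hL hlev hlev' ih
        rcases hm' with rfl | rfl | rfl | rfl <;>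
          simp [Macro.pre, Macro.dx] at hv hQ hlo g4 ⊢ <;> omega
      · exact k2 v hv
  · obtain rfl : Y = y := by omega
    obtain ⟨h1, h2⟩ := Prod.mk.inj (H.disj _ (start_mem_verts x Y u) (start_mem_verts x Y l))
    subst h1 h2
    obtain rfl := H.regU.eq_nil (by linarith [H.ux]) (by linarith [H.uy])
    obtain rfl := H.regL.eq_nil (by linarith [H.lx]) (by linarith [H.ly])
    have h1 := H.rectU _ (start_mem_verts _ _ _)
    have h2 := H.rectL _ (start_mem_verts _ _ _)
    simp [verts] at h1 h2 ⊢
    omega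

/-! ### Staircase polygons as pairs of words. -/

/-- The edges of the path that starts at `(x, y)` and follows the steps of a word. -/
def wedges (x y : ℤ) : Wd → List (Sym2 (ℤ × ℤ))
  | [] => []
  | Dir.E :: u => s((x, y), (x + 1, y)) :: wedges (x + 1) y u
  | Dir.N :: u => s((x, y), (x, y + 1)) :: wedges x (y + 1) u
  | Dir.W :: u => s((x, y), (x - 1, y)) :: wedges (x - 1) y u
  | Dir.S :: u => s((x, y), (x, y - 1)) :: wedges x (y - 1) u

theorem adj_E (x y : ℤ) : squareLattice.Adj (x, y) (x + 1, y) := by simp [squareLattice]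

theorem adj_N (x y : ℤ) : squareLattice.Adj (x, y) (x, y + 1) := by simp [squareLattice]

theorem adj_W (x y : ℤ) : squareLattice.Adj (x, y) (x - 1, y) := by simp [squareLattice]

theorem adj_S (x y : ℤ) : squareLattice.Adj (x, y) (x, y - 1) := by simp [squareLattice]

theorem exists_walk (u : Wd) (x y X Y : ℤ) (hX : x + dX u = X) (hY : y + dY u = Y) :
    ∃ p : squareLattice.Walk (x, y) (X, Y), p.support = verts x y u ∧ p.edges = wedges x y u := by
  induction u generalizing x y with
  | nil =>
    obtain rfl : x = X := by simpa [dX] using hX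
    obtain rfl : y = Y := by simpa [dY] using hY
    exact ⟨.nil, rfl, rfl⟩
  | cons s u ih =>
    cases s
    · obtain ⟨p, hp, hp'⟩ := ih (x + 1) y (by rw [← hX, dX]; ring) (by rw [← hY, dY])
      refine ⟨.cons (adj_E x y) p, ?_, ?_⟩
      · rw [SimpleGraph.Walk.support_cons, hp, verts]
      · rw [SimpleGraph.Walk.edges_cons, hp', wedges]
    · obtain ⟨p, hp, hp'⟩ := ih x (y + 1) (by rw [← hX, dX]) (by rw [← hY, dY]; ring)
      refine ⟨.cons (adj_N x y) p, ?_, ?_⟩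
      · rw [SimpleGraph.Walk.support_cons, hp, verts]
      · rw [SimpleGraph.Walk.edges_cons, hp', wedges]
    · obtain ⟨p, hp, hp'⟩ := ih (x - 1) y (by rw [← hX, dX]; ring) (by rw [← hY, dY])
      refine ⟨.cons (adj_W x y) p, ?_, ?_⟩
      · rw [SimpleGraph.Walk.support_cons, hp, verts]
      · rw [SimpleGraph.Walk.edges_cons, hp', wedges]
    · obtain ⟨p, hp, hp'⟩ := ih x (y - 1) (by rw [← hX, dX]) (by rw [← hY, dY]; ring)
      refine ⟨.cons (adj_S x y) p, ?_, ?_⟩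
      · rw [SimpleGraph.Walk.support_cons, hp, verts]
      · rw [SimpleGraph.Walk.edges_cons, hp', wedges]

theorem squareLattice_adj {x y : ℤ} {v : ℤ × ℤ} (h : squareLattice.Adj (x, y) v) :
    v = (x + 1, y) ∨ v = (x, y + 1) ∨ v = (x - 1, y) ∨ v = (x, y - 1) := by
  obtain ⟨a, c⟩ := v
  simp only [squareLattice] at h
  simp only [Prod.mk.injEq]
  rcases abs_cases (x - a) with h1 | h1 <;> rcases abs_cases (y - c) with h2 | h2 <;> omega

theorem exists_word {a b : ℤ × ℤ} (p : squareLattice.Walk a b) :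
    ∃ u, p.support = verts a.1 a.2 u ∧ p.edges = wedges a.1 a.2 u ∧ a.1 + dX u = b.1 ∧
      a.2 + dY u = b.2 := by
  induction p with
  | nil => exact ⟨[], by simp [verts], by simp [wedges], by simp [dX], by simp [dY]⟩
  | @cons a v b h p ih =>
    obtain ⟨u, h1, h2, h3, h4⟩ := ih
    obtain rfl | rfl | rfl | rfl := squareLattice_adj h
    · exact ⟨.E :: u, by simp [verts, h1], by simp [wedges, h2], by rw [dX, ← h3]; ring,
        by rw [dY, ← h4]⟩
    · exact ⟨.N :: u, by simp [verts, h1], by simp [wedges, h2], by rw [dX, ← h3],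
        by rw [dY, ← h4]; ring⟩
    · exact ⟨.W :: u, by simp [verts, h1], by simp [wedges, h2], by rw [dX, ← h3]; ring,
        by rw [dY, ← h4]⟩
    · exact ⟨.S :: u, by simp [verts, h1], by simp [wedges, h2], by rw [dX, ← h3],
        by rw [dY, ← h4]; ring⟩

theorem length_wedges (x y : ℤ) (u : Wd) : (wedges x y u).length = u.length := by
  induction u generalizing x y with
  | nil => rfl
  | cons s u ih => cases s <;> simp [wedges, ih]

theorem mem_verts_of_mem_wedges {x y : ℤ} {u : Wd} {e : Sym2 (ℤ × ℤ)} (he : e ∈ wedges x y u)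
    {v : ℤ × ℤ} (hv : v ∈ e) : v ∈ verts x y u := by
  obtain ⟨p, hp, hp'⟩ := exists_walk u x y _ _ rfl rfl
  rw [← hp]
  rw [← hp'] at he
  exact p.mem_support_of_mem_edges he hv

theorem exists_mem_wedges {x y : ℤ} {u : Wd} {v : ℤ × ℤ} (hv : v ∈ verts x y u) :
    v = (x, y) ∨ ∃ e ∈ wedges x y u, v ∈ e := by
  induction u generalizing x y with
  | nil => left; simpa [verts] using hv
  | cons s u ih =>
    cases s <;> simp only [verts, wedges, List.mem_cons] at hv ⊢ <;> rcases hv with rfl | hv <;>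
      first
        | exact Or.inl rfl
        | (right
           rcases ih hv with rfl | ⟨e, he, hve⟩
           · exact ⟨_, Or.inl rfl, by simp⟩
           · exact ⟨e, Or.inr he, hve⟩)

/-- A walk that consists of two walks with common end is a cycle if and only if the two walks are
paths which only meet at their ends. -/
theorem isCycle_cons_append_reverse_iff {V : Type*} {G : SimpleGraph V} {o a b t : V}
    (h : G.Adj o a) (h' : G.Adj o b) (p : G.Walk a t) (p' : G.Walk b t) :
    (SimpleGraph.Walk.cons h (p.append (SimpleGraph.Walk.cons h' p').reverse)).IsCycle ↔
    p.support.Nodup ∧ p'.support.Nodup ∧ (∀ v ∈ p.support, v ∈ p'.support → v = t) ∧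
      o ∉ p.support ∧ o ∉ p'.support ∧ a ≠ b := by
  -- The common end occurs in both walks but only once in the cycle, so it is split off from the
  -- second one.
  obtain ⟨B, hB⟩ : ∃ B, p'.support = B ++ [t] :=
    ⟨_, (List.dropLast_append_getLast p'.support_ne_nil).symm.trans (by rw [p'.getLast_support])⟩
  have hsupp : (p.append (SimpleGraph.Walk.cons h' p').reverse).support =
      p.support ++ (B.reverse ++ [o]) := by
    rw [SimpleGraph.Walk.support_append, SimpleGraph.Walk.support_reverse,
      SimpleGraph.Walk.support_cons, hB]
    simp
  have ht : t ∈ p.support := p.end_mem_support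
  have hne := h.ne
  rw [SimpleGraph.Walk.cons_isCycle_iff, SimpleGraph.Walk.isPath_def, hsupp,
    SimpleGraph.Walk.edges_append, SimpleGraph.Walk.edges_reverse, SimpleGraph.Walk.edges_cons]
  have hmem (q : V) (hq : q ∈ B ++ [t]) : q ∈ B ∨ q = t := by simpa using hq
  constructor
  · rintro ⟨h1, h2⟩
    have hab : a ≠ b := by
      rintro rfl
      exact h2 (by simp)
    simp only [List.nodup_append, List.nodup_reverse, List.mem_append, List.mem_reverse,
      List.mem_singleton] at h1
    obtain ⟨h3, ⟨h4, -, h5⟩, h6⟩ := h1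
    have h7 : ∀ v ∈ p.support, v ∉ B := fun v hv hv' => h6 v hv v (Or.inl hv') rfl
    have ho : o ∉ p.support := fun ho => h6 o ho o (Or.inr rfl) rfl
    refine ⟨h3, ?_, fun v hv hv' => ?_, ho, ?_, hab⟩
    · rw [hB, List.nodup_append]
      exact ⟨h4, by simp, fun x hx y hy e => h7 t ht (by simp_all)⟩
    · rw [hB] at hv'
      exact (hmem v hv').resolve_left (h7 v hv)
    · rw [hB]
      intro hoB
      rcases hmem o hoB with hoB | rfl
      · exact h5 o hoB o rfl rfl
      · exact ho ht
  · rintro ⟨h1, h2, h3, h4, h5, h6⟩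
    rw [hB, List.nodup_append] at h2
    refine ⟨?_, fun he => ?_⟩
    · simp only [List.nodup_append, List.nodup_reverse, List.mem_append, List.mem_reverse,
        List.mem_singleton]
      refine ⟨h1, ⟨h2.1, by simp, fun x hx y hy e => h5 (by rw [hB]; simp_all)⟩,
        fun x hx y hy e => ?_⟩
      subst e
      rcases hy with hy | rfl
      · have := h3 x hx (by rw [hB]; simp [hy])
        exact h2.2.2 x hy t (by simp) this
      · exact h4 hx
    · simp only [List.mem_append, List.mem_reverse, List.mem_cons] at he
      rcases he with he | he | he
      · exact h4 (p.fst_mem_support_of_mem_edges he)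
      · rw [Sym2.eq_iff] at he
        rcases he with ⟨-, he⟩ | ⟨he, he'⟩
        · exact h6 he
        · exact hne he'.symm
      · exact h5 (p'.fst_mem_support_of_mem_edges he)

/-- The edges of two paths from the origin to the same point that start with a step to the north
and to the east, respectively. -/
def pairEdges (q : Wd × Wd) : Finset (Sym2 (ℤ × ℤ)) :=
  (wedges 0 0 (.N :: q.1) ++ wedges 0 0 (.E :: q.2)).toFinset

/-- Two paths from `(0, 1)` and `(1, 0)` to `(w, h)` in the rectangle which avoid the origin and only
meet at the end, with two steps to the west or south. -/
structure Loop (w h : ℤ) (q : Wd × Wd) : Prop where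
  back : backs q.1 + backs q.2 = 2
  ux : dX q.1 = w
  uy : 1 + dY q.1 = h
  lx : 1 + dX q.2 = w
  ly : dY q.2 = h
  nodupU : (verts 0 1 q.1).Nodup
  nodupL : (verts 1 0 q.2).Nodup
  disj : ∀ v ∈ verts 0 1 q.1, v ∈ verts 1 0 q.2 → v = (w, h)
  origU : (0, 0) ∉ verts 0 1 q.1
  origL : (0, 0) ∉ verts 1 0 q.2
  rectU : ∀ v ∈ verts 0 1 q.1, 0 ≤ v.1 ∧ v.1 ≤ w ∧ 0 ≤ v.2 ∧ v.2 ≤ h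
  rectL : ∀ v ∈ verts 1 0 q.2, 0 ≤ v.1 ∧ v.1 ≤ w ∧ 0 ≤ v.2 ∧ v.2 ≤ h

theorem verts_cons (x y : ℤ) (s : Dir) (u : Wd) :
    verts x y (s :: u) = (x, y) :: verts (x + dX [s]) (y + dY [s]) u := by
  cases s <;> simp [verts, dX, dY, sub_eq_add_neg]

theorem wedges_cons (x y : ℤ) (s : Dir) (u : Wd) : wedges x y (s :: u) =
    s((x, y), (x + dX [s], y + dY [s])) :: wedges (x + dX [s]) (y + dY [s]) u := by
  cases s <;> simp [wedges, dX, dY, sub_eq_add_neg]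

theorem eq_nil_of_nodup {x y : ℤ} {u : Wd} (hn : (verts x y u).Nodup)
    (h : (x, y) = (x + dX u, y + dY u)) : u = [] := by
  rcases u with _ | ⟨s, u⟩
  · rfl
  · rw [verts_cons, List.nodup_cons] at hn
    refine absurd ?_ hn.1
    convert end_mem_verts _ _ u using 1
    rw [h, ← List.singleton_append, dX_append, dY_append, add_assoc, add_assoc]

/-- A path is determined by its starting point and its set of edges, even if edges are added that
meet the path only at its end. -/
theorem eq_of_wedges_cover {x y : ℤ} {u u' : Wd} {t : ℤ × ℤ} {S : Set (Sym2 (ℤ × ℤ))}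
    (hu : (verts x y u).Nodup) (hu' : (verts x y u').Nodup)
    (ht : t = (x + dX u, y + dY u)) (ht' : t = (x + dX u', y + dY u'))
    (hS : ∀ e ∈ S, ∀ v ∈ e, v ∈ verts x y u' → v = t)
    (h : ∀ e ∈ wedges x y u, e ∈ wedges x y u' ∨ e ∈ S) : u = u' := by
  induction u generalizing x y u' with
  | nil =>
    refine (eq_nil_of_nodup hu' ?_).symm
    rw [← ht', ht, dX, dY, add_zero, add_zero]
  | cons s u ih =>
    rcases u' with _ | ⟨s', u'⟩
    · refine eq_nil_of_nodup hu ?_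
      rw [← ht, ht', dX, dY, add_zero, add_zero]
    · have hne : (x, y) ≠ t := fun e => by
        have := eq_nil_of_nodup hu' (e.trans ht')
        simp at this
      have hs := h s((x, y), (x + dX [s], y + dY [s])) (by rw [wedges_cons]; simp)
      have hmem : (x, y) ∈ verts x y (s' :: u') := start_mem_verts _ _ _
      rw [verts_cons, List.nodup_cons] at hu hu'
      rw [wedges_cons, List.mem_cons] at hs
      rcases hs with (hs | hs) | hs
      · have hss : s = s' := by
          rw [Sym2.eq_iff] at hs
          rcases hs with ⟨-, hs⟩ | ⟨hs, -⟩
          · cases s <;> cases s' <;> simp [dX, dY] at hs ⊢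
          · cases s' <;> simp [dX, dY] at hs
        subst hss
        congr 1
        refine ih hu.2 hu'.2 ?_ ?_ (fun e he v hv hv' => hS e he v hv ?_) fun e he => ?_
        · rw [ht, ← List.singleton_append, dX_append, dY_append, add_assoc, add_assoc]
        · rw [ht', ← List.singleton_append, dX_append, dY_append, add_assoc, add_assoc]
        · rw [verts_cons]
          exact List.mem_cons_of_mem _ hv'
        · have := h e (by rw [wedges_cons]; exact List.mem_cons_of_mem _ he)
          rw [wedges_cons, List.mem_cons] at this
          rcases this with (rfl | this) | this
          · exact absurd (mem_verts_of_mem_wedges he (Sym2.mem_mk_left _ _)) hu.1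
          · exact Or.inl this
          · exact Or.inr this
      -- An edge at the start occurring later in the other path would make that path revisit its
      -- start.
      · exact absurd (mem_verts_of_mem_wedges hs (Sym2.mem_mk_left _ _)) hu'.1
      · exact absurd (hS _ hs _ (Sym2.mem_mk_left _ _) hmem) hne

theorem mem_pairEdges {q : Wd × Wd} {e : Sym2 (ℤ × ℤ)} : e ∈ pairEdges q ↔
    e = s((0, 0), (0, 1)) ∨ e ∈ wedges 0 1 q.1 ∨ e = s((0, 0), (1, 0)) ∨ e ∈ wedges 1 0 q.2 := by
  simp only [pairEdges, wedges, List.mem_toFinset, List.mem_append, List.mem_cons, zero_add]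
  tauto

theorem passesThrough_pairEdges {q : Wd × Wd} {v : ℤ × ℤ} : PassesThrough (pairEdges q) v ↔
    v = (0, 0) ∨ v ∈ verts 0 1 q.1 ∨ v ∈ verts 1 0 q.2 := by
  simp only [PassesThrough, mem_pairEdges]
  constructor
  · rintro ⟨e, rfl | he | rfl | he, hv⟩
    · rcases Sym2.mem_iff.1 hv with rfl | rfl
      · exact Or.inl rfl
      · exact Or.inr (Or.inl (start_mem_verts _ _ _))
    · exact Or.inr (Or.inl (mem_verts_of_mem_wedges he hv))
    · rcases Sym2.mem_iff.1 hv with rfl | rfl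
      · exact Or.inl rfl
      · exact Or.inr (Or.inr (start_mem_verts _ _ _))
    · exact Or.inr (Or.inr (mem_verts_of_mem_wedges he hv))
  · rintro (rfl | hv | hv)
    · exact ⟨_, Or.inl rfl, Sym2.mem_mk_left _ _⟩
    · rcases exists_mem_wedges hv with rfl | ⟨e, he, hve⟩
      · exact ⟨_, Or.inl rfl, Sym2.mem_mk_right _ _⟩
      · exact ⟨e, Or.inr (Or.inl he), hve⟩
    · rcases exists_mem_wedges hv with rfl | ⟨e, he, hve⟩
      · exact ⟨_, Or.inr (Or.inr (Or.inl rfl)), Sym2.mem_mk_right _ _⟩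
      · exact ⟨e, Or.inr (Or.inr (Or.inr he)), hve⟩

/-- The edges not belonging to one path form the other one together with the two edges at the
origin. They touch the first path only at its end, apart from the edge by which it is entered, so
each path can be followed uniquely inside the edge set. -/
theorem Loop.pairEdges_injOn (w h : ℤ) : Set.InjOn pairEdges {q | Loop w h q} := by
  rintro ⟨u, l⟩ hq ⟨u', l'⟩ hq' he
  have hU := hq.ux
  have hU' := hq'.ux
  have hL := hq.lx
  have hL' := hq'.lx
  have h1 : u = u' := by
    refine eq_of_wedges_cover (t := (w, h)) (S := {e | e = s((0, 0), (1, 0)) ∨ e ∈ wedges 1 0 l'})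
      hq.nodupU hq'.nodupU (by rw [← hq.ux, ← hq.uy, zero_add])
        (by rw [← hq'.ux, ← hq'.uy, zero_add])
      ?_ fun e hm => ?_
    · rintro e (rfl | hm) v hv hv'
      · rcases Sym2.mem_iff.1 hv with rfl | rfl
        · exact absurd hv' hq'.origU
        · exact hq'.disj _ hv' (start_mem_verts _ _ _)
      · exact hq'.disj _ hv' (mem_verts_of_mem_wedges hm hv)
    · have := mem_pairEdges.1 (he ▸ mem_pairEdges.2 (Or.inr (Or.inl hm)))
      rcases this with rfl | this | this
      · exact absurd (mem_verts_of_mem_wedges hm (Sym2.mem_mk_left _ _)) hq.origU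
      · exact Or.inl this
      · exact Or.inr this
  have h2 : l = l' := by
    refine eq_of_wedges_cover (t := (w, h)) (S := {e | e = s((0, 0), (0, 1)) ∨ e ∈ wedges 0 1 u'})
      hq.nodupL hq'.nodupL (by rw [← hq.lx, ← hq.ly, zero_add])
        (by rw [← hq'.lx, ← hq'.ly, zero_add])
      ?_ fun e hm => ?_
    · rintro e (rfl | hm) v hv hv'
      · rcases Sym2.mem_iff.1 hv with rfl | rfl
        · exact absurd hv' hq'.origL
        · exact hq'.disj _ (start_mem_verts _ _ _) hv'
      · exact hq'.disj _ (mem_verts_of_mem_wedges hm hv) hv'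
    · have := mem_pairEdges.1 (he ▸ mem_pairEdges.2 (Or.inr (Or.inr (Or.inr hm))))
      rcases this with this | this | rfl | this
      · exact Or.inr (Or.inl this)
      · exact Or.inr (Or.inr this)
      · exact absurd (mem_verts_of_mem_wedges hm (Sym2.mem_mk_left _ _)) hq.origL
      · exact Or.inl this
  rw [h1, h2]

theorem Loop.isStaircasePolygon {w h : ℕ} {q : Wd × Wd} (H : Loop w h q) :
    IsStaircasePolygon 2 w h (pairEdges q) := by
  obtain ⟨p, hp, hp'⟩ := exists_walk q.1 0 1 w h (by rw [← H.ux, zero_add]) H.uy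
  obtain ⟨p₂, hp₂, hp₂'⟩ := exists_walk q.2 1 0 w h H.lx (by rw [← H.ly, zero_add])
  have h₁ : squareLattice.Adj (0, 0) (0, 1) := adj_N 0 0
  have h₂ : squareLattice.Adj (0, 0) (1, 0) := adj_E 0 0
  have hc := (isCycle_cons_append_reverse_iff h₁ h₂ p p₂).2
    ⟨hp ▸ H.nodupU, hp₂ ▸ H.nodupL, by rw [hp, hp₂]; exact H.disj, hp ▸ H.origU, hp₂ ▸ H.origL,
      by simp⟩
  have hE : (SimpleGraph.Walk.cons h₁ (p.append (SimpleGraph.Walk.cons h₂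
    p₂).reverse)).edges.toFinset
      = pairEdges q := by
    ext e
    rw [mem_pairEdges, List.mem_toFinset, SimpleGraph.Walk.edges_cons,
      SimpleGraph.Walk.edges_append, SimpleGraph.Walk.edges_reverse, SimpleGraph.Walk.edges_cons,
        hp',
      hp₂']
    simp only [List.mem_cons, List.mem_append, List.mem_reverse]
  have hT : ((w : ℤ), (h : ℤ)) ∈ verts 0 1 q.1 := hp ▸ p.end_mem_support
  have hw := H.rectU _ hT
  have hN := H.rectU _ (start_mem_verts _ _ _)
  simp only at hw hN
  have p0 : PassesThrough (pairEdges q) (0, 0) := passesThrough_pairEdges.2 (Or.inl rfl)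
  have pT : PassesThrough (pairEdges q) ((w : ℤ), (h : ℤ)) :=
    passesThrough_pairEdges.2 (Or.inr (Or.inl hT))
  refine ⟨⟨_, _, hc, hE⟩, ⟨fun v hv => ?_, ⟨_, p0, rfl⟩, ⟨_, pT, rfl⟩, ⟨_, p0, rfl⟩, ⟨_, pT, rfl⟩⟩,
    ?_, p0, pT⟩
  · rcases passesThrough_pairEdges.1 hv with rfl | hv | hv
    · simp
    · exact H.rectU v hv
    · exact H.rectL v hv
  · rw [← hE, List.toFinset_card_of_nodup hc.isTrail.edges_nodup, SimpleGraph.Walk.edges_cons,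
      SimpleGraph.Walk.edges_append, SimpleGraph.Walk.edges_reverse, SimpleGraph.Walk.edges_cons,
        hp',
      hp₂']
    simp only [List.length_cons, List.length_append, List.length_reverse, length_wedges]
    have h1 := length_eq q.1
    have h2 := length_eq q.2
    have h3 := H.back
    have h4 := H.ux
    have h5 := H.uy
    have h6 := H.lx
    have h7 := H.ly
    omega

/-- A cycle that passes through `t` consists of two walks from the starting point to `t`. -/
theorem exists_cons_append_reverse {V : Type*} {G : SimpleGraph V} {o t : V} (c : G.Walk o o)
    (ht : t ∈ c.support) (hto : t ≠ o) : ∃ (a b : V) (h : G.Adj o a) (h' : G.Adj o b)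
      (p : G.Walk a t) (p' : G.Walk b t),
      c = SimpleGraph.Walk.cons h (p.append (SimpleGraph.Walk.cons h' p').reverse) := by
  cases c with
  | nil => exact absurd (by simpa using ht) hto
  | @cons _ a _ h q =>
    rw [SimpleGraph.Walk.support_cons, List.mem_cons] at ht
    obtain ⟨p, r, rfl⟩ := SimpleGraph.Walk.mem_support_iff_exists_append.1 (ht.resolve_left hto)
    obtain ⟨r, rfl⟩ : ∃ r' : G.Walk o t, r = r'.reverse := ⟨r.reverse, r.reverse_reverse.symm⟩
    cases r with
    | nil => exact absurd rfl hto
    | @cons _ b _ h' p' => exact ⟨a, b, h, h', p, p', rfl⟩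

theorem exists_loop {w h : ℤ} (p : squareLattice.Walk (0, 1) (w, h))
    (p' : squareLattice.Walk (1, 0) (w, h)) (h1 : p.support.Nodup) (h2 : p'.support.Nodup)
    (h3 : ∀ v ∈ p.support, v ∈ p'.support → v = (w, h)) (h4 : (0, 0) ∉ p.support)
    (h5 : (0, 0) ∉ p'.support) (hr : ∀ v, v ∈ p.support ∨ v ∈ p'.support →
      0 ≤ v.1 ∧ v.1 ≤ w ∧ 0 ≤ v.2 ∧ v.2 ≤ h)
    (hl : (p.edges.length + p'.edges.length + 2 : ℤ) = 2 * (w + h) + 4) :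
    ∃ q, Loop w h q ∧ ∀ e, e ∈ pairEdges q ↔
      e = s((0, 0), (0, 1)) ∨ e ∈ p.edges ∨ e = s((0, 0), (1, 0)) ∨ e ∈ p'.edges := by
  obtain ⟨u, hu, hu', hX, hY⟩ := exists_word p
  obtain ⟨l, hL, hL', hX', hY'⟩ := exists_word p'
  rw [hu] at h1 h3 h4
  rw [hL] at h2 h3 h5
  simp only [hu, hL] at hr
  rw [hu', hL', length_wedges, length_wedges] at hl
  have h6 := length_eq u
  have h7 := length_eq l
  simp only at hX hY hX' hY'
  refine ⟨(u, l), ⟨?_, by simpa using hX, hY, hX', by simpa using hY', h1, h2, h3, h4, h5,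
    fun v hv => hr v (Or.inl hv), fun v hv => hr v (Or.inr hv)⟩, fun e => ?_⟩
  · simp only
    omega
  · rw [mem_pairEdges, hu', hL']

/-- Rotate the cycle to start at the origin and split it at the opposite corner. Inside the
rectangle the origin has only two possible neighbours, and the cycle uses both; the length then
fixes the number of backward steps. -/
theorem IsStaircasePolygon.exists_loop {w h : ℕ} {E : Finset (Sym2 (ℤ × ℤ))}
    (H : IsStaircasePolygon 2 w h E) : ∃ q, Loop w h q ∧ pairEdges q = E := by
  obtain ⟨⟨v, c, hc, rfl⟩, ⟨hr, -⟩, hcard, h0, hT⟩ := H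
  have hsupp {v' : ℤ × ℤ} (hv : PassesThrough c.edges.toFinset v') : v' ∈ c.support := by
    obtain ⟨e, he, hve⟩ := hv
    exact c.mem_support_of_mem_edges (List.mem_toFinset.1 he) hve
  obtain ⟨c', hc', hE⟩ : ∃ c' : squareLattice.Walk (0, 0) (0, 0),
      c'.IsCycle ∧ c.edges.toFinset = c'.edges.toFinset := by
    refine ⟨c.rotate _ (hsupp h0), hc.rotate _, ?_⟩
    ext e
    rw [List.mem_toFinset, List.mem_toFinset, (c.rotate_edges _ (hsupp h0)).mem_iff]
  rw [hE] at hr hcard hT ⊢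
  clear hE hsupp hc h0 c
  have hsupp {v' : ℤ × ℤ} : PassesThrough c'.edges.toFinset v' ↔ v' ∈ c'.support := by
    rw [SimpleGraph.Walk.mem_support_iff_exists_mem_edges_of_not_nil hc'.not_nil]
    simp [PassesThrough]
  simp only [hsupp] at hr hT
  rw [List.toFinset_card_of_nodup hc'.isTrail.edges_nodup] at hcard
  -- A rectangle reduced to a point has no room for the first edge of the cycle.
  have hto : ((w : ℤ), (h : ℤ)) ≠ (0, 0) := fun e => by
    rw [Prod.mk.injEq] at e
    cases c' with
    | nil => exact SimpleGraph.Walk.not_isCycle_nil hc'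
    | @cons _ a _ hadj q =>
      have := hr a (by simp)
      rcases squareLattice_adj hadj with rfl | rfl | rfl | rfl <;> simp at this <;> omega
  obtain ⟨a, b, ha, hb, p, p', rfl⟩ := exists_cons_append_reverse c' hT hto
  obtain ⟨k1, k2, k3, k4, k5, k6⟩ := (isCycle_cons_append_reverse_iff ha hb p p').1 hc'
  have hr' : ∀ v, v ∈ p.support ∨ v ∈ p'.support → 0 ≤ v.1 ∧ v.1 ≤ w ∧ 0 ≤ v.2 ∧ v.2 ≤ h := by
    refine fun v hv => hr v ?_
    rw [SimpleGraph.Walk.support_cons, List.mem_cons, SimpleGraph.Walk.mem_support_append_iff,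
      SimpleGraph.Walk.support_reverse, List.mem_reverse, SimpleGraph.Walk.support_cons,
        List.mem_cons]
    tauto
  have nbr (a : ℤ × ℤ) (ha : squareLattice.Adj (0, 0) a) (hpos : 0 ≤ a.1 ∧ 0 ≤ a.2) :
      a = (1, 0) ∨ a = (0, 1) := by
    rcases squareLattice_adj ha with rfl | rfl | rfl | rfl <;> simp at hpos ⊢
  have hra := hr' a (Or.inl p.start_mem_support)
  have hrb := hr' b (Or.inr p'.start_mem_support)
  have hl : (p.edges.length + p'.edges.length + 2 : ℤ) = 2 * (w + h) + 4 := by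
    rw [SimpleGraph.Walk.edges_cons, SimpleGraph.Walk.edges_append, SimpleGraph.Walk.edges_reverse,
      SimpleGraph.Walk.edges_cons] at hcard
    simp only [List.length_cons, List.length_append, List.length_reverse] at hcard
    omega
  have hmem (e : Sym2 (ℤ × ℤ)) : e ∈ (SimpleGraph.Walk.cons ha
      (p.append (SimpleGraph.Walk.cons hb p').reverse)).edges.toFinset ↔
      e = s((0, 0), a) ∨ e ∈ p.edges ∨ e = s((0, 0), b) ∨ e ∈ p'.edges := by
    rw [List.mem_toFinset, SimpleGraph.Walk.edges_cons, SimpleGraph.Walk.edges_append,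
      SimpleGraph.Walk.edges_reverse, SimpleGraph.Walk.edges_cons]
    simp only [List.mem_cons, List.mem_append, List.mem_reverse]
  -- The cycle may be traversed in either direction; in one of them the two walks exchange their
  -- roles.
  rcases nbr a ha ⟨hra.1, hra.2.2.1⟩ with rfl | rfl <;>
    rcases nbr b hb ⟨hrb.1, hrb.2.2.1⟩ with rfl | rfl
  · exact absurd rfl k6
  · obtain ⟨q, hq, hqe⟩ := _root_.exists_loop p' p k2 k1 (fun v hv hv' => k3 v hv' hv) k5 k4
      (fun v hv => hr' v hv.symm) (by omega)
    refine ⟨q, hq, Finset.ext fun e => ?_⟩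
    rw [hqe, hmem]
    tauto
  · obtain ⟨q, hq, hqe⟩ := _root_.exists_loop p p' k1 k2 k3 k4 k5 hr' hl
    refine ⟨q, hq, Finset.ext fun e => ?_⟩
    rw [hqe, hmem]
  · exact absurd rfl k6

theorem mem_verts_append_left {x y : ℤ} {u u' : Wd} {v : ℤ × ℤ} (hv : v ∈ verts x y u) :
    v ∈ verts x y (u ++ u') := by
  induction u generalizing x y with
  | nil =>
    obtain rfl : v = (x, y) := by simpa [verts] using hv
    exact start_mem_verts _ _ _
  | cons s u ih =>
    rw [List.cons_append, verts_cons] at *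
    rcases List.mem_cons.1 hv with rfl | hv
    · exact List.mem_cons_self
    · exact List.mem_cons_of_mem _ (ih hv)

/-- The origin is the only point of the rectangle below the diagonal of the start. A last step to
the west or south would come from outside, as the path ends at the top-right corner. -/
theorem Loop.reg {w h : ℤ} {q : Wd × Wd} (H : Loop w h q) : Reg 0 1 (backs q.1) q.1 := by
  have key (s : Dir) (hs : s = .W ∨ s = .S) : q.1.getLast? ≠ some s := by
    intro e
    obtain ⟨u, hu⟩ : ∃ u, q.1 = u ++ [s] := List.getLast?_eq_some_iff.1 e
    have h1 := H.rectU (0 + dX u, 1 + dY u) (by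
      rw [hu]; exact mem_verts_append_left (end_mem_verts 0 1 u))
    have h2 := H.ux
    have h3 := H.uy
    rw [hu, dX_append] at h2
    rw [hu, dY_append] at h3
    rcases hs with rfl | rfl <;> simp [dX, dY] at h1 h2 h3 <;> omega
  refine ⟨rfl, fun v hv => ?_, H.nodupU, key _ (Or.inl rfl), key _ (Or.inr rfl)⟩
  have h1 := H.rectU v hv
  by_contra hlt
  obtain rfl : v = (0, 0) := by ext <;> simp only <;> omega
  exact H.origU hv

theorem Loop.swap {w h : ℤ} {q : Wd × Wd} (H : Loop w h q) :
    Loop h w (q.2.map Dir.swap, q.1.map Dir.swap) := by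
  obtain ⟨h1, h2, h3, h4, h5, h6, h7, h8, h9, h10, h11, h12⟩ := H
  refine ⟨?_, ?_, ?_, ?_, ?_, ?_, ?_, fun v hv hv' => ?_, fun hv => h10 (mem_verts_swap.1 hv),
    fun hv => h9 (mem_verts_swap.1 hv), fun v hv => ?_, fun v hv => ?_⟩
  · simp only [backs_swap]; omega
  · rwa [dX_swap]
  · rwa [dY_swap]
  · rwa [dX_swap]
  · rwa [dY_swap]
  · rw [verts_swap]; exact h7.map Prod.swap_injective
  · rw [verts_swap]; exact h6.map Prod.swap_injective
  · have := h8 _ (mem_verts_swap.1 hv') (mem_verts_swap.1 hv)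
    rw [← Prod.swap_swap v, this, Prod.swap_prod_mk]
  · have := h12 _ (mem_verts_swap.1 hv)
    simp only [Prod.fst_swap, Prod.snd_swap] at this; omega
  · have := h11 _ (mem_verts_swap.1 hv)
    simp only [Prod.fst_swap, Prod.snd_swap] at this; omega

/-- With two backward steps above, the lower path is monotone. The wall conditions that `Pair20`
omits follow from the order of the two paths. -/
theorem loop_iff_pair20 {w h : ℤ} {q : Wd × Wd} :
    Loop w h q ∧ backs q.1 = 2 ↔ q ∈ set20 2 0 0 1 1 0 w h := by
  constructor
  · rintro ⟨H, hb⟩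
    exact ⟨hb ▸ H.reg, by have := H.back; omega, by rw [H.ux, zero_add], H.uy, H.lx,
      by rw [H.ly, zero_add], H.disj, fun h => absurd rfl h, fun v hv =>
      ⟨(H.rectU v hv).1, (H.rectU v hv).2.2.2⟩⟩
  · intro H
    have H' : Pair20 2 0 0 1 1 0 w h q.1 q.2 := H
    have hr := H'.rect' le_rfl (Or.inl rfl) zero_le_one rfl
    have hl := H'.rect
    refine ⟨⟨by rw [H'.reg.back, H'.plain], by rw [← H'.ux, zero_add], H'.uy, H'.lx,
      by rw [← H'.ly, zero_add], H'.reg.nodup, nodup_verts_of_backs_eq_zero H'.plain, H'.disj,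
      fun hv => ?_, fun hv => ?_, fun v hv => ?_, fun v hv => ?_⟩, H'.reg.back⟩
    · have := H'.reg.lev _ hv
      simp at this
    · have := mem_verts_of_backs_eq_zero H'.plain hv
      simp at this
    · have h1 := hr v hv
      have h2 := hl v hv
      omega
    · have h1 := mem_verts_of_backs_eq_zero H'.plain hv
      have h2 := mem_verts_le_of_backs_eq_zero H'.plain hv
      have h3 := H'.lx
      have h4 := H'.ly
      omega

theorem loop_iff_pair11 {w h : ℤ} {q : Wd × Wd} :
    Loop w h q ∧ backs q.1 = 1 ↔ q ∈ set11 1 1 False False 0 1 1 0 w h := by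
  constructor
  · rintro ⟨H, hb⟩
    have hb' : backs q.2 = 1 := by have := H.back; omega
    have hL := H.swap.reg.swap
    simp only [map_swap_swap, backs_swap, hb'] at hL
    exact ⟨hb ▸ H.reg, hL, by rw [H.ux, zero_add], H.uy, H.lx, by rw [H.ly, zero_add], H.disj,
      False.elim, False.elim, fun v hv => ⟨(H.rectU v hv).1, (H.rectU v hv).2.2.2⟩,
      fun v hv => ⟨(H.rectL v hv).2.2.1, (H.rectL v hv).2.1⟩⟩
  · intro H
    have H' : Pair11 1 1 False False 0 1 1 0 w h q.1 q.2 := H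
    obtain ⟨hr, hr'⟩ := H'.rect' le_rfl le_rfl False.elim False.elim zero_le_one rfl
    have hu := H'.rectU
    have hl := H'.rectL
    refine ⟨⟨by rw [H'.regU.back, H'.regL.back], by rw [← H'.ux, zero_add], H'.uy, H'.lx,
      by rw [← H'.ly, zero_add], H'.regU.nodup, H'.regL.nodup, H'.disj,
      fun hv => ?_, fun hv => ?_, fun v hv => ?_, fun v hv => ?_⟩, H'.regU.back⟩
    · have := H'.regU.lev _ hv
      simp at this
    · have := H'.regL.lev _ hv
      simp at this
    · have h1 := hr v hv
      have h2 := hu v hv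
      omega
    · have h1 := hr' v hv
      have h2 := hl v hv
      omega

/-- The set is partitioned by the number of backward steps of the upper path; reflection turns the
case of none into that of two, with width and height exchanged. -/
theorem ncard_loop (w h : ℤ) : {q | Loop w h q}.Finite ∧ {q | Loop w h q}.ncard =
    cnt20 2 0 0 1 w h + cnt20 2 0 0 1 h w + cnt11 1 1 False False 0 0 1 w h := by
  have e1 : {q | Loop w h q ∧ backs q.1 = 2} = set20 2 0 0 1 1 0 w h :=
    Set.ext fun q => loop_iff_pair20
  have e2 : {q | Loop w h q ∧ backs q.1 = 1} = set11 1 1 False False 0 1 1 0 w h :=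
    Set.ext fun q => loop_iff_pair11
  let f : Wd × Wd → Wd × Wd := fun q => (q.2.map Dir.swap, q.1.map Dir.swap)
  have hf : Function.Involutive f := fun q => by simp only [f, map_swap_swap]
  have e3 : {q | Loop w h q ∧ backs q.1 = 0} = f '' set20 2 0 0 1 1 0 h w := by
    ext q
    constructor
    · rintro ⟨H, hb⟩
      refine ⟨f q, loop_iff_pair20.1 ⟨H.swap, ?_⟩, hf q⟩
      have := H.back
      simp only [f, backs_swap]
      omega
    · rintro ⟨q, hq, rfl⟩
      obtain ⟨H, hb⟩ := loop_iff_pair20.2 hq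
      refine ⟨H.swap, ?_⟩
      have := H.back
      simp only [f, backs_swap]
      omega
  have eu : {q | Loop w h q} = ({q | Loop w h q ∧ backs q.1 = 2} ∪ {q | Loop w h q ∧ backs q.1 = 0})
    ∪
      {q | Loop w h q ∧ backs q.1 = 1} := by
    ext q
    simp only [Set.mem_union, Set.mem_ofPred_eq]
    constructor
    · intro H
      have := H.back
      have : backs q.1 = 2 ∨ backs q.1 = 0 ∨ backs q.1 = 1 := by omega
      tauto
    · tauto
  have f1 : (set20 2 0 0 1 1 0 w h).Finite := set20_finite ..
  have f2 : (set11 1 1 False False 0 1 1 0 w h).Finite := set11_finite ..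
  have f3 : (f '' set20 2 0 0 1 1 0 h w).Finite := (set20_finite ..).image f
  have d1 : Disjoint {q | Loop w h q ∧ backs q.1 = 2} {q | Loop w h q ∧ backs q.1 = 0} :=
    Set.disjoint_left.2 fun q h1 h2 => by have := h1.2.symm.trans h2.2; omega
  have d2 : Disjoint ({q | Loop w h q ∧ backs q.1 = 2} ∪ {q | Loop w h q ∧ backs q.1 = 0})
      {q | Loop w h q ∧ backs q.1 = 1} :=
    Set.disjoint_left.2 fun q h1 h2 => by
      rcases h1 with h1 | h1 <;> (have := h1.2.symm.trans h2.2; omega)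
  rw [e1, e3] at d1 d2
  rw [e2] at d2
  rw [eu, e1, e2, e3]
  refine ⟨(f1.union f3).union f2, ?_⟩
  rw [Set.ncard_union_eq d2 (f1.union f3) f2, Set.ncard_union_eq d1 f1 f3,
    Set.ncard_image_of_injective _ hf.injective]
  simp only [cnt20, cnt11, zero_add]

theorem ncard_staircase (w h : ℕ) : {E | IsStaircasePolygon 2 w h E}.Finite ∧
    {E | IsStaircasePolygon 2 w h E}.ncard =
      cnt20 2 0 0 1 w h + cnt20 2 0 0 1 h w + cnt11 1 1 False False 0 0 1 w h := by
  have e : {E | IsStaircasePolygon 2 w h E} = pairEdges '' {q | Loop w h q} := by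
    ext E
    exact ⟨fun H => H.exists_loop, by rintro ⟨q, hq, rfl⟩; exact hq.isStaircasePolygon⟩
  rw [e, (Loop.pairEdges_injOn w h).ncard_image]
  exact ⟨(ncard_loop w h).1.image _, (ncard_loop w h).2⟩

/-! ### Assembly of the generating function. -/

theorem Us_eq_gK {a b : Fin 2} {f d : ℤ} (hd : 0 ≤ d) :
    Us a b f d = gK a b fun i j => cnt20 2 0 f d i j := by
  rw [Us, F20, if_pos hd]
  congr 1
  ext i j
  refine ite_eq_left_iff.2 fun h => ?_
  by_contra h'
  have := le_of_cnt20_ne_zero (Ne.symm h')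
  omega

theorem Hs_eq_gK {a b : Fin 2} {f g d : ℤ} (hd : 0 ≤ d) :
    Hs a b f g d = gK a b fun i j => cnt11 1 1 False False f g d i j := by
  rw [Hs, F11, if_pos hd]
  congr 1
  ext i j
  refine ite_eq_left_iff.2 fun h => ?_
  by_contra h'
  have := le_of_cnt11_ne_zero (Ne.symm h')
  omega

theorem toFPS_staircaseGF :
    toFPS (staircaseGF 2) = Us 0 1 0 1 + Us 1 0 0 1 + Hs 0 1 0 0 1 := by
  rw [Us_eq_gK zero_le_one, Us_eq_gK zero_le_one, Hs_eq_gK zero_le_one, gK, gK, gK, ← map_add,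
    ← map_add]
  congr 1
  ext n
  rw [map_add, map_add, coeff_gf, coeff_gf, coeff_gf]
  change ((Set.ncard {E | IsStaircasePolygon 2 (n 0) (n 1) E} : ℕ) : ℚ) = _
  rw [(ncard_staircase _ _).2]
  push_cast
  rfl

namespace Param

variable {a b : Fin 2} {p q : FPS}

/-- The upper path of a polygon starts at the western wall, at distance one from the lower one. Its
series is the wall-free series minus the two successive differences in the distance from the wall.
-/
theorem Us_zero_one (h : Param a b p q) :
    Us a b 0 1 = startTwoNum (1 - p - q) (p * q) * p ^ 2 * q ^ 2 / ((1 - p) ^ 3 * (1 - q) ^ 3 *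
      (1 - p - q) ^ 3 * (1 - p * (1 - q)) * (1 - q * (1 - p)) * (1 - p - q + 2 * p * q)) := by
  rw [← startTwo h.gen]
  have h₂ := h.Us_cand zero_le_one
  have h₁ := h.Us_diff_eq le_rfl
  have h₀ := h.Us_diff_zero_cand zero_le_one
  rw [cand_one] at h₀ h₂
  linear_combination h₂ - h₁ - h₀

theorem Hs_zero_one (h : Param a b p q) :
    Hs a b 0 0 1 = startBothNum (1 - p - q) (p * q) * p ^ 2 * q ^ 2 / ((1 - p) ^ 4 * (1 - q) ^ 4 *
      (1 - p - q) ^ 3 * (1 - p * (1 - q)) ^ 3 * (1 - q * (1 - p)) ^ 3) := by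
  rw [← startBoth h.gen]
  have h₃ := h.Hs_cand zero_le_one
  have h₂ := h.Hs_diff_cand zero_le_one
  have h₁ := h.symm.Hs_diff_cand zero_le_one
  have h₀ := h.Hs_diff_diff_cand zero_le_one
  rw [Hs_swap (a := b), Hs_swap (a := b)] at h₁
  rw [cand_one] at h₀ h₁ h₂ h₃
  linear_combination h₃ - h₂ - h₁ + h₀

end Param

theorem mainTheorem3 :
    (∀ w h : ℕ, {E | IsStaircasePolygon 2 w h E}.Finite) ∧
    ∃ s : MvPowerSeries (Fin 2) ℚ,
      s ^ 2 = discr (X 0) (X 1) ∧ constantCoeff s = 1 ∧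
      ∀ x y sqrtΔ : FractionRing (MvPowerSeries (Fin 2) ℚ),
        x = algebraMap (MvPowerSeries (Fin 2) ℚ) _ (X 0) →
        y = algebraMap (MvPowerSeries (Fin 2) ℚ) _ (X 1) →
        sqrtΔ = algebraMap (MvPowerSeries (Fin 2) ℚ) _ s →
        algebraMap (MvPowerSeries (Fin 2) ℚ) _ (staircaseGF 2) =
          polyA x y / (2 * x ^ 4 * y ^ 4 * (1 - x) ^ 3 * (1 - y) ^ 3 * (1 - x - y)) -
          polyB x y / (2 * x ^ 4 * y ^ 4 * (1 - x) * (1 - y) * sqrtΔ ^ 3) := by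
  refine ⟨fun w h => (ncard_staircase w h).1, ?_⟩
  obtain ⟨s, hs, h1⟩ := exists_sq_eq (discr (X 0 : MvPowerSeries (Fin 2) ℚ) (X 1))
    (by simp [discr])
  obtain ⟨p, q, h, hpq⟩ := exists_param hs h1
  refine ⟨s, hs, h1, fun x y r hx hy hr => ?_⟩
  rw [polyA_div_sub_polyB_div h.gen (hx.trans h.hx) (hy.trans h.hy) (hr.trans hpq)]
  refine toFPS_staircaseGF.trans ?_
  -- The two types with a monotone path have closed forms that differ only by exchanging p and q,
  -- hence coincide and account for the factor two.
  rw [h.Us_zero_one, h.symm.Us_zero_one, h.Hs_zero_one, hr.trans hpq, sub_right_comm 1 q p,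
    mul_comm q p, two_mul (_ / _)]
  ring
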